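/- **Setting.** Let $\mathbb{T}^2=(\mathbb{R}/2\pi\mathbb{Z})^2$, $e_n(x)=\frac1{2\pi}e^{in\cdot x}$ and $\langle n\rangle=(1+|n|^2)^{1/2}$ for $n\in\mathbb{Z}^2$. For $s\in\mathbb{R}$ let $W^{s,\infty}(\mathbb{T}^2)$ be the space of distributions $u$ on $\mathbb{T}^2$ with $\langle\nabla\rangle^{s}u\in L^\infty(\mathbb{T}^2)$, normed by $\|\langle\nabla\rangle^{s}u\|_{L^\infty}$, where $\langle\nabla\rangle^s$ is the Fourier multiplier with symbol $\langle n\rangle^s$. Let $W(t)=\sum_{n\in\mathbb{Z}^2}B_n(t)e_n$ be a cylindrical Wiener process on the real space $L^2(\mathbb{T}^2)$, defined on a probability space $(\Omega,\mathbb{P})$: $B_0$ is a standard real Brownian motion, the $B_n$, $n\ne0$, are standard complex Brownian motions with $\mathbb{E}|B_n(t)|^2=t$, and the $B_n$ are mutually independent up to the constraint $B_{-n}=\overline{B_n}$. Let $\chi:\mathbb{R}\to[0,\infty)$ be smooth with $\chi=1$ on $[-1,1]$ and $\operatorname{supp}\chi\subset[-2,2]$. For $\varepsilon\in[0,1]$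 and $N\in\mathbb{N}=\{1,2,\dots\}$ let $$\Psi_{\varepsilon,N}(t,x)=\sum_{n\in\mathbb{Z}^2}\chi\Big(\frac{\langle n\rangle}{N}\Big)\Big(\int_0^tK_\varepsilon(n,t-t')\,dB_n(t')\Big)e_n(x),\qquad t\ge0,\ x\in\mathbb{T}^2,$$ where $K_0(n,t)=e^{-t\langle n\rangle^2}$ and, for $\varepsilon>0$, $$K_\varepsilon(n,t)=\varepsilon^{-2}e^{-\frac{t}{2\varepsilon^2}}\cdot\begin{cases}\dfrac{\sinh(\lambda_\varepsilon(n)t)}{\lambda_\varepsilon(n)},\quad \lambda_\varepsilon(n)=\dfrac{\sqrt{1-4\langle n\rangle^2\varepsilon^2}}{2\varepsilon^2},&\langle n\rangle<(2\varepsilon)^{-1},\\[2mm] t,&\langle n\rangle=(2\varepsilon)^{-1},\\[1mm] \dfrac{\sin(\zeta_\varepsilon(n)t)}{\zeta_\varepsilon(n)},\quad \zeta_\varepsilon(n)=\dfrac{\sqrt{4\langle n\rangle^2\varepsilon^2-1}}{2\varepsilon^2},&\langle n\rangle>(2\varepsilon)^{-1};\end{cases}$$ that is, $\Psi_{\varepsilon,N}$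 solves $\varepsilon^2\partial_t^2\Psi+\partial_t\Psi+(1-\Delta)\Psi=\mathbf{P}_N\,\partial_tW$ with zero initial data, $\mathbf{P}_N$ being the multiplier with symbol $\chi(\langle n\rangle/N)$. The stochastic integrals are taken pathwise, as limits of Riemann sums. Put $\sigma_{\varepsilon,N}(t)=\mathbb{E}[\Psi_{\varepsilon,N}(t,x)^2]$ (independent of $x$) and, for $\beta\in\mathbb{R}$, $$\Theta_{\varepsilon,N}(t,x)=e^{\frac{\beta^2}{2}\sigma_{\varepsilon,N}(t)}\,e^{i\beta\Psi_{\varepsilon,N}(t,x)}.$$ **Proposition 5.6.** Let $0<\beta^2<4\pi$. There is a random family of distributions $\Theta_\varepsilon(t)$ on $\mathbb{T}^2$, $\varepsilon\in[0,1]$, $t\ge0$, such that for all finite $p,q\ge1$, all $T>0$ and all $\alpha>\frac{\beta^2}{4\pi}$: 1. for each $\varepsilon\in[0,1]$, $\{\Theta_{\varepsilon,N}\}_{N\in\mathbb{N}}$ is a Cauchy sequence in $L^p\big(\Omega;L^q([0,T];W^{-\alpha,\infty}(\mathbb{T}^2))\big)$ and converges there to $\Theta_\varepsilon$ as $N\to\infty$;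 2. $\{(\varepsilon,t)\mapsto\Theta_{\varepsilon,N}(t)\}_{N\in\mathbb{N}}$ is a Cauchy sequence in $L^p\big(\Omega;L^q([0,1]\times[0,T];W^{-\alpha,\infty}(\mathbb{T}^2))\big)$ and converges there to $(\varepsilon,t)\mapsto\Theta_\varepsilon(t)$ as $N\to\infty$; 3. almost surely, the maps $(\varepsilon,t)\mapsto\Theta_{\varepsilon,N}(t)$, $N\in\mathbb{N}$, and $(\varepsilon,t)\mapsto\Theta_\varepsilon(t)$ belong to $C\big([0,1]\times[0,T];W^{-\alpha,\infty}(\mathbb{T}^2)\big)$, and the former converge to the latter in this space as $N\to\infty$. -/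

import Mathlib

open MeasureTheory Filter Topology
open scoped NNReal ENNReal ComplexConjugate

noncomputable section

namespace SmoluchowskiKramers

/-! ### The torus, Fourier series and the Sobolev spaces `W^{s,∞}` -/

instance fact_two_pi_pos : Fact (0 < 2 * Real.pi) := ⟨Real.two_pi_pos⟩

/-- The torus `𝕋² = (ℝ / 2πℤ)²`, with Lebesgue measure (of total mass `(2π)²`). -/
abbrev Torus : Type := Fin 2 → AddCircle (2 * Real.pi)

/-- The lattice `ℤ²` of frequencies. -/
abbrev Freq : Type := Fin 2 → ℤ

/-- The Japanese bracket `⟨n⟩ = (1 + |n|²)^{1/2}`. -/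
def bracket (n : Freq) : ℝ := Real.sqrt (1 + ∑ i, (n i : ℝ) ^ 2)

/-- The orthonormal basis `e_n(x) = (2π)⁻¹ exp(i n·x)` of `L²(𝕋²)`. -/
def torusChar (n : Freq) (x : Torus) : ℂ :=
  (2 * (Real.pi : ℂ))⁻¹ * ∏ i, fourier (n i) (x i)

/-- The Fourier coefficients `∫ f(x) conj(e_n(x)) dx` of a function on the torus. -/
def torusCoeff (f : Torus → ℂ) (n : Freq) : ℂ := ∫ x : Torus, f x * conj (torusChar n x)

/-- A distribution on the torus, identified with the sequence of its Fourier coefficients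
with respect to the basis `e_n`. -/
abbrev TorusDistribution : Type := Freq → ℂ

/-- The Sobolev space `W^{s,∞}(𝕋²)` of the distributions `u` with `⟨∇⟩^s u ∈ L^∞(𝕋²)`, where
`⟨∇⟩^s` multiplies the `n`-th Fourier coefficient by `⟨n⟩^s`, with the norm
`‖u‖ = ‖⟨∇⟩^s u‖_{L^∞}`. Since `u ↦ ⟨∇⟩^s u` is by definition an isometric isomorphism of
`W^{s,∞}` onto `L^∞`, an element `u` is stored as its potential `⟨∇⟩^s u`; the distribution `u`
itself is recovered by `SobolevInfty.toDistribution`. -/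
def SobolevInfty (_s : ℝ) : Type := Lp ℂ ∞ (volume : Measure Torus)

instance (s : ℝ) : NormedAddCommGroup (SobolevInfty s) :=
  inferInstanceAs (NormedAddCommGroup (Lp ℂ ∞ (volume : Measure Torus)))

instance (s : ℝ) : NormedSpace ℂ (SobolevInfty s) :=
  inferInstanceAs (NormedSpace ℂ (Lp ℂ ∞ (volume : Measure Torus)))

instance (s : ℝ) : CompleteSpace (SobolevInfty s) :=
  inferInstanceAs (CompleteSpace (Lp ℂ ∞ (volume : Measure Torus)))

/-- The potential `⟨∇⟩^s u ∈ L^∞` of `u ∈ W^{s,∞}`. -/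
def SobolevInfty.potential {s : ℝ} (u : SobolevInfty s) : Lp ℂ ∞ (volume : Measure Torus) := u

/-- The distribution underlying an element `u` of `W^{s,∞}`: its Fourier coefficients are
`⟨n⟩^{-s}` times those of `⟨∇⟩^s u`. -/
def SobolevInfty.toDistribution {s : ℝ} (u : SobolevInfty s) : TorusDistribution :=
  fun n => ((bracket n ^ (-s) : ℝ) : ℂ) * torusCoeff u.potential n

/-! ### The noise -/

/-- The half `{n : n₁ > 0} ∪ {n : n₁ = 0, n₂ ≥ 0}` of the lattice, which contains `0` and exactly
one element of each pair `{n, -n}`. -/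
def halfLattice : Set Freq := {n | 0 < n 0 ∨ (n 0 = 0 ∧ 0 ≤ n 1)}

/-- `(B_n)` is the family of coordinates of a cylindrical Wiener process `W = ∑ B_n e_n` on the
real space `L²(𝕋²)`: `B_{-n} = conj B_n`, `B_0` is a standard real Brownian motion, for `n ≠ 0`
the real and imaginary parts of `B_n` are independent and `√2` times each of them is a standard
real Brownian motion (so that `Var B_n(t) = E|B_n(t)|² = t`), and the `B_n` are mutually
independent up to the constraint `B_{-n} = conj B_n`. -/
structure IsCylindricalWiener {Ω : Type*} [MeasurableSpace Ω] (B : Freq → ℝ≥0 → Ω → ℂ)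
    (P : Measure Ω) : Prop where
  conj_symm : ∀ n t ω, B (-n) t ω = conj (B n t ω)
  brownian_zero : ProbabilityTheory.IsBrownianReal (fun t ω => (B 0 t ω).re) P
  brownian_re : ∀ n, n ≠ 0 → ProbabilityTheory.IsBrownianReal (fun t ω => Real.sqrt 2 * (B n t ω).re) P
  brownian_im : ∀ n, n ≠ 0 → ProbabilityTheory.IsBrownianReal (fun t ω => Real.sqrt 2 * (B n t ω).im) P
  indep_re_im : ∀ n, n ≠ 0 →
    ProbabilityTheory.IndepFun (fun ω (t : ℝ≥0) => (B n t ω).re) (fun ω (t : ℝ≥0) => (B n t ω).im) P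
  indep : ProbabilityTheory.iIndepFun (fun (n : halfLattice) ω (t : ℝ≥0) => B n t ω) P

/-- The Riemann sums `∑_{k<m} f(kt/m) (b((k+1)t/m) - b(kt/m))` on `[0,t]`. -/
def riemannSum (f : ℝ → ℝ) (b : ℝ≥0 → ℂ) (t : ℝ) (m : ℕ) : ℂ :=
  ∑ k ∈ Finset.range m, (f (k * t / m) : ℂ) *
    (b (((k + 1 : ℕ) * t / m : ℝ).toNNReal) - b ((k * t / m : ℝ).toNNReal))

/-- The (Wiener) integral `∫_0^t f(t') db(t')` of a deterministic `C¹` integrand against a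
continuous path `b`, as the limit of the Riemann sums. -/
def wienerIntegral (f : ℝ → ℝ) (b : ℝ≥0 → ℂ) (t : ℝ) : ℂ :=
  limUnder atTop (riemannSum f b t)

/-- The limit defining `wienerIntegral` exists for every `C¹` integrand and continuous path. -/
theorem tendsto_riemannSum {f f' : ℝ → ℝ} (hf : ∀ s, HasDerivAt f (f' s) s)
    (hf' : Continuous f') {b : ℝ≥0 → ℂ} (hb : Continuous b) {t : ℝ} (ht : 0 ≤ t) :
    Tendsto (riemannSum f b t) atTop (𝓝 (f t * b t.toNNReal - f 0 * b 0 -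
      ∫ s in (0 : ℝ)..t, (f' s : ℂ) * b s.toNNReal)) := by
  set g : ℝ → ℂ := fun s => b s.toNNReal with hg
  have hgc : Continuous g := hb.comp continuous_real_toNNReal
  obtain ⟨C, hC⟩ := (isCompact_Icc (a := (0 : ℝ)) (b := t)).exists_bound_of_continuousOn
    hf'.continuousOn
  have hC0 : 0 ≤ C := le_trans (norm_nonneg _) (hC 0 ⟨le_rfl, ht⟩)
  have huc : UniformContinuousOn g (Set.Icc 0 t) :=
    isCompact_Icc.uniformContinuousOn_of_continuous hgc.continuousOn
  rw [Metric.tendsto_atTop]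
  intro η hη
  obtain ⟨δ, hδ, hgδ⟩ := Metric.uniformContinuousOn_iff.1 huc (η / (2 * (C * t + 1))) (by positivity)
  obtain ⟨M, hM⟩ := exists_nat_gt (t / δ)
  refine ⟨M + 1, fun m hm => ?_⟩
  have hm0 : (0 : ℝ) < m := by
    have : 0 < m := by omega
    exact_mod_cast this
  have hmM : t / m < δ := by
    rw [div_lt_iff₀ hm0]
    rw [div_lt_iff₀ hδ] at hM
    have : (M : ℝ) ≤ m := by exact_mod_cast (by omega : M ≤ m)
    nlinarith
  set a : ℕ → ℝ := fun k => k * t / m with ha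
  have ham : a m = t := by simp only [ha]; field_simp
  have ha0 : a 0 = 0 := by simp [ha]
  have hstep : ∀ k, a (k + 1) - a k = t / m := by
    intro k; simp only [ha]; push_cast; ring
  have hle : ∀ k, a k ≤ a (k + 1) := by
    intro k; have := hstep k; have : 0 ≤ t / m := by positivity
    linarith
  have hmono : Monotone a := monotone_nat_of_le_succ hle
  have hint : ∀ u v : ℝ, IntervalIntegrable (fun s => (f' s : ℂ) * g s) volume u v := fun u v =>
    (Continuous.intervalIntegrable (by fun_prop) _ _)
  have hsum : riemannSum f b t m = f t * g t - f 0 * g 0 -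
      ∑ k ∈ Finset.range m, ((f (a (k + 1)) : ℂ) - f (a k)) * g (a (k + 1)) := by
    have h1 := Finset.sum_range_sub (fun k => (f (a k) : ℂ) * g (a k)) m
    rw [ham, ha0] at h1
    rw [← h1, ← Finset.sum_sub_distrib, riemannSum]
    refine Finset.sum_congr rfl fun k _ => ?_
    simp only [hg, ha]
    ring
  have hI : ∫ s in (0 : ℝ)..t, (f' s : ℂ) * g s =
      ∑ k ∈ Finset.range m, ∫ s in a k..a (k + 1), (f' s : ℂ) * g s := by
    rw [intervalIntegral.sum_integral_adjacent_intervals (fun k _ => hint _ _), ham, ha0]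
  have hfk : ∀ k, ((f (a (k + 1)) : ℂ) - f (a k)) * g (a (k + 1)) =
      ∫ s in a k..a (k + 1), (f' s : ℂ) * g (a (k + 1)) := by
    intro k
    rw [intervalIntegral.integral_mul_const, intervalIntegral.integral_ofReal,
      intervalIntegral.integral_eq_sub_of_hasDerivAt (fun s _ => hf s)
        (hf'.intervalIntegrable _ _)]
    push_cast
    ring
  have hb0 : b 0 = g 0 := by simp [hg]
  rw [dist_eq_norm, hb0, hsum, hI]
  have : (f t * g t - f 0 * g 0 -
      ∑ k ∈ Finset.range m, ((f (a (k + 1)) : ℂ) - f (a k)) * g (a (k + 1))) -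
      (f t * g t - f 0 * g 0 -
        ∑ k ∈ Finset.range m, ∫ s in a k..a (k + 1), (f' s : ℂ) * g s) =
      ∑ k ∈ Finset.range m, ∫ s in a k..a (k + 1), (f' s : ℂ) * (g s - g (a (k + 1))) := by
    simp only [hfk]
    rw [sub_sub_sub_cancel_left, ← Finset.sum_sub_distrib]
    refine Finset.sum_congr rfl fun k _ => ?_
    rw [← intervalIntegral.integral_sub (hint _ _)
      (Continuous.intervalIntegrable (by fun_prop) _ _)]
    simp only [mul_sub]
  rw [show (b t.toNNReal) = g t from rfl, this]
  have hk : ∀ k ∈ Finset.range m,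
      ‖∫ s in a k..a (k + 1), (f' s : ℂ) * (g s - g (a (k + 1)))‖ ≤
        C * (η / (2 * (C * t + 1))) * (t / m) := by
    intro k hk
    have hkm : k + 1 ≤ m := Finset.mem_range.1 hk
    have h0k : 0 ≤ a k := ha0 ▸ hmono (Nat.zero_le k)
    have hkt : a (k + 1) ≤ t := ham ▸ hmono hkm
    have := intervalIntegral.norm_integral_le_of_norm_le_const (a := a k) (b := a (k + 1))
      (f := fun s => (f' s : ℂ) * (g s - g (a (k + 1)))) (C := C * (η / (2 * (C * t + 1)))) ?_
    · rwa [hstep, abs_of_nonneg (by positivity)] at this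
    · intro s hs
      rw [Set.uIoc_of_le (hle k)] at hs
      have hs' : s ∈ Set.Icc 0 t := ⟨by linarith [hs.1], by linarith [hs.2]⟩
      rw [norm_mul, Complex.norm_real]
      refine mul_le_mul (hC s hs') ?_ (norm_nonneg _) hC0
      rw [← dist_eq_norm]
      refine (hgδ s hs' _ ⟨h0k.trans (hle k), hkt⟩ ?_).le
      rw [Real.dist_eq, abs_sub_comm, abs_of_nonneg (by linarith [hs.2])]
      linarith [hs.1, hstep k]
  calc _ ≤ ∑ k ∈ Finset.range m, C * (η / (2 * (C * t + 1))) * (t / m) :=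
        (norm_sum_le _ _).trans (Finset.sum_le_sum hk)
    _ = (C * t) * (η / (2 * (C * t + 1))) := by
        rw [Finset.sum_const, Finset.card_range, nsmul_eq_mul]; field_simp
    _ < η := by
        have : 0 ≤ C * t := by positivity
        rw [mul_div_assoc', div_lt_iff₀ (by positivity)]
        nlinarith

/-! ### The stochastic convolutions and the imaginary multiplicative chaos -/

/-- `λ_ε(n) = √(1 - 4⟨n⟩²ε²) / (2ε²)`, for `⟨n⟩ ≤ (2ε)⁻¹`. -/
def lowFreq (ε : ℝ) (n : Freq) : ℝ := Real.sqrt (1 - 4 * bracket n ^ 2 * ε ^ 2) / (2 * ε ^ 2)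

/-- `ζ_ε(n) = √(4⟨n⟩²ε² - 1) / (2ε²)`, for `⟨n⟩ > (2ε)⁻¹`. -/
def highFreq (ε : ℝ) (n : Freq) : ℝ := Real.sqrt (4 * bracket n ^ 2 * ε ^ 2 - 1) / (2 * ε ^ 2)

/-- The symbol of the damped wave propagator `𝒟_ε(t)`, `ε > 0`, extended by continuity to the
exceptional values `ε = (2⟨n⟩)⁻¹`. -/
def waveSymbol (ε : ℝ) (n : Freq) (t : ℝ) : ℝ :=
  Real.exp (-t / (2 * ε ^ 2)) *
    if bracket n < (2 * ε)⁻¹ then Real.sinh (lowFreq ε n * t) / lowFreq ε n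
    else if bracket n = (2 * ε)⁻¹ then t
    else Real.sin (highFreq ε n * t) / highFreq ε n

/-- The symbol of the Duhamel kernel: `ε⁻² 𝒟_ε(t)` for `ε > 0`, and the heat propagator
`P_0(t) = e^{t(Δ-1)}` for `ε = 0`. -/
def duhamelSymbol (ε : ℝ) (n : Freq) (t : ℝ) : ℝ :=
  if ε = 0 then Real.exp (-t * bracket n ^ 2) else (ε ^ 2)⁻¹ * waveSymbol ε n t

/-- A smooth frequency cutoff: `χ ≥ 0` smooth, `χ = 1` on `[-1,1]`, `supp χ ⊆ [-2,2]`. -/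
structure IsCutoff (χ : ℝ → ℝ) : Prop where
  smooth : ContDiff ℝ (⊤ : ℕ∞) χ
  nonneg : ∀ r, 0 ≤ χ r
  eq_one : ∀ r, |r| ≤ 1 → χ r = 1
  supp : ∀ r, 2 < |r| → χ r = 0

variable {Ω : Type*}

/-- The truncated stochastic convolution
`Ψ_{ε,N}(t,x) = ∑_n χ(⟨n⟩/N) (∫_0^t K_ε(n,t-t') dB_n(t')) e_n(x)`, with `K_ε` the symbol of the
Duhamel kernel. For `N ≥ 1` the sum is finite; it is real by `B_{-n} = conj B_n`, and we record it
as a real number. -/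
def stochConv (χ : ℝ → ℝ) (B : Freq → ℝ≥0 → Ω → ℂ) (ε : ℝ) (N : ℕ) (t : ℝ) (x : Torus)
    (ω : Ω) : ℝ :=
  (∑' n : Freq, (χ (bracket n / N) : ℂ) *
    wienerIntegral (fun s => duhamelSymbol ε n (t - s)) (fun s => B n s ω) t * torusChar n x).re

variable [MeasurableSpace Ω]

/-- The variance `σ_{ε,N}(t) = E[Ψ_{ε,N}(t,x)²]` (it does not depend on `x`). -/
def stochVar (P : Measure Ω) (χ : ℝ → ℝ) (B : Freq → ℝ≥0 → Ω → ℂ) (ε : ℝ) (N : ℕ) (t : ℝ)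
    (x : Torus) : ℝ :=
  ∫ ω, stochConv χ B ε N t x ω ^ 2 ∂P

/-- The renormalized imaginary multiplicative chaos
`Θ_{ε,N}(t,x) = exp(β² σ_{ε,N}(t) / 2) exp(i β Ψ_{ε,N}(t,x))`. -/
def chaos (P : Measure Ω) (χ : ℝ → ℝ) (B : Freq → ℝ≥0 → Ω → ℂ) (β ε : ℝ) (N : ℕ) (t : ℝ)
    (ω : Ω) (x : Torus) : ℂ :=
  (Real.exp (β ^ 2 / 2 * stochVar P χ B ε N t x) : ℂ) *
    Complex.exp (Complex.I * β * stochConv χ B ε N t x ω)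

/-! ### Modes of convergence -/

/-- The element `U` of `L^p(Ω; L^q(X; W^{s,∞}))` is the class of the random distribution-valued
function `V` on `X`. -/
def IsClassOf {X : Type*} [MeasurableSpace X] {μ : Measure X} {P : Measure Ω} {s : ℝ}
    {p q : ℝ≥0∞} [Fact (1 ≤ q)] (U : Lp (Lp (SobolevInfty s) q μ) p P)
    (V : X → Ω → TorusDistribution) : Prop :=
  ∀ᵐ ω ∂P, ∀ᵐ z ∂μ, ((U : Ω → Lp (SobolevInfty s) q μ) ω z).toDistribution = V z ω

/-- The sequence `(V N)_{N ≥ 1}` lies in `L^p(Ω; L^q(X; W^{s,∞}))`, is a Cauchy sequence there and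
converges there to `V∞`. -/
def ConvergesLpLq {X : Type*} [MeasurableSpace X] (P : Measure Ω) (p q : ℝ≥0∞) [Fact (1 ≤ p)]
    [Fact (1 ≤ q)] (μ : Measure X) (s : ℝ) (V : ℕ → X → Ω → TorusDistribution)
    (Vlim : X → Ω → TorusDistribution) : Prop :=
  ∃ (U : ℕ → Lp (Lp (SobolevInfty s) q μ) p P) (Ulim : Lp (Lp (SobolevInfty s) q μ) p P),
    (∀ N, 1 ≤ N → IsClassOf (U N) (V N)) ∧ IsClassOf Ulim Vlim ∧
    CauchySeq U ∧ Tendsto U atTop (𝓝 Ulim)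

/-- The sequence of functions `(v N)_{N ≥ 1}` of `(ε,t)` lies in `C([0,1] × [0,T]; W^{s,∞})` and
converges there (that is, uniformly) to `vlim`, which lies in this space as well. -/
def ConvergesC (T s : ℝ) (v : ℕ → ℝ → ℝ → TorusDistribution)
    (vlim : ℝ → ℝ → TorusDistribution) : Prop :=
  ∃ (F : ℕ → C(Set.Icc (0 : ℝ) 1 × Set.Icc (0 : ℝ) T, SobolevInfty s))
    (Flim : C(Set.Icc (0 : ℝ) 1 × Set.Icc (0 : ℝ) T, SobolevInfty s)),
    (∀ N, 1 ≤ N → ∀ z, (F N z).toDistribution = v N z.1 z.2) ∧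
    (∀ z, (Flim z).toDistribution = vlim z.1 z.2) ∧ Tendsto F atTop (𝓝 Flim)

end SmoluchowskiKramers

end

noncomputable section

namespace SmoluchowskiKramers

/-! ### The damped oscillator -/

/-! For fixed (ε,t) the field Ψ is a finite Gaussian trigonometric sum. Its modes have variance
∫_0^t K_ε(n,s)² ds, and the energy identity of the damped oscillator bounds this by 1/(2⟨n⟩²),
uniformly in ε and t (`IsDampedPair.energy`, `modeVar_le`). So Ψ is at most as correlated as a
log-correlated field with covariance (1/4π) log(1/|x-y|) + O(1), and exp(β² · covariance) behaves at
worst like |x-y|^{-γ} with γ = β²/(4π) < 1.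

The operator ⟨∇⟩^{-α} is averaging against a probability measure ν, the law of a Brownian motion on
the torus at a Gamma time (`integral_echar_besselMeasure`). The 2m-th moment of such an average of
an imaginary chaos is an integral over neutral gases of m positive and m negative charges. Removing
nearest opposite pairs one after the other bounds the energy of a gas by that of m dipoles
(`exists_perm_gasEnergy_le`). After a Cauchy–Schwarz inequality everything rests on ∬ |x-y|^{-2γ} dν
dν < ∞, which holds for γ < min(1,α) (`lintegral_tdist_besselMeasure_lt_top`).

The matching argument needs a covariance with a doubling property, whereas the variances of the
modes are only bounded above and have no regularity in n. Therefore an independent Gaussian field is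
added that completes the covariance to a reference kernel with radially decreasing coefficients, for
which summation by parts gives doubling and the logarithmic bound (`refKernel_le_of_tdist_le`,
`exp_refKernel_sq_le`). The added chaos has mean one, so by Jensen's inequality its insertion can
only increase moments (`enorm_gderiv_pow_le`).

For R ≤ N ≤ 2R, both Θ_{ε,N} and Θ_{ε,R} have the same conditional expectation given the modes with
⟨n⟩ ≤ R, namely the chaos with a sharp cut-off. The fluctuation about it is controlled by Pisier's
rotation argument (`lintegral_enorm_integral_gchaos_sub_le`) through the derivative in the high
modes. Its moments carry one factor of the high frequency covariance per dipole, and the L²(ν⊗ν)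
norm of that covariance is a negative power of R (`lintegral_highCov_le`). This gives pointwise
increments decaying polynomially in R in every L^{2m}
(`IsCylindricalWiener.exists_lintegral_besselAvg_sub_le`).

Uniformity in (ε,t,x) comes from pathwise Hölder bounds whose constants grow only polynomially in N
(`IsCylindricalWiener.exists_besselAvg_holder`) and from a polynomially fine net: large moments
absorb the number of its points (`IsCylindricalWiener.exists_lintegral_iSup_sub_le`). Summing over
dyadic scales gives convergence of the potentials in L^p(Ω;C) and almost surely in C
(`exists_limit_of_dyadic`), and all three modes of convergence are images of this under continuous
linear maps. -/

/-- The solution `K` of `ε² K'' + K' + lam K = 0`, `K 0 = 0`, `K' 0 = ε⁻²`, written as a first order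
system with `L = ε² K' + K`. -/
structure IsDampedPair (ε lam : ℝ) (K L : ℝ → ℝ) : Prop where
  hasDerivAt_fst : ∀ t, HasDerivAt K ((L t - K t) / ε ^ 2) t
  hasDerivAt_snd : ∀ t, HasDerivAt L (-(lam * K t)) t
  fst_zero : K 0 = 0
  snd_zero : L 0 = 1

lemma bracket_sq (n : Freq) : bracket n ^ 2 = 1 + ∑ i, (n i : ℝ) ^ 2 :=
  Real.sq_sqrt (by positivity)

lemma one_le_bracket (n : Freq) : 1 ≤ bracket n := by
  rw [bracket, Real.one_le_sqrt]
  have : 0 ≤ ∑ i, (n i : ℝ) ^ 2 := by positivity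
  linarith

lemma bracket_pos (n : Freq) : 0 < bracket n := zero_lt_one.trans_le (one_le_bracket n)

lemma bracket_neg (n : Freq) : bracket (-n) = bracket n := by simp [bracket]

/-- Factoring out the damping exp(-t/(2ε²)) leaves the undamped equation S'' = κS. The sign of κ
selects sinh, the identity or sin, so one computation serves the three branches of `waveSymbol`. -/
lemma isDampedPair_of_oscillator {ε lam κ : ℝ} (hε : ε ≠ 0)
    (hκ : κ = (1 - 4 * lam * ε ^ 2) / (2 * ε ^ 2) ^ 2) {S C : ℝ → ℝ}
    (hS : ∀ t, HasDerivAt S (C t) t) (hC : ∀ t, HasDerivAt C (κ * S t) t) (hS0 : S 0 = 0)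
    (hC0 : C 0 = 1) :
    ∃ L, IsDampedPair ε lam (fun t => (ε ^ 2)⁻¹ * (Real.exp (-t / (2 * ε ^ 2)) * S t)) L := by
  have hexp : ∀ t : ℝ, HasDerivAt (fun t => Real.exp (-t / (2 * ε ^ 2)))
      (Real.exp (-t / (2 * ε ^ 2)) * (-1 / (2 * ε ^ 2))) t := fun t =>
    ((hasDerivAt_neg t).div_const _).exp
  refine ⟨fun t => Real.exp (-t / (2 * ε ^ 2)) * (C t + (2 * ε ^ 2)⁻¹ * S t), ?_, ?_, ?_, ?_⟩
  · intro t
    refine HasDerivAt.congr_deriv (((hexp t).mul (hS t)).const_mul ((ε ^ 2)⁻¹)) ?_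
    field_simp
    ring
  · intro t
    refine HasDerivAt.congr_deriv ((hexp t).mul ((hC t).add ((hS t).const_mul ((2 * ε ^ 2)⁻¹)))) ?_
    rw [hκ]
    field_simp
    ring
  · simp [hS0]
  · simp [hS0, hC0]

lemma exists_isDampedPair {ε : ℝ} (hε : 0 < ε) (n : Freq) :
    ∃ L, IsDampedPair ε (bracket n ^ 2) (duhamelSymbol ε n) L := by
  have hb := bracket_pos n
  have hfun : ∀ S : ℝ → ℝ, (∀ t, waveSymbol ε n t = Real.exp (-t / (2 * ε ^ 2)) * S t) →
      duhamelSymbol ε n = fun t => (ε ^ 2)⁻¹ * (Real.exp (-t / (2 * ε ^ 2)) * S t) := by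
    intro S hS
    funext t
    rw [duhamelSymbol, if_neg hε.ne', hS]
  rcases lt_trichotomy (bracket n) (2 * ε)⁻¹ with h | h | h
  · have h1 : 2 * ε * bracket n < 1 := by
      rw [lt_inv_comm₀ hb (by positivity)] at h
      calc 2 * ε * bracket n < (bracket n)⁻¹ * bracket n := by gcongr
        _ = 1 := inv_mul_cancel₀ hb.ne'
    have hpos : 0 < 1 - 4 * bracket n ^ 2 * ε ^ 2 := by nlinarith [mul_pos hε hb]
    have hl : 0 < lowFreq ε n := div_pos (Real.sqrt_pos.2 hpos) (by positivity)
    have hl2 : lowFreq ε n ^ 2 = (1 - 4 * bracket n ^ 2 * ε ^ 2) / (2 * ε ^ 2) ^ 2 := by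
      rw [lowFreq, div_pow, Real.sq_sqrt hpos.le]
    rw [hfun (fun t => Real.sinh (lowFreq ε n * t) / lowFreq ε n)
      (fun t => by rw [waveSymbol, if_pos h])]
    refine isDampedPair_of_oscillator (C := fun t => Real.cosh (lowFreq ε n * t)) hε.ne' hl2 ?_ ?_
      (by simp) (by simp)
    · intro t
      refine HasDerivAt.congr_deriv ((((hasDerivAt_id t).const_mul (lowFreq ε n)).sinh).div_const (lowFreq ε n)) ?_
      simp only [id]
      field_simp
    · intro t
      refine HasDerivAt.congr_deriv (((hasDerivAt_id t).const_mul (lowFreq ε n)).cosh) ?_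
      simp only [id]
      field_simp
  · have hpos : 2 * ε * bracket n = 1 := by rw [h]; field_simp
    have h4 : 1 - 4 * bracket n ^ 2 * ε ^ 2 = 0 := by
      calc 1 - 4 * bracket n ^ 2 * ε ^ 2 = 1 - (2 * ε * bracket n) ^ 2 := by ring
        _ = 0 := by rw [hpos]; norm_num
    rw [hfun (fun t => t) (fun t => by rw [waveSymbol, if_neg (by rw [h]; exact lt_irrefl _), if_pos h])]
    refine isDampedPair_of_oscillator (κ := 0) (C := fun _ => 1) hε.ne' (by rw [h4]; simp)
      (fun t => hasDerivAt_id t) (fun t => ?_) rfl rfl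
    simpa using hasDerivAt_const t (1 : ℝ)
  · have h1 : 1 < 2 * ε * bracket n := by
      calc (1 : ℝ) = 2 * ε * (2 * ε)⁻¹ := by field_simp
        _ < 2 * ε * bracket n := by gcongr
    have hpos : 0 < 4 * bracket n ^ 2 * ε ^ 2 - 1 := by nlinarith [mul_pos hε hb]
    have hl : 0 < highFreq ε n := div_pos (Real.sqrt_pos.2 hpos) (by positivity)
    have hl2 : -highFreq ε n ^ 2 = (1 - 4 * bracket n ^ 2 * ε ^ 2) / (2 * ε ^ 2) ^ 2 := by
      rw [highFreq, div_pow, Real.sq_sqrt hpos.le]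
      ring
    rw [hfun (fun t => Real.sin (highFreq ε n * t) / highFreq ε n)
      (fun t => by rw [waveSymbol, if_neg h.le.not_gt, if_neg h.ne'])]
    refine isDampedPair_of_oscillator (C := fun t => Real.cos (highFreq ε n * t)) hε.ne' hl2 ?_ ?_
      (by simp) (by simp)
    · intro t
      refine HasDerivAt.congr_deriv ((((hasDerivAt_id t).const_mul (highFreq ε n)).sin).div_const (highFreq ε n)) ?_
      simp only [id]
      field_simp
    · intro t
      refine HasDerivAt.congr_deriv (((hasDerivAt_id t).const_mul (highFreq ε n)).cos) ?_
      simp only [id]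
      field_simp

/-- If `ε² y' + y = f` with `|f| ≤ F`, then `|y(t)| ≤ |y(0)| e^{-t/ε²} + F`. -/
lemma abs_le_of_relaxation {ε F : ℝ} (hε : 0 < ε) {y f : ℝ → ℝ}
    (hy : ∀ t, HasDerivAt y ((f t - y t) / ε ^ 2) t) (hfc : Continuous f) {t : ℝ} (ht : 0 ≤ t)
    (hf : ∀ s ∈ Set.Icc 0 t, |f s| ≤ F) :
    |y t| ≤ |y 0| * Real.exp (-t / ε ^ 2) + F := by
  have hF : 0 ≤ F := (abs_nonneg _).trans (hf 0 ⟨le_rfl, ht⟩)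
  have hexp : ∀ s : ℝ, HasDerivAt (fun s => Real.exp (s / ε ^ 2))
      (Real.exp (s / ε ^ 2) * (1 / ε ^ 2)) s := fun s => ((hasDerivAt_id s).div_const _).exp
  have hd : ∀ s, HasDerivAt (fun s => Real.exp (s / ε ^ 2) * y s)
      (Real.exp (s / ε ^ 2) * (1 / ε ^ 2) * f s) s := by
    intro s
    refine HasDerivAt.congr_deriv ((hexp s).mul (hy s)) ?_
    field_simp
    ring
  have hI := intervalIntegral.integral_eq_sub_of_hasDerivAt (a := 0) (b := t) (fun s _ => hd s)
    ((by fun_prop : Continuous fun s => Real.exp (s / ε ^ 2) * (1 / ε ^ 2) * f s).intervalIntegrable _ _)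
  have hI2 := intervalIntegral.integral_eq_sub_of_hasDerivAt (a := 0) (b := t)
    (fun s _ => (hexp s).mul_const F)
    ((by fun_prop : Continuous fun s => Real.exp (s / ε ^ 2) * (1 / ε ^ 2) * F).intervalIntegrable _ _)
  have hle : |∫ s in (0 : ℝ)..t, Real.exp (s / ε ^ 2) * (1 / ε ^ 2) * f s| ≤
      ∫ s in (0 : ℝ)..t, Real.exp (s / ε ^ 2) * (1 / ε ^ 2) * F := by
    rw [← Real.norm_eq_abs]
    refine intervalIntegral.norm_integral_le_of_norm_le ht (ae_of_all _ fun s hs => ?_)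
      ((by fun_prop : Continuous fun s => Real.exp (s / ε ^ 2) * (1 / ε ^ 2) * F).intervalIntegrable _ _)
    rw [norm_mul, Real.norm_eq_abs, abs_of_nonneg (by positivity), Real.norm_eq_abs]
    gcongr
    exact hf s ⟨hs.1.le, hs.2⟩
  rw [hI, hI2] at hle
  simp only [zero_div, Real.exp_zero, one_mul] at hle
  have h3 : Real.exp (t / ε ^ 2) * |y t| ≤ |y 0| + Real.exp (t / ε ^ 2) * F := by
    rw [← abs_of_pos (Real.exp_pos (t / ε ^ 2)), ← abs_mul, abs_of_pos (Real.exp_pos (t / ε ^ 2))]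
    calc _ = |(Real.exp (t / ε ^ 2) * y t - y 0) + y 0| := by ring_nf
      _ ≤ _ := (abs_add_le _ _).trans (by linarith)
  have h4 : Real.exp (-t / ε ^ 2) * Real.exp (t / ε ^ 2) = 1 := by
    rw [← Real.exp_add]; simp [neg_div]
  calc |y t| = Real.exp (-t / ε ^ 2) * (Real.exp (t / ε ^ 2) * |y t|) := by
        rw [← mul_assoc, h4, one_mul]
    _ ≤ Real.exp (-t / ε ^ 2) * (|y 0| + Real.exp (t / ε ^ 2) * F) := by gcongr
    _ = |y 0| * Real.exp (-t / ε ^ 2) + (Real.exp (-t / ε ^ 2) * Real.exp (t / ε ^ 2)) * F := by ring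
    _ = _ := by rw [h4, one_mul]

namespace IsDampedPair

variable {ε lam : ℝ} {K L : ℝ → ℝ}

lemma continuous_fst (h : IsDampedPair ε lam K L) : Continuous K :=
  continuous_iff_continuousAt.2 fun t => (h.hasDerivAt_fst t).continuousAt

lemma continuous_snd (h : IsDampedPair ε lam K L) : Continuous L :=
  continuous_iff_continuousAt.2 fun t => (h.hasDerivAt_snd t).continuousAt

lemma continuous_deriv (h : IsDampedPair ε lam K L) : Continuous fun t => (L t - K t) / ε ^ 2 :=
  (h.continuous_snd.sub h.continuous_fst).div_const _

/-- The quantity L² + ε²λK² starts at 1 and is dissipated at the exact rate 2λK². This gives the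
same bound 1/(2λ) for ∫K² as for the heat kernel, free of ε and t. -/
lemma energy (h : IsDampedPair ε lam K L) (hε : 0 < ε) (t : ℝ) :
    L t ^ 2 + ε ^ 2 * lam * K t ^ 2 + 2 * lam * ∫ s in (0 : ℝ)..t, K s ^ 2 = 1 := by
  have hd : ∀ s, HasDerivAt (fun s => L s ^ 2 + ε ^ 2 * lam * K s ^ 2)
      (-(2 * lam) * K s ^ 2) s := by
    intro s
    refine HasDerivAt.congr_deriv (((h.hasDerivAt_snd s).pow 2).add (((h.hasDerivAt_fst s).pow 2).const_mul (ε ^ 2 * lam))) ?_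
    field_simp
    ring
  have hI := intervalIntegral.integral_eq_sub_of_hasDerivAt (a := 0) (b := t) (fun s _ => hd s)
    (((h.continuous_fst.pow 2).const_mul _).intervalIntegrable _ _)
  rw [intervalIntegral.integral_const_mul] at hI
  simp only [h.fst_zero, h.snd_zero] at hI
  linarith

lemma integral_sq_nonneg (f : ℝ → ℝ) {t : ℝ} (ht : 0 ≤ t) : 0 ≤ ∫ s in (0 : ℝ)..t, f s ^ 2 :=
  intervalIntegral.integral_nonneg ht fun _ _ => sq_nonneg _

lemma integral_sq_le (h : IsDampedPair ε lam K L) (hε : 0 < ε) (hl : 0 < lam) (t : ℝ) :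
    ∫ s in (0 : ℝ)..t, K s ^ 2 ≤ 1 / (2 * lam) := by
  have := h.energy hε t
  rw [le_div_iff₀ (by positivity)]
  nlinarith [sq_nonneg (L t), mul_nonneg (mul_nonneg (sq_nonneg ε) hl.le) (sq_nonneg (K t))]

lemma abs_snd_le (h : IsDampedPair ε lam K L) (hε : 0 < ε) (hl : 0 < lam) {t : ℝ} (ht : 0 ≤ t) :
    |L t| ≤ 1 := by
  have := h.energy hε t
  have h2 := mul_nonneg hl.le (integral_sq_nonneg K ht)
  have h3 := mul_nonneg (mul_nonneg (sq_nonneg ε) hl.le) (sq_nonneg (K t))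
  rw [← sq_le_one_iff_abs_le_one]
  linarith

lemma abs_fst_le (h : IsDampedPair ε lam K L) (hε : 0 < ε) (hl : 0 < lam) {t : ℝ} (ht : 0 ≤ t) :
    |K t| ≤ 1 := by
  have := abs_le_of_relaxation hε h.hasDerivAt_fst h.continuous_snd ht
    (fun s hs => h.abs_snd_le hε hl hs.1)
  simpa [h.fst_zero] using this

lemma hasDerivAt_deriv (h : IsDampedPair ε lam K L) (t : ℝ) :
    HasDerivAt (fun t => (L t - K t) / ε ^ 2)
      ((-(lam * K t) - (L t - K t) / ε ^ 2) / ε ^ 2) t :=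
  ((h.hasDerivAt_snd t).sub (h.hasDerivAt_fst t)).div_const _

/-- K' itself relaxes: ε²(K')' + K' = -λK with |λK| ≤ λ and K'(0) = ε⁻². The exponential term is the
initial layer; its time integral is at most 1, so the total variation of K stays bounded as ε → 0.
-/
lemma abs_deriv_le (h : IsDampedPair ε lam K L) (hε : 0 < ε) (hl : 0 < lam) {t : ℝ} (ht : 0 ≤ t) :
    |(L t - K t) / ε ^ 2| ≤ (ε ^ 2)⁻¹ * Real.exp (-t / ε ^ 2) + lam := by
  have := abs_le_of_relaxation (F := lam) hε h.hasDerivAt_deriv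
    (h.continuous_fst.const_mul lam).neg ht (fun s hs => by
      rw [abs_neg, abs_mul, abs_of_pos hl]
      nlinarith [h.abs_fst_le hε hl hs.1])
  simpa [h.fst_zero, h.snd_zero] using this

lemma integral_abs_deriv_le (h : IsDampedPair ε lam K L) (hε : 0 < ε) (hl : 0 < lam) {t : ℝ}
    (ht : 0 ≤ t) : ∫ s in (0 : ℝ)..t, |(L s - K s) / ε ^ 2| ≤ 1 + lam * t := by
  have hd : ∀ s : ℝ, HasDerivAt (fun s => -Real.exp (-s / ε ^ 2) + lam * s)
      ((ε ^ 2)⁻¹ * Real.exp (-s / ε ^ 2) + lam) s := by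
    intro s
    refine HasDerivAt.congr_deriv ((((hasDerivAt_neg s).div_const (ε ^ 2)).exp.neg).add ((hasDerivAt_id s).const_mul lam)) ?_
    field_simp
  have hc : Continuous fun s => (ε ^ 2)⁻¹ * Real.exp (-s / ε ^ 2) + lam := by fun_prop
  have hI := intervalIntegral.integral_eq_sub_of_hasDerivAt (a := 0) (b := t) (fun s _ => hd s)
    (hc.intervalIntegrable _ _)
  calc _ ≤ ∫ s in (0 : ℝ)..t, ((ε ^ 2)⁻¹ * Real.exp (-s / ε ^ 2) + lam) := by
        refine intervalIntegral.integral_mono_on ht (h.continuous_deriv.abs.intervalIntegrable _ _)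
          (hc.intervalIntegrable _ _) fun s hs => h.abs_deriv_le hε hl hs.1
    _ ≤ _ := by
        rw [hI]
        have := Real.exp_pos (-t / ε ^ 2)
        simp
        linarith

/-- ε²K'² + λK² starts at ε⁻² and decreases at the rate 2K'². -/
lemma integral_deriv_sq_le (h : IsDampedPair ε lam K L) (hε : 0 < ε) (hl : 0 < lam) (t : ℝ) :
    ∫ s in (0 : ℝ)..t, ((L s - K s) / ε ^ 2) ^ 2 ≤ 1 / (2 * ε ^ 2) := by
  have hd : ∀ s, HasDerivAt (fun s => ε ^ 2 * ((L s - K s) / ε ^ 2) ^ 2 + lam * K s ^ 2)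
      (-2 * ((L s - K s) / ε ^ 2) ^ 2) s := by
    intro s
    refine HasDerivAt.congr_deriv ((((h.hasDerivAt_deriv s).pow 2).const_mul (ε ^ 2)).add
      (((h.hasDerivAt_fst s).pow 2).const_mul lam)) ?_
    have hne : ε ≠ 0 := hε.ne'
    simp only [Nat.cast_ofNat, Nat.add_one_sub_one, pow_one]
    field_simp
    ring
  have hI := intervalIntegral.integral_eq_sub_of_hasDerivAt (a := 0) (b := t) (fun s _ => hd s)
    (((h.continuous_deriv.pow 2).const_mul _).intervalIntegrable _ _)
  rw [intervalIntegral.integral_const_mul] at hI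
  simp only [h.fst_zero, h.snd_zero] at hI
  have h1 : 0 ≤ ε ^ 2 * ((L t - K t) / ε ^ 2) ^ 2 + lam * K t ^ 2 := by positivity
  have h2 : ε ^ 2 * ((1 - 0) / ε ^ 2) ^ 2 + lam * 0 ^ 2 = 1 / ε ^ 2 := by field_simp; ring
  rw [h2] at hI
  rw [show 1 / (2 * ε ^ 2) = (1 / ε ^ 2) / 2 by field_simp]
  linarith

/-- An energy estimate for a perturbed oscillator. -/
lemma integral_sq_le_of_perturbation {ε lam : ℝ} (hε : 0 < ε) (hl : 0 < lam) {k l r : ℝ → ℝ}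
    (hr : Continuous r) (hk : ∀ t, HasDerivAt k ((l t - k t - r t) / ε ^ 2) t)
    (hlk : ∀ t, HasDerivAt l (-(lam * k t)) t) {t : ℝ} (ht : 0 ≤ t) :
    lam * ∫ s in (0 : ℝ)..t, k s ^ 2 ≤
      l 0 ^ 2 + ε ^ 2 * lam * k 0 ^ 2 + lam * ∫ s in (0 : ℝ)..t, r s ^ 2 := by
  have hkc : Continuous k := continuous_iff_continuousAt.2 fun t => (hk t).continuousAt
  have hd : ∀ s, HasDerivAt (fun s => l s ^ 2 + ε ^ 2 * lam * k s ^ 2)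
      (-(2 * lam) * k s ^ 2 - 2 * lam * (k s * r s)) s := by
    intro s
    refine HasDerivAt.congr_deriv (((hlk s).pow 2).add (((hk s).pow 2).const_mul (ε ^ 2 * lam))) ?_
    field_simp
    ring
  have hI := intervalIntegral.integral_eq_sub_of_hasDerivAt (a := 0) (b := t) (fun s _ => hd s)
    ((by fun_prop : Continuous fun s => -(2 * lam) * k s ^ 2 - 2 * lam * (k s * r s)).intervalIntegrable _ _)
  have hle : ∫ s in (0 : ℝ)..t, (-(2 * lam) * k s ^ 2 - 2 * lam * (k s * r s)) ≤
      ∫ s in (0 : ℝ)..t, (lam * r s ^ 2 - lam * k s ^ 2) := by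
    refine intervalIntegral.integral_mono_on ht (Continuous.intervalIntegrable (by fun_prop) _ _)
      (Continuous.intervalIntegrable (by fun_prop) _ _) fun s _ => ?_
    nlinarith [mul_nonneg hl.le (sq_nonneg (k s + r s))]
  have hle' := hle
  rw [hI] at hle'
  rw [intervalIntegral.integral_sub (Continuous.intervalIntegrable (by fun_prop) _ _)
    (Continuous.intervalIntegrable (by fun_prop) _ _), intervalIntegral.integral_const_mul,
    intervalIntegral.integral_const_mul] at hle'
  have : 0 ≤ l t ^ 2 + ε ^ 2 * lam * k t ^ 2 := by positivity
  linarith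

/-- The difference solves the ε-oscillator with source (ε² - ε'²)K'_{ε'} and zero data. Placing the
larger parameter in the source makes the cost 1/(2ε'²) of K' harmless, because (ε + ε')² ≤ 4ε'². -/
lemma integral_sub_sq_le {ε' : ℝ} {K' L' : ℝ → ℝ} (h : IsDampedPair ε lam K L)
    (h' : IsDampedPair ε' lam K' L') (hε : 0 < ε) (hε' : ε ≤ ε') (hl : 0 < lam) {t : ℝ}
    (ht : 0 ≤ t) : ∫ s in (0 : ℝ)..t, (K s - K' s) ^ 2 ≤ 2 * (ε - ε') ^ 2 := by
  have hε'0 : 0 < ε' := hε.trans_le hε'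
  have := integral_sq_le_of_perturbation (ε := ε) (lam := lam) (k := fun s => K s - K' s)
    (l := fun s => L s - L' s) (r := fun s => (ε ^ 2 - ε' ^ 2) * ((L' s - K' s) / ε' ^ 2)) hε hl
    (h'.continuous_deriv.const_mul _) (fun s => by
      refine HasDerivAt.congr_deriv ((h.hasDerivAt_fst s).sub (h'.hasDerivAt_fst s)) ?_
      field_simp
      ring) (fun s => by
      refine HasDerivAt.congr_deriv ((h.hasDerivAt_snd s).sub (h'.hasDerivAt_snd s)) ?_
      ring) ht
  simp only [h.fst_zero, h'.fst_zero, h.snd_zero, h'.snd_zero, sub_self, mul_pow] at this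
  rw [intervalIntegral.integral_const_mul] at this
  have h3 : ∫ s in (0 : ℝ)..t, (K s - K' s) ^ 2 ≤
      (ε ^ 2 - ε' ^ 2) ^ 2 * ∫ s in (0 : ℝ)..t, ((L' s - K' s) / ε' ^ 2) ^ 2 := by
    have := this
    simp only [ne_eq, OfNat.ofNat_ne_zero, not_false_eq_true, zero_pow, mul_zero, zero_add] at this
    exact le_of_mul_le_mul_left this hl
  calc _ ≤ (ε ^ 2 - ε' ^ 2) ^ 2 * (1 / (2 * ε' ^ 2)) :=
        h3.trans (by gcongr; exact h'.integral_deriv_sq_le hε'0 hl t)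
    _ ≤ 2 * (ε - ε') ^ 2 := by
        rw [mul_one_div, div_le_iff₀ (by positivity)]
        have : (ε + ε') ^ 2 ≤ (2 * ε') ^ 2 := by gcongr; linarith
        nlinarith [mul_le_mul_of_nonneg_left this (sq_nonneg (ε - ε'))]

/-- The heat kernel solves the ε-oscillator up to a source of size ε²λe^{-λs}. It starts at 1
instead of 0; this initial mismatch enters the energy only through the term ε²λk(0)². -/
lemma integral_sub_exp_sq_le (h : IsDampedPair ε lam K L) (hε : 0 < ε) (hε1 : ε ≤ 1) (hl : 0 < lam)
    {t : ℝ} (ht : 0 ≤ t) :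
    ∫ s in (0 : ℝ)..t, (K s - Real.exp (-s * lam)) ^ 2 ≤ (1 + lam) * ε ^ 2 := by
  have hexp : ∀ s : ℝ, HasDerivAt (fun s => Real.exp (-s * lam)) (Real.exp (-s * lam) * (-lam)) s :=
    fun s => by
      refine HasDerivAt.congr_deriv (((hasDerivAt_neg s).mul_const lam).exp) ?_
      ring
  have := integral_sq_le_of_perturbation (ε := ε) (lam := lam)
    (k := fun s => K s - Real.exp (-s * lam)) (l := fun s => L s - Real.exp (-s * lam))
    (r := fun s => -(ε ^ 2 * lam) * Real.exp (-s * lam)) hε hl (by fun_prop) (fun s => by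
      refine HasDerivAt.congr_deriv ((h.hasDerivAt_fst s).sub (hexp s)) ?_
      field_simp
      ring) (fun s => by
      refine HasDerivAt.congr_deriv ((h.hasDerivAt_snd s).sub (hexp s)) ?_
      ring) ht
  simp only [h.fst_zero, h.snd_zero, mul_pow] at this
  rw [intervalIntegral.integral_const_mul] at this
  have hexp2 : ∀ s : ℝ, HasDerivAt (fun s => -(2 * lam)⁻¹ * Real.exp (-s * lam) ^ 2)
      (Real.exp (-s * lam) ^ 2) s := fun s => by
    refine HasDerivAt.congr_deriv (((hexp s).pow 2).const_mul (-(2 * lam)⁻¹)) ?_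
    field_simp
    ring
  have hI := intervalIntegral.integral_eq_sub_of_hasDerivAt (a := 0) (b := t) (fun s _ => hexp2 s)
    (Continuous.intervalIntegrable (by fun_prop) _ _)
  have hI' : ∫ s in (0 : ℝ)..t, Real.exp (-s * lam) ^ 2 ≤ (2 * lam)⁻¹ := by
    rw [hI]
    have : 0 ≤ (2 * lam)⁻¹ * Real.exp (-t * lam) ^ 2 := by positivity
    simp
    simp at this
    linarith
  simp only [neg_zero, zero_mul, Real.exp_zero, sub_self, zero_sub] at this
  have h5 : lam * ∫ s in (0 : ℝ)..t, (K s - Real.exp (-s * lam)) ^ 2 ≤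
      lam * ((1 + lam) * ε ^ 2) := by
    refine this.trans ?_
    have h6 : (-(ε ^ 2 * lam)) ^ 2 * (∫ s in (0 : ℝ)..t, Real.exp (-s * lam) ^ 2) ≤
        (ε ^ 2 * lam) ^ 2 * (2 * lam)⁻¹ := by
      rw [neg_sq]; gcongr
    have h7 : (ε ^ 2 * lam) ^ 2 * (2 * lam)⁻¹ = ε ^ 2 * (ε ^ 2 * lam) / 2 := by
      field_simp
    have h8 : ε ^ 2 * (ε ^ 2 * lam) ≤ ε ^ 2 * (1 * lam) := by
      gcongr
      nlinarith
    have h9 : 0 ≤ ε ^ 2 * lam := by positivity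
    nlinarith
  exact le_of_mul_le_mul_left h5 hl

end IsDampedPair

/-! ### The Duhamel symbol -/

/-- The time derivative of the Duhamel symbol. -/
def duhamelDeriv (ε : ℝ) (n : Freq) (t : ℝ) : ℝ := deriv (duhamelSymbol ε n) t

lemma duhamelSymbol_zero_left (n : Freq) :
    duhamelSymbol 0 n = fun t => Real.exp (-t * bracket n ^ 2) := by
  funext t; simp [duhamelSymbol]

lemma hasDerivAt_duhamelSymbol_zero (n : Freq) (t : ℝ) :
    HasDerivAt (duhamelSymbol 0 n) (-(bracket n ^ 2 * Real.exp (-t * bracket n ^ 2))) t := by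
  rw [duhamelSymbol_zero_left]
  refine HasDerivAt.congr_deriv (((hasDerivAt_neg t).mul_const (bracket n ^ 2)).exp) ?_
  ring

lemma duhamelDeriv_zero (n : Freq) :
    duhamelDeriv 0 n = fun t => -(bracket n ^ 2 * Real.exp (-t * bracket n ^ 2)) := by
  funext t; exact (hasDerivAt_duhamelSymbol_zero n t).deriv

lemma duhamelDeriv_of_pair {ε : ℝ} {n : Freq} {L : ℝ → ℝ}
    (hL : IsDampedPair ε (bracket n ^ 2) (duhamelSymbol ε n) L) :
    duhamelDeriv ε n = fun t => (L t - duhamelSymbol ε n t) / ε ^ 2 := by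
  funext t; exact (hL.hasDerivAt_fst t).deriv

lemma hasDerivAt_duhamelSymbol {ε : ℝ} (hε : 0 ≤ ε) (n : Freq) (t : ℝ) :
    HasDerivAt (duhamelSymbol ε n) (duhamelDeriv ε n t) t := by
  rcases hε.eq_or_lt with rfl | hε
  · exact (hasDerivAt_duhamelSymbol_zero n t).differentiableAt.hasDerivAt
  · obtain ⟨L, hL⟩ := exists_isDampedPair hε n
    exact (hL.hasDerivAt_fst t).differentiableAt.hasDerivAt

lemma continuous_duhamelSymbol {ε : ℝ} (hε : 0 ≤ ε) (n : Freq) : Continuous (duhamelSymbol ε n) :=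
  continuous_iff_continuousAt.2 fun t => (hasDerivAt_duhamelSymbol hε n t).continuousAt

lemma continuous_duhamelDeriv {ε : ℝ} (hε : 0 ≤ ε) (n : Freq) : Continuous (duhamelDeriv ε n) := by
  rcases hε.eq_or_lt with rfl | hε
  · rw [duhamelDeriv_zero]; fun_prop
  · obtain ⟨L, hL⟩ := exists_isDampedPair hε n
    rw [duhamelDeriv_of_pair hL]
    exact hL.continuous_deriv

/-- The variance `∫_0^t K_ε(n,s)² ds` of the `n`-th mode. -/
def modeVar (ε : ℝ) (n : Freq) (t : ℝ) : ℝ := ∫ s in (0 : ℝ)..t, duhamelSymbol ε n s ^ 2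

lemma modeVar_nonneg (ε : ℝ) (n : Freq) {t : ℝ} (ht : 0 ≤ t) : 0 ≤ modeVar ε n t :=
  intervalIntegral.integral_nonneg ht fun _ _ => sq_nonneg _

lemma modeVar_le {ε : ℝ} (hε : 0 ≤ ε) (n : Freq) (t : ℝ) :
    modeVar ε n t ≤ 1 / (2 * bracket n ^ 2) := by
  have hb := bracket_pos n
  rcases hε.eq_or_lt with rfl | hε
  · have hd : ∀ s : ℝ, HasDerivAt
        (fun s => -(2 * bracket n ^ 2)⁻¹ * Real.exp (-s * bracket n ^ 2) ^ 2)
        (Real.exp (-s * bracket n ^ 2) ^ 2) s := fun s => by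
      refine HasDerivAt.congr_deriv ((((((hasDerivAt_neg s).mul_const (bracket n ^ 2)).exp).pow 2).const_mul
        (-(2 * bracket n ^ 2)⁻¹))) ?_
      field_simp
      ring
    have hI := intervalIntegral.integral_eq_sub_of_hasDerivAt (a := 0) (b := t) (fun s _ => hd s)
      (Continuous.intervalIntegrable (by fun_prop) _ _)
    rw [modeVar, duhamelSymbol_zero_left, hI]
    have : 0 ≤ (2 * bracket n ^ 2)⁻¹ * Real.exp (-t * bracket n ^ 2) ^ 2 := by positivity
    simp only [neg_zero, zero_mul, Real.exp_zero, one_pow, mul_one, one_div]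
    linarith
  · obtain ⟨L, hL⟩ := exists_isDampedPair hε n
    exact hL.integral_sq_le hε (by positivity) t

/-- Total variation including the jump at time 0: the heat kernel jumps by 1 and then decreases by
at most 1, while the oscillator starts at 0 and varies by at most 1 + ⟨n⟩²t. Multiplied by the
oscillation of the path it bounds the integrated-by-parts convolution. -/
lemma abs_add_integral_duhamelDeriv_le {ε : ℝ} (hε : 0 ≤ ε) (n : Freq) {t : ℝ} (ht : 0 ≤ t) :
    |duhamelSymbol ε n 0| + ∫ s in (0 : ℝ)..t, |duhamelDeriv ε n s| ≤ 2 + bracket n ^ 2 * t := by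
  have hb := bracket_pos n
  rcases hε.eq_or_lt with rfl | hε
  · have hI := intervalIntegral.integral_eq_sub_of_hasDerivAt (a := 0) (b := t)
      (fun s _ => hasDerivAt_duhamelSymbol_zero n s)
      (Continuous.intervalIntegrable (by fun_prop) _ _)
    have : ∫ s in (0 : ℝ)..t, |duhamelDeriv 0 n s| =
        -∫ s in (0 : ℝ)..t, -(bracket n ^ 2 * Real.exp (-s * bracket n ^ 2)) := by
      rw [← intervalIntegral.integral_neg]
      refine intervalIntegral.integral_congr fun s _ => ?_
      simp only [duhamelDeriv_zero]
      rw [abs_neg, abs_of_nonneg (by positivity), neg_neg]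
    rw [this, hI, duhamelSymbol_zero_left]
    have h2 := Real.exp_pos (-t * bracket n ^ 2)
    have h3 : 0 ≤ bracket n ^ 2 * t := by positivity
    simp only [neg_zero, zero_mul, Real.exp_zero, abs_one]
    linarith
  · obtain ⟨L, hL⟩ := exists_isDampedPair hε n
    have := hL.integral_abs_deriv_le hε (by positivity) ht
    rw [duhamelDeriv_of_pair hL, hL.fst_zero, abs_zero]
    linarith

lemma integral_duhamelSymbol_sub_sq_le {ε ε' : ℝ} (hε : 0 ≤ ε) (hε' : ε' ≤ 1) (h : ε ≤ ε')
    (n : Freq) {t : ℝ} (ht : 0 ≤ t) :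
    ∫ s in (0 : ℝ)..t, (duhamelSymbol ε n s - duhamelSymbol ε' n s) ^ 2 ≤
      2 * bracket n ^ 2 * (ε - ε') ^ 2 := by
  have hb : 1 ≤ bracket n ^ 2 := one_le_pow₀ (one_le_bracket n)
  rcases h.eq_or_lt with rfl | hlt
  · simp
  have hε'0 : 0 < ε' := hε.trans_lt hlt
  obtain ⟨L', hL'⟩ := exists_isDampedPair hε'0 n
  rcases hε.eq_or_lt with rfl | hε
  · have := hL'.integral_sub_exp_sq_le hε'0 hε' (by positivity) ht
    have h2 : ∀ s : ℝ, (duhamelSymbol 0 n s - duhamelSymbol ε' n s) ^ 2 =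
        (duhamelSymbol ε' n s - Real.exp (-s * bracket n ^ 2)) ^ 2 := fun s => by
      rw [duhamelSymbol_zero_left]; ring
    simp only [h2]
    refine this.trans ?_
    rw [zero_sub, neg_sq]
    gcongr
    linarith
  · obtain ⟨L, hL⟩ := exists_isDampedPair hε n
    refine (hL.integral_sub_sq_le hL' hε h (by positivity) ht).trans ?_
    nlinarith [sq_nonneg (ε - ε')]

/-! ### Pathwise regularity of the Wiener integrals -/

/-- The Wiener integral `∫_0^t K_ε(n, t - s) dg(s)` after integration by parts. -/
def duhamelInt (ε : ℝ) (n : Freq) (g : ℝ → ℂ) (t : ℝ) : ℂ :=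
  duhamelSymbol ε n 0 * g t + ∫ s in (0 : ℝ)..t, (duhamelDeriv ε n (t - s) : ℂ) * g s

lemma wienerIntegral_duhamelSymbol {ε : ℝ} (hε : 0 ≤ ε) (n : Freq) {b : ℝ≥0 → ℂ}
    (hb : Continuous b) (hb0 : b 0 = 0) {t : ℝ} (ht : 0 ≤ t) :
    wienerIntegral (fun s => duhamelSymbol ε n (t - s)) b t =
      duhamelInt ε n (fun s => b s.toNNReal) t := by
  have h := tendsto_riemannSum (f := fun s => duhamelSymbol ε n (t - s))
    (f' := fun s => -duhamelDeriv ε n (t - s)) (fun s => by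
      refine HasDerivAt.congr_deriv ((hasDerivAt_duhamelSymbol hε n (t - s)).comp s
        ((hasDerivAt_id s).const_sub t)) ?_
      ring)
    (((continuous_duhamelDeriv hε n).comp (by fun_prop)).neg) hb ht
  rw [wienerIntegral, h.limUnder_eq, duhamelInt, hb0]
  simp only [sub_self, mul_zero, sub_zero, Complex.ofReal_neg, neg_mul,
    intervalIntegral.integral_neg, sub_neg_eq_add]

/-- With the path extended by zero to negative times, the time shift can be put on the path over a
fixed interval. Time increments of the convolution then become integrals of increments of g. -/
lemma duhamelInt_eq_integral_shift {ε : ℝ} (hε : 0 ≤ ε) (n : Freq) {g : ℝ → ℂ} (hg : Continuous g)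
    (hg0 : ∀ s ≤ 0, g s = 0) {t T : ℝ} (htT : t ≤ T) :
    duhamelInt ε n g t =
      duhamelSymbol ε n 0 * g t + ∫ r in (0 : ℝ)..T, (duhamelDeriv ε n r : ℂ) * g (t - r) := by
  have hc := continuous_duhamelDeriv hε n
  have hint : ∀ a b : ℝ, IntervalIntegrable (fun r => (duhamelDeriv ε n r : ℂ) * g (t - r)) volume
      a b := fun a b => Continuous.intervalIntegrable (by fun_prop) _ _
  rw [duhamelInt, ← intervalIntegral.integral_add_adjacent_intervals (hint 0 t) (hint t T)]
  have h1 : ∫ r in t..T, (duhamelDeriv ε n r : ℂ) * g (t - r) = 0 := by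
    rw [intervalIntegral.integral_congr (g := fun _ => (0 : ℂ))]
    · simp
    · intro r hr
      rw [Set.uIcc_of_le htT] at hr
      simp [hg0 (t - r) (by linarith [hr.1])]
  have h2 := intervalIntegral.integral_comp_sub_left (a := 0) (b := t)
    (fun r => (duhamelDeriv ε n r : ℂ) * g (t - r)) t
  simp only [sub_sub_cancel, sub_self, sub_zero] at h2
  rw [h1, add_zero, h2]

/-- The moving average of `g` over an interval of length `h`. -/
def movingAverage (h : ℝ) (g : ℝ → ℂ) (s : ℝ) : ℂ := (h : ℂ)⁻¹ * ∫ r in (s - h)..s, g r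

lemma hasDerivAt_movingAverage {h : ℝ} {g : ℝ → ℂ} (hg : Continuous g) (s : ℝ) :
    HasDerivAt (movingAverage h g) ((h : ℂ)⁻¹ * (g s - g (s - h))) s := by
  have hG : ∀ u : ℝ, HasDerivAt (fun u => ∫ r in (0 : ℝ)..u, g r) (g u) u := fun u =>
    (hg.integral_hasStrictDerivAt 0 u).hasDerivAt
  have heq : movingAverage h g = fun s => (h : ℂ)⁻¹ *
      ((∫ r in (0 : ℝ)..s, g r) - ∫ r in (0 : ℝ)..(s - h), g r) := by
    funext s
    rw [movingAverage, intervalIntegral.integral_interval_sub_left (hg.intervalIntegrable _ _)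
      (hg.intervalIntegrable _ _)]
  rw [heq]
  exact ((hG s).sub ((hG (s - h)).comp_sub_const s h)).const_mul _

lemma norm_sub_movingAverage_le {h c : ℝ} (hh : 0 < h) {g : ℝ → ℂ} (hg : Continuous g) {s : ℝ}
    (hc : ∀ r, s - h ≤ r → r ≤ s → ‖g s - g r‖ ≤ c) : ‖g s - movingAverage h g s‖ ≤ c := by
  have h1 : g s - movingAverage h g s = (h : ℂ)⁻¹ * ∫ r in (s - h)..s, (g s - g r) := by
    rw [movingAverage, intervalIntegral.integral_sub (by simp) (hg.intervalIntegrable _ _),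
      intervalIntegral.integral_const]
    have : (h : ℂ) ≠ 0 := by exact_mod_cast hh.ne'
    rw [mul_sub, sub_sub_cancel, Complex.real_smul]
    field_simp
  have h2 := intervalIntegral.norm_integral_le_of_norm_le_const (a := s - h) (b := s)
    (f := fun r => g s - g r) (C := c) (fun r hr => by
      rw [Set.uIoc_of_le (by linarith)] at hr
      exact hc r hr.1.le hr.2)
  rw [h1, norm_mul, norm_inv, Complex.norm_real, Real.norm_of_nonneg hh.le]
  rw [sub_sub_cancel, abs_of_pos hh] at h2
  calc h⁻¹ * _ ≤ h⁻¹ * (c * h) := by gcongr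
    _ = c := by field_simp

/-! ### Convolution of a differentiable kernel with a Hölder path. -/

section Kernel

variable {k k' : ℝ → ℝ} {g : ℝ → ℂ}

lemma norm_convolution_le (hk' : Continuous k') (hg : Continuous g) {c t T : ℝ} (ht : 0 ≤ t)
    (htT : t ≤ T) (hc : ∀ s, 0 ≤ s → s ≤ t → ‖g s‖ ≤ c) :
    ‖(k 0 : ℂ) * g t + ∫ s in (0 : ℝ)..t, (k' (t - s) : ℂ) * g s‖ ≤
      (|k 0| + ∫ r in (0 : ℝ)..T, |k' r|) * c := by
  have hc0 : 0 ≤ c := (norm_nonneg _).trans (hc t ht le_rfl)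
  have h1 : ‖∫ s in (0 : ℝ)..t, (k' (t - s) : ℂ) * g s‖ ≤ ∫ s in (0 : ℝ)..t, |k' (t - s)| * c := by
    refine intervalIntegral.norm_integral_le_of_norm_le ht (ae_of_all _ fun s hs => ?_)
      (Continuous.intervalIntegrable (by fun_prop) _ _)
    rw [norm_mul, Complex.norm_real, Real.norm_eq_abs]
    gcongr
    exact hc s hs.1.le hs.2
  have h2 : ∫ s in (0 : ℝ)..t, |k' (t - s)| * c = (∫ r in (0 : ℝ)..t, |k' r|) * c := by
    rw [intervalIntegral.integral_mul_const]
    have := intervalIntegral.integral_comp_sub_left (a := 0) (b := t) (fun r => |k' r|) t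
    simp only [sub_self, sub_zero] at this
    rw [this]
  have h3 : ∫ r in (0 : ℝ)..t, |k' r| ≤ ∫ r in (0 : ℝ)..T, |k' r| :=
    intervalIntegral.integral_mono_interval le_rfl ht htT (ae_of_all _ fun _ => abs_nonneg _)
      (hk'.abs.intervalIntegrable _ _)
  calc _ ≤ ‖(k 0 : ℂ) * g t‖ + _ := norm_add_le _ _
    _ ≤ |k 0| * c + (∫ r in (0 : ℝ)..T, |k' r|) * c := by
        rw [norm_mul, Complex.norm_real, Real.norm_eq_abs]
        gcongr
        · exact hc t ht le_rfl
        · exact h1.trans (h2.le.trans (by gcongr))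
    _ = _ := by ring

lemma convolution_deriv_eq {g' : ℝ → ℂ} (hk : ∀ t, HasDerivAt k (k' t) t) (hk' : Continuous k')
    (hg : ∀ s, HasDerivAt g (g' s) s) (hg' : Continuous g') (hg0 : g 0 = 0) (t : ℝ) :
    (k 0 : ℂ) * g t + ∫ s in (0 : ℝ)..t, (k' (t - s) : ℂ) * g s =
      ∫ s in (0 : ℝ)..t, (k (t - s) : ℂ) * g' s := by
  have hgc : Continuous g := continuous_iff_continuousAt.2 fun s => (hg s).continuousAt
  have hkc : Continuous k := continuous_iff_continuousAt.2 fun s => (hk s).continuousAt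
  have hd : ∀ s, HasDerivAt (fun s => (k (t - s) : ℂ) * g s)
      ((k (t - s) : ℂ) * g' s - (k' (t - s) : ℂ) * g s) s := by
    intro s
    have h1 : HasDerivAt (fun s => (k (t - s) : ℂ)) (-(k' (t - s) : ℂ)) s := by
      have := ((hk (t - s)).comp s ((hasDerivAt_id s).const_sub t)).ofReal_comp
      refine this.congr_deriv ?_
      push_cast
      ring
    refine (h1.mul (hg s)).congr_deriv ?_
    ring
  have hI := intervalIntegral.integral_eq_sub_of_hasDerivAt (a := 0) (b := t) (fun s _ => hd s)
    (Continuous.intervalIntegrable (by fun_prop) _ _)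
  rw [intervalIntegral.integral_sub (Continuous.intervalIntegrable (by fun_prop) _ _)
    (Continuous.intervalIntegrable (by fun_prop) _ _)] at hI
  simp only [sub_self, hg0, mul_zero, sub_zero] at hI
  linear_combination -hI

/-- Two norms of the kernel are combined. Against g minus its moving average at scale h, of size H
h^{1/4}, the total variation of k is used. Against the average, which is differentiable with
derivative at most h⁻¹ H h^{1/4}, integrating by parts back leaves only the L¹ norm of k. -/
lemma norm_convolution_le_of_holder (hk : ∀ t, HasDerivAt k (k' t) t) (hk' : Continuous k')
    (hg : Continuous g) (hg0 : ∀ s ≤ 0, g s = 0) {t T H h : ℝ} (ht : 0 ≤ t) (htT : t ≤ T)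
    (hH : ∀ s s', s ≤ T → s' ≤ T → ‖g s - g s'‖ ≤ H * |s - s'| ^ (1 / 4 : ℝ)) (hh : 0 < h)
    (hH0 : 0 ≤ H) :
    ‖(k 0 : ℂ) * g t + ∫ s in (0 : ℝ)..t, (k' (t - s) : ℂ) * g s‖ ≤
      (|k 0| + ∫ r in (0 : ℝ)..T, |k' r|) * (H * h ^ (1 / 4 : ℝ)) +
        (∫ r in (0 : ℝ)..T, |k r|) * (h⁻¹ * (H * h ^ (1 / 4 : ℝ))) := by
  have hkc : Continuous k := continuous_iff_continuousAt.2 fun s => (hk s).continuousAt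
  set m := movingAverage h g with hm
  have hmd := fun s => hasDerivAt_movingAverage (h := h) hg s
  have hmc : Continuous m := continuous_iff_continuousAt.2 fun s => (hmd s).continuousAt
  have hm0 : m 0 = 0 := by
    rw [hm, movingAverage, intervalIntegral.integral_congr (g := fun _ => (0 : ℂ))]
    · simp
    · intro r hr
      rw [Set.uIcc_of_le (by linarith)] at hr
      exact hg0 r hr.2
  have hdiff : ∀ s, s ≤ T → ‖g s - m s‖ ≤ H * h ^ (1 / 4 : ℝ) := fun s hs =>
    norm_sub_movingAverage_le hh hg fun r hr hrs => (hH s r hs (hrs.trans hs)).trans (by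
      gcongr
      rw [abs_of_nonneg (by linarith)]
      linarith)
  have h1 := norm_convolution_le (k := k) hk' (hg.sub hmc) ht htT
    (fun s _ hs => hdiff s (hs.trans htT))
  have h2 := convolution_deriv_eq hk hk' hmd (by fun_prop) hm0 t
  have h3 := norm_convolution_le (k := fun _ => 0) (k' := k)
    (g := fun s => (h : ℂ)⁻¹ * (g s - g (s - h))) hkc (by fun_prop)
    (c := h⁻¹ * (H * h ^ (1 / 4 : ℝ))) ht htT (fun s _ hs => by
      rw [norm_mul, norm_inv, Complex.norm_real, Real.norm_of_nonneg hh.le]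
      gcongr
      refine (hH s (s - h) (hs.trans htT) (by linarith)).trans (by simp [abs_of_pos hh]))
  simp only [Complex.ofReal_zero, zero_mul, abs_zero, zero_add] at h3
  rw [← h2] at h3
  have hsplit : (k 0 : ℂ) * g t + ∫ s in (0 : ℝ)..t, (k' (t - s) : ℂ) * g s =
      ((k 0 : ℂ) * (g - m) t + ∫ s in (0 : ℝ)..t, (k' (t - s) : ℂ) * (g - m) s) +
      ((k 0 : ℂ) * m t + ∫ s in (0 : ℝ)..t, (k' (t - s) : ℂ) * m s) := by
    simp only [Pi.sub_apply, mul_sub]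
    rw [intervalIntegral.integral_sub (Continuous.intervalIntegrable (by fun_prop) _ _)
      (Continuous.intervalIntegrable (by fun_prop) _ _)]
    ring
  rw [hsplit]
  exact (norm_add_le _ _).trans (add_le_add h1 h3)

end Kernel

/-! ### Joint Hölder modulus of the modes in ε and t. -/

section Modulus

variable {g : ℝ → ℂ} {T H : ℝ}

lemma norm_duhamelInt_sub_time_le {ε : ℝ} (hε : 0 ≤ ε) (n : Freq) (hg : Continuous g)
    (hg0 : ∀ s ≤ 0, g s = 0) (hT : 0 ≤ T)
    (hH : ∀ s s', s ≤ T → s' ≤ T → ‖g s - g s'‖ ≤ H * |s - s'| ^ (1 / 4 : ℝ))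
    {t t' : ℝ} (htT : t ≤ T) (ht'T : t' ≤ T) :
    ‖duhamelInt ε n g t - duhamelInt ε n g t'‖ ≤
      (2 + bracket n ^ 2 * T) * (H * |t - t'| ^ (1 / 4 : ℝ)) := by
  have hc := continuous_duhamelDeriv hε n
  rw [duhamelInt_eq_integral_shift hε n hg hg0 htT, duhamelInt_eq_integral_shift hε n hg hg0 ht'T]
  have h := norm_convolution_le (k := duhamelSymbol ε n) (k' := fun r => duhamelDeriv ε n (T - r))
    (g := fun r => g (t - r) - g (t' - r)) (by fun_prop) (by fun_prop) hT le_rfl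
    (c := H * |t - t'| ^ (1 / 4 : ℝ)) (fun s hs _ => by
      refine (hH _ _ (by linarith) (by linarith)).trans (by rw [sub_sub_sub_cancel_right]))
  have hsub : ∀ r, T - (T - r) = r := fun r => sub_sub_cancel T r
  have hbound : ‖(duhamelSymbol ε n 0 : ℂ) * (g t - g t') +
      ∫ r in (0 : ℝ)..T, (duhamelDeriv ε n r : ℂ) * (g (t - r) - g (t' - r))‖ ≤
      (|duhamelSymbol ε n 0| + ∫ r in (0 : ℝ)..T, |duhamelDeriv ε n r|) *
        (H * |t - t'| ^ (1 / 4 : ℝ)) := by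
    refine (norm_add_le _ _).trans ?_
    rw [add_mul]
    refine add_le_add ?_ ?_
    · rw [norm_mul, Complex.norm_real, Real.norm_eq_abs]
      exact mul_le_mul_of_nonneg_left (hH _ _ htT ht'T) (abs_nonneg _)
    · rw [← intervalIntegral.integral_mul_const]
      refine intervalIntegral.norm_integral_le_of_norm_le hT (ae_of_all _ fun s hs => ?_)
        (Continuous.intervalIntegrable (by fun_prop) _ _)
      rw [norm_mul, Complex.norm_real, Real.norm_eq_abs]
      refine mul_le_mul_of_nonneg_left ?_ (abs_nonneg _)
      refine (hH _ _ (by linarith [hs.1]) (by linarith [hs.1])).trans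
        (by rw [sub_sub_sub_cancel_right])
  have heq : (duhamelSymbol ε n 0 * g t + ∫ r in (0 : ℝ)..T, (duhamelDeriv ε n r : ℂ) * g (t - r)) -
      (duhamelSymbol ε n 0 * g t' + ∫ r in (0 : ℝ)..T, (duhamelDeriv ε n r : ℂ) * g (t' - r)) =
      (duhamelSymbol ε n 0 : ℂ) * (g t - g t') +
      ∫ r in (0 : ℝ)..T, (duhamelDeriv ε n r : ℂ) * (g (t - r) - g (t' - r)) := by
    simp only [mul_sub]
    rw [intervalIntegral.integral_sub (Continuous.intervalIntegrable (by fun_prop) _ _)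
      (Continuous.intervalIntegrable (by fun_prop) _ _)]
    ring
  rw [heq]
  refine hbound.trans (mul_le_mul_of_nonneg_right (abs_add_integral_duhamelDeriv_le hε n hT) ?_)
  exact (norm_nonneg _).trans (hH t t' htT ht'T)

/-- The bound available for the total variation of K_ε - K_ε' does not become small as ε' → ε, but
the L¹ norm is O(⟨n⟩|ε - ε'|). Averaging the path at scale h = |ε - ε'| therefore balances the two
contributions. -/
lemma norm_duhamelInt_sub_param_le {ε ε' : ℝ} (hε : 0 ≤ ε) (hε' : ε' ≤ 1) (hlt : ε < ε') (n : Freq)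
    (hg : Continuous g) (hg0 : ∀ s ≤ 0, g s = 0) (hH0 : 0 ≤ H)
    (hH : ∀ s s', s ≤ T → s' ≤ T → ‖g s - g s'‖ ≤ H * |s - s'| ^ (1 / 4 : ℝ))
    {t : ℝ} (ht : 0 ≤ t) (htT : t ≤ T) :
    ‖duhamelInt ε n g t - duhamelInt ε' n g t‖ ≤
      (5 + 3 * T) * bracket n ^ 2 * (H * |ε - ε'| ^ (1 / 4 : ℝ)) := by
  have hT : 0 ≤ T := ht.trans htT
  have hε'0 : 0 ≤ ε' := hε.trans hlt.le
  have hc := continuous_duhamelDeriv hε n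
  have hc' := continuous_duhamelDeriv hε'0 n
  have hk := continuous_duhamelSymbol hε n
  have hk' := continuous_duhamelSymbol hε'0 n
  set h := |ε - ε'| with hh
  have hh0 : 0 < h := abs_pos.2 (sub_ne_zero.2 hlt.ne)
  have hb1 := one_le_bracket n
  have hb := bracket_pos n
  have hmain := norm_convolution_le_of_holder
    (k := fun s => duhamelSymbol ε n s - duhamelSymbol ε' n s)
    (k' := fun s => duhamelDeriv ε n s - duhamelDeriv ε' n s)
    (fun s => (hasDerivAt_duhamelSymbol hε n s).sub (hasDerivAt_duhamelSymbol hε'0 n s))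
    (hc.sub hc') hg hg0 ht htT hH hh0 hH0
  have heq : duhamelInt ε n g t - duhamelInt ε' n g t =
      ((duhamelSymbol ε n 0 - duhamelSymbol ε' n 0 : ℝ) : ℂ) * g t +
      ∫ s in (0 : ℝ)..t, ((duhamelDeriv ε n (t - s) - duhamelDeriv ε' n (t - s) : ℝ) : ℂ) * g s := by
    simp only [Complex.ofReal_sub, sub_mul]
    rw [intervalIntegral.integral_sub (Continuous.intervalIntegrable (by fun_prop) _ _)
      (Continuous.intervalIntegrable (by fun_prop) _ _), duhamelInt, duhamelInt]
    ring
  rw [heq]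
  refine hmain.trans ?_
  have hV : |duhamelSymbol ε n 0 - duhamelSymbol ε' n 0| +
      ∫ r in (0 : ℝ)..T, |duhamelDeriv ε n r - duhamelDeriv ε' n r| ≤ 4 + 2 * (bracket n ^ 2 * T) := by
    have h1 : ∫ r in (0 : ℝ)..T, |duhamelDeriv ε n r - duhamelDeriv ε' n r| ≤
        (∫ r in (0 : ℝ)..T, |duhamelDeriv ε n r|) + ∫ r in (0 : ℝ)..T, |duhamelDeriv ε' n r| := by
      rw [← intervalIntegral.integral_add (hc.abs.intervalIntegrable _ _)
        (hc'.abs.intervalIntegrable _ _)]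
      exact intervalIntegral.integral_mono_on hT ((hc.sub hc').abs.intervalIntegrable _ _)
        ((hc.abs.add hc'.abs).intervalIntegrable _ _) fun s _ => abs_sub _ _
    have h2 := abs_sub (duhamelSymbol ε n 0) (duhamelSymbol ε' n 0)
    have h3 := abs_add_integral_duhamelDeriv_le hε n hT
    have h4 := abs_add_integral_duhamelDeriv_le hε'0 n hT
    linarith
  -- The L² bound is turned into an L¹ bound by |a| ≤ δ/2 + a²/(2δ) with δ = ⟨n⟩h, the size of a
  -- suggested by the L² estimate.
  have hK : ∫ r in (0 : ℝ)..T, |duhamelSymbol ε n r - duhamelSymbol ε' n r| ≤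
      (T / 2 + 1) * bracket n * h := by
    have h1 : ∫ r in (0 : ℝ)..T, |duhamelSymbol ε n r - duhamelSymbol ε' n r| ≤
        ∫ r in (0 : ℝ)..T, (bracket n * h / 2 +
          (2 * (bracket n * h))⁻¹ * (duhamelSymbol ε n r - duhamelSymbol ε' n r) ^ 2) := by
      refine intervalIntegral.integral_mono_on hT ((hk.sub hk').abs.intervalIntegrable _ _)
        (Continuous.intervalIntegrable (by fun_prop) _ _) fun s _ => ?_
      rw [← sq_abs (_ - _)]
      generalize |duhamelSymbol ε n s - duhamelSymbol ε' n s| = a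
      have hp : 0 < bracket n * h := by positivity
      rw [div_add' _ _ _ two_ne_zero, le_div_iff₀ two_pos, ← sub_nonneg]
      have : bracket n * h + (2 * (bracket n * h))⁻¹ * a ^ 2 * 2 - a * 2 =
          (bracket n * h)⁻¹ * (bracket n * h - a) ^ 2 := by field_simp; ring
      rw [this]
      positivity
    rw [intervalIntegral.integral_add (Continuous.intervalIntegrable (by fun_prop) _ _)
      (Continuous.intervalIntegrable (by fun_prop) _ _), intervalIntegral.integral_const_mul,
      intervalIntegral.integral_const, sub_zero, smul_eq_mul] at h1
    refine h1.trans ?_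
    have h2 := integral_duhamelSymbol_sub_sq_le hε hε' hlt.le n hT
    rw [← sq_abs (ε - ε'), ← hh] at h2
    calc _ ≤ T * (bracket n * h / 2) + (2 * (bracket n * h))⁻¹ * (2 * bracket n ^ 2 * h ^ 2) := by
          gcongr
      _ = _ := by field_simp
  have hp : 0 ≤ H * h ^ (1 / 4 : ℝ) := by positivity
  calc _ ≤ (4 + 2 * (bracket n ^ 2 * T)) * (H * h ^ (1 / 4 : ℝ)) +
        ((T / 2 + 1) * bracket n * h) * (h⁻¹ * (H * h ^ (1 / 4 : ℝ))) := by gcongr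
    _ = (4 + 2 * (bracket n ^ 2 * T) + (T / 2 + 1) * bracket n) * (H * h ^ (1 / 4 : ℝ)) := by
        field_simp
    _ ≤ _ := by
        refine mul_le_mul_of_nonneg_right ?_ hp
        have : bracket n ≤ bracket n ^ 2 := le_self_pow₀ hb1 two_ne_zero
        nlinarith

lemma norm_duhamelInt_sub_le {ε ε' : ℝ} (hε : ε ∈ Set.Icc (0 : ℝ) 1) (hε' : ε' ∈ Set.Icc (0 : ℝ) 1)
    (n : Freq) (hg : Continuous g) (hg0 : ∀ s ≤ 0, g s = 0) (hH0 : 0 ≤ H)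
    (hH : ∀ s s', s ≤ T → s' ≤ T → ‖g s - g s'‖ ≤ H * |s - s'| ^ (1 / 4 : ℝ))
    {t t' : ℝ} (ht : t ∈ Set.Icc 0 T) (ht' : t' ∈ Set.Icc 0 T) :
    ‖duhamelInt ε n g t - duhamelInt ε' n g t'‖ ≤
      (5 + 3 * T) * bracket n ^ 2 * H * (|ε - ε'| ^ (1 / 4 : ℝ) + |t - t'| ^ (1 / 4 : ℝ)) := by
  have hT : 0 ≤ T := ht.1.trans ht.2
  have h1 := norm_duhamelInt_sub_time_le hε'.1 n hg hg0 hT hH ht.2 ht'.2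
  have h2 : ‖duhamelInt ε n g t - duhamelInt ε' n g t‖ ≤
      (5 + 3 * T) * bracket n ^ 2 * (H * |ε - ε'| ^ (1 / 4 : ℝ)) := by
    rcases lt_trichotomy ε ε' with h | h | h
    · exact norm_duhamelInt_sub_param_le hε.1 hε'.2 h n hg hg0 hH0 hH ht.1 ht.2
    · rw [h, sub_self, norm_zero]; positivity
    · rw [norm_sub_rev, abs_sub_comm]
      exact norm_duhamelInt_sub_param_le hε'.1 hε.2 h n hg hg0 hH0 hH ht.1 ht.2
  have hb1 : 1 ≤ bracket n ^ 2 := one_le_pow₀ (one_le_bracket n)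
  have hp : 0 ≤ H * |t - t'| ^ (1 / 4 : ℝ) := by positivity
  have h3 : (2 + bracket n ^ 2 * T) * (H * |t - t'| ^ (1 / 4 : ℝ)) ≤
      (5 + 3 * T) * bracket n ^ 2 * (H * |t - t'| ^ (1 / 4 : ℝ)) := by
    refine mul_le_mul_of_nonneg_right ?_ hp
    nlinarith
  calc _ ≤ ‖duhamelInt ε n g t - duhamelInt ε' n g t‖ +
        ‖duhamelInt ε' n g t - duhamelInt ε' n g t'‖ := norm_sub_le_norm_sub_add_norm_sub _ _ _
    _ ≤ _ := add_le_add h2 (h1.trans h3)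
    _ = _ := by ring

end Modulus

/-! ### Hölder continuity of Brownian paths, with moments -/

/-- The constant in the dyadic chaining bound with exponent `1/4`. -/
def chainingConst : ℝ := (1 + 2 / (1 - (1 / 2 : ℝ) ^ (1 / 4 : ℝ))) * 2 ^ (1 / 4 : ℝ)

lemma half_rpow_lt_one : (1 / 2 : ℝ) ^ (1 / 4 : ℝ) < 1 :=
  Real.rpow_lt_one (by norm_num) (by norm_num) (by norm_num)

lemma chainingConst_nonneg : 0 ≤ chainingConst := by
  have := half_rpow_lt_one
  have h2 : 0 ≤ 1 - (1 / 2 : ℝ) ^ (1 / 4 : ℝ) := by linarith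
  unfold chainingConst
  positivity

lemma norm_sub_le_of_dyadic {E : Type*} [NormedAddCommGroup E] {f : ℝ → E}
    (hf : ContinuousOn f (Set.Icc 0 1)) {A : ℝ} (hA : 0 ≤ A)
    (h : ∀ k j : ℕ, j < 2 ^ k →
      ‖f ((j + 1 : ℕ) / 2 ^ k) - f (j / 2 ^ k)‖ ≤ A * ((1 / 2 : ℝ) ^ (1 / 4 : ℝ)) ^ k)
    {s t : ℝ} (hs : s ∈ Set.Icc (0 : ℝ) 1) (ht : t ∈ Set.Icc (0 : ℝ) 1) :
    ‖f s - f t‖ ≤ chainingConst * A * |s - t| ^ (1 / 4 : ℝ) := by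
  set r : ℝ := (1 / 2 : ℝ) ^ (1 / 4 : ℝ) with hr
  have hr0 : 0 < r := by positivity
  have hr1 : r < 1 := half_rpow_lt_one
  -- Dyadic approximation from below. Passing from level k to k + 1 either leaves the point
  -- unchanged or moves it by one step 2^{-(k+1)}, so each move is an increment covered by `h`.
  let a : ℕ → ℝ → ℝ := fun k u => (⌊2 ^ k * u⌋₊ : ℝ) / 2 ^ k
  have ha_le : ∀ k u, 0 ≤ u → a k u ≤ u := by
    intro k u hu
    rw [div_le_iff₀ (by positivity), mul_comm]
    exact Nat.floor_le (by positivity)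
  have ha_lt : ∀ k u, u < a k u + (1 / 2) ^ k := by
    intro k u
    have h1 := Nat.lt_floor_add_one (2 ^ k * u)
    have h2 : (a k u + (1 / 2) ^ k) = ((⌊2 ^ k * u⌋₊ : ℝ) + 1) / 2 ^ k := by
      simp only [a]; rw [one_div_pow]; ring
    rw [h2, lt_div_iff₀ (by positivity), mul_comm]
    exact h1
  have ha_mem : ∀ k u, u ∈ Set.Icc (0 : ℝ) 1 → a k u ∈ Set.Icc (0 : ℝ) 1 := fun k u hu =>
    ⟨by positivity, (ha_le k u hu.1).trans hu.2⟩
  have hstep : ∀ u ∈ Set.Icc (0 : ℝ) 1, ∀ k, dist (f (a k u)) (f (a (k + 1) u)) ≤ A * r ^ k := by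
    intro u hu k
    have h0 : (0 : ℝ) ≤ 2 ^ k * u := mul_nonneg (by positivity) hu.1
    set m := ⌊2 ^ k * u⌋₊ with hm
    set m' := ⌊2 ^ (k + 1) * u⌋₊ with hm'
    have e1 : (m : ℝ) ≤ 2 ^ k * u := Nat.floor_le h0
    have e2 : 2 ^ k * u < m + 1 := Nat.lt_floor_add_one _
    have e3 : (m' : ℝ) ≤ 2 ^ (k + 1) * u := Nat.floor_le (by rw [pow_succ]; nlinarith)
    have e4 : 2 ^ (k + 1) * u < m' + 1 := Nat.lt_floor_add_one _
    have e5 : (2 : ℝ) ^ (k + 1) * u = 2 * (2 ^ k * u) := by ring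
    have c1 : m' < 2 * m + 2 := by
      have : (m' : ℝ) < 2 * m + 2 := by linarith
      exact_mod_cast this
    have c2 : 2 * m < m' + 1 := by
      have : (2 * m : ℝ) < m' + 1 := by linarith
      exact_mod_cast this
    have hak : a k u = (2 * m : ℕ) / 2 ^ (k + 1) := by
      simp only [a, ← hm]; push_cast; field_simp; ring
    have hak1 : a (k + 1) u = (m' : ℕ) / 2 ^ (k + 1) := rfl
    rcases (by omega : m' = 2 * m ∨ m' = 2 * m + 1) with h3 | h3
    · rw [hak, hak1, h3, dist_self]; positivity
    · have hlt : 2 * m < 2 ^ (k + 1) := by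
        have h6 : ((2 * m + 1 : ℕ) : ℝ) ≤ 2 ^ (k + 1) := by
          rw [← h3]
          calc (m' : ℝ) ≤ 2 ^ (k + 1) * u := e3
            _ ≤ 2 ^ (k + 1) * 1 := by gcongr; exact hu.2
            _ = _ := mul_one _
        have : 2 * m + 1 ≤ 2 ^ (k + 1) := by exact_mod_cast h6
        omega
      rw [hak, hak1, h3, dist_comm, dist_eq_norm]
      refine (h (k + 1) (2 * m) hlt).trans ?_
      rw [pow_succ]
      have : r ^ k * r ≤ r ^ k := mul_le_of_le_one_right (by positivity) hr1.le
      gcongr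
  have hlim : ∀ u ∈ Set.Icc (0 : ℝ) 1, Tendsto (fun k => f (a k u)) atTop (𝓝 (f u)) := by
    intro u hu
    have h1 : Tendsto (fun k => a k u) atTop (𝓝 u) := by
      have h2 : Tendsto (fun k : ℕ => u - (1 / 2 : ℝ) ^ k) atTop (𝓝 (u - 0)) :=
        tendsto_const_nhds.sub (tendsto_pow_atTop_nhds_zero_of_lt_one (by norm_num) (by norm_num))
      rw [sub_zero] at h2
      exact tendsto_of_tendsto_of_tendsto_of_le_of_le h2 tendsto_const_nhds
        (fun k => by have := ha_lt k u; simp only; linarith) (fun k => ha_le k u hu.1)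
    have h2 : Tendsto (fun k => a k u) atTop (𝓝[Set.Icc 0 1] u) :=
      tendsto_nhdsWithin_iff.2 ⟨h1, Eventually.of_forall fun k => ha_mem k u hu⟩
    exact (hf u hu).tendsto.comp h2
  have hclose : ∀ u ∈ Set.Icc (0 : ℝ) 1, ∀ k, dist (f (a k u)) (f u) ≤ A * r ^ k / (1 - r) :=
    fun u hu k => dist_le_of_le_geometric_of_tendsto r A hr1 (hstep u hu) (hlim u hu) k
  wlog hst : s ≤ t generalizing s t
  · rw [norm_sub_rev, abs_sub_comm]
    exact this ht hs (le_of_not_ge hst)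
  rcases hst.eq_or_lt with rfl | hst
  · rw [sub_self, norm_zero]
    have := chainingConst_nonneg
    positivity
  have hd0 : 0 < t - s := by linarith
  have hd1 : t - s ≤ 1 := by linarith [hs.1, ht.2]
  -- The level with 2^{-(k+1)} < t - s ≤ 2^{-k}: the approximations of s and t at this level
  -- coincide or are neighbours.
  obtain ⟨k, hk1, hk2⟩ := exists_nat_pow_near_of_lt_one hd0 hd1 (by norm_num : (0 : ℝ) < 1 / 2)
    (by norm_num : (1 / 2 : ℝ) < 1)
  have hadj : dist (f (a k s)) (f (a k t)) ≤ A * r ^ k := by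
    have hpk : (0 : ℝ) < 2 ^ k := by positivity
    set m := ⌊2 ^ k * s⌋₊ with hm
    set m' := ⌊2 ^ k * t⌋₊ with hm'
    have e2 : 2 ^ k * s < m + 1 := Nat.lt_floor_add_one _
    have e3 : (m' : ℝ) ≤ 2 ^ k * t := Nat.floor_le (by have := ht.1; positivity)
    have hle : m ≤ m' := Nat.floor_le_floor (by gcongr)
    have h6 : 2 ^ k * (t - s) ≤ 1 := by
      rw [one_div_pow, le_div_iff₀ hpk] at hk2
      linarith
    have c1 : m' < m + 2 := by
      have : (m' : ℝ) < m + 2 := by linarith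
      exact_mod_cast this
    rcases (by omega : m' = m ∨ m' = m + 1) with h3 | h3
    · have : a k s = a k t := by simp only [a, ← hm, ← hm', h3]
      rw [this, dist_self]; positivity
    · have hlt : m < 2 ^ k := by
        have h7 : (m' : ℝ) ≤ 2 ^ k := e3.trans (mul_le_of_le_one_right hpk.le ht.2)
        have : m' ≤ 2 ^ k := by exact_mod_cast h7
        omega
      have h8 : a k t = (m + 1 : ℕ) / 2 ^ k := by simp only [a, ← hm', h3]
      rw [h8, dist_comm, dist_eq_norm]
      exact h k m hlt
  have hrk : r ^ k ≤ 2 ^ (1 / 4 : ℝ) * |s - t| ^ (1 / 4 : ℝ) := by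
    rw [← Real.mul_rpow (by norm_num) (abs_nonneg _), abs_sub_comm, abs_of_pos hd0, hr,
      ← Real.rpow_natCast, ← Real.rpow_mul (by norm_num), mul_comm, Real.rpow_mul (by norm_num),
      Real.rpow_natCast]
    gcongr
    rw [pow_succ] at hk1
    linarith
  have h1r : 0 < 1 - r := by linarith
  rw [← dist_eq_norm]
  calc dist (f s) (f t) ≤ dist (f s) (f (a k s)) + dist (f (a k s)) (f (a k t)) +
        dist (f (a k t)) (f t) := dist_triangle4 _ _ _ _
    _ ≤ A * r ^ k / (1 - r) + A * r ^ k + A * r ^ k / (1 - r) := by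
        gcongr
        · rw [dist_comm]; exact hclose s hs k
        · exact hclose t ht k
    _ = A * (1 + 2 / (1 - r)) * r ^ k := by ring
    _ ≤ A * (1 + 2 / (1 - r)) * (2 ^ (1 / 4 : ℝ) * |s - t| ^ (1 / 4 : ℝ)) := by gcongr
    _ = _ := by rw [chainingConst]; ring

section Brownian

variable {Ω : Type*} [MeasurableSpace Ω] {P : Measure Ω}

/-- A process with `E‖b(s) - b(t)‖^{4m} ≤ C |s - t|^{2m}`, `m ≥ 2`, and continuous paths has
`1/4`-Hölder paths, with a Hölder constant in `L^{4m}`. -/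
lemma exists_holder_const {m : ℕ} (hm : 2 ≤ m) {C : ℝ≥0∞} {T : ℝ} (hT : 0 < T)
    {b : ℝ≥0 → Ω → ℂ} (hb : ∀ t, AEMeasurable (b t) P)
    (hmom : ∀ s t : ℝ≥0, ∫⁻ ω, ‖b s ω - b t ω‖ₑ ^ (4 * m) ∂P ≤
      C * ENNReal.ofReal |(s : ℝ) - t| ^ (2 * m))
    (hC : C ≠ ⊤) (hcont : ∀ᵐ ω ∂P, Continuous fun t => b t ω) :
    ∃ H : Ω → ℝ, (∀ ω, 0 ≤ H ω) ∧ AEMeasurable H P ∧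
      ∫⁻ ω, ENNReal.ofReal (H ω) ^ (4 * m) ∂P ≤
        ENNReal.ofReal (chainingConst * (T ^ (1 / 4 : ℝ))⁻¹) ^ (4 * m) *
          (C * ENNReal.ofReal T ^ (2 * m) * 2) ∧
      ∀ᵐ ω ∂P, ∀ s s' : ℝ, 0 ≤ s → s ≤ T → 0 ≤ s' → s' ≤ T →
        ‖b s.toNNReal ω - b s'.toNNReal ω‖ ≤ H ω * |s - s'| ^ (1 / 4 : ℝ) := by
  have hm0 : 4 * m ≠ 0 := by omega
  let incr : ℕ → ℕ → Ω → ℂ := fun k j ω =>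
    b (T * ((j + 1 : ℕ) / 2 ^ k)).toNNReal ω - b (T * (j / 2 ^ k)).toNNReal ω
  -- The weight 2^{km} is chosen so that each summand being at most Q means ‖incr‖ ≤ Q^{1/(4m)}
  -- 2^{-k/4}. The expectation of level k is at most C · 2^k · 2^{km} · (T 2^{-k})^{2m} = C T^{2m}
  -- 2^{k(1-m)}, which is summable since m ≥ 2.
  let Q : Ω → ℝ≥0∞ := fun ω => ∑' k : ℕ, ∑ j ∈ Finset.range (2 ^ k),
    (2 ^ k) ^ m * ‖incr k j ω‖ₑ ^ (4 * m)
  have hincr : ∀ k j, AEMeasurable (incr k j) P := fun k j => (hb _).sub (hb _)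
  have hQm : AEMeasurable Q P := by
    refine AEMeasurable.tsum fun k => Finset.aemeasurable_fun_sum _ fun j _ => ?_
    exact ((hincr k j).enorm.pow_const _).const_mul _
  have hQ : ∫⁻ ω, Q ω ∂P ≤ C * ENNReal.ofReal T ^ (2 * m) * 2 := by
    rw [lintegral_tsum (fun k => Finset.aemeasurable_fun_sum _ fun j _ =>
      ((hincr k j).enorm.pow_const _).const_mul _)]
    have hk : ∀ k : ℕ, ∫⁻ ω, ∑ j ∈ Finset.range (2 ^ k), (2 ^ k) ^ m * ‖incr k j ω‖ₑ ^ (4 * m) ∂P ≤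
        C * ENNReal.ofReal T ^ (2 * m) * (2⁻¹) ^ k := by
      intro k
      rw [lintegral_finsetSum' _ (fun j _ => ((hincr k j).enorm.pow_const _).const_mul _)]
      have hj : ∀ j ∈ Finset.range (2 ^ k), ∫⁻ ω, (2 ^ k) ^ m * ‖incr k j ω‖ₑ ^ (4 * m) ∂P ≤
          (2 ^ k) ^ m * (C * (ENNReal.ofReal T * (2⁻¹) ^ k) ^ (2 * m)) := by
        intro j _
        rw [lintegral_const_mul'' _ ((hincr k j).enorm.pow_const _)]
        gcongr
        refine (hmom _ _).trans_eq ?_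
        congr 2
        rw [Real.coe_toNNReal _ (by positivity), Real.coe_toNNReal _ (by positivity)]
        have : T * ((j + 1 : ℕ) / 2 ^ k) - T * (j / 2 ^ k) = T * (2⁻¹) ^ k := by
          push_cast
          rw [inv_pow]
          ring
        rw [this, abs_of_nonneg (by positivity), ENNReal.ofReal_mul hT.le,
          ENNReal.ofReal_pow (by norm_num), ENNReal.ofReal_inv_of_pos two_pos]
        simp
      refine (Finset.sum_le_sum hj).trans ?_
      rw [Finset.sum_const, Finset.card_range, nsmul_eq_mul]
      push_cast
      have h2 : ∀ i : ℕ, (2 : ℝ≥0∞) ^ i * (2⁻¹) ^ i = 1 := fun i => by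
        rw [← mul_pow, ENNReal.mul_inv_cancel two_ne_zero ENNReal.ofNat_ne_top, one_pow]
      obtain ⟨l, rfl⟩ := Nat.exists_eq_add_of_le hm
      calc (2 : ℝ≥0∞) ^ k * ((2 ^ k) ^ (2 + l) * (C * (ENNReal.ofReal T * 2⁻¹ ^ k) ^ (2 * (2 + l))))
          = C * ENNReal.ofReal T ^ (2 * (2 + l)) * (2⁻¹) ^ k *
            ((2 ^ k * 2⁻¹ ^ k) ^ (3 + l) * (2⁻¹ ^ k) ^ l) := by ring
        _ ≤ C * ENNReal.ofReal T ^ (2 * (2 + l)) * (2⁻¹) ^ k * 1 := by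
            gcongr
            rw [h2, one_pow, one_mul, ← pow_mul]
            exact pow_le_one₀ (zero_le) (by simp [ENNReal.inv_le_one])
        _ = _ := mul_one _
    refine (ENNReal.tsum_le_tsum hk).trans ?_
    rw [ENNReal.tsum_mul_left, ENNReal.tsum_geometric, ENNReal.one_sub_inv_two, inv_inv]
  refine ⟨fun ω => chainingConst * (T ^ (1 / 4 : ℝ))⁻¹ * (Q ω).toReal ^ (1 / (4 * m : ℕ) : ℝ),
    fun ω => ?_, ?_, ?_, ?_⟩
  · have := chainingConst_nonneg
    positivity
  · exact (hQm.ennreal_toReal.pow_const _).const_mul _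
  · refine le_trans ?_ (mul_le_mul_right hQ _)
    rw [← lintegral_const_mul'' _ hQm]
    refine lintegral_mono fun ω => ?_
    have h0 : 0 ≤ chainingConst * (T ^ (1 / 4 : ℝ))⁻¹ := by
      have := chainingConst_nonneg
      positivity
    rw [ENNReal.ofReal_mul h0, mul_pow]
    gcongr
    rw [← ENNReal.ofReal_pow (by positivity), ← Real.rpow_natCast, ← Real.rpow_mul (by positivity),
      one_div, inv_mul_cancel₀ (by positivity), Real.rpow_one]
    exact ENNReal.ofReal_toReal_le
  · have hfin : ∀ᵐ ω ∂P, Q ω < ⊤ := by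
      refine ae_lt_top' hQm (ne_top_of_le_ne_top ?_ hQ)
      finiteness
    filter_upwards [hfin, hcont] with ω hω hc
    set A := (Q ω).toReal ^ (1 / (4 * m : ℕ) : ℝ) with hA
    have hA0 : 0 ≤ A := by positivity
    have hdy : ∀ k j : ℕ, j < 2 ^ k → ‖incr k j ω‖ ≤ A * ((1 / 2 : ℝ) ^ (1 / 4 : ℝ)) ^ k := by
      intro k j hj
      have h1 : (2 ^ k) ^ m * ‖incr k j ω‖ₑ ^ (4 * m) ≤ Q ω :=
        (Finset.single_le_sum (f := fun j => (2 ^ k : ℝ≥0∞) ^ m * ‖incr k j ω‖ₑ ^ (4 * m))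
          (fun _ _ => zero_le) (Finset.mem_range.2 hj)).trans
          (ENNReal.le_tsum (f := fun k => ∑ j ∈ Finset.range (2 ^ k),
            (2 ^ k : ℝ≥0∞) ^ m * ‖incr k j ω‖ₑ ^ (4 * m)) k)
      have h2 : (2 ^ k : ℝ) ^ m * ‖incr k j ω‖ ^ (4 * m) ≤ (Q ω).toReal := by
        have := ENNReal.toReal_mono hω.ne h1
        simpa using this
      have h3 : ‖incr k j ω‖ ^ (4 * m) ≤ (A * ((1 / 2 : ℝ) ^ (1 / 4 : ℝ)) ^ k) ^ (4 * m) := by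
        have hA4 : A ^ (4 * m) = (Q ω).toReal := by
          rw [hA, ← Real.rpow_natCast, ← Real.rpow_mul (by positivity), one_div,
            inv_mul_cancel₀ (by positivity), Real.rpow_one]
        have hr4 : (((1 / 2 : ℝ) ^ (1 / 4 : ℝ)) ^ k) ^ (4 * m) = ((2 ^ k : ℝ) ^ m)⁻¹ := by
          have : ((1 / 2 : ℝ) ^ (1 / 4 : ℝ)) ^ 4 = 1 / 2 := by
            rw [← Real.rpow_natCast, ← Real.rpow_mul (by norm_num)]
            norm_num
          rw [← pow_mul, show k * (4 * m) = 4 * (k * m) by ring, pow_mul, this, ← pow_mul,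
            one_div, inv_pow]
        rw [mul_pow, hA4, hr4, ← div_eq_mul_inv, le_div_iff₀ (by positivity)]
        linarith
      exact le_of_pow_le_pow_left₀ hm0 (by positivity) h3
    intro s s' hs hsT hs' hs'T
    have hf : Continuous fun u : ℝ => b (T * u).toNNReal ω :=
      hc.comp (continuous_real_toNNReal.comp (by fun_prop))
    have h4 := norm_sub_le_of_dyadic (f := fun u : ℝ => b (T * u).toNNReal ω) hf.continuousOn hA0
      hdy (s := s / T) (t := s' / T) ⟨by positivity, (div_le_one hT).2 hsT⟩
      ⟨by positivity, (div_le_one hT).2 hs'T⟩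
    simp only [mul_div_cancel₀ _ hT.ne'] at h4
    refine h4.trans_eq ?_
    rw [← sub_div, abs_div, abs_of_pos hT, Real.div_rpow (abs_nonneg _) hT.le]
    ring

/-! ### Moments of Brownian increments -/

open ProbabilityTheory

/-- The absolute moments of the standard Gaussian. -/
def gaussianMoment (q : ℕ) : ℝ≥0∞ := ∫⁻ x, ‖x‖ₑ ^ q ∂(gaussianReal 0 1)

lemma gaussianMoment_ne_top (q : ℕ) : gaussianMoment q ≠ ⊤ := by
  rcases eq_or_ne q 0 with rfl | hq
  · simp [gaussianMoment]
  have h := (memLp_id_gaussianReal (μ := 0) (v := 1) (q : ℝ≥0)).eLpNorm_lt_top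
  rw [eLpNorm_lt_top_iff_lintegral_rpow_enorm_lt_top (by simpa using hq) (by simp)] at h
  simpa [gaussianMoment] using h.ne

lemma lintegral_enorm_pow_gaussianReal (v : ℝ≥0) (q : ℕ) :
    ∫⁻ x, ‖x‖ₑ ^ q ∂(gaussianReal 0 v) = ENNReal.ofReal (Real.sqrt v) ^ q * gaussianMoment q := by
  have h : gaussianReal 0 v = (gaussianReal 0 1).map (fun x => Real.sqrt v * x) := by
    rw [gaussianReal_map_const_mul]
    congr 1
    · simp
    · ext
      simp
  rw [h, lintegral_map (by fun_prop) (by fun_prop), gaussianMoment,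
    ← lintegral_const_mul _ (by fun_prop)]
  refine lintegral_congr fun x => ?_
  rw [enorm_mul, mul_pow, Real.enorm_of_nonneg (Real.sqrt_nonneg _)]

lemma lintegral_brownian_sub_pow {X : ℝ≥0 → Ω → ℝ} (hX : IsBrownianReal X P) (m : ℕ) (s t : ℝ≥0) :
    ∫⁻ ω, ‖X s ω - X t ω‖ₑ ^ (4 * m) ∂P =
      gaussianMoment (4 * m) * ENNReal.ofReal |(s : ℝ) - t| ^ (2 * m) := by
  have h := (hX.hasLaw_sub s t).lintegral_comp (f := fun x : ℝ => ‖x‖ₑ ^ (4 * m)) (by fun_prop)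
  simp only [Pi.sub_apply] at h
  rw [h, lintegral_enorm_pow_gaussianReal, mul_comm]
  congr 1
  rw [show 4 * m = 2 * (2 * m) by ring, pow_mul, ← ENNReal.ofReal_pow (Real.sqrt_nonneg _),
    Real.sq_sqrt (by positivity)]
  rfl

variable {B : Freq → ℝ≥0 → Ω → ℂ}

namespace IsCylindricalWiener

lemma im_zero (hB : IsCylindricalWiener B P) (t : ℝ≥0) (ω : Ω) : (B 0 t ω).im = 0 := by
  have h := congrArg Complex.im (hB.conj_symm 0 t ω)
  rw [neg_zero, Complex.conj_im] at h
  linarith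

lemma aemeasurable_re (hB : IsCylindricalWiener B P) (n : Freq) (t : ℝ≥0) :
    AEMeasurable (fun ω => (B n t ω).re) P := by
  rcases eq_or_ne n 0 with rfl | hn
  · exact hB.brownian_zero.aemeasurable t
  · have h := ((hB.brownian_re n hn).aemeasurable t).const_mul (Real.sqrt 2)⁻¹
    simpa using h

lemma aemeasurable_im (hB : IsCylindricalWiener B P) (n : Freq) (t : ℝ≥0) :
    AEMeasurable (fun ω => (B n t ω).im) P := by
  rcases eq_or_ne n 0 with rfl | hn
  · simp [hB.im_zero]
  · have h := ((hB.brownian_im n hn).aemeasurable t).const_mul (Real.sqrt 2)⁻¹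
    simpa using h

lemma aemeasurable (hB : IsCylindricalWiener B P) (n : Freq) (t : ℝ≥0) :
    AEMeasurable (B n t) P := by
  have h : B n t = fun ω => ((B n t ω).re : ℂ) + (B n t ω).im * Complex.I := by
    funext ω; exact (Complex.re_add_im _).symm
  rw [h]
  exact (Complex.measurable_ofReal.comp_aemeasurable (hB.aemeasurable_re n t)).add
    ((Complex.measurable_ofReal.comp_aemeasurable (hB.aemeasurable_im n t)).mul_const _)

lemma ae_regular (hB : IsCylindricalWiener B P) :
    ∀ᵐ ω ∂P, ∀ n, Continuous (fun t => B n t ω) ∧ B n 0 ω = 0 := by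
  rw [ae_all_iff]
  intro n
  have hcomp : ∀ ω, Continuous (fun t => (B n t ω).re) → Continuous (fun t => (B n t ω).im) →
      Continuous fun t => B n t ω := by
    intro ω h1 h2
    have h : (fun t => B n t ω) = fun t => ((B n t ω).re : ℂ) + (B n t ω).im * Complex.I := by
      funext t; exact (Complex.re_add_im _).symm
    rw [h]
    fun_prop
  rcases eq_or_ne n 0 with rfl | hn
  · filter_upwards [hB.brownian_zero.cont, hB.brownian_zero.eval_zero_ae_eq_zero] with ω h1 h2
    refine ⟨hcomp ω h1 ?_, Complex.ext h2 (hB.im_zero 0 ω)⟩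
    simpa [hB.im_zero] using continuous_const
  · have hs : Real.sqrt 2 ≠ 0 := by positivity
    filter_upwards [(hB.brownian_re n hn).cont, (hB.brownian_re n hn).eval_zero_ae_eq_zero,
      (hB.brownian_im n hn).cont, (hB.brownian_im n hn).eval_zero_ae_eq_zero] with ω h1 h2 h3 h4
    refine ⟨hcomp ω ?_ ?_, Complex.ext ?_ ?_⟩
    · have : Continuous fun t => (Real.sqrt 2)⁻¹ * (Real.sqrt 2 * (B n t ω).re) :=
        continuous_const.mul h1
      simpa [hs] using this
    · have : Continuous fun t => (Real.sqrt 2)⁻¹ * (Real.sqrt 2 * (B n t ω).im) :=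
        continuous_const.mul h3
      simpa [hs] using this
    · simpa [hs] using h2
    · simpa [hs] using h4

/-- For n ≠ 0 the real and imaginary parts are Brownian motions divided by √2, and dropping this
factor only increases the moments; for n = 0 the imaginary part vanishes. Hence a constant that does
not depend on the frequency. -/
lemma lintegral_sub_pow_le (hB : IsCylindricalWiener B P) (n : Freq) {m : ℕ} (hm : 1 ≤ m)
    (s t : ℝ≥0) :
    ∫⁻ ω, ‖B n s ω - B n t ω‖ₑ ^ (4 * m) ∂P ≤
      2 ^ (4 * m) * (gaussianMoment (4 * m) + gaussianMoment (4 * m)) *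
        ENNReal.ofReal |(s : ℝ) - t| ^ (2 * m) := by
  have hre : ∫⁻ ω, ‖(B n s ω).re - (B n t ω).re‖ₑ ^ (4 * m) ∂P ≤
      gaussianMoment (4 * m) * ENNReal.ofReal |(s : ℝ) - t| ^ (2 * m) := by
    rcases eq_or_ne n 0 with rfl | hn
    · exact (lintegral_brownian_sub_pow hB.brownian_zero m s t).le
    · rw [← lintegral_brownian_sub_pow (hB.brownian_re n hn) m s t]
      refine lintegral_mono fun ω => ?_
      dsimp only
      rw [← mul_sub, enorm_mul]
      gcongr
      refine le_mul_of_one_le_left' ?_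
      rw [Real.enorm_of_nonneg (Real.sqrt_nonneg _), ENNReal.one_le_ofReal]
      exact Real.one_le_sqrt.2 one_le_two
  have him : ∫⁻ ω, ‖(B n s ω).im - (B n t ω).im‖ₑ ^ (4 * m) ∂P ≤
      gaussianMoment (4 * m) * ENNReal.ofReal |(s : ℝ) - t| ^ (2 * m) := by
    rcases eq_or_ne n 0 with rfl | hn
    · simp only [hB.im_zero, sub_self, enorm_zero]
      rw [zero_pow (by omega), lintegral_zero]
      exact zero_le
    · rw [← lintegral_brownian_sub_pow (hB.brownian_im n hn) m s t]
      refine lintegral_mono fun ω => ?_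
      dsimp only
      rw [← mul_sub, enorm_mul]
      gcongr
      refine le_mul_of_one_le_left' ?_
      rw [Real.enorm_of_nonneg (Real.sqrt_nonneg _), ENNReal.one_le_ofReal]
      exact Real.one_le_sqrt.2 one_le_two
  have hpt : ∀ z : ℂ, ‖z‖ₑ ^ (4 * m) ≤ 2 ^ (4 * m) * (‖z.re‖ₑ ^ (4 * m) + ‖z.im‖ₑ ^ (4 * m)) := by
    intro z
    have h1 : ‖z‖ₑ ≤ 2 * max ‖z.re‖ₑ ‖z.im‖ₑ := by
      have h2 : ‖z‖ₑ ≤ ‖z.re‖ₑ + ‖z.im‖ₑ := by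
        rw [← ofReal_norm, ← ofReal_norm, ← ofReal_norm, ← ENNReal.ofReal_add (norm_nonneg _)
          (norm_nonneg _)]
        exact ENNReal.ofReal_le_ofReal (Complex.norm_le_abs_re_add_abs_im z)
      rw [two_mul]
      exact h2.trans (add_le_add (le_max_left _ _) (le_max_right _ _))
    calc ‖z‖ₑ ^ (4 * m) ≤ (2 * max ‖z.re‖ₑ ‖z.im‖ₑ) ^ (4 * m) := by gcongr
      _ = 2 ^ (4 * m) * (max ‖z.re‖ₑ ‖z.im‖ₑ) ^ (4 * m) := mul_pow _ _ _
      _ ≤ _ := by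
          gcongr
          rcases max_choice ‖z.re‖ₑ ‖z.im‖ₑ with h | h <;> rw [h]
          · exact le_self_add
          · exact le_add_self
  calc _ ≤ ∫⁻ ω, 2 ^ (4 * m) * (‖(B n s ω).re - (B n t ω).re‖ₑ ^ (4 * m) +
        ‖(B n s ω).im - (B n t ω).im‖ₑ ^ (4 * m)) ∂P := lintegral_mono fun ω => by
          simpa using hpt (B n s ω - B n t ω)
    _ = 2 ^ (4 * m) * (∫⁻ ω, ‖(B n s ω).re - (B n t ω).re‖ₑ ^ (4 * m) ∂P +
        ∫⁻ ω, ‖(B n s ω).im - (B n t ω).im‖ₑ ^ (4 * m) ∂P) := by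
        have h1 := ((hB.aemeasurable_re n s).sub (hB.aemeasurable_re n t)).enorm.pow_const (4 * m)
        have h2 := ((hB.aemeasurable_im n s).sub (hB.aemeasurable_im n t)).enorm.pow_const (4 * m)
        exact (lintegral_const_mul'' _ (h1.add h2)).trans
          (congrArg _ (lintegral_add_left' h1 _))
    _ ≤ 2 ^ (4 * m) * (gaussianMoment (4 * m) * ENNReal.ofReal |(s : ℝ) - t| ^ (2 * m) +
        gaussianMoment (4 * m) * ENNReal.ofReal |(s : ℝ) - t| ^ (2 * m)) := by gcongr
    _ = _ := by ring

/-- The Brownian coordinates are `1/4`-Hölder on `[0,T]`, extended by zero to negative times, with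
Hölder constants bounded in every `L^{4m}`, uniformly in the frequency. -/
lemma exists_holder (hB : IsCylindricalWiener B P) {m : ℕ} (hm : 2 ≤ m) {T : ℝ} (hT : 0 < T) :
    ∃ C : ℝ≥0∞, C ≠ ⊤ ∧ ∀ n, ∃ H : Ω → ℝ, (∀ ω, 0 ≤ H ω) ∧ AEMeasurable H P ∧
      ∫⁻ ω, ENNReal.ofReal (H ω) ^ (4 * m) ∂P ≤ C ∧
      ∀ᵐ ω ∂P, ∀ s s' : ℝ, s ≤ T → s' ≤ T →
        ‖B n s.toNNReal ω - B n s'.toNNReal ω‖ ≤ H ω * |s - s'| ^ (1 / 4 : ℝ) := by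
  have hG := gaussianMoment_ne_top (4 * m)
  refine ⟨ENNReal.ofReal (chainingConst * (T ^ (1 / 4 : ℝ))⁻¹) ^ (4 * m) *
    (2 ^ (4 * m) * (gaussianMoment (4 * m) + gaussianMoment (4 * m)) * ENNReal.ofReal T ^ (2 * m) * 2),
    by finiteness, fun n => ?_⟩
  · obtain ⟨H, hH0, hHm, hHp, hH⟩ := exists_holder_const hm hT (hB.aemeasurable n)
      (hB.lintegral_sub_pow_le n (by omega)) (by finiteness)
      (hB.ae_regular.mono fun ω h => (h n).1)
    refine ⟨H, hH0, hHm, hHp, ?_⟩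
    filter_upwards [hH] with ω h s s' hs hs'
    -- `Real.toNNReal` freezes the path at negative times. Clamping at 0 is 1-Lipschitz, so the
    -- Hölder bound on [0,T] extends.
    have h1 : ∀ u : ℝ, u.toNNReal = (max u 0).toNNReal := fun u => by
      rw [Real.toNNReal_of_nonneg (le_max_right u 0)]; rfl
    rw [h1 s, h1 s']
    refine (h (max s 0) (max s' 0) (le_max_right _ _) (max_le hs hT.le) (le_max_right _ _)
      (max_le hs' hT.le)).trans ?_
    have h2 := abs_max_sub_max_le_abs s s' 0
    exact mul_le_mul_of_nonneg_left (Real.rpow_le_rpow (abs_nonneg _) h2 (by norm_num)) (hH0 ω)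

end IsCylindricalWiener

end Brownian

/-! ### The electrostatic inequality for neutral gases -/

section Gas

variable {X : Type*}

/-- The interaction energy of the charges `+1` at the points `x j` and `-1` at the points `y j`. -/
def gasEnergy (κ : X → X → ℝ) {m : ℕ} (x y : Fin m → X) : ℝ :=
  ∑ j, ∑ k, κ (x j) (y k) - (∑ j, ∑ k, κ (x j) (x k) - ∑ j, κ (x j) (x j)) / 2 -
    (∑ j, ∑ k, κ (y j) (y k) - ∑ j, κ (y j) (y j)) / 2

/-- The remaining charges see the pair x_a, y_b as a dipole: each of them enters through a
difference of two values of κ. -/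
lemma gasEnergy_succAbove {κ : X → X → ℝ} (hκ : ∀ a b, κ a b = κ b a) {m : ℕ}
    (x y : Fin (m + 1) → X) (a b : Fin (m + 1)) :
    gasEnergy κ x y = κ (x a) (y b) +
      ∑ j, (κ (x (a.succAbove j)) (y b) - κ (x (a.succAbove j)) (x a)) +
      ∑ j, (κ (y (b.succAbove j)) (x a) - κ (y (b.succAbove j)) (y b)) +
      gasEnergy κ (fun j => x (a.succAbove j)) (fun j => y (b.succAbove j)) := by
  have split : ∀ (u v : Fin (m + 1) → X) (c d : Fin (m + 1)), ∑ j, ∑ k, κ (u j) (v k) =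
      κ (u c) (v d) + ∑ j, κ (v (d.succAbove j)) (u c) + ∑ j, κ (u (c.succAbove j)) (v d) +
        ∑ j, ∑ k, κ (u (c.succAbove j)) (v (d.succAbove k)) := by
    intro u v c d
    have h1 : ∀ z, ∑ k, κ z (v k) = κ z (v d) + ∑ k, κ z (v (d.succAbove k)) :=
      fun z => Fin.sum_univ_succAbove _ d
    rw [Fin.sum_univ_succAbove _ c]
    simp only [h1, Finset.sum_add_distrib]
    simp only [fun k => hκ (u c) (v (d.succAbove k))]
    ring
  have diag : ∀ (u : Fin (m + 1) → X) (c : Fin (m + 1)), ∑ j, κ (u j) (u j) =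
      κ (u c) (u c) + ∑ j, κ (u (c.succAbove j)) (u (c.succAbove j)) :=
    fun u c => Fin.sum_univ_succAbove _ c
  simp only [gasEnergy, Finset.sum_sub_distrib]
  rw [split x y a b, split x x a a, split y y b b, diag x a, diag y b]
  ring

/-- The energy of a neutral gas is, up to a constant, at most that of the dipoles formed by a
suitable matching of the charges. -/
lemma exists_perm_gasEnergy_le {κ ρ : X → X → ℝ} (hκ : ∀ a b, κ a b = κ b a)
    (hρ : ∀ a b, ρ a b = ρ b a) (htri : ∀ a b c, ρ a c ≤ ρ a b + ρ b c) {C : ℝ} (hC : 0 ≤ C)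
    (hdouble : ∀ a b c d, ρ c d ≤ 2 * ρ a b → κ a b ≤ κ c d + C) :
    ∀ {m : ℕ} (x y : Fin m → X), ∃ σ : Equiv.Perm (Fin m),
      gasEnergy κ x y ≤ ∑ j, κ (x j) (y (σ j)) + m ^ 2 * C
  | 0, x, y => ⟨1, by simp [gasEnergy]⟩
  | m + 1, x, y => by
    -- The closest pair of opposite charges. By minimality and the triangle inequality ρ(x_j, x_a) ≤
    -- ρ(x_j, y_b) + ρ(y_b, x_a) ≤ 2ρ(x_j, y_b), so doubling bounds each dipole difference by C. The
    -- 2m differences cost 2mC ≤ ((m+1)² - m²)C.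
    obtain ⟨⟨a, b⟩, -, hmin⟩ := Finset.exists_min_image
      (Finset.univ : Finset (Fin (m + 1) × Fin (m + 1))) (fun p => ρ (x p.1) (y p.2)) ⟨(0, 0), by simp⟩
    obtain ⟨σ, hσ⟩ := exists_perm_gasEnergy_le hκ hρ htri hC hdouble
      (fun j => x (a.succAbove j)) (fun j => y (b.succAbove j))
    -- The permutation sending a to b and acting as σ on the other indices.
    refine ⟨(finSuccEquiv' a).trans ((Equiv.optionCongr σ).trans (finSuccEquiv' b).symm), ?_⟩
    rw [gasEnergy_succAbove hκ x y a b, Fin.sum_univ_succAbove _ a]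
    have h1 : ∑ j, (κ (x (a.succAbove j)) (y b) - κ (x (a.succAbove j)) (x a)) ≤ m * C := by
      refine (Finset.sum_le_card_nsmul _ _ C fun j _ => ?_).trans (by simp)
      have := hdouble (x (a.succAbove j)) (y b) (x (a.succAbove j)) (x a) ?_
      · linarith
      · have h2 := htri (x (a.succAbove j)) (y b) (x a)
        have h3 := hmin (a.succAbove j, b) (Finset.mem_univ _)
        rw [hρ (y b)] at h2
        simp only at h3
        linarith
    have h2 : ∑ j, (κ (y (b.succAbove j)) (x a) - κ (y (b.succAbove j)) (y b)) ≤ m * C := by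
      refine (Finset.sum_le_card_nsmul _ _ C fun j _ => ?_).trans (by simp)
      have := hdouble (y (b.succAbove j)) (x a) (y (b.succAbove j)) (y b) ?_
      · linarith
      · have h2 := htri (y (b.succAbove j)) (x a) (y b)
        have h3 := hmin (a, b.succAbove j) (Finset.mem_univ _)
        rw [hρ (y (b.succAbove j)) (x a)] at h2 ⊢
        simp only at h3
        linarith
    simp only [Equiv.trans_apply, finSuccEquiv'_at, finSuccEquiv'_succAbove,
      Equiv.optionCongr_apply, Option.map_none, Option.map_some, finSuccEquiv'_symm_none,
      finSuccEquiv'_symm_some]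
    push_cast
    nlinarith

end Gas

/-! ### Moments of lower integrals -/

lemma lintegral_pow_le {α : Type*} [MeasurableSpace α] {μ : Measure α} {f : α → ℝ≥0∞}
    (hf : AEMeasurable f μ) (n : ℕ) (hn : 1 ≤ n) :
    (∫⁻ a, f a ∂μ) ^ n ≤ μ Set.univ ^ (n - 1) * ∫⁻ a, f a ^ n ∂μ := by
  rcases hn.eq_or_lt with rfl | hn
  · simp
  have hn0 : (0 : ℝ) < n := by positivity
  have hn1 : (1 : ℝ) < n := by exact_mod_cast hn
  have hpq : (n : ℝ).HolderConjugate (n / (n - 1)) := Real.HolderConjugate.conjExponent hn1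
  have h := ENNReal.lintegral_mul_le_Lp_mul_Lq μ hpq hf (aemeasurable_const (b := (1 : ℝ≥0∞)))
  simp only [Pi.mul_apply, mul_one, ENNReal.one_rpow, lintegral_const, one_mul,
    ENNReal.rpow_natCast] at h
  calc (∫⁻ a, f a ∂μ) ^ n ≤ ((∫⁻ a, f a ^ n ∂μ) ^ (1 / (n : ℝ)) *
        μ Set.univ ^ (1 / ((n : ℝ) / (n - 1)))) ^ n := by gcongr
    _ = μ Set.univ ^ (n - 1) * ∫⁻ a, f a ^ n ∂μ := by
      rw [mul_pow, ← ENNReal.rpow_natCast, ← ENNReal.rpow_natCast, ← ENNReal.rpow_mul,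
        ← ENNReal.rpow_mul, mul_comm]
      congr 1
      · rw [← ENNReal.rpow_natCast]
        congr 1
        push_cast [Nat.cast_sub hn.le]
        field_simp
      · rw [one_div, inv_mul_cancel₀ hn0.ne', ENNReal.rpow_one]

/-- Jensen's inequality for the powers of a norm. -/
lemma enorm_integral_pow_le {α E : Type*} [MeasurableSpace α] {μ : Measure α}
    [IsProbabilityMeasure μ] [NormedAddCommGroup E] [NormedSpace ℝ E] {f : α → E}
    (hf : AEStronglyMeasurable f μ) (n : ℕ) (hn : 1 ≤ n) :
    ‖∫ a, f a ∂μ‖ₑ ^ n ≤ ∫⁻ a, ‖f a‖ₑ ^ n ∂μ := by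
  calc _ ≤ (∫⁻ a, ‖f a‖ₑ ∂μ) ^ n := by
        gcongr; exact enorm_integral_le_lintegral_enorm f
    _ ≤ _ := (lintegral_pow_le hf.enorm n hn).trans (by simp)

lemma lintegral_mul_le_sqrt {α : Type*} [MeasurableSpace α] {μ : Measure α} {f g : α → ℝ≥0∞}
    (hf : AEMeasurable f μ) (hg : AEMeasurable g μ) :
    ∫⁻ a, f a * g a ∂μ ≤ (∫⁻ a, f a ^ 2 ∂μ) ^ (1 / 2 : ℝ) * (∫⁻ a, g a ^ 2 ∂μ) ^ (1 / 2 : ℝ) := by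
  have h := ENNReal.lintegral_mul_le_Lp_mul_Lq μ Real.HolderConjugate.two_two hf hg
  simpa only [Pi.mul_apply, ENNReal.rpow_two] using h

/-! ### Finite-dimensional Gaussian fields -/

section GaussianField

open ProbabilityTheory

variable {D : Type*} [Fintype D]

/-- The standard Gaussian measure on `ℝ^D`. -/
def gaussPi (D : Type*) [Fintype D] : Measure (D → ℝ) := Measure.pi fun _ => gaussianReal 0 1

instance : IsProbabilityMeasure (gaussPi D) := by unfold gaussPi; infer_instance

lemma integral_cexp_gaussPi (a : D → ℝ) :
    ∫ g, Complex.exp (Complex.I * (∑ d, a d * g d : ℝ)) ∂gaussPi D =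
      Real.exp (-(∑ d, a d ^ 2) / 2) := by
  have h1 : ∀ g : D → ℝ, Complex.exp (Complex.I * (∑ d, a d * g d : ℝ)) =
      ∏ d, Complex.exp (a d * g d * Complex.I) := by
    intro g
    rw [← Complex.exp_sum, ← Finset.sum_mul]
    push_cast
    rw [mul_comm]
  simp_rw [h1, gaussPi]
  rw [integral_fintype_prod_eq_prod (fun d (x : ℝ) => Complex.exp (a d * x * Complex.I))]
  have h2 : ∀ d, ∫ x : ℝ, Complex.exp (a d * x * Complex.I) ∂gaussianReal 0 1 =
      Complex.exp (-(a d : ℂ) ^ 2 / 2) := by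
    intro d
    rw [← charFun_apply_real, charFun_gaussianReal]
    congr 1
    push_cast
    ring
  simp_rw [h2]
  rw [← Complex.exp_sum]
  push_cast
  rw [← Finset.sum_div, Finset.sum_neg_distrib]

lemma map_linear_gaussPi (a : D → ℝ) :
    (gaussPi D).map (fun g => ∑ d, a d * g d) = gaussianReal 0 (∑ d, a d ^ 2).toNNReal := by
  have hm : Measurable fun g : D → ℝ => ∑ d, a d * g d := by fun_prop
  have : IsProbabilityMeasure ((gaussPi D).map (fun g => ∑ d, a d * g d)) :=
    Measure.isProbabilityMeasure_map hm.aemeasurable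
  refine Measure.ext_of_charFun (funext fun t => ?_)
  rw [charFun_gaussianReal, charFun_apply_real, integral_map hm.aemeasurable (by fun_prop)]
  have h := integral_cexp_gaussPi (fun d => t * a d)
  have h0 : (0 : ℝ) ≤ ∑ d, a d ^ 2 := Finset.sum_nonneg fun d _ => sq_nonneg _
  calc _ = ∫ g, Complex.exp (Complex.I * (∑ d, (t * a d) * g d : ℝ)) ∂gaussPi D := by
        congr 1
        ext g
        congr 1
        simp only [mul_assoc, ← Finset.mul_sum]
        push_cast
        ring
    _ = _ := by
        rw [h, Complex.ofReal_exp]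
        congr 1
        simp only [mul_pow, ← Finset.mul_sum]
        rw [show (((∑ d, a d ^ 2).toNNReal : ℝ) : ℂ) = ((∑ d, a d ^ 2 : ℝ) : ℂ) from
          congrArg _ (Real.coe_toNNReal _ h0)]
        push_cast
        ring

/-- The real and imaginary parts of the linear form are one-dimensional centred Gaussians whose
variances are at most ∑‖z_d‖². -/
lemma lintegral_enorm_linear_pow_le (z : D → ℂ) (q : ℕ) :
    ∫⁻ g, ‖∑ d, (g d : ℂ) * z d‖ₑ ^ q ∂gaussPi D ≤
      2 ^ q * (2 * gaussianMoment q) * ENNReal.ofReal (Real.sqrt (∑ d, ‖z d‖ ^ 2)) ^ q := by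
  have key : ∀ a : D → ℝ, (∀ d, |a d| ≤ ‖z d‖) → ∫⁻ g, ‖∑ d, a d * g d‖ₑ ^ q ∂gaussPi D ≤
      ENNReal.ofReal (Real.sqrt (∑ d, ‖z d‖ ^ 2)) ^ q * gaussianMoment q := by
    intro a ha
    have h1 : ∫⁻ g, ‖∑ d, a d * g d‖ₑ ^ q ∂gaussPi D =
        ∫⁻ x, ‖x‖ₑ ^ q ∂(gaussPi D).map (fun g => ∑ d, a d * g d) := by
      rw [lintegral_map (by fun_prop) (by fun_prop)]
    rw [h1, map_linear_gaussPi, lintegral_enorm_pow_gaussianReal]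
    gcongr ENNReal.ofReal (Real.sqrt ?_) ^ q * _
    rw [Real.coe_toNNReal _ (Finset.sum_nonneg fun d _ => sq_nonneg _)]
    refine Finset.sum_le_sum fun d _ => ?_
    rw [← sq_abs]
    gcongr
    exact ha d
  have hsplit : ∀ g : D → ℝ, ‖∑ d, (g d : ℂ) * z d‖ₑ ^ q ≤
      2 ^ q * (‖∑ d, (z d).re * g d‖ₑ ^ q + ‖∑ d, (z d).im * g d‖ₑ ^ q) := by
    intro g
    have e1 : ∑ d, (g d : ℂ) * z d =
        ((∑ d, (z d).re * g d : ℝ) : ℂ) + ((∑ d, (z d).im * g d : ℝ) : ℂ) * Complex.I := by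
      push_cast
      rw [Finset.sum_mul, ← Finset.sum_add_distrib]
      refine Finset.sum_congr rfl fun d _ => ?_
      nth_rw 1 [← Complex.re_add_im (z d)]
      ring
    rw [e1]
    set A := (∑ d, (z d).re * g d : ℝ)
    set B := (∑ d, (z d).im * g d : ℝ)
    calc ‖(A : ℂ) + B * Complex.I‖ₑ ^ q ≤ (‖A‖ₑ + ‖B‖ₑ) ^ q := by
          gcongr
          refine (enorm_add_le _ _).trans (le_of_eq ?_)
          rw [enorm_mul]
          simp [enorm_eq_nnnorm]
      _ ≤ (2 * max ‖A‖ₑ ‖B‖ₑ) ^ q := by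
          gcongr
          rw [two_mul]
          exact add_le_add (le_max_left _ _) (le_max_right _ _)
      _ ≤ 2 ^ q * (‖A‖ₑ ^ q + ‖B‖ₑ ^ q) := by
          rw [mul_pow]
          gcongr
          rcases max_choice ‖A‖ₑ ‖B‖ₑ with h | h <;> rw [h]
          · exact le_self_add
          · exact le_add_self
  calc _ ≤ ∫⁻ g, 2 ^ q * (‖∑ d, (z d).re * g d‖ₑ ^ q + ‖∑ d, (z d).im * g d‖ₑ ^ q) ∂gaussPi D :=
        lintegral_mono hsplit
    _ = 2 ^ q * (∫⁻ g, ‖∑ d, (z d).re * g d‖ₑ ^ q ∂gaussPi D +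
        ∫⁻ g, ‖∑ d, (z d).im * g d‖ₑ ^ q ∂gaussPi D) := by
        rw [lintegral_const_mul _ (by fun_prop), lintegral_add_left (by fun_prop)]
    _ ≤ 2 ^ q * (ENNReal.ofReal (Real.sqrt (∑ d, ‖z d‖ ^ 2)) ^ q * gaussianMoment q +
        ENNReal.ofReal (Real.sqrt (∑ d, ‖z d‖ ^ 2)) ^ q * gaussianMoment q) := by
        gcongr
        · exact key _ fun d => Complex.abs_re_le_norm _
        · exact key _ fun d => Complex.abs_im_le_norm _
    _ = _ := by ring

/-- Rotation by the angles `θ d` in the planes of `(g d, y d)`. -/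
def gaussRot (θ : D → ℝ) (p : (D → ℝ) × (D → ℝ)) : (D → ℝ) × (D → ℝ) :=
  (fun d => Real.cos (θ d) * p.1 d + Real.sin (θ d) * p.2 d,
    fun d => -Real.sin (θ d) * p.1 d + Real.cos (θ d) * p.2 d)

lemma measurePreserving_rotation_gaussianReal (θ : ℝ) :
    MeasurePreserving (fun p : ℝ × ℝ => (Real.cos θ * p.1 + Real.sin θ * p.2,
      -Real.sin θ * p.1 + Real.cos θ * p.2)) ((gaussianReal 0 1).prod (gaussianReal 0 1))
      ((gaussianReal 0 1).prod (gaussianReal 0 1)) := by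
  refine ⟨by fun_prop, ?_⟩
  have h := IsGaussian.map_rotation_eq_self (μ := gaussianReal 0 1) (by simp) θ
  convert! h using 2

lemma measurePreserving_gaussRot (θ : D → ℝ) :
    MeasurePreserving (gaussRot θ) ((gaussPi D).prod (gaussPi D))
      ((gaussPi D).prod (gaussPi D)) := by
  have h1 := measurePreserving_arrowProdEquivProdArrow ℝ ℝ D (fun _ => gaussianReal 0 1)
    (fun _ => gaussianReal 0 1)
  have h2 := measurePreserving_pi (fun _ : D => (gaussianReal 0 1).prod (gaussianReal 0 1))
    (fun _ : D => (gaussianReal 0 1).prod (gaussianReal 0 1))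
    (fun d => measurePreserving_rotation_gaussianReal (θ d))
  exact (h1.comp h2).comp (h1.symm)

variable {X : Type*}

/-- The Gaussian field `∑_d u_d(x) g_d`. -/
def gfield (u : D → X → ℝ) (g : D → ℝ) (x : X) : ℝ := ∑ d, u d x * g d

/-- The covariance of `gfield u`. -/
def gcov (u : D → X → ℝ) (x y : X) : ℝ := ∑ d, u d x * u d y

/-- The renormalized imaginary exponential of `gfield u`. -/
def gchaos (β : ℝ) (u : D → X → ℝ) (g : D → ℝ) (x : X) : ℂ :=
  (Real.exp (β ^ 2 / 2 * gcov u x x) : ℂ) * Complex.exp (Complex.I * β * gfield u g x)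

lemma norm_gchaos (β : ℝ) (u : D → X → ℝ) (g : D → ℝ) (x : X) :
    ‖gchaos β u g x‖ = Real.exp (β ^ 2 / 2 * gcov u x x) := by
  rw [gchaos, norm_mul, Complex.norm_real, Real.norm_of_nonneg (Real.exp_pos _).le,
    show Complex.I * β * gfield u g x = ((β * gfield u g x : ℝ) : ℂ) * Complex.I by
      push_cast; ring, Complex.norm_exp_ofReal_mul_I, mul_one]

/-- The part of `u` selected by the weights `h`. -/
def gpart (h : D → ℝ) (u : D → X → ℝ) : D → X → ℝ := fun d x => h d * u d x

/-- At angle π/2 the selected coordinates are replaced by those of y and the others are untouched.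
Averaging over y cancels exactly the share of the renormalization due to the selected coordinates:
this is the conditional expectation given the remaining ones. -/
lemma integral_gchaos_rot (β : ℝ) (u : D → X → ℝ) (h : D → ℝ) (hh : ∀ d, h d = 0 ∨ h d = 1)
    (g : D → ℝ) (x : X) :
    ∫ y, gchaos β u (gaussRot (fun d => h d * (Real.pi / 2)) (g, y)).1 x ∂gaussPi D =
      gchaos β (gpart (fun d => 1 - h d) u) g x := by
  have hc : ∀ d, Real.cos (h d * (Real.pi / 2)) = 1 - h d := by
    intro d; rcases hh d with e | e <;> simp [e]
  have hs : ∀ d, Real.sin (h d * (Real.pi / 2)) = h d := by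
    intro d; rcases hh d with e | e <;> simp [e]
  have hsq : ∀ d, h d * h d = h d := by
    intro d; rcases hh d with e | e <;> simp [e]
  have e1 : ∀ y, gchaos β u (gaussRot (fun d => h d * (Real.pi / 2)) (g, y)).1 x =
      (Real.exp (β ^ 2 / 2 * gcov u x x) : ℂ) *
        Complex.exp (Complex.I * β * gfield (gpart (fun d => 1 - h d) u) g x) *
        Complex.exp (Complex.I * (∑ d, (β * (h d * u d x)) * y d : ℝ)) := by
    intro y
    rw [gchaos, mul_assoc (Real.exp _ : ℂ), ← Complex.exp_add]
    congr 2
    simp only [gfield, gpart, gaussRot, hc, hs]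
    push_cast
    simp only [Finset.mul_sum]
    rw [← Finset.sum_add_distrib]
    refine Finset.sum_congr rfl fun d _ => ?_
    ring
  simp_rw [e1]
  rw [integral_const_mul, integral_cexp_gaussPi, gchaos, mul_right_comm, ← Complex.ofReal_mul,
    ← Real.exp_add]
  congr 3
  simp only [gcov, gpart, Finset.mul_sum, ← Finset.sum_neg_distrib, Finset.sum_div]
  rw [← Finset.sum_add_distrib]
  refine Finset.sum_congr rfl fun d _ => ?_
  have := hsq d
  linear_combination (β ^ 2 / 2 * u d x ^ 2 * (-2)) * this

/-- The expectation of a product of exponentials of opposite charges. -/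
lemma integral_prod_gchaos (β : ℝ) (u : D → X → ℝ) {m : ℕ} (x y : Fin m → X) :
    ∫ g, ∏ j, gchaos β u g (x j) * conj (gchaos β u g (y j)) ∂gaussPi D =
      Real.exp (gasEnergy (fun a b => β ^ 2 * gcov u a b) x y) := by
  have e1 : ∀ g, ∏ j, gchaos β u g (x j) * conj (gchaos β u g (y j)) =
      (Real.exp (β ^ 2 / 2 * (∑ j, gcov u (x j) (x j) + ∑ j, gcov u (y j) (y j))) : ℂ) *
        Complex.exp (Complex.I * (∑ d, (β * ∑ j, (u d (x j) - u d (y j))) * g d : ℝ)) := by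
    intro g
    have e2 : ∀ j, gchaos β u g (x j) * conj (gchaos β u g (y j)) =
        Complex.exp ((β ^ 2 / 2 * (gcov u (x j) (x j) + gcov u (y j) (y j)) : ℝ) +
          Complex.I * (β * ∑ d, (u d (x j) - u d (y j)) * g d : ℝ)) := by
      intro j
      rw [gchaos, gchaos, map_mul, Complex.conj_ofReal, ← Complex.exp_conj]
      simp only [Complex.ofReal_exp, ← Complex.exp_add]
      congr 1
      simp only [gfield, map_mul, Complex.conj_I, Complex.conj_ofReal, sub_mul,
        Finset.sum_sub_distrib]
      push_cast
      ring
    simp_rw [e2]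
    rw [← Complex.exp_sum, Complex.ofReal_exp, ← Complex.exp_add, Finset.sum_add_distrib]
    congr 2
    · push_cast
      rw [← Finset.mul_sum, Finset.sum_add_distrib]
    · rw [← Finset.mul_sum, ← Complex.ofReal_sum]
      congr 2
      rw [← Finset.mul_sum, Finset.sum_comm]
      simp only [mul_assoc, ← Finset.mul_sum, ← Finset.sum_mul]
  simp_rw [e1]
  rw [integral_const_mul, integral_cexp_gaussPi, ← Complex.ofReal_mul, ← Real.exp_add]
  congr 2
  have h1 : ∀ a b : Fin m → X, ∑ j, ∑ k, gcov u (a j) (b k) =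
      ∑ d, (∑ j, u d (a j)) * ∑ k, u d (b k) := by
    intro a b
    simp only [gcov, Finset.sum_mul_sum]
    rw [Finset.sum_congr rfl fun j _ => Finset.sum_comm, Finset.sum_comm]
  -- The diagonal terms removed in `gasEnergy` are those supplied by the renormalization; the rest
  -- is the expanded square of the total charge density.
  simp only [gasEnergy, ← Finset.mul_sum, h1, Finset.sum_sub_distrib]
  have h2 : ∑ d, (β * (∑ j, u d (x j) - ∑ j, u d (y j))) ^ 2 =
      β ^ 2 * (∑ d, (∑ j, u d (x j)) * ∑ k, u d (x k) + ∑ d, (∑ j, u d (y j)) * ∑ k, u d (y k) -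
        2 * ∑ d, (∑ j, u d (x j)) * ∑ k, u d (y k)) := by
    rw [Finset.mul_sum, ← Finset.sum_add_distrib, ← Finset.sum_sub_distrib, Finset.mul_sum]
    refine Finset.sum_congr rfl fun d _ => ?_
    ring
  rw [h2]
  ring

end GaussianField

/-! ### Interpolation by rotations and Pisier's inequality. -/

section GaussianField

open ProbabilityTheory

variable {D : Type*} [Fintype D] {X : Type*} [MeasurableSpace X]

lemma measurable_gfield {Z : Type*} [MeasurableSpace Z] {u : D → X → ℝ}
    (hu : ∀ d, Measurable (u d)) {a : Z → D → ℝ} {c : Z → X} (ha : Measurable a)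
    (hc : Measurable c) : Measurable fun z => gfield u (a z) (c z) := by
  unfold gfield
  refine Finset.measurable_fun_sum _ fun d _ => ?_
  exact ((hu d).comp hc).mul ((measurable_pi_apply d).comp ha)

lemma measurable_gcov {Z : Type*} [MeasurableSpace Z] {u : D → X → ℝ}
    (hu : ∀ d, Measurable (u d)) {a c : Z → X} (ha : Measurable a)
    (hc : Measurable c) : Measurable fun z => gcov u (a z) (c z) := by
  unfold gcov
  refine Finset.measurable_fun_sum _ fun d _ => ?_
  exact ((hu d).comp ha).mul ((hu d).comp hc)

lemma measurable_gchaos {Z : Type*} [MeasurableSpace Z] {β : ℝ} {u : D → X → ℝ}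
    (hu : ∀ d, Measurable (u d)) {a : Z → D → ℝ} {c : Z → X} (ha : Measurable a)
    (hc : Measurable c) : Measurable fun z => gchaos β u (a z) (c z) := by
  have h1 := measurable_gfield hu ha hc
  have h2 := measurable_gcov hu hc hc
  unfold gchaos
  fun_prop

lemma measurable_gaussRot (θ : D → ℝ) : Measurable (gaussRot θ) := by
  unfold gaussRot
  fun_prop

lemma measurable_gpart {u : D → X → ℝ} (hu : ∀ d, Measurable (u d)) (h : D → ℝ) (d : D) :
    Measurable (gpart h u d) := (hu d).const_mul _

lemma abs_gfield_le {u : D → X → ℝ} {b : ℝ} (hb : ∀ d x, |u d x| ≤ b) (g : D → ℝ) (x : X) :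
    |gfield u g x| ≤ b * ∑ d, |g d| := by
  rw [gfield, Finset.mul_sum]
  refine (Finset.abs_sum_le_sum_abs _ _).trans (Finset.sum_le_sum fun d _ => ?_)
  rw [abs_mul]
  exact mul_le_mul_of_nonneg_right (hb d x) (abs_nonneg _)

lemma gcov_self_le {u : D → X → ℝ} {b : ℝ} (hb : ∀ d x, |u d x| ≤ b) (x : X) :
    gcov u x x ≤ Fintype.card D * b ^ 2 := by
  refine (Finset.sum_le_card_nsmul _ _ (b ^ 2) fun d _ => ?_).trans (by simp)
  rw [← sq, ← sq_abs]
  exact pow_le_pow_left₀ (abs_nonneg _) (hb d x) 2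

lemma norm_gchaos_le (β : ℝ) {u : D → X → ℝ} {b : ℝ} (hb : ∀ d x, |u d x| ≤ b) (g : D → ℝ)
    (x : X) : ‖gchaos β u g x‖ ≤ Real.exp (β ^ 2 / 2 * (Fintype.card D * b ^ 2)) := by
  rw [norm_gchaos]
  gcongr
  exact gcov_self_le hb x

lemma abs_gpart_le {u : D → X → ℝ} {b : ℝ} (hb : ∀ d x, |u d x| ≤ b) {h : D → ℝ}
    (hh : ∀ d, h d = 0 ∨ h d = 1) (d : D) (x : X) : |gpart h u d x| ≤ b := by
  have h0 : 0 ≤ b := (abs_nonneg _).trans (hb d x)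
  rcases hh d with e | e <;> simp [gpart, e, h0, hb d x]

lemma one_sub_zero_or_one {h : D → ℝ} (hh : ∀ d, h d = 0 ∨ h d = 1) (d : D) :
    1 - h d = 0 ∨ 1 - h d = 1 := by
  rcases hh d with e | e <;> simp [e]

/-- In the selected planes the angular derivative of the first component of the rotated pair is its
second component. At every angle this pair is again a pair of independent standard vectors, which is
what makes the rotation useful. -/
lemma hasDerivAt_gchaos_rot (β : ℝ) (u : D → X → ℝ) (h : D → ℝ) (p : (D → ℝ) × (D → ℝ)) (x : X)
    (s : ℝ) :
    HasDerivAt (fun s => gchaos β u (gaussRot (fun d => h d * s) p).1 x)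
      (Complex.I * ((β * gfield (gpart h u) (gaussRot (fun d => h d * s) p).2 x : ℝ) *
        gchaos β u (gaussRot (fun d => h d * s) p).1 x)) s := by
  have h1 : HasDerivAt (fun s => gfield u (gaussRot (fun d => h d * s) p).1 x)
      (gfield (gpart h u) (gaussRot (fun d => h d * s) p).2 x) s := by
    simp only [gfield, gaussRot, gpart]
    refine HasDerivAt.fun_sum fun d _ => ?_
    have e1 : HasDerivAt (fun s : ℝ => h d * s) (h d) s := by
      simpa using (hasDerivAt_id s).const_mul (h d)
    refine HasDerivAt.congr_deriv
      (((e1.cos.mul_const (p.1 d)).add (e1.sin.mul_const (p.2 d))).const_mul (u d x)) ?_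
    ring
  have h2 := ((h1.ofReal_comp.const_mul (Complex.I * β)).cexp).const_mul
    (Real.exp (β ^ 2 / 2 * gcov u x x) : ℂ)
  refine HasDerivAt.congr_deriv h2 ?_
  rw [gchaos]
  push_cast
  ring

variable {ν : Measure X} [IsProbabilityMeasure ν]

/-- The derivative of `∫ Θ_u(g) dν` along the direction `y`, up to a factor `i`. -/
def gderiv (β : ℝ) (ν : Measure X) (u v : D → X → ℝ) (g y : D → ℝ) : ℂ :=
  ∫ x, ((β * gfield v y x : ℝ) : ℂ) * gchaos β u g x ∂ν

lemma measurable_gderiv_integrand {Z : Type*} [MeasurableSpace Z] (β : ℝ) {u v : D → X → ℝ}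
    (hu : ∀ d, Measurable (u d)) (hv : ∀ d, Measurable (v d)) {a c : Z → D → ℝ}
    (ha : Measurable a) (hc : Measurable c) :
    Measurable fun z : Z × X =>
      ((β * gfield v (c z.1) z.2 : ℝ) : ℂ) * gchaos β u (a z.1) z.2 := by
  have h1 := measurable_gfield hv (hc.comp measurable_fst) (measurable_snd (α := Z) (β := X))
  have h2 := measurable_gchaos (β := β) hu (ha.comp measurable_fst)
    (measurable_snd (α := Z) (β := X))
  exact (Complex.measurable_ofReal.comp (h1.const_mul β)).mul h2

lemma measurable_gderiv {Z : Type*} [MeasurableSpace Z] (β : ℝ) {u v : D → X → ℝ}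
    (hu : ∀ d, Measurable (u d)) (hv : ∀ d, Measurable (v d)) {a c : Z → D → ℝ}
    (ha : Measurable a) (hc : Measurable c) :
    Measurable fun z => gderiv β ν u v (a z) (c z) :=
  ((measurable_gderiv_integrand β hu hv ha hc).stronglyMeasurable.integral_prod_right').measurable

lemma integrable_gchaos (β : ℝ) {u : D → X → ℝ} (hu : ∀ d, Measurable (u d)) {b : ℝ}
    (hb : ∀ d x, |u d x| ≤ b) (g : D → ℝ) : Integrable (gchaos β u g) ν :=
  Integrable.of_bound (measurable_gchaos hu (a := fun _ => g) measurable_const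
    measurable_id).aestronglyMeasurable _ (Eventually.of_forall (norm_gchaos_le β hb g))

/-- The difference between angles π/2 and 0 is the integral of the angular derivative; Fubini brings
the angle outside, where the inner integral is i times `gderiv`. -/
lemma enorm_integral_gchaos_rot_sub_le (β : ℝ) {u : D → X → ℝ} (hu : ∀ d, Measurable (u d)) {b : ℝ}
    (hb : ∀ d x, |u d x| ≤ b) {h : D → ℝ} (hh : ∀ d, h d = 0 ∨ h d = 1)
    (p : (D → ℝ) × (D → ℝ)) :
    ‖∫ x, gchaos β u (gaussRot (fun d => h d * (Real.pi / 2)) p).1 x - gchaos β u p.1 x ∂ν‖ₑ ≤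
      ∫⁻ s in Set.Ioc 0 (Real.pi / 2), ‖gderiv β ν u (gpart h u)
        (gaussRot (fun d => h d * s) p).1 (gaussRot (fun d => h d * s) p).2‖ₑ := by
  have hv := measurable_gpart hu h
  have hrm : Measurable fun s : ℝ => gaussRot (fun d => h d * s) p := by
    unfold gaussRot; fun_prop
  have hrc : Continuous fun s : ℝ => gaussRot (fun d => h d * s) p := by
    unfold gaussRot; fun_prop
  have hcd : ∀ x, Continuous fun s : ℝ => Complex.I *
      ((β * gfield (gpart h u) (gaussRot (fun d => h d * s) p).2 x : ℝ) *
        gchaos β u (gaussRot (fun d => h d * s) p).1 x) := by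
    intro x
    unfold gchaos gfield
    fun_prop
  have h0 : (gaussRot (fun d => h d * 0) p).1 = p.1 := by
    ext d; simp [gaussRot]
  have e1 : ∀ x, gchaos β u (gaussRot (fun d => h d * (Real.pi / 2)) p).1 x - gchaos β u p.1 x =
      ∫ s in (0 : ℝ)..(Real.pi / 2), Complex.I *
        ((β * gfield (gpart h u) (gaussRot (fun d => h d * s) p).2 x : ℝ) *
        gchaos β u (gaussRot (fun d => h d * s) p).1 x) := by
    intro x
    rw [intervalIntegral.integral_eq_sub_of_hasDerivAt
      (fun s _ => hasDerivAt_gchaos_rot β u h p x s) ((hcd x).intervalIntegrable _ _), h0]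
  have hpi : (0 : ℝ) ≤ Real.pi / 2 := by positivity
  have hint : Integrable (Function.uncurry fun (s : ℝ) x => Complex.I *
        ((β * gfield (gpart h u) (gaussRot (fun d => h d * s) p).2 x : ℝ) *
        gchaos β u (gaussRot (fun d => h d * s) p).1 x))
      ((volume.restrict (Set.uIoc 0 (Real.pi / 2))).prod ν) := by
    have hfin : IsFiniteMeasure (volume.restrict (Set.uIoc (0 : ℝ) (Real.pi / 2))) := by
      rw [Set.uIoc_of_le hpi]; infer_instance
    refine Integrable.of_bound (C := |β| * (b * ∑ d, (|p.1 d| + |p.2 d|)) *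
      Real.exp (β ^ 2 / 2 * (Fintype.card D * b ^ 2))) ?_ (Eventually.of_forall ?_)
    · exact ((measurable_gderiv_integrand β hu hv hrm.fst hrm.snd).const_mul
        Complex.I).aestronglyMeasurable
    · rintro ⟨s, x⟩
      simp only [Function.uncurry]
      rw [norm_mul, Complex.norm_I, one_mul, norm_mul, Complex.norm_real, norm_mul, Real.norm_eq_abs,
        Real.norm_eq_abs]
      -- The hypothesis on b forces b ≥ 0 only if there is at least one coordinate; with no
      -- coordinates the fields vanish.
      have hb0 : 0 ≤ b ∨ IsEmpty D := by
        rcases isEmpty_or_nonempty D with hD | ⟨⟨d⟩⟩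
        · exact Or.inr hD
        · exact Or.inl ((abs_nonneg _).trans (hb d x))
      have hA : |gfield (gpart h u) (gaussRot (fun d => h d * s) p).2 x| ≤
          b * ∑ d, (|p.1 d| + |p.2 d|) := by
        refine (abs_gfield_le (abs_gpart_le hb hh) _ _).trans ?_
        rcases hb0 with hb0 | hD
        · gcongr with d
          simp only [gaussRot]
          refine (abs_add_le _ _).trans ?_
          rw [abs_mul, abs_mul, abs_neg]
          gcongr
          · exact mul_le_of_le_one_left (abs_nonneg _) (Real.abs_sin_le_one _)
          · exact mul_le_of_le_one_left (abs_nonneg _) (Real.abs_cos_le_one _)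
        · simp
      exact mul_le_mul (mul_le_mul_of_nonneg_left hA (abs_nonneg _)) (norm_gchaos_le β hb _ x)
        (norm_nonneg _) (mul_nonneg (abs_nonneg _) ((abs_nonneg _).trans hA))
  simp_rw [e1]
  rw [← intervalIntegral_integral_swap hint, intervalIntegral.integral_of_le hpi]
  refine (enorm_integral_le_lintegral_enorm _).trans (le_of_eq ?_)
  refine lintegral_congr fun s => ?_
  rw [integral_const_mul, enorm_mul]
  simp [gderiv, enorm_eq_nnnorm]

/-- Pisier's inequality: the fluctuation of `∫ Θ_u dν` when the coordinates selected by `h` are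
averaged out is controlled by its derivative in these coordinates. -/
lemma lintegral_enorm_integral_gchaos_sub_le (β : ℝ) {u : D → X → ℝ} (hu : ∀ d, Measurable (u d))
    {b : ℝ} (hb : ∀ d x, |u d x| ≤ b) {h : D → ℝ} (hh : ∀ d, h d = 0 ∨ h d = 1) {n : ℕ}
    (hn : 1 ≤ n) :
    ∫⁻ g, ‖∫ x, gchaos β u g x - gchaos β (gpart (fun d => 1 - h d) u) g x ∂ν‖ₑ ^ n ∂gaussPi D ≤
      ENNReal.ofReal (Real.pi / 2) ^ n *
        ∫⁻ p, ‖gderiv β ν u (gpart h u) p.1 p.2‖ₑ ^ n ∂(gaussPi D).prod (gaussPi D) := by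
  have hv := measurable_gpart hu h
  set R : (D → ℝ) × (D → ℝ) → D → ℝ := fun p => (gaussRot (fun d => h d * (Real.pi / 2)) p).1
  have hR : Measurable R := (measurable_gaussRot _).fst
  have hF1 : Measurable fun q : ((D → ℝ) × (D → ℝ)) × X => gchaos β u (R q.1) q.2 :=
    measurable_gchaos hu (hR.comp measurable_fst) measurable_snd
  have hF2 : Measurable fun q : ((D → ℝ) × (D → ℝ)) × X => gchaos β u q.1.1 q.2 :=
    measurable_gchaos hu measurable_fst.fst measurable_snd
  have hdiff : Measurable fun p => ∫ x, gchaos β u (R p) x - gchaos β u p.1 x ∂ν :=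
    ((hF1.sub hF2).stronglyMeasurable.integral_prod_right').measurable
  -- averaging out
  have step1 : ∀ g, ‖∫ x, gchaos β u g x - gchaos β (gpart (fun d => 1 - h d) u) g x ∂ν‖ₑ ^ n ≤
      ∫⁻ y, ‖∫ x, gchaos β u (R (g, y)) x - gchaos β u g x ∂ν‖ₑ ^ n ∂gaussPi D := by
    intro g
    have e1 : ∫ x, gchaos β u g x - gchaos β (gpart (fun d => 1 - h d) u) g x ∂ν =
        -∫ y, ∫ x, gchaos β u (R (g, y)) x - gchaos β u g x ∂ν ∂gaussPi D := by
      have hi : Integrable (Function.uncurry fun (y : D → ℝ) (x : X) => gchaos β u (R (g, y)) x)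
          ((gaussPi D).prod ν) := by
        refine Integrable.of_bound (C := Real.exp (β ^ 2 / 2 * (Fintype.card D * b ^ 2))) ?_
          (Eventually.of_forall fun q => norm_gchaos_le β hb _ _)
        exact (measurable_gchaos hu (hR.comp (measurable_const.prodMk measurable_fst))
          measurable_snd).aestronglyMeasurable
      have e2 : ∀ y, ∫ x, gchaos β u (R (g, y)) x - gchaos β u g x ∂ν =
          ∫ x, gchaos β u (R (g, y)) x ∂ν - ∫ x, gchaos β u g x ∂ν := fun y =>
        integral_sub (integrable_gchaos β hu hb _) (integrable_gchaos β hu hb _)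
      simp_rw [e2]
      have hi' : Integrable (fun y => ∫ x, gchaos β u (R (g, y)) x ∂ν) (gaussPi D) :=
        hi.integral_prod_left
      rw [integral_sub (integrable_gchaos β hu hb _)
        (integrable_gchaos β (measurable_gpart hu _) (abs_gpart_le hb (one_sub_zero_or_one hh)) _),
        integral_sub hi' (integrable_const _), integral_integral_swap hi,
        integral_congr_ae (Eventually.of_forall fun x => integral_gchaos_rot β u h hh g x)]
      simp
    rw [e1, enorm_neg]
    exact enorm_integral_pow_le
      (hdiff.comp measurable_prodMk_left).aestronglyMeasurable n hn
  have hm : Measurable fun q : ((D → ℝ) × (D → ℝ)) × ℝ => ‖gderiv β ν u (gpart h u)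
      (gaussRot (fun d => h d * q.2) q.1).1 (gaussRot (fun d => h d * q.2) q.1).2‖ₑ := by
    have hr : Measurable fun q : ((D → ℝ) × (D → ℝ)) × ℝ => gaussRot (fun d => h d * q.2) q.1 := by
      unfold gaussRot; fun_prop
    exact (measurable_gderiv β hu hv hr.fst hr.snd).enorm
  have hvol : (volume.restrict (Set.Ioc 0 (Real.pi / 2))) Set.univ =
      ENNReal.ofReal (Real.pi / 2) := by
    simp
  calc _ ≤ ∫⁻ g, ∫⁻ y, ‖∫ x, gchaos β u (R (g, y)) x - gchaos β u g x ∂ν‖ₑ ^ n ∂gaussPi D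
        ∂gaussPi D := lintegral_mono step1
    _ = ∫⁻ p, ‖∫ x, gchaos β u (R p) x - gchaos β u p.1 x ∂ν‖ₑ ^ n
        ∂(gaussPi D).prod (gaussPi D) := by
        rw [lintegral_prod _ (hdiff.enorm.pow_const n).aemeasurable]
    _ ≤ ∫⁻ p, (ENNReal.ofReal (Real.pi / 2) ^ (n - 1) *
        ∫⁻ s in Set.Ioc 0 (Real.pi / 2), ‖gderiv β ν u (gpart h u)
          (gaussRot (fun d => h d * s) p).1 (gaussRot (fun d => h d * s) p).2‖ₑ ^ n)
          ∂(gaussPi D).prod (gaussPi D) := by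
        refine lintegral_mono fun p => ?_
        refine (pow_le_pow_left' (enorm_integral_gchaos_rot_sub_le β hu hb hh p) n).trans ?_
        refine (lintegral_pow_le ?_ n hn).trans (le_of_eq (by rw [hvol]))
        exact (hm.comp measurable_prodMk_left).aemeasurable
    _ = ENNReal.ofReal (Real.pi / 2) ^ (n - 1) *
        ∫⁻ s in Set.Ioc 0 (Real.pi / 2), ∫⁻ p, ‖gderiv β ν u (gpart h u)
          (gaussRot (fun d => h d * s) p).1 (gaussRot (fun d => h d * s) p).2‖ₑ ^ n
          ∂(gaussPi D).prod (gaussPi D) := by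
        rw [lintegral_const_mul _ (hm.pow_const n).lintegral_prod_right',
          lintegral_lintegral_swap (hm.pow_const n).aemeasurable]
    _ = ENNReal.ofReal (Real.pi / 2) ^ (n - 1) *
        ∫⁻ s in Set.Ioc 0 (Real.pi / 2), ∫⁻ p, ‖gderiv β ν u (gpart h u) p.1 p.2‖ₑ ^ n
          ∂(gaussPi D).prod (gaussPi D) := by
        congr 1
        refine lintegral_congr fun s => ?_
        -- Rotations preserve the law of two independent standard vectors, so the moment of the
        -- derivative is the same at every angle.
        exact (measurePreserving_gaussRot fun d => h d * s).lintegral_comp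
          (f := fun p => ‖gderiv β ν u (gpart h u) p.1 p.2‖ₑ ^ n)
          ((measurable_gderiv β hu hv measurable_fst measurable_snd).enorm.pow_const n)
    _ = _ := by
        rw [lintegral_const, hvol, mul_comm (lintegral _ _), ← mul_assoc, ← pow_succ,
          Nat.sub_add_cancel hn]

end GaussianField

lemma lintegral_fin_prod_eq_prod {E : Type*} [MeasurableSpace E] {μ : Measure E} [SigmaFinite μ] :
    ∀ {m : ℕ} {f : Fin m → E → ℝ≥0∞} (_ : ∀ i, Measurable (f i)),
    ∫⁻ x : Fin m → E, ∏ i, f i (x i) ∂(Measure.pi fun _ => μ) = ∏ i, ∫⁻ x, f i x ∂μ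
  | 0, f, hf => by simp
  | m + 1, f, hf => by
    have h1 := (measurePreserving_piFinSuccAbove (fun _ : Fin (m + 1) => μ) 0).symm
    have hm : Measurable fun x : Fin m → E => ∏ i : Fin m, f i.succ (x i) :=
      Finset.measurable_fun_prod _ fun i _ => (hf i.succ).comp (measurable_pi_apply i)
    have hm' : Measurable fun x : Fin (m + 1) → E => ∏ i, f i (x i) :=
      Finset.measurable_fun_prod _ fun i _ => (hf i).comp (measurable_pi_apply i)
    rw [← h1.lintegral_comp hm']
    calc _ = ∫⁻ x : E × (Fin m → E), f 0 x.1 * ∏ i : Fin m, f i.succ (x.2 i)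
          ∂(μ.prod (Measure.pi fun _ => μ)) := by
          refine lintegral_congr fun x => ?_
          simp [MeasurableEquiv.piFinSuccAbove_symm_apply, Fin.insertNthEquiv, Fin.prod_univ_succ]
      _ = _ := by
          rw [lintegral_prod_mul (hf 0).aemeasurable hm.aemeasurable, Fin.prod_univ_succ,
            lintegral_fin_prod_eq_prod fun i => hf i.succ]

/-! ### Moments of the derivative as integrals over neutral gases. -/

section GaussianField

open ProbabilityTheory

variable {D : Type*} [Fintype D] {X : Type*} [MeasurableSpace X] {ν : Measure X}
  [IsProbabilityMeasure ν]

/-- This normalization is what allows an independent chaos to be inserted into an average without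
changing its expectation. -/
lemma integral_gchaos_eq_one (β : ℝ) (w : D → X → ℝ) (x : X) :
    ∫ k, gchaos β w k x ∂gaussPi D = 1 := by
  have e1 : ∀ k, gchaos β w k x = (Real.exp (β ^ 2 / 2 * gcov w x x) : ℂ) *
      Complex.exp (Complex.I * (∑ d, (β * w d x) * k d : ℝ)) := by
    intro k
    rw [gchaos, mul_assoc Complex.I, ← Complex.ofReal_mul, gfield, Finset.mul_sum]
    simp only [mul_assoc]
  simp_rw [e1]
  rw [integral_const_mul, integral_cexp_gaussPi, ← Complex.ofReal_mul, ← Real.exp_add]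
  have : β ^ 2 / 2 * gcov w x x + -(∑ d, (β * w d x) ^ 2) / 2 = 0 := by
    simp only [gcov, mul_pow, ← Finset.mul_sum, ← sq]
    ring
  rw [this]
  simp

/-- Averaging over an independent field can only decrease the moments of the derivative. -/
lemma enorm_gderiv_pow_le (β : ℝ) {u v w : D → X → ℝ} (hu : ∀ d, Measurable (u d))
    (hv : ∀ d, Measurable (v d)) (hw : ∀ d, Measurable (w d)) {b : ℝ} (hbu : ∀ d x, |u d x| ≤ b)
    (hbv : ∀ d x, |v d x| ≤ b) (hbw : ∀ d x, |w d x| ≤ b) (g y : D → ℝ) {n : ℕ} (hn : 1 ≤ n) :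
    ‖gderiv β ν u v g y‖ₑ ^ n ≤ ∫⁻ k, ‖∑ d, (y d : ℂ) *
      (β * ∫ x, v d x * (gchaos β u g x * gchaos β w k x) ∂ν)‖ₑ ^ n ∂gaussPi D := by
  set E := Real.exp (β ^ 2 / 2 * (Fintype.card D * b ^ 2))
  have hT : ∀ k x, ‖gchaos β u g x * gchaos β w k x‖ ≤ E * E := by
    intro k x
    rw [norm_mul]
    exact mul_le_mul (norm_gchaos_le β hbu _ _) (norm_gchaos_le β hbw _ _) (norm_nonneg _)
      (Real.exp_pos _).le
  have hmT : Measurable fun q : (D → ℝ) × X => gchaos β u g q.2 * gchaos β w q.1 q.2 :=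
    (measurable_gchaos hu measurable_const measurable_snd).mul
      (measurable_gchaos hw measurable_fst measurable_snd)
  have hmF : Measurable fun q : (D → ℝ) × X => ((β * gfield v y q.2 : ℝ) : ℂ) *
      (gchaos β u g q.2 * gchaos β w q.1 q.2) :=
    (Complex.measurable_ofReal.comp ((measurable_gfield hv (a := fun _ => y) measurable_const
      measurable_snd).const_mul β)).mul hmT
  have hi : Integrable (Function.uncurry fun (k : D → ℝ) x => ((β * gfield v y x : ℝ) : ℂ) *
      (gchaos β u g x * gchaos β w k x)) ((gaussPi D).prod ν) := by
    refine Integrable.of_bound hmF.aestronglyMeasurable (|β| * (b * ∑ d, |y d|) * (E * E))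
      (Eventually.of_forall ?_)
    rintro ⟨k, x⟩
    simp only [Function.uncurry]
    rw [norm_mul, Complex.norm_real, norm_mul, Real.norm_eq_abs, Real.norm_eq_abs]
    have hA := abs_gfield_le hbv y x
    exact mul_le_mul (mul_le_mul_of_nonneg_left hA (abs_nonneg _)) (hT k x)
      (norm_nonneg _) (mul_nonneg (abs_nonneg _) ((abs_nonneg _).trans hA))
  -- A factor of mean one is inserted under the integral and its expectation is pulled outside;
  -- Jensen's inequality then moves the power inside.
  have e1 : gderiv β ν u v g y = ∫ k, ∫ x, ((β * gfield v y x : ℝ) : ℂ) *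
      (gchaos β u g x * gchaos β w k x) ∂ν ∂gaussPi D := by
    rw [integral_integral_swap hi, gderiv]
    refine integral_congr_ae (Eventually.of_forall fun x => ?_)
    simp only
    rw [integral_const_mul, integral_const_mul, integral_gchaos_eq_one, mul_one]
  have e2 : ∀ k, ∫ x, ((β * gfield v y x : ℝ) : ℂ) * (gchaos β u g x * gchaos β w k x) ∂ν =
      ∑ d, (y d : ℂ) * (β * ∫ x, v d x * (gchaos β u g x * gchaos β w k x) ∂ν) := by
    intro k
    have e3 : ∀ x, ((β * gfield v y x : ℝ) : ℂ) * (gchaos β u g x * gchaos β w k x) =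
        ∑ d, ((y d * β : ℝ) : ℂ) * (v d x * (gchaos β u g x * gchaos β w k x)) := by
      intro x
      rw [gfield]
      push_cast
      rw [Finset.mul_sum, Finset.sum_mul]
      refine Finset.sum_congr rfl fun d _ => ?_
      ring
    simp_rw [e3]
    rw [integral_finsetSum]
    · refine Finset.sum_congr rfl fun d _ => ?_
      rw [integral_const_mul]
      push_cast
      ring
    · intro d _
      refine Integrable.const_mul (Integrable.of_bound (((Complex.measurable_ofReal.comp
        (hv d)).mul (hmT.comp measurable_prodMk_left)).aestronglyMeasurable) (b * (E * E))
        (Eventually.of_forall fun x => ?_)) _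
      rw [Pi.mul_apply, norm_mul]
      refine mul_le_mul ?_ (hT k x) (norm_nonneg _) ((abs_nonneg _).trans (hbv d x))
      simpa using hbv d x
  rw [e1]
  refine (enorm_integral_pow_le hi.integral_prod_left.aestronglyMeasurable n hn).trans ?_
  refine le_of_eq (lintegral_congr fun k => ?_)
  rw [← e2]
  rfl

/-- The moments of the square function, expanded as an integral over configurations. -/
lemma lintegral_sum_norm_sq_pow_le (β : ℝ) {u v w : D → X → ℝ} (hu : ∀ d, Measurable (u d))
    (hv : ∀ d, Measurable (v d)) (hw : ∀ d, Measurable (w d)) {b : ℝ} (hbu : ∀ d x, |u d x| ≤ b)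
    (hbv : ∀ d x, |v d x| ≤ b) (hbw : ∀ d x, |w d x| ≤ b) (m : ℕ) :
    ∫⁻ q : (D → ℝ) × (D → ℝ), ENNReal.ofReal (∑ d, ‖∫ x, v d x *
      (gchaos β u q.1 x * gchaos β w q.2 x) ∂ν‖ ^ 2) ^ m ∂(gaussPi D).prod (gaussPi D) ≤
    ∫⁻ p : Fin m → X × X, (∏ j, ENNReal.ofReal |gcov v (p j).1 (p j).2|) *
      ENNReal.ofReal (Real.exp (gasEnergy (fun a c => β ^ 2 * (gcov u a c + gcov w a c))
        (fun j => (p j).1) (fun j => (p j).2))) ∂(Measure.pi fun _ => ν.prod ν) := by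
  set E := Real.exp (β ^ 2 / 2 * (Fintype.card D * b ^ 2))
  obtain ⟨T, hTq⟩ : ∃ T : (D → ℝ) × (D → ℝ) → X → ℂ,
      ∀ q x, gchaos β u q.1 x * gchaos β w q.2 x = T q x := ⟨_, fun _ _ => rfl⟩
  simp_rw [hTq]
  have hT : ∀ q x, ‖T q x‖ ≤ E * E := by
    intro k x
    rw [← hTq, norm_mul]
    exact mul_le_mul (norm_gchaos_le β hbu _ _) (norm_gchaos_le β hbw _ _) (norm_nonneg _)
      (Real.exp_pos _).le
  have hmT : Measurable fun q : ((D → ℝ) × (D → ℝ)) × X => T q.1 q.2 := by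
    simp_rw [← hTq]
    exact (measurable_gchaos hu measurable_fst.fst measurable_snd).mul
      (measurable_gchaos hw measurable_fst.snd measurable_snd)
  set S : (D → ℝ) × (D → ℝ) → ℝ := fun q => ∑ d, ‖∫ x, v d x * T q x ∂ν‖ ^ 2
  set F : (D → ℝ) × (D → ℝ) → X × X → ℂ := fun q z =>
    gcov v z.1 z.2 * (T q z.1 * conj (T q z.2))
  have hmF : Measurable fun r : ((D → ℝ) × (D → ℝ)) × (X × X) => F r.1 r.2 := by
    have h1 : Measurable fun r : ((D → ℝ) × (D → ℝ)) × (X × X) => gcov v r.2.1 r.2.2 :=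
      measurable_gcov hv measurable_snd.fst measurable_snd.snd
    have h2 : Measurable fun r : ((D → ℝ) × (D → ℝ)) × (X × X) => T r.1 r.2.1 :=
      hmT.comp (show Measurable fun r : ((D → ℝ) × (D → ℝ)) × (X × X) => (r.1, r.2.1) by fun_prop)
    have h3 : Measurable fun r : ((D → ℝ) × (D → ℝ)) × (X × X) => T r.1 r.2.2 :=
      hmT.comp (show Measurable fun r : ((D → ℝ) × (D → ℝ)) × (X × X) => (r.1, r.2.2) by fun_prop)
    exact (Complex.measurable_ofReal.comp h1).mul
      (h2.mul (Complex.continuous_conj.measurable.comp h3))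
  have hgc : ∀ x y, |gcov v x y| ≤ Fintype.card D * b ^ 2 := by
    intro x y
    refine (Finset.abs_sum_le_sum_abs _ _).trans
      ((Finset.sum_le_card_nsmul _ _ (b ^ 2) fun d _ => ?_).trans (by simp))
    rw [abs_mul, sq]
    exact mul_le_mul (hbv d x) (hbv d y) (abs_nonneg _) ((abs_nonneg _).trans (hbv d x))
  have hF : ∀ q z, ‖F q z‖ ≤ Fintype.card D * b ^ 2 * (E * E * (E * E)) := by
    intro q z
    simp only [F]
    rw [norm_mul, norm_mul, RCLike.norm_conj, Complex.norm_real]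
    exact mul_le_mul (hgc _ _) (mul_le_mul (hT _ _) (hT _ _) (norm_nonneg _) (by positivity))
      (by positivity) (by positivity)
  have hS0 : ∀ q, 0 ≤ S q := fun q => Finset.sum_nonneg fun d _ => by positivity
  -- Expanding each squared modulus as a double integral and summing over d replaces the products
  -- v_d(x)v_d(y) by the covariance of v. The m-th power is then an integral over m pairs of
  -- opposite charges.
  have hSF : ∀ q, (S q : ℂ) = ∫ z, F q z ∂ν.prod ν := by
    intro q
    have hmq : Measurable (T q) := hmT.comp measurable_prodMk_left
    have hi : ∀ d, Integrable (fun x => (v d x : ℂ) * T q x) ν := by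
      intro d
      refine Integrable.of_bound ((Complex.measurable_ofReal.comp (hv d)).mul
        hmq).aestronglyMeasurable (b * (E * E)) (Eventually.of_forall fun x => ?_)
      rw [norm_mul]
      refine mul_le_mul ?_ (hT q x) (norm_nonneg _) ((abs_nonneg _).trans (hbv d x))
      simpa using hbv d x
    have hi' : ∀ d, Integrable (fun x => conj ((v d x : ℂ) * T q x)) ν := fun d =>
      (hi d).mono (Complex.continuous_conj.comp_aestronglyMeasurable (hi d).aestronglyMeasurable)
        (Eventually.of_forall fun x => by simp)
    have e1 : ∀ d, ((‖∫ x, v d x * T q x ∂ν‖ ^ 2 : ℝ) : ℂ) =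
        ∫ z : X × X, (v d z.1 * T q z.1) * conj (v d z.2 * T q z.2) ∂ν.prod ν := by
      intro d
      rw [integral_prod_mul (fun x => (v d x : ℂ) * T q x) (fun x => conj ((v d x : ℂ) * T q x)),
        integral_conj, Complex.mul_conj, Complex.normSq_eq_norm_sq]
    simp only [S, Complex.ofReal_sum, e1]
    rw [← integral_finsetSum]
    · refine integral_congr_ae (Eventually.of_forall fun z => ?_)
      simp only [F, gcov, map_mul, Complex.conj_ofReal]
      push_cast
      rw [Finset.sum_mul]
      refine Finset.sum_congr rfl fun d _ => ?_
      ring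
    · intro d _
      exact (hi d).mul_prod (hi' d)
  have hSm : ∀ q, ((S q ^ m : ℝ) : ℂ) =
      ∫ p : Fin m → X × X, ∏ j, F q (p j) ∂(Measure.pi fun _ => ν.prod ν) := by
    intro q
    rw [integral_fintype_prod_eq_pow, ← hSF, Fintype.card_fin, Complex.ofReal_pow]
  have hint : Integrable (Function.uncurry fun (q : (D → ℝ) × (D → ℝ)) (p : Fin m → X × X) =>
      ∏ j, F q (p j)) (((gaussPi D).prod (gaussPi D)).prod (Measure.pi fun _ => ν.prod ν)) := by
    refine Integrable.of_bound (Finset.measurable_fun_prod _ fun j _ => hmF.comp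
      (measurable_fst.prodMk ((measurable_pi_apply j).comp measurable_snd))).aestronglyMeasurable
      ((Fintype.card D * b ^ 2 * (E * E * (E * E))) ^ m) (Eventually.of_forall fun r => ?_)
    simp only [Function.uncurry, norm_prod]
    refine (Finset.prod_le_prod (fun j _ => norm_nonneg _) fun j _ => hF r.1 (r.2 j)).trans ?_
    simp
  -- The two chaoses are independent, so their charge correlations multiply; the energy is linear in
  -- the kernel, so the exponents add to the energy of the sum of the covariances.
  have hexp : ∀ p : Fin m → X × X, ∫ q, ∏ j, F q (p j) ∂(gaussPi D).prod (gaussPi D) =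
      (∏ j, (gcov v (p j).1 (p j).2 : ℂ)) * (Real.exp (gasEnergy
        (fun a c => β ^ 2 * (gcov u a c + gcov w a c)) (fun j => (p j).1) fun j => (p j).2) : ℂ) := by
    intro p
    have e1 : ∀ q, ∏ j, F q (p j) = (∏ j, (gcov v (p j).1 (p j).2 : ℂ)) *
        ((∏ j, gchaos β u q.1 (p j).1 * conj (gchaos β u q.1 (p j).2)) *
          ∏ j, gchaos β w q.2 (p j).1 * conj (gchaos β w q.2 (p j).2)) := by
      intro q
      simp only [F, ← hTq]
      rw [← Finset.prod_mul_distrib, ← Finset.prod_mul_distrib]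
      refine Finset.prod_congr rfl fun j _ => ?_
      rw [map_mul]
      ring
    simp_rw [e1]
    rw [integral_const_mul, integral_prod_mul
      (fun g => ∏ j, gchaos β u g (p j).1 * conj (gchaos β u g (p j).2))
      (fun g => ∏ j, gchaos β w g (p j).1 * conj (gchaos β w g (p j).2)),
      integral_prod_gchaos β u (fun j => (p j).1) (fun j => (p j).2),
      integral_prod_gchaos β w (fun j => (p j).1) (fun j => (p j).2), ← Complex.ofReal_mul,
      ← Real.exp_add]
    congr 3
    simp only [gasEnergy, mul_add, Finset.sum_add_distrib]
    ring
  have hSint : Integrable (fun q => S q ^ m) ((gaussPi D).prod (gaussPi D)) := by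
    have h1 : Integrable (fun q => ((S q ^ m : ℝ) : ℂ)) ((gaussPi D).prod (gaussPi D)) := by
      simp_rw [hSm]
      exact hint.integral_prod_left
    exact h1.re.congr (Eventually.of_forall fun q => Complex.ofReal_re _)
  have hval : ∫ q, ((S q ^ m : ℝ) : ℂ) ∂(gaussPi D).prod (gaussPi D) =
      ∫ p : Fin m → X × X, (∏ j, (gcov v (p j).1 (p j).2 : ℂ)) * (Real.exp (gasEnergy
        (fun a c => β ^ 2 * (gcov u a c + gcov w a c)) (fun j => (p j).1) fun j => (p j).2) : ℂ)
        ∂(Measure.pi fun _ => ν.prod ν) := by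
    simp_rw [hSm]
    rw [integral_integral_swap hint]
    simp_rw [hexp]
  calc _ = ENNReal.ofReal (∫ q, S q ^ m ∂(gaussPi D).prod (gaussPi D)) := by
        rw [ofReal_integral_eq_lintegral_ofReal hSint
          (Eventually.of_forall fun q => pow_nonneg (hS0 q) m)]
        simp_rw [ENNReal.ofReal_pow (hS0 _)]
        rfl
    _ = ‖∫ q, ((S q ^ m : ℝ) : ℂ) ∂(gaussPi D).prod (gaussPi D)‖ₑ := by
        rw [integral_complex_ofReal, ← ofReal_norm, Complex.norm_real,
          Real.norm_of_nonneg (integral_nonneg fun q => pow_nonneg (hS0 q) m)]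
    _ ≤ _ := by
        rw [hval]
        refine (enorm_integral_le_lintegral_enorm _).trans (le_of_eq (lintegral_congr fun p => ?_))
        rw [← ofReal_norm, norm_mul, norm_prod, Complex.norm_real,
          Real.norm_of_nonneg (Real.exp_pos _).le, ENNReal.ofReal_mul (by positivity),
          ENNReal.ofReal_prod_of_nonneg (fun _ _ => norm_nonneg _)]
        simp

/-- The Cauchy–Schwarz bound for the dipole expansion. -/
lemma lintegral_prod_mul_exp_gasEnergy_le {κ ρ Γ : X → X → ℝ} (hκm : Measurable fun z : X × X => κ z.1 z.2)
    (hΓm : Measurable fun z : X × X => Γ z.1 z.2) (hκ : ∀ a b, κ a b = κ b a)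
    (hρ : ∀ a b, ρ a b = ρ b a) (htri : ∀ a b c, ρ a c ≤ ρ a b + ρ b c) {C : ℝ} (hC : 0 ≤ C)
    (hdouble : ∀ a b c d, ρ c d ≤ 2 * ρ a b → κ a b ≤ κ c d + C) {K L : ℝ≥0∞}
    (hK : ∫⁻ z : X × X, ENNReal.ofReal (Real.exp (κ z.1 z.2)) ^ 2 ∂ν.prod ν ≤ K)
    (hL : ∫⁻ z : X × X, ENNReal.ofReal |Γ z.1 z.2| ^ 2 ∂ν.prod ν ≤ L) (m : ℕ) :
    ∫⁻ p : Fin m → X × X, (∏ j, ENNReal.ofReal |Γ (p j).1 (p j).2|) *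
      ENNReal.ofReal (Real.exp (gasEnergy κ (fun j => (p j).1) (fun j => (p j).2)))
        ∂(Measure.pi fun _ => ν.prod ν) ≤
      ENNReal.ofReal (Real.exp (m ^ 2 * C)) * m.factorial * ((L * K) ^ (1 / 2 : ℝ)) ^ m := by
  set M : Measure (Fin m → X × X) := Measure.pi fun _ => ν.prod ν
  set G : (Fin m → X × X) → ℝ≥0∞ := fun p => ∏ j, ENNReal.ofReal |Γ (p j).1 (p j).2|
  set f : X → X → ℝ≥0∞ := fun a c => ENNReal.ofReal (Real.exp (κ a c)) with hf
  have hfm : Measurable fun z : X × X => f z.1 z.2 :=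
    (Real.measurable_exp.comp hκm).ennreal_ofReal
  have hgm : Measurable fun z : X × X => ENNReal.ofReal |Γ z.1 z.2| :=
    (hΓm.abs).ennreal_ofReal
  have hGm : Measurable G := Finset.measurable_fun_prod _ fun j _ =>
    hgm.comp (measurable_pi_apply j)
  have hPm : ∀ σ : Equiv.Perm (Fin m), Measurable fun p : Fin m → X × X =>
      ∏ j, f (p j).1 (p (σ j)).2 := fun σ => Finset.measurable_fun_prod _ fun j _ =>
    hfm.comp (show Measurable fun p : Fin m → X × X => ((p j).1, (p (σ j)).2) by fun_prop)
  -- The good matching depends on the configuration. Summing over all permutations removes this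
  -- dependence at the cost of a factor m!.
  have hpt : ∀ p : Fin m → X × X,
      ENNReal.ofReal (Real.exp (gasEnergy κ (fun j => (p j).1) (fun j => (p j).2))) ≤
        ENNReal.ofReal (Real.exp (m ^ 2 * C)) *
          ∑ σ : Equiv.Perm (Fin m), ∏ j, f (p j).1 (p (σ j)).2 := by
    intro p
    obtain ⟨σ, hσ⟩ := exists_perm_gasEnergy_le hκ hρ htri hC hdouble (fun j => (p j).1)
      (fun j => (p j).2)
    calc _ ≤ ENNReal.ofReal (Real.exp (m ^ 2 * C) * ∏ j, Real.exp (κ (p j).1 (p (σ j)).2)) := by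
          rw [← Real.exp_sum, ← Real.exp_add]
          gcongr
          linarith
      _ = ENNReal.ofReal (Real.exp (m ^ 2 * C)) * ∏ j, f (p j).1 (p (σ j)).2 := by
          rw [ENNReal.ofReal_mul (Real.exp_pos _).le,
            ENNReal.ofReal_prod_of_nonneg fun _ _ => (Real.exp_pos _).le]
      _ ≤ _ := by
          gcongr
          exact Finset.single_le_sum (f := fun σ : Equiv.Perm (Fin m) =>
            ∏ j, f (p j).1 (p (σ j)).2) (fun _ _ => zero_le) (Finset.mem_univ σ)
  -- The covariance factors join x_j to y_j whereas the dipoles join x_j to y_{σ(j)}. Cauchy–Schwarz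
  -- separates the two pairings, and each square then factorizes over pairs.
  have hG2 : ∫⁻ p, G p ^ 2 ∂M ≤ L ^ m := by
    simp only [G, ← Finset.prod_pow]
    rw [lintegral_fin_prod_eq_prod
      (f := fun (_ : Fin m) (z : X × X) => ENNReal.ofReal |Γ z.1 z.2| ^ 2)
      fun _ => hgm.pow_const 2]
    simp only [Finset.prod_const, Finset.card_univ, Fintype.card_fin]
    gcongr
  -- All the points x_j and y_j are independent with law ν, so relabelling the y_j by σ restores a
  -- product over independent pairs.
  have hP2 : ∀ σ : Equiv.Perm (Fin m), ∫⁻ p, (∏ j, f (p j).1 (p (σ j)).2) ^ 2 ∂M ≤ K ^ m := by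
    intro σ
    have hmp := measurePreserving_arrowProdEquivProdArrow X X (Fin m) (fun _ => ν) (fun _ => ν)
    have hHm : Measurable fun r : (Fin m → X) × (Fin m → X) =>
        ∏ j, f (r.1 j) (r.2 (σ j)) ^ 2 := by
      refine Finset.measurable_fun_prod _ fun j _ => ?_
      have h1 : Measurable fun r : (Fin m → X) × (Fin m → X) => f (r.1 j) (r.2 (σ j)) :=
        hfm.comp (show Measurable fun r : (Fin m → X) × (Fin m → X) =>
          (r.1 j, r.2 (σ j)) by fun_prop)
      exact h1.pow_const 2
    calc _ = ∫⁻ r : (Fin m → X) × (Fin m → X), ∏ j, f (r.1 j) (r.2 (σ j)) ^ 2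
          ∂((Measure.pi fun _ => ν).prod (Measure.pi fun _ => ν)) := by
          rw [← hmp.lintegral_comp hHm]
          refine lintegral_congr fun p => ?_
          rw [← Finset.prod_pow]
          rfl
      _ = ∫⁻ x : Fin m → X, ∫⁻ y : Fin m → X, ∏ k, f (x (σ.symm k)) (y k) ^ 2
          ∂(Measure.pi fun _ => ν) ∂(Measure.pi fun _ => ν) := by
          rw [lintegral_prod _ hHm.aemeasurable]
          refine lintegral_congr fun x => lintegral_congr fun y => ?_
          rw [← Equiv.prod_comp σ fun k => f (x (σ.symm k)) (y k) ^ 2]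
          simp
      _ = ∫⁻ x : Fin m → X, ∏ j, ∫⁻ y, f (x j) y ^ 2 ∂ν ∂(Measure.pi fun _ => ν) := by
          refine lintegral_congr fun x => ?_
          rw [lintegral_fin_prod_eq_prod (f := fun k y => f (x (σ.symm k)) y ^ 2)
            fun k => (hfm.comp measurable_prodMk_left).pow_const 2,
            Equiv.prod_comp σ.symm fun j => ∫⁻ y, f (x j) y ^ 2 ∂ν]
      _ = ∏ _j : Fin m, ∫⁻ x, ∫⁻ y, f x y ^ 2 ∂ν ∂ν :=
          lintegral_fin_prod_eq_prod (f := fun (_ : Fin m) x => ∫⁻ y, f x y ^ 2 ∂ν)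
            fun _ => (hfm.pow_const 2).lintegral_prod_right'
      _ ≤ K ^ m := by
          simp only [Finset.prod_const, Finset.card_univ, Fintype.card_fin]
          gcongr
          rw [← lintegral_prod _ (hfm.pow_const 2).aemeasurable]
          exact hK
  calc _ ≤ ∫⁻ p, ENNReal.ofReal (Real.exp (m ^ 2 * C)) *
        ∑ σ : Equiv.Perm (Fin m), G p * ∏ j, f (p j).1 (p (σ j)).2 ∂M := by
        refine lintegral_mono fun p => ?_
        rw [← Finset.mul_sum, mul_left_comm]
        exact mul_le_mul_right (hpt p) _
    _ = ENNReal.ofReal (Real.exp (m ^ 2 * C)) *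
        ∑ σ : Equiv.Perm (Fin m), ∫⁻ p, G p * ∏ j, f (p j).1 (p (σ j)).2 ∂M := by
        have hGP : ∀ σ : Equiv.Perm (Fin m), Measurable fun p : Fin m → X × X =>
            G p * ∏ j, f (p j).1 (p (σ j)).2 := fun σ => hGm.mul (hPm σ)
        rw [lintegral_const_mul _ (Finset.measurable_fun_sum _ fun σ _ => hGP σ),
          lintegral_finsetSum _ fun σ _ => hGP σ]
    _ ≤ ENNReal.ofReal (Real.exp (m ^ 2 * C)) *
        ∑ σ : Equiv.Perm (Fin m), ((L * K) ^ (1 / 2 : ℝ)) ^ m := by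
        gcongr with σ
        refine (lintegral_mul_le_sqrt hGm.aemeasurable (hPm σ).aemeasurable).trans ?_
        calc _ ≤ (L ^ m) ^ (1 / 2 : ℝ) * (K ^ m) ^ (1 / 2 : ℝ) := by
              gcongr
              exact hP2 σ
          _ = _ := by
              rw [← ENNReal.mul_rpow_of_nonneg _ _ (by norm_num), ← mul_pow,
                ← ENNReal.rpow_natCast, ← ENNReal.rpow_natCast, ← ENNReal.rpow_mul,
                ← ENNReal.rpow_mul, mul_comm (m : ℝ)]
    _ = _ := by
        rw [Finset.sum_const, Finset.card_univ, Fintype.card_perm, Fintype.card_fin,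
          nsmul_eq_mul, mul_assoc]

/-- The constant in the moment bound for imaginary chaos. -/
def chaosMomentConst (β C : ℝ) (m : ℕ) : ℝ≥0∞ :=
  ENNReal.ofReal (Real.pi / 2) ^ (2 * m) * (2 ^ (2 * m) * (2 * gaussianMoment (2 * m))) *
    ENNReal.ofReal (β ^ 2) ^ m * (ENNReal.ofReal (Real.exp (m ^ 2 * C)) * m.factorial)

lemma chaosMomentConst_ne_top (β C : ℝ) (m : ℕ) : chaosMomentConst β C m ≠ ⊤ := by
  have := gaussianMoment_ne_top (2 * m)
  unfold chaosMomentConst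
  finiteness

/-- The moments of the high frequency fluctuations of the averages `∫ Θ_u dν` of an imaginary chaos,
in terms of the covariance of the high frequency part and of any covariance `κ / β²` dominating
that of the field. -/
theorem lintegral_enorm_integral_gchaos_sub_pow_le (β : ℝ) {u w : D → X → ℝ}
    (hu : ∀ d, Measurable (u d)) (hw : ∀ d, Measurable (w d)) {b : ℝ} (hbu : ∀ d x, |u d x| ≤ b)
    (hbw : ∀ d x, |w d x| ≤ b) {h : D → ℝ} (hh : ∀ d, h d = 0 ∨ h d = 1) {ρ : X → X → ℝ}
    (hρ : ∀ a b, ρ a b = ρ b a) (htri : ∀ a b c, ρ a c ≤ ρ a b + ρ b c) {C : ℝ} (hC : 0 ≤ C)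
    (hdouble : ∀ a b c d, ρ c d ≤ 2 * ρ a b →
      β ^ 2 * (gcov u a b + gcov w a b) ≤ β ^ 2 * (gcov u c d + gcov w c d) + C) {K L : ℝ≥0∞}
    (hK : ∫⁻ z : X × X, ENNReal.ofReal (Real.exp (β ^ 2 * (gcov u z.1 z.2 + gcov w z.1 z.2))) ^ 2
      ∂ν.prod ν ≤ K)
    (hL : ∫⁻ z : X × X, ENNReal.ofReal |gcov (gpart h u) z.1 z.2| ^ 2 ∂ν.prod ν ≤ L) {m : ℕ}
    (hm : 1 ≤ m) :
    ∫⁻ g, ‖∫ x, gchaos β u g x - gchaos β (gpart (fun d => 1 - h d) u) g x ∂ν‖ₑ ^ (2 * m)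
      ∂gaussPi D ≤ chaosMomentConst β C m * ((L * K) ^ (1 / 2 : ℝ)) ^ m := by
  have hv := measurable_gpart hu h
  have hbv := abs_gpart_le hbu hh
  have h2m : 1 ≤ 2 * m := by omega
  set Z : (D → ℝ) → (D → ℝ) → D → ℂ := fun g k d =>
    ∫ x, gpart h u d x * (gchaos β u g x * gchaos β w k x) ∂ν
  have hZ : ∀ d, Measurable fun q : (D → ℝ) × (D → ℝ) => Z q.1 q.2 d := by
    intro d
    have h1 : Measurable fun r : ((D → ℝ) × (D → ℝ)) × X =>
        (gpart h u d r.2 : ℂ) * (gchaos β u r.1.1 r.2 * gchaos β w r.1.2 r.2) :=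
      (Complex.measurable_ofReal.comp ((hv d).comp measurable_snd)).mul
        ((measurable_gchaos hu measurable_fst.fst measurable_snd).mul
          (measurable_gchaos hw measurable_fst.snd measurable_snd))
    exact h1.stronglyMeasurable.integral_prod_right'.measurable
  -- For fixed g and k the sum is a linear form in the Gaussian vector y, so its moments are
  -- controlled by the square function ∑‖Z_d‖².
  have hbound : ∀ g k, ∫⁻ y, ‖∑ d, (y d : ℂ) * (β * Z g k d)‖ₑ ^ (2 * m) ∂gaussPi D ≤
      2 ^ (2 * m) * (2 * gaussianMoment (2 * m)) * ENNReal.ofReal (β ^ 2) ^ m *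
        ENNReal.ofReal (∑ d, ‖Z g k d‖ ^ 2) ^ m := by
    intro g k
    refine (lintegral_enorm_linear_pow_le _ _).trans (le_of_eq ?_)
    rw [mul_assoc _ _ (ENNReal.ofReal (∑ d, ‖Z g k d‖ ^ 2) ^ m), ← mul_pow,
      ← ENNReal.ofReal_mul (sq_nonneg _), pow_mul (ENNReal.ofReal (Real.sqrt _)),
      ← ENNReal.ofReal_pow (Real.sqrt_nonneg _), Real.sq_sqrt (by positivity)]
    congr 3
    simp only [norm_mul, mul_pow, Finset.mul_sum]
    simp
  have hmeas3 : Measurable fun r : ((D → ℝ) × (D → ℝ)) × (D → ℝ) =>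
      ‖∑ d, (r.1.2 d : ℂ) * (β * Z r.1.1 r.2 d)‖ₑ ^ (2 * m) := by
    refine (Finset.measurable_fun_sum _ fun d _ => ?_).enorm.pow_const _
    refine (Complex.measurable_ofReal.comp ((measurable_pi_apply d).comp
      measurable_fst.snd)).mul (((hZ d).comp (measurable_fst.fst.prodMk measurable_snd)).const_mul _)
  calc _ ≤ ENNReal.ofReal (Real.pi / 2) ^ (2 * m) *
        ∫⁻ p, ‖gderiv β ν u (gpart h u) p.1 p.2‖ₑ ^ (2 * m) ∂(gaussPi D).prod (gaussPi D) :=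
        lintegral_enorm_integral_gchaos_sub_le β hu hbu hh h2m
    _ ≤ ENNReal.ofReal (Real.pi / 2) ^ (2 * m) *
        ∫⁻ p, (∫⁻ k, ‖∑ d, (p.2 d : ℂ) * (β * Z p.1 k d)‖ₑ ^ (2 * m) ∂gaussPi D)
          ∂(gaussPi D).prod (gaussPi D) := by
        gcongr with p
        exact enorm_gderiv_pow_le β hu hv hw hbu hbv hbw p.1 p.2 h2m
    _ = ENNReal.ofReal (Real.pi / 2) ^ (2 * m) *
        ∫⁻ g, (∫⁻ k, (∫⁻ y, ‖∑ d, (y d : ℂ) * (β * Z g k d)‖ₑ ^ (2 * m) ∂gaussPi D) ∂gaussPi D)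
          ∂gaussPi D := by
        rw [lintegral_prod _ hmeas3.lintegral_prod_right'.aemeasurable]
        congr 1
        refine lintegral_congr fun g => ?_
        refine lintegral_lintegral_swap (Measurable.aemeasurable ?_)
        exact hmeas3.comp ((measurable_const.prodMk measurable_fst).prodMk measurable_snd)
    _ ≤ ENNReal.ofReal (Real.pi / 2) ^ (2 * m) *
        ∫⁻ g, (∫⁻ k, 2 ^ (2 * m) * (2 * gaussianMoment (2 * m)) * ENNReal.ofReal (β ^ 2) ^ m *
          ENNReal.ofReal (∑ d, ‖Z g k d‖ ^ 2) ^ m ∂gaussPi D) ∂gaussPi D := by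
        gcongr with g k
        exact hbound g k
    _ = ENNReal.ofReal (Real.pi / 2) ^ (2 * m) *
        (2 ^ (2 * m) * (2 * gaussianMoment (2 * m)) * ENNReal.ofReal (β ^ 2) ^ m *
          ∫⁻ q : (D → ℝ) × (D → ℝ), ENNReal.ofReal (∑ d, ‖Z q.1 q.2 d‖ ^ 2) ^ m
            ∂(gaussPi D).prod (gaussPi D)) := by
        have hm2 : Measurable fun q : (D → ℝ) × (D → ℝ) =>
            ENNReal.ofReal (∑ d, ‖Z q.1 q.2 d‖ ^ 2) ^ m :=
          (Finset.measurable_fun_sum _ fun d _ =>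
            ((hZ d).norm.pow_const 2)).ennreal_ofReal.pow_const m
        rw [← lintegral_const_mul _ hm2, lintegral_prod _ (hm2.const_mul _).aemeasurable]
    _ ≤ ENNReal.ofReal (Real.pi / 2) ^ (2 * m) *
        (2 ^ (2 * m) * (2 * gaussianMoment (2 * m)) * ENNReal.ofReal (β ^ 2) ^ m *
          (ENNReal.ofReal (Real.exp (m ^ 2 * C)) * m.factorial *
            ((L * K) ^ (1 / 2 : ℝ)) ^ m)) := by
        gcongr
        refine (lintegral_sum_norm_sq_pow_le β hu hv hw hbu hbv hbw m).trans ?_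
        refine lintegral_prod_mul_exp_gasEnergy_le
          (κ := fun a c => β ^ 2 * (gcov u a c + gcov w a c)) (Γ := gcov (gpart h u)) (ρ := ρ)
          ?_ ?_ ?_ hρ htri hC hdouble hK hL m
        · exact ((measurable_gcov hu measurable_fst measurable_snd).add
            (measurable_gcov hw measurable_fst measurable_snd)).const_mul _
        · exact measurable_gcov hv measurable_fst measurable_snd
        · intro a c
          simp only [gcov, mul_comm]
    _ = _ := by
        unfold chaosMomentConst
        ring

end GaussianField

/-! ### Lattice sums -/

/-- The frequencies with `|n_i| ≤ M`. -/
def freqBox (M : ℕ) : Finset Freq := Fintype.piFinset fun _ => Finset.Icc (-(M : ℤ)) M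

lemma mem_freqBox {M : ℕ} {n : Freq} : n ∈ freqBox M ↔ ∀ i, |n i| ≤ M := by
  simp [freqBox, Fintype.mem_piFinset, abs_le]

lemma abs_le_bracket (n : Freq) (i : Fin 2) : |(n i : ℝ)| ≤ bracket n := by
  refine Real.abs_le_sqrt ?_
  have : (n i : ℝ) ^ 2 ≤ ∑ i, (n i : ℝ) ^ 2 :=
    Finset.single_le_sum (f := fun i => (n i : ℝ) ^ 2) (fun _ _ => sq_nonneg _) (Finset.mem_univ i)
  linarith

lemma mem_freqBox_of_bracket_le {n : Freq} {R : ℝ} {M : ℕ} (h : bracket n ≤ R) (hM : ⌊R⌋₊ ≤ M) :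
    n ∈ freqBox M := by
  rw [mem_freqBox]
  intro i
  have h1 : ((|n i| : ℤ) : ℝ) ≤ R := by
    push_cast
    exact (abs_le_bracket n i).trans h
  have h2 : |n i| ≤ ⌊R⌋ := Int.le_floor.2 h1
  have h3 : (⌊R⌋₊ : ℤ) = ⌊R⌋ := Int.natCast_floor_eq_floor ((bracket_pos n).le.trans h)
  omega

lemma sum_freqBox {E : Type*} [AddCommMonoid E] (M : ℕ) (f : ℤ → ℤ → E) :
    ∑ n ∈ freqBox M, f (n 0) (n 1) =
      ∑ k ∈ Finset.Icc (-(M : ℤ)) M, ∑ l ∈ Finset.Icc (-(M : ℤ)) M, f k l := by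
  rw [← Finset.sum_product']
  refine Finset.sum_nbij' (fun n => (n 0, n 1)) (fun p => ![p.1, p.2]) ?_ ?_ ?_ ?_ ?_
  · intro n hn
    simp only [freqBox, Fintype.mem_piFinset] at hn
    exact Finset.mem_product.2 ⟨hn 0, hn 1⟩
  · intro p hp
    rw [Finset.mem_product] at hp
    simp only [freqBox, Fintype.mem_piFinset]
    intro i
    fin_cases i
    · exact hp.1
    · exact hp.2
  · intro n _
    ext i
    fin_cases i <;> rfl
  · intro p _
    rfl
  · intro n _
    rfl

lemma sum_int_Icc {E : Type*} [AddCommGroup E] (M : ℕ) (f : ℤ → E) :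
    ∑ k ∈ Finset.Icc (-(M : ℤ)) M, f k =
      ∑ k ∈ Finset.range (M + 1), f k + ∑ k ∈ Finset.range (M + 1), f (-(k : ℤ)) - f 0 := by
  induction M with
  | zero => simp
  | succ M ih =>
    have h1 : Finset.Icc (-((M + 1 : ℕ) : ℤ)) ((M + 1 : ℕ) : ℤ) =
        insert (-((M + 1 : ℕ) : ℤ)) (insert ((M + 1 : ℕ) : ℤ) (Finset.Icc (-(M : ℤ)) M)) := by
      ext k
      simp only [Finset.mem_insert, Finset.mem_Icc]
      omega
    rw [h1, Finset.sum_insert, Finset.sum_insert, ih, Finset.sum_range_succ _ (M + 1),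
      Finset.sum_range_succ (fun k : ℕ => f (-(k : ℤ))) (M + 1)]
    · abel
    · simp
    · simp only [Finset.mem_insert, Finset.mem_Icc]
      omega

/-- x ↦ 1/(a² + x²) decreases, so its value at k + 1 is at most its integral over [k, k+1], a
difference of arctangents. -/
lemma inv_add_sq_le_arctan_sub {a : ℝ} (ha : 0 < a) (k : ℕ) :
    1 / (a ^ 2 + ((k + 1 : ℕ) : ℝ) ^ 2) ≤
      (Real.arctan ((k + 1 : ℕ) / a) - Real.arctan (k / a)) / a := by
  have hk : (k : ℝ) / a ≤ ((k + 1 : ℕ) : ℝ) / a := by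
    gcongr
    simp
  have h := (convex_Icc ((k : ℝ) / a) (((k + 1 : ℕ) : ℝ) / a)).mul_sub_le_image_sub_of_le_deriv
    (f := Real.arctan) (C := 1 / (1 + (((k + 1 : ℕ) : ℝ) / a) ^ 2))
    Real.continuous_arctan.continuousOn Real.differentiable_arctan.differentiableOn ?_
    ((k : ℝ) / a) ⟨le_rfl, hk⟩ (((k + 1 : ℕ) : ℝ) / a) ⟨hk, le_rfl⟩ hk
  · rw [le_div_iff₀ ha]
    refine le_trans (le_of_eq ?_) h
    push_cast
    field_simp
    ring
  · intro x hx
    rw [interior_Icc] at hx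
    have h0 : (0 : ℝ) ≤ k / a := by positivity
    have hx0 : 0 ≤ x := h0.trans hx.1.le
    rw [Real.deriv_arctan]
    exact one_div_le_one_div_of_le (by positivity)
      (add_le_add_right (pow_le_pow_left₀ hx0 hx.2.le 2) 1)

lemma sum_range_inv_add_sq_le {a : ℝ} (ha : 0 < a) (M : ℕ) :
    ∑ k ∈ Finset.range (M + 1), 1 / (a ^ 2 + (k : ℝ) ^ 2) ≤ 1 / a ^ 2 + Real.pi / 2 / a := by
  rw [Finset.sum_range_succ']
  have h1 : ∑ k ∈ Finset.range M, 1 / (a ^ 2 + ((k + 1 : ℕ) : ℝ) ^ 2) ≤ Real.pi / 2 / a := by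
    calc _ ≤ ∑ k ∈ Finset.range M,
          (Real.arctan ((k + 1 : ℕ) / a) - Real.arctan (k / a)) / a :=
          Finset.sum_le_sum fun k _ => inv_add_sq_le_arctan_sub ha k
      _ = Real.arctan (M / a) / a := by
          rw [← Finset.sum_div, Finset.sum_range_sub (fun k : ℕ => Real.arctan (k / a))]
          simp
      _ ≤ _ := by
          gcongr
          exact (Real.arctan_lt_pi_div_two _).le
  simp only [Nat.cast_zero, ne_eq, OfNat.ofNat_ne_zero, not_false_eq_true, zero_pow, add_zero]
  linarith

lemma sum_Icc_inv_add_sq_le {a : ℝ} (ha : 0 < a) (M : ℕ) :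
    ∑ k ∈ Finset.Icc (-(M : ℤ)) M, 1 / (a ^ 2 + (k : ℝ) ^ 2) ≤ 1 / a ^ 2 + Real.pi / a := by
  rw [sum_int_Icc M fun k : ℤ => 1 / (a ^ 2 + (k : ℝ) ^ 2)]
  have h := sum_range_inv_add_sq_le ha M
  have e : Real.pi / a = Real.pi / 2 / a + Real.pi / 2 / a := by ring
  simp only [Int.cast_natCast, Int.cast_neg, neg_sq, Int.cast_zero, ne_eq, OfNat.ofNat_ne_zero,
    not_false_eq_true, zero_pow, add_zero]
  linarith

lemma bracket_sq' (n : Freq) : bracket n ^ 2 = 1 + (n 0 : ℝ) ^ 2 + (n 1 : ℝ) ^ 2 := by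
  rw [bracket_sq, Fin.sum_univ_two]; ring

lemma card_freqBox (M : ℕ) : (freqBox M).card = (2 * M + 1) ^ 2 := by
  simp only [freqBox, Fintype.card_piFinset, Int.card_Icc, Finset.prod_const, Finset.card_univ,
    Fintype.card_fin]
  congr 1
  omega

lemma card_bracket_le {S : Finset Freq} {R : ℝ} (hS : ∀ n ∈ S, bracket n ≤ R) :
    (S.card : ℝ) ≤ 9 * R ^ 2 := by
  rcases S.eq_empty_or_nonempty with rfl | ⟨n, hn⟩
  · simp; positivity
  have hR : 1 ≤ R := (one_le_bracket n).trans (hS n hn)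
  have h1 : S ⊆ freqBox ⌊R⌋₊ := fun k hk => mem_freqBox_of_bracket_le (hS k hk) le_rfl
  have h2 : (⌊R⌋₊ : ℝ) ≤ R := Nat.floor_le (by linarith)
  calc (S.card : ℝ) ≤ (freqBox ⌊R⌋₊).card := by exact_mod_cast Finset.card_le_card h1
    _ = (2 * ⌊R⌋₊ + 1) ^ 2 := by rw [card_freqBox]; push_cast; ring
    _ ≤ (3 * R) ^ 2 := by gcongr; linarith
    _ = _ := by ring

/-- The leading constant 2π is sharp and has to be: it fixes the exponent β²/(4π). The inner sum is
bounded through the arctangent by about π/√(1+k²), and the outer one is a two-sided harmonic sum,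
whence 2 log R. -/
lemma sum_inv_bracket_sq_le {S : Finset Freq} {R : ℝ} (hR : 1 ≤ R)
    (hS : ∀ n ∈ S, bracket n ≤ R) :
    ∑ n ∈ S, 1 / bracket n ^ 2 ≤ 2 * Real.pi * Real.log R + (1 + 4 * Real.pi) := by
  set M := ⌊R⌋₊
  have hM1 : 1 ≤ M := Nat.one_le_floor_iff _ |>.2 hR
  have hMR : (M : ℝ) ≤ R := Nat.floor_le (by linarith)
  have h1 : S ⊆ freqBox M := fun k hk => mem_freqBox_of_bracket_le (hS k hk) le_rfl
  have hpi := Real.pi_pos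
  have hlog : ∑ k ∈ Finset.range (M + 1), 1 / Real.sqrt (1 + (k : ℝ) ^ 2) ≤ 2 + Real.log R := by
    rw [Finset.sum_range_succ']
    have e1 : ∑ k ∈ Finset.range M, 1 / Real.sqrt (1 + ((k + 1 : ℕ) : ℝ) ^ 2) ≤
        (harmonic M : ℝ) := by
      rw [harmonic]
      push_cast
      refine Finset.sum_le_sum fun k _ => ?_
      rw [← one_div]
      gcongr
      exact Real.le_sqrt_of_sq_le (by push_cast; linarith)
    have e2 := harmonic_le_one_add_log M
    have e3 : Real.log M ≤ Real.log R := Real.log_le_log (by positivity) hMR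
    simp only [Nat.cast_zero, ne_eq, OfNat.ofNat_ne_zero, not_false_eq_true, zero_pow, add_zero,
      Real.sqrt_one, div_one]
    linarith
  calc ∑ n ∈ S, 1 / bracket n ^ 2 ≤ ∑ n ∈ freqBox M, 1 / bracket n ^ 2 :=
        Finset.sum_le_sum_of_subset_of_nonneg h1 fun _ _ _ => by positivity
    _ = ∑ k ∈ Finset.Icc (-(M : ℤ)) M, ∑ l ∈ Finset.Icc (-(M : ℤ)) M,
        1 / (Real.sqrt (1 + (k : ℝ) ^ 2) ^ 2 + (l : ℝ) ^ 2) := by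
        rw [← sum_freqBox M fun k l => 1 / (Real.sqrt (1 + (k : ℝ) ^ 2) ^ 2 + (l : ℝ) ^ 2)]
        refine Finset.sum_congr rfl fun n _ => ?_
        rw [bracket_sq', Real.sq_sqrt (by positivity)]
    _ ≤ ∑ k ∈ Finset.Icc (-(M : ℤ)) M,
        (1 / (1 ^ 2 + (k : ℝ) ^ 2) + Real.pi * (1 / Real.sqrt (1 + (k : ℝ) ^ 2))) := by
        refine Finset.sum_le_sum fun k _ => ?_
        refine (sum_Icc_inv_add_sq_le (Real.sqrt_pos.2 (by positivity)) M).trans ?_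
        rw [Real.sq_sqrt (by positivity), one_pow, mul_one_div]
    _ ≤ (1 + Real.pi) + Real.pi * (2 * (2 + Real.log R) - 1) := by
        rw [Finset.sum_add_distrib, ← Finset.mul_sum]
        have e1 := sum_Icc_inv_add_sq_le one_pos M
        gcongr
        · simpa using e1
        · rw [sum_int_Icc M fun k : ℤ => 1 / Real.sqrt (1 + (k : ℝ) ^ 2)]
          simp only [Int.cast_natCast, Int.cast_neg, neg_sq, Int.cast_zero, ne_eq,
            OfNat.ofNat_ne_zero, not_false_eq_true, zero_pow, add_zero, Real.sqrt_one, div_one]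
          linarith
    _ = _ := by ring

/-! ### Summation by parts -/

lemma norm_sum_antitone_mul_pow_le {b : ℕ → ℝ} (hb : Antitone b) (hb0 : ∀ j, 0 ≤ b j) {w : ℂ}
    (hw : ‖w‖ = 1) (n : ℕ) :
    ‖∑ j ∈ Finset.range n, (b j : ℂ) * w ^ j‖ * ‖w - 1‖ ≤ 2 * b 0 := by
  -- Multiplication by w - 1 makes the sum telescope up to the decrements of b. Keeping the boundary
  -- term b_n wⁿ apart, and -b_n on the right, closes the induction.
  have key : ‖(∑ j ∈ Finset.range n, (b j : ℂ) * w ^ j) * (w - 1) - b n * w ^ n‖ ≤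
      2 * b 0 - b n := by
    induction n with
    | zero =>
      simp [abs_of_nonneg (hb0 0)]
      linarith
    | succ n ih =>
      have e : (∑ j ∈ Finset.range (n + 1), (b j : ℂ) * w ^ j) * (w - 1) - b (n + 1) * w ^ (n + 1) =
          ((∑ j ∈ Finset.range n, (b j : ℂ) * w ^ j) * (w - 1) - b n * w ^ n) +
            ((b n - b (n + 1) : ℝ) : ℂ) * w ^ (n + 1) := by
        rw [Finset.sum_range_succ]
        push_cast
        ring
      rw [e]
      refine (norm_add_le _ _).trans ?_
      rw [norm_mul, norm_pow, hw, one_pow, mul_one, Complex.norm_real,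
        Real.norm_of_nonneg (sub_nonneg.2 (hb (Nat.le_succ n)))]
      linarith
  rw [← norm_mul]
  calc _ ≤ ‖(∑ j ∈ Finset.range n, (b j : ℂ) * w ^ j) * (w - 1) - b n * w ^ n‖ +
        ‖(b n : ℂ) * w ^ n‖ := by
        refine le_trans (le_of_eq ?_) (norm_add_le _ _)
        congr 1
        ring
    _ ≤ (2 * b 0 - b n) + b n := by
        gcongr
        rw [norm_mul, norm_pow, hw, one_pow, mul_one, Complex.norm_real, Real.norm_of_nonneg (hb0 n)]
    _ = _ := by ring

lemma norm_sum_Icc_mul_zpow_le {b : ℕ → ℝ} (hb : Antitone b) (hb0 : ∀ j, 0 ≤ b j) {w : ℂ}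
    (hw : ‖w‖ = 1) (M : ℕ) :
    ‖∑ k ∈ Finset.Icc (-(M : ℤ)) M, (b k.natAbs : ℂ) * w ^ k‖ * ‖w - 1‖ ≤ 6 * b 0 := by
  have h1 := norm_sum_antitone_mul_pow_le hb hb0 hw (M + 1)
  have hw' : ‖w⁻¹‖ = 1 := by rw [norm_inv, hw, inv_one]
  have h2 := norm_sum_antitone_mul_pow_le hb hb0 hw' (M + 1)
  have hw0 : w ≠ 0 := by
    rintro rfl
    simp at hw
  have e : ‖w⁻¹ - 1‖ = ‖w - 1‖ := by
    have : w⁻¹ - 1 = -(w⁻¹ * (w - 1)) := by field_simp; ring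
    rw [this, norm_neg, norm_mul, hw', one_mul]
  rw [e] at h2
  have h3 : ‖(b 0 : ℂ)‖ * ‖w - 1‖ ≤ 2 * b 0 := by
    rw [Complex.norm_real, Real.norm_of_nonneg (hb0 0), mul_comm]
    have : ‖w - 1‖ ≤ 2 := (norm_sub_le _ _).trans (by rw [hw, norm_one]; norm_num)
    exact mul_le_mul_of_nonneg_right this (hb0 0)
  rw [sum_int_Icc M fun k : ℤ => (b k.natAbs : ℂ) * w ^ k]
  simp only [Int.natAbs_natCast, zpow_natCast, Int.natAbs_neg, zpow_neg, Int.natAbs_zero,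
    zpow_zero, mul_one, ← inv_pow]
  calc _ ≤ (‖∑ j ∈ Finset.range (M + 1), (b j : ℂ) * w ^ j‖ +
        ‖∑ j ∈ Finset.range (M + 1), (b j : ℂ) * w⁻¹ ^ j‖ + ‖(b 0 : ℂ)‖) * ‖w - 1‖ := by
        gcongr
        exact (norm_sub_le _ _).trans (by gcongr; exact norm_add_le _ _)
    _ ≤ _ := by linarith

/-- Summation by parts for trigonometric sums in two dimensions with radially decreasing
coefficients. -/
lemma norm_sum_freqBox_le {q : ℝ → ℝ} (hq : AntitoneOn q (Set.Ici 1)) (hq0 : ∀ r, 0 ≤ q r)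
    {w : Fin 2 → ℂ} (hw : ∀ i, ‖w i‖ = 1) {r : ℝ} (hr : 0 < r)
    (hwr : ∃ i, ‖w i - 1‖ = r) {B : ℝ} (hqB : ∀ s, 1 ≤ s → q s ≤ B * r ^ 2)
    (hqB' : ∀ s, 1 ≤ s → q s ≤ B / s ^ 2) (M : ℕ) :
    ‖∑ n ∈ freqBox M, (q (bracket n) : ℂ) * (w 0 ^ n 0 * w 1 ^ n 1)‖ ≤ 64 * B := by
  have hB : 0 ≤ B := by
    have h := (hq0 1).trans (hqB' 1 le_rfl)
    simpa using h
  obtain ⟨i, hi⟩ := hwr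
  have hr2 : r ≤ 2 := by
    rw [← hi]
    exact (norm_sub_le _ _).trans (by rw [hw, norm_one]; norm_num)
  have hanti : ∀ l : ℤ, Antitone fun k : ℕ => q (Real.sqrt (1 + (l : ℝ) ^ 2 + (k : ℝ) ^ 2)) := by
    intro l k k' hkk
    refine hq ?_ ?_ ?_
    · exact Set.mem_Ici.2 (Real.le_sqrt_of_sq_le (by nlinarith))
    · exact Set.mem_Ici.2 (Real.le_sqrt_of_sq_le (by nlinarith))
    · gcongr
  -- One-dimensional summation by parts in the direction where w is farthest from 1. The two bounds
  -- on q combine into q · (r⁻² + 1 + l²) ≤ 2B, so that 6q ≤ 12B/(r⁻² + l²).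
  have hinner : ∀ v : ℂ, ‖v‖ = 1 → ‖v - 1‖ = r → ∀ l : ℤ,
      ‖∑ k ∈ Finset.Icc (-(M : ℤ)) M, (q (Real.sqrt (1 + (l : ℝ) ^ 2 + (k : ℝ) ^ 2)) : ℂ) * v ^ k‖ * r
        ≤ 12 * B * (1 / ((1 / r) ^ 2 + (l : ℝ) ^ 2)) := by
    intro v hv hvr l
    have h := norm_sum_Icc_mul_zpow_le (hanti l) (fun _ => hq0 _) hv M
    rw [hvr] at h
    have e : ∀ k : ℤ, ((k.natAbs : ℕ) : ℝ) ^ 2 = (k : ℝ) ^ 2 := by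
      intro k
      rw [Nat.cast_natAbs, Int.cast_abs, sq_abs]
    simp only [e] at h
    refine h.trans ?_
    have hs : 1 ≤ Real.sqrt (1 + (l : ℝ) ^ 2) := Real.le_sqrt_of_sq_le (by nlinarith)
    simp only [Nat.cast_zero, ne_eq, OfNat.ofNat_ne_zero, not_false_eq_true, zero_pow, add_zero]
    have h1 := hqB _ hs
    have h2 := hqB' _ hs
    rw [Real.sq_sqrt (by positivity)] at h2
    set t := q (Real.sqrt (1 + (l : ℝ) ^ 2))
    have h3 : t * (1 / r) ^ 2 ≤ B := by
      rw [one_div, inv_pow, ← div_eq_mul_inv, div_le_iff₀ (by positivity)]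
      exact h1
    have h4 : t * (1 + (l : ℝ) ^ 2) ≤ B := by
      rw [le_div_iff₀ (by positivity)] at h2
      exact h2
    have h5 := hq0 (Real.sqrt (1 + (l : ℝ) ^ 2))
    rw [mul_one_div, le_div_iff₀ (by positivity)]
    change 0 ≤ t at h5
    nlinarith
  -- The remaining sum over l is at most r² + πr ≤ (16/3)r because r ≤ 2, and 12 · 16/3 = 64.
  have houter : ∀ S : ℂ, ‖S‖ * r ≤ ∑ l ∈ Finset.Icc (-(M : ℤ)) M,
      12 * B * (1 / ((1 / r) ^ 2 + (l : ℝ) ^ 2)) → ‖S‖ ≤ 64 * B := by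
    intro S hS
    rw [← Finset.mul_sum] at hS
    have h := sum_Icc_inv_add_sq_le (one_div_pos.2 hr) M
    have h2 : 1 / (1 / r) ^ 2 + Real.pi / (1 / r) ≤ (16 / 3) * r := by
      have := Real.pi_lt_d2
      have e : 1 / (1 / r) ^ 2 + Real.pi / (1 / r) = r ^ 2 + Real.pi * r := by field_simp
      rw [e]
      nlinarith
    have h3 : ‖S‖ * r ≤ 64 * B * r := by
      calc _ ≤ 12 * B * ((16 / 3) * r) := hS.trans (by gcongr; exact h.trans h2)
        _ = _ := by ring
    exact le_of_mul_le_mul_right h3 hr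
  have hbr : ∀ n : Freq, bracket n = Real.sqrt (1 + (n 0 : ℝ) ^ 2 + (n 1 : ℝ) ^ 2) := by
    intro n
    rw [bracket, Fin.sum_univ_two, add_assoc]
  simp_rw [hbr]
  rw [sum_freqBox M fun k l => (q (Real.sqrt (1 + (k : ℝ) ^ 2 + (l : ℝ) ^ 2)) : ℂ) *
    (w 0 ^ k * w 1 ^ l)]
  refine houter _ ?_
  fin_cases i
  · rw [Finset.sum_comm]
    refine (mul_le_mul_of_nonneg_right (norm_sum_le _ _) hr.le).trans ?_
    rw [Finset.sum_mul]
    refine Finset.sum_le_sum fun l _ => ?_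
    refine le_trans (le_of_eq ?_) (hinner (w 0) (hw 0) hi l)
    have e : ∀ k : ℤ, (q (Real.sqrt (1 + (k : ℝ) ^ 2 + (l : ℝ) ^ 2)) : ℂ) * (w 0 ^ k * w 1 ^ l) =
        w 1 ^ l * ((q (Real.sqrt (1 + (l : ℝ) ^ 2 + (k : ℝ) ^ 2)) : ℂ) * w 0 ^ k) := by
      intro k
      rw [add_right_comm]
      ring
    simp_rw [e]
    rw [← Finset.mul_sum, norm_mul, norm_zpow, hw, one_zpow, one_mul]
  · refine (mul_le_mul_of_nonneg_right (norm_sum_le _ _) hr.le).trans ?_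
    rw [Finset.sum_mul]
    refine Finset.sum_le_sum fun k _ => ?_
    refine le_trans (le_of_eq ?_) (hinner (w 1) (hw 1) hi k)
    have e : ∀ l : ℤ, (q (Real.sqrt (1 + (k : ℝ) ^ 2 + (l : ℝ) ^ 2)) : ℂ) * (w 0 ^ k * w 1 ^ l) =
        w 0 ^ k * ((q (Real.sqrt (1 + (k : ℝ) ^ 2 + (l : ℝ) ^ 2)) : ℂ) * w 1 ^ l) := by
      intro k
      ring
    simp_rw [e]
    rw [← Finset.mul_sum, norm_mul, norm_zpow, hw, one_zpow, one_mul]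

/-! ### The reference kernel -/

/-- The coefficients of the reference covariance: they dominate `1 / (2⟨n⟩²)` on `⟨n⟩ ≤ L` and
decrease radially. -/
def refCoeff (A L : ℝ) (n : Freq) : ℝ :=
  if bracket n ≤ L then 1 / (2 * bracket n ^ 2) + A / L ^ 2 else 0

lemma refCoeff_nonneg {A L : ℝ} (hA : 0 ≤ A) (n : Freq) : 0 ≤ refCoeff A L n := by
  unfold refCoeff
  split_ifs <;> positivity

lemma refCoeff_le {A L : ℝ} (hA : 0 ≤ A) (n : Freq) :
    refCoeff A L n ≤ (1 / 2 + A) / bracket n ^ 2 := by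
  have hb := bracket_pos n
  unfold refCoeff
  split_ifs with h
  · have h1 : A / L ^ 2 ≤ A / bracket n ^ 2 := by gcongr
    calc _ ≤ 1 / (2 * bracket n ^ 2) + A / bracket n ^ 2 := by gcongr
      _ = _ := by field_simp
  · positivity

lemma refCoeff_neg (A L : ℝ) (n : Freq) : refCoeff A L (-n) = refCoeff A L n := by
  simp [refCoeff, bracket_neg]

/-- The low frequency part, at the origin, of the reference kernel. -/
def refLow (A L : ℝ) (M : ℕ) (r : ℝ) : ℝ :=
  ∑ n ∈ (freqBox M).filter (fun n => bracket n * r ≤ 1), refCoeff A L n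

lemma norm_zpow_sub_one_le {w : ℂ} (hw : ‖w‖ = 1) (k : ℤ) : ‖w ^ k - 1‖ ≤ |(k : ℝ)| * ‖w - 1‖ := by
  have hnat : ∀ (v : ℂ), ‖v‖ = 1 → ∀ k : ℕ, ‖v ^ k - 1‖ ≤ k * ‖v - 1‖ := by
    intro v hv k
    induction k with
    | zero => simp
    | succ k ih =>
      have e : v ^ (k + 1) - 1 = v ^ k * (v - 1) + (v ^ k - 1) := by ring
      rw [e]
      refine (norm_add_le _ _).trans ?_
      rw [norm_mul, norm_pow, hv, one_pow, one_mul]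
      push_cast
      linarith
  have hw0 : w ≠ 0 := by
    rintro rfl
    simp at hw
  obtain ⟨n, rfl | rfl⟩ := k.eq_nat_or_neg
  · simpa using hnat w hw n
  · have hw' : ‖w⁻¹‖ = 1 := by rw [norm_inv, hw, inv_one]
    have e : ‖w⁻¹ - 1‖ = ‖w - 1‖ := by
      have : w⁻¹ - 1 = -(w⁻¹ * (w - 1)) := by field_simp; ring
      rw [this, norm_neg, norm_mul, hw', one_mul]
    have h := hnat w⁻¹ hw' n
    rw [e] at h
    simpa using h

lemma one_sub_re_eq {E : ℂ} (hE : ‖E‖ = 1) : 1 - E.re = ‖E - 1‖ ^ 2 / 2 := by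
  have h1 : ‖E‖ ^ 2 = E.re ^ 2 + E.im ^ 2 := by rw [← Complex.normSq_eq_norm_sq, Complex.normSq_apply]; ring
  have h2 : ‖E - 1‖ ^ 2 = (E.re - 1) ^ 2 + E.im ^ 2 := by
    rw [← Complex.normSq_eq_norm_sq, Complex.normSq_apply]; simp; ring
  rw [hE] at h1
  rw [h2]
  linarith

lemma one_sub_re_monomial_le {w : Fin 2 → ℂ} (hw : ∀ i, ‖w i‖ = 1) {r : ℝ}
    (hwr : ∀ i, ‖w i - 1‖ ≤ r) (n : Freq) :
    1 - (w 0 ^ n 0 * w 1 ^ n 1).re ≤ bracket n ^ 2 * r ^ 2 := by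
  have hE : ‖w 0 ^ n 0 * w 1 ^ n 1‖ = 1 := by simp [norm_zpow, hw]
  have hr : 0 ≤ r := (norm_nonneg _).trans (hwr 0)
  rw [one_sub_re_eq hE, bracket_sq']
  have h1 : ‖w 0 ^ n 0 * w 1 ^ n 1 - 1‖ ≤ (|(n 0 : ℝ)| + |(n 1 : ℝ)|) * r := by
    have e : w 0 ^ n 0 * w 1 ^ n 1 - 1 = w 0 ^ n 0 * (w 1 ^ n 1 - 1) + (w 0 ^ n 0 - 1) := by ring
    rw [e]
    refine (norm_add_le _ _).trans ?_
    rw [norm_mul, norm_zpow, hw, one_zpow, one_mul]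
    have a0 := (norm_zpow_sub_one_le (hw 0) (n 0)).trans
      (mul_le_mul_of_nonneg_left (hwr 0) (abs_nonneg _))
    have a1 := (norm_zpow_sub_one_le (hw 1) (n 1)).trans
      (mul_le_mul_of_nonneg_left (hwr 1) (abs_nonneg _))
    linarith
  have h2 : ‖w 0 ^ n 0 * w 1 ^ n 1 - 1‖ ^ 2 ≤ ((|(n 0 : ℝ)| + |(n 1 : ℝ)|) * r) ^ 2 := by gcongr
  have h3 : (|(n 0 : ℝ)| + |(n 1 : ℝ)|) ^ 2 ≤ 2 * ((n 0 : ℝ) ^ 2 + (n 1 : ℝ) ^ 2) := by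
    have := sq_nonneg (|(n 0 : ℝ)| - |(n 1 : ℝ)|)
    nlinarith [sq_abs (n 0 : ℝ), sq_abs (n 1 : ℝ)]
  rw [mul_pow] at h2
  nlinarith [sq_nonneg r]

/-- The reference kernel, as a function of the displacement `w` on the unit circles. -/
def refKernel (A L : ℝ) (M : ℕ) (w : Fin 2 → ℂ) : ℝ :=
  ∑ n ∈ freqBox M, refCoeff A L n * (w 0 ^ n 0 * w 1 ^ n 1).re

lemma card_filter_mul_sq_le (M : ℕ) {r : ℝ} (hr : 0 ≤ r) :
    (((freqBox M).filter (fun n => bracket n * r ≤ 1)).card : ℝ) * r ^ 2 ≤ 9 := by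
  rcases hr.eq_or_lt with rfl | hr
  · simp
  have h := card_bracket_le (S := (freqBox M).filter (fun n => bracket n * r ≤ 1)) (R := 1 / r)
    (fun n hn => by rw [le_div_iff₀ hr]; exact (Finset.mem_filter.1 hn).2)
  calc _ ≤ 9 * (1 / r) ^ 2 * r ^ 2 := by gcongr
    _ = 9 := by field_simp

lemma refProfile_bound {A L R : ℝ} (hA : 0 ≤ A) (hR : 0 < R) (hRL : R ≤ L) :
    1 / (2 * R ^ 2) + A / L ^ 2 ≤ (1 / 2 + A) / R ^ 2 := by
  have h1 : A / L ^ 2 ≤ A / R ^ 2 := by gcongr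
  calc _ ≤ 1 / (2 * R ^ 2) + A / R ^ 2 := by gcongr
    _ = _ := by field_simp

/-- Coefficients restricted to ⟨n⟩ > 1/r are not monotone, since they vanish up to 1/r and then
jump. They are the difference of two decreasing profiles: the full one capped at its value at 1/r,
and that constant value on ⟨n⟩ ≤ 1/r. Both are at most (1/2 + A)r², as summation by parts requires.
-/
lemma abs_sum_high_le {A L : ℝ} (hA : 0 ≤ A) (M : ℕ) {w : Fin 2 → ℂ}
    (hw : ∀ i, ‖w i‖ = 1) {r : ℝ} (hwr : ∃ i, ‖w i - 1‖ = r) (hr : 0 < r) :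
    ‖∑ n ∈ (freqBox M).filter (fun n => ¬ bracket n * r ≤ 1),
      (refCoeff A L n : ℂ) * (w 0 ^ n 0 * w 1 ^ n 1)‖ ≤ 128 * (1 / 2 + A) := by
  set p : ℝ → ℝ := fun s => 1 / (2 * s ^ 2) + A / L ^ 2 with hp
  have hp0 : ∀ s, 0 ≤ p s := fun s => by positivity
  have hpanti : ∀ s t, 0 < s → s ≤ t → p t ≤ p s := by
    intro s t hs hst
    simp only [hp]
    gcongr
  rcases lt_or_ge L (1 / r) with hL | hL
  · rw [Finset.sum_eq_zero]
    · rw [norm_zero]; positivity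
    · intro n hn
      have h1 := (Finset.mem_filter.1 hn).2
      rw [not_le, ← div_lt_iff₀ hr] at h1
      rw [refCoeff, if_neg (by linarith)]
      simp
  have hR : 0 < 1 / r := by positivity
  set R := 1 / r with hRdef
  have hpR : p R ≤ (1 / 2 + A) * r ^ 2 := by
    refine (refProfile_bound hA hR hL).trans (le_of_eq ?_)
    rw [hRdef]; field_simp
  set q1 : ℝ → ℝ := fun s => if s ≤ L then min (p s) (p R) else 0 with hq1
  set q2 : ℝ → ℝ := fun s => if s ≤ R then p R else 0 with hq2
  have hdiff : ∀ n : Freq, (if ¬ bracket n * r ≤ 1 then (refCoeff A L n : ℂ) else 0) =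
      (q1 (bracket n) : ℂ) - q2 (bracket n) := by
    intro n
    have hb := bracket_pos n
    have hiff : bracket n * r ≤ 1 ↔ bracket n ≤ R := (le_div_iff₀ hr).symm
    simp only [hiff, hq1, hq2, refCoeff]
    by_cases h1 : bracket n ≤ R
    · rw [if_neg (not_not.2 h1), if_pos (h1.trans hL), if_pos h1, min_eq_right (hpanti _ _ hb h1),
        sub_self]
    · rw [if_pos h1, if_neg h1, Complex.ofReal_zero, sub_zero]
      by_cases h2 : bracket n ≤ L
      · rw [if_pos h2, if_pos h2, min_eq_left (hpanti _ _ hR (not_le.1 h1).le)]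
      · rw [if_neg h2, if_neg h2]
  have b1 := norm_sum_freqBox_le (q := q1) (B := 1 / 2 + A) ?_ ?_ hw hr hwr ?_ ?_ M
  · have b2 := norm_sum_freqBox_le (q := q2) (B := 1 / 2 + A) ?_ ?_ hw hr hwr ?_ ?_ M
    · rw [Finset.sum_filter]
      have e : ∀ n : Freq, (if ¬ bracket n * r ≤ 1 then
          (refCoeff A L n : ℂ) * (w 0 ^ n 0 * w 1 ^ n 1) else 0) =
          (q1 (bracket n) : ℂ) * (w 0 ^ n 0 * w 1 ^ n 1) -
            (q2 (bracket n) : ℂ) * (w 0 ^ n 0 * w 1 ^ n 1) := by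
        intro n
        rw [← sub_mul, ← hdiff n, ite_mul, zero_mul]
      simp_rw [e]
      rw [Finset.sum_sub_distrib]
      refine (norm_sub_le _ _).trans ?_
      linarith
    · intro s _ t _ hst
      simp only [hq2]
      split_ifs with h1 h2 h2
      · exact le_rfl
      · exact absurd (hst.trans h1) h2
      · exact hp0 _
      · exact le_rfl
    · intro s
      simp only [hq2]
      split_ifs
      · exact hp0 _
      · exact le_rfl
    · intro s _
      simp only [hq2]
      split_ifs
      · exact hpR
      · positivity
    · intro s hs
      simp only [hq2]
      split_ifs with h1
      · exact (hpanti _ _ (by linarith) h1).trans (refProfile_bound hA (by linarith) (h1.trans hL))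
      · positivity
  · intro s hs t _ hst
    have hs1 : (1 : ℝ) ≤ s := hs
    simp only [hq1]
    split_ifs with h1 h2 h2
    · exact min_le_min_right _ (hpanti _ _ (by linarith) hst)
    · exact absurd (hst.trans h1) h2
    · exact le_min (hp0 _) (hp0 _)
    · exact le_rfl
  · intro s
    simp only [hq1]
    split_ifs
    · exact le_min (hp0 _) (hp0 _)
    · exact le_rfl
  · intro s _
    simp only [hq1]
    split_ifs
    · exact (min_le_right _ _).trans hpR
    · positivity
  · intro s hs
    simp only [hq1]
    split_ifs with h1
    · exact (min_le_left _ _).trans (refProfile_bound hA (by linarith) h1)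
    · positivity

/-- For ⟨n⟩ ≤ 1/r the cosine is 1 up to ⟨n⟩²r², so each term costs (1/2 + A)r² and there are at most
9/r² of them. Above 1/r the oscillation is summed by parts. When r = 0 the second range is empty. -/
lemma abs_refKernel_sub_refLow_le {A L : ℝ} (hA : 0 ≤ A) (M : ℕ) {w : Fin 2 → ℂ}
    (hw : ∀ i, ‖w i‖ = 1) {r : ℝ} (hwr : ∃ i, ‖w i - 1‖ = r) (hwr' : ∀ i, ‖w i - 1‖ ≤ r) :
    |refKernel A L M w - refLow A L M r| ≤ 137 * (1 / 2 + A) := by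
  have hr : 0 ≤ r := (norm_nonneg _).trans (hwr' 0)
  have hlow : |∑ n ∈ (freqBox M).filter (fun n => bracket n * r ≤ 1),
      refCoeff A L n * ((w 0 ^ n 0 * w 1 ^ n 1).re - 1)| ≤ 9 * (1 / 2 + A) := by
    refine (Finset.abs_sum_le_sum_abs _ _).trans ?_
    have hterm : ∀ n ∈ (freqBox M).filter (fun n => bracket n * r ≤ 1),
        |refCoeff A L n * ((w 0 ^ n 0 * w 1 ^ n 1).re - 1)| ≤ (1 / 2 + A) * r ^ 2 := by
      intro n _
      have hE : ‖w 0 ^ n 0 * w 1 ^ n 1‖ = 1 := by simp [norm_zpow, hw]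
      have h0 : 0 ≤ 1 - (w 0 ^ n 0 * w 1 ^ n 1).re := by
        have := (Complex.re_le_norm (w 0 ^ n 0 * w 1 ^ n 1)).trans hE.le
        linarith
      rw [abs_mul, abs_of_nonneg (refCoeff_nonneg hA n), abs_sub_comm, abs_of_nonneg h0]
      have hb := bracket_pos n
      calc _ ≤ (1 / 2 + A) / bracket n ^ 2 * (bracket n ^ 2 * r ^ 2) :=
            mul_le_mul (refCoeff_le hA n) (one_sub_re_monomial_le hw hwr' n) h0 (by positivity)
        _ = _ := by field_simp
    refine (Finset.sum_le_card_nsmul _ _ _ hterm).trans ?_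
    rw [nsmul_eq_mul]
    have := card_filter_mul_sq_le M hr
    nlinarith
  have hhigh : |∑ n ∈ (freqBox M).filter (fun n => ¬ bracket n * r ≤ 1),
      refCoeff A L n * (w 0 ^ n 0 * w 1 ^ n 1).re| ≤ 128 * (1 / 2 + A) := by
    rcases hr.eq_or_lt with h0 | h0
    · rw [← h0]
      simp
      positivity
    · refine le_trans ?_ (abs_sum_high_le (L := L) hA M hw hwr h0)
      refine le_trans (le_of_eq ?_) (Complex.abs_re_le_norm _)
      rw [Complex.re_sum]
      simp only [Complex.re_ofReal_mul]
  have e : refKernel A L M w - refLow A L M r =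
      ∑ n ∈ (freqBox M).filter (fun n => bracket n * r ≤ 1),
        refCoeff A L n * ((w 0 ^ n 0 * w 1 ^ n 1).re - 1) +
      ∑ n ∈ (freqBox M).filter (fun n => ¬ bracket n * r ≤ 1),
        refCoeff A L n * (w 0 ^ n 0 * w 1 ^ n 1).re := by
    rw [refKernel, refLow, ← Finset.sum_filter_add_sum_filter_not _ (fun n => bracket n * r ≤ 1)]
    simp only [mul_sub, mul_one, Finset.sum_sub_distrib]
    ring
  rw [e]
  refine (abs_add_le _ _).trans ?_
  linarith

/-- A frequency counted at r but not at r' satisfies 1/(2r) < ⟨n⟩ ≤ 1/r. There are at most 9/r² of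
these, with coefficients at most 4(1/2 + A)r². -/
lemma refLow_le_of_le {A L : ℝ} (hA : 0 ≤ A) (M : ℕ) {r r' : ℝ} (hr : 0 ≤ r)
    (h : r' ≤ 2 * r) : refLow A L M r ≤ refLow A L M r' + 36 * (1 / 2 + A) := by
  rw [refLow, refLow, Finset.sum_filter, Finset.sum_filter, ← sub_le_iff_le_add',
    ← Finset.sum_sub_distrib]
  calc _ ≤ ∑ n ∈ (freqBox M), if bracket n * r ≤ 1 then 4 * (1 / 2 + A) * r ^ 2 else 0 := by
        refine Finset.sum_le_sum fun n _ => ?_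
        have hb := bracket_pos n
        have h0 := refCoeff_nonneg (L := L) hA n
        have h4 : 0 ≤ 4 * (1 / 2 + A) * r ^ 2 := by positivity
        split_ifs with h1 h2 h2
        · linarith
        · have h3 : 1 < bracket n * (2 * r) := by
            refine lt_of_lt_of_le (not_le.1 h2) ?_
            gcongr
          rw [sub_zero]
          refine (refCoeff_le hA n).trans ?_
          rw [div_le_iff₀ (by positivity)]
          have h5 : 1 ≤ (bracket n * (2 * r)) ^ 2 := one_le_pow₀ h3.le
          calc (1 / 2 + A) = (1 / 2 + A) * 1 := by ring
            _ ≤ (1 / 2 + A) * (bracket n * (2 * r)) ^ 2 := by gcongr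
            _ = _ := by ring
        · linarith
        · linarith
    _ = (4 * (1 / 2 + A)) *
        ((((freqBox M).filter (fun n => bracket n * r ≤ 1)).card : ℝ) * r ^ 2) := by
        rw [← Finset.sum_filter, Finset.sum_const, nsmul_eq_mul]
        ring
    _ ≤ (4 * (1 / 2 + A)) * 9 := by
        gcongr
        exact card_filter_mul_sq_le M hr
    _ = _ := by ring

/-- The constant A/L² sits on at most 9L² frequencies, so it adds 9A and does not affect the
coefficient of the logarithm. -/
lemma sum_refCoeff_le {A L : ℝ} (hA : 0 ≤ A) {S : Finset Freq} {R : ℝ} (hR : 1 ≤ R)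
    (hS : ∀ n ∈ S, bracket n ≤ R) :
    ∑ n ∈ S, refCoeff A L n ≤ Real.pi * Real.log R + (1 + 2 * Real.pi + 9 * A) := by
  have e : ∀ n, refCoeff A L n ≤ 1 / 2 * (1 / bracket n ^ 2) + if bracket n ≤ L then A / L ^ 2 else 0 := by
    intro n
    have hb := bracket_pos n
    unfold refCoeff
    split_ifs
    · refine le_of_eq ?_
      congr 1
      field_simp
    · positivity
  have h2 : ∑ n ∈ S, (if bracket n ≤ L then A / L ^ 2 else 0) ≤ 9 * A := by
    rw [← Finset.sum_filter, Finset.sum_const, nsmul_eq_mul]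
    have h3 := card_bracket_le (S := S.filter fun n => bracket n ≤ L) (R := L)
      (fun n hn => (Finset.mem_filter.1 hn).2)
    rcases eq_or_ne L 0 with rfl | hL
    · simp; positivity
    calc _ ≤ 9 * L ^ 2 * (A / L ^ 2) := by gcongr
      _ = _ := by field_simp
  calc _ ≤ ∑ n ∈ S, (1 / 2 * (1 / bracket n ^ 2) + if bracket n ≤ L then A / L ^ 2 else 0) :=
        Finset.sum_le_sum fun n _ => e n
    _ ≤ 1 / 2 * (2 * Real.pi * Real.log R + (1 + 4 * Real.pi)) + 9 * A := by
        rw [Finset.sum_add_distrib, ← Finset.mul_sum]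
        gcongr
        exact sum_inv_bracket_sq_le hR hS
    _ ≤ _ := by linarith

lemma refLow_le_log {A L : ℝ} (hA : 0 ≤ A) (M : ℕ) {r : ℝ} (hr : 0 < r) (hr2 : r ≤ 2) :
    refLow A L M r ≤ Real.pi * Real.log (1 / r) + (1 + 3 * Real.pi + 9 * A) := by
  have hpi := Real.pi_pos
  have hS : ∀ n ∈ (freqBox M).filter (fun n => bracket n * r ≤ 1), bracket n ≤ 1 / r := by
    intro n hn
    rw [le_div_iff₀ hr]
    exact (Finset.mem_filter.1 hn).2
  rcases le_or_gt 1 (1 / r) with h1 | h1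
  · have := sum_refCoeff_le (L := L) hA h1 hS
    rw [refLow]
    linarith
  -- For 1 < r ≤ 2 no frequency remains, but log(1/r) is negative; 3π in place of 2π in the constant
  -- absorbs it.
  · have h2 : (freqBox M).filter (fun n => bracket n * r ≤ 1) = ∅ := by
      rw [Finset.eq_empty_iff_forall_notMem]
      intro n hn
      exact absurd ((one_le_bracket n).trans (hS n hn)) (not_le.2 h1)
    rw [refLow, h2, Finset.sum_empty]
    have h3 : Real.log r ≤ 1 := (Real.log_le_sub_one_of_pos hr).trans (by linarith)
    rw [one_div, Real.log_inv]
    nlinarith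

/-! ### Characters of the torus -/

/-- The character `exp(i n·x)`. -/
def echar (n : Freq) (x : Torus) : ℂ := ∏ i, fourier (n i) (x i)

/-- The coordinates `exp(i x_j)` of a point of the torus. -/
def unitPt (x : Torus) (i : Fin 2) : ℂ := fourier 1 (x i)

lemma norm_unitPt (x : Torus) (i : Fin 2) : ‖unitPt x i‖ = 1 := Circle.norm_coe _

lemma fourier_eq_zpow (k : ℤ) (y : AddCircle (2 * Real.pi)) :
    (fourier k y : ℂ) = (fourier 1 y : ℂ) ^ k := by
  rw [fourier_apply, fourier_apply, one_zsmul, AddCircle.toCircle_zsmul, Circle.coe_zpow]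

lemma echar_eq (n : Freq) (x : Torus) : echar n x = unitPt x 0 ^ n 0 * unitPt x 1 ^ n 1 := by
  rw [echar, Fin.prod_univ_two, fourier_eq_zpow, fourier_eq_zpow (n 1)]
  rfl

lemma norm_echar (n : Freq) (x : Torus) : ‖echar n x‖ = 1 := by
  simp [echar_eq, norm_unitPt]

lemma unitPt_add (x y : Torus) (i : Fin 2) : unitPt (x + y) i = unitPt x i * unitPt y i := by
  simp [unitPt, fourier_apply, AddCircle.toCircle_add]

lemma echar_add (n : Freq) (x y : Torus) : echar n (x + y) = echar n x * echar n y := by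
  simp only [echar_eq, unitPt_add, mul_zpow]
  ring

lemma echar_neg (n : Freq) (x : Torus) : echar (-n) x = conj (echar n x) := by
  rw [echar, echar, map_prod]
  simp

lemma echar_zero (x : Torus) : echar 0 x = 1 := by simp [echar_eq]

lemma echar_mul_conj_self (n : Freq) (x : Torus) : echar n x * conj (echar n x) = 1 := by
  rw [Complex.mul_conj, Complex.normSq_eq_norm_sq, norm_echar]
  simp

lemma continuous_unitPt : Continuous unitPt := by
  unfold unitPt
  fun_prop

lemma continuous_echar (n : Freq) : Continuous (echar n) := by
  unfold echar
  fun_prop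

lemma torusChar_eq (n : Freq) (x : Torus) : torusChar n x = (2 * (Real.pi : ℂ))⁻¹ * echar n x := rfl

/-- The chordal distance on the torus. -/
def tdist (x y : Torus) : ℝ := dist (unitPt x) (unitPt y)

lemma tdist_nonneg (x y : Torus) : 0 ≤ tdist x y := dist_nonneg

/-- The displacement from `y` to `x`. -/
def displ (x y : Torus) (i : Fin 2) : ℂ := unitPt x i * conj (unitPt y i)

lemma norm_displ (x y : Torus) (i : Fin 2) : ‖displ x y i‖ = 1 := by
  simp [displ, norm_unitPt]

lemma unitPt_mul_conj (x : Torus) (i : Fin 2) : unitPt x i * conj (unitPt x i) = 1 := by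
  rw [Complex.mul_conj, Complex.normSq_eq_norm_sq, norm_unitPt]
  simp

lemma norm_displ_sub_one (x y : Torus) (i : Fin 2) :
    ‖displ x y i - 1‖ = dist (unitPt x i) (unitPt y i) := by
  have : displ x y i - 1 = (unitPt x i - unitPt y i) * conj (unitPt y i) := by
    rw [sub_mul, unitPt_mul_conj, displ]
  rw [this, norm_mul, RCLike.norm_conj, norm_unitPt, mul_one, dist_eq_norm]

lemma norm_displ_sub_one_le (x y : Torus) (i : Fin 2) : ‖displ x y i - 1‖ ≤ tdist x y := by
  rw [norm_displ_sub_one]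
  exact dist_le_pi_dist _ _ i

lemma exists_norm_displ_sub_one (x y : Torus) : ∃ i, ‖displ x y i - 1‖ = tdist x y := by
  by_contra! h
  have h1 : ∀ i, dist (unitPt x i) (unitPt y i) < tdist x y := by
    intro i
    rw [← norm_displ_sub_one]
    exact lt_of_le_of_ne (norm_displ_sub_one_le x y i) (h i)
  have h0 : 0 < tdist x y := dist_nonneg.trans_lt (h1 0)
  exact lt_irrefl _ ((dist_pi_lt_iff h0).2 h1)

lemma tdist_le_two (x y : Torus) : tdist x y ≤ 2 := by
  refine (dist_pi_le_iff (by norm_num)).2 fun i => ?_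
  rw [dist_eq_norm]
  refine (norm_sub_le _ _).trans ?_
  rw [norm_unitPt, norm_unitPt]
  norm_num

lemma echar_mul_conj (n : Freq) (x y : Torus) :
    echar n x * conj (echar n y) = displ x y 0 ^ n 0 * displ x y 1 ^ n 1 := by
  simp only [echar_eq, displ, map_mul, map_zpow₀, mul_zpow]
  ring

/-! ### Folding sums over the lattice -/

open Classical in
/-- The part of `freqBox M` in the half lattice. -/
def halfBox (M : ℕ) : Finset Freq := (freqBox M).filter (· ∈ halfLattice)

lemma halfBox_subset (M : ℕ) : halfBox M ⊆ freqBox M := by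
  classical
  unfold halfBox
  exact Finset.filter_subset _ _

lemma mem_halfBox {M : ℕ} {n : Freq} :
    n ∈ halfBox M ↔ n ∈ freqBox M ∧ (0 < n 0 ∨ (n 0 = 0 ∧ 0 ≤ n 1)) := by
  classical
  unfold halfBox
  exact Finset.mem_filter

/-- The number of elements of `{n, -n}`. -/
def multiplicity (n : Freq) : ℝ := if n = 0 then 1 else 2

lemma multiplicity_pos (n : Freq) : 0 < multiplicity n := by
  unfold multiplicity; split_ifs <;> norm_num

lemma neg_mem_freqBox {M : ℕ} {n : Freq} (h : n ∈ freqBox M) : -n ∈ freqBox M := by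
  rw [mem_freqBox] at h ⊢
  simpa using h

lemma freq_eq_zero_iff (n : Freq) : n = 0 ↔ n 0 = 0 ∧ n 1 = 0 := by
  constructor
  · rintro rfl; simp
  · rintro ⟨h0, h1⟩
    ext i
    fin_cases i
    · exact h0
    · exact h1

/-- The modes at n and -n are conjugate, so only those in the half lattice are independent; even
sums are folded onto it. -/
lemma sum_freqBox_eq_sum_halfBox (M : ℕ) {f : Freq → ℝ} (hf : ∀ n, f (-n) = f n) :
    ∑ n ∈ freqBox M, f n = ∑ n ∈ halfBox M, multiplicity n * f n := by
  classical
  have h1 : ∑ n ∈ (freqBox M).filter (fun n => ¬ n ∈ halfLattice), f n =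
      ∑ n ∈ (halfBox M).filter (fun n => n ≠ 0), f n := by
    refine Finset.sum_nbij' (fun n => -n) (fun n => -n) ?_ ?_ (fun n _ => neg_neg n)
      (fun n _ => neg_neg n) (fun n _ => (hf n).symm)
    · intro n hn
      obtain ⟨h1, h2⟩ := Finset.mem_filter.1 hn
      have h3 : ¬ (0 < n 0 ∨ (n 0 = 0 ∧ 0 ≤ n 1)) := h2
      rw [Finset.mem_filter, mem_halfBox, ne_eq, neg_eq_zero, freq_eq_zero_iff, Pi.neg_apply,
        Pi.neg_apply]
      refine ⟨⟨neg_mem_freqBox h1, ?_⟩, ?_⟩ <;> omega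
    · intro n hn
      rw [Finset.mem_filter, mem_halfBox, ne_eq, freq_eq_zero_iff] at hn
      refine Finset.mem_filter.2 ⟨neg_mem_freqBox hn.1.1, ?_⟩
      change ¬ (0 < -n 0 ∨ (-n 0 = 0 ∧ 0 ≤ -n 1))
      omega
  have h2 : ∀ n, multiplicity n * f n = f n + if n ≠ 0 then f n else 0 := by
    intro n
    unfold multiplicity
    split_ifs <;> simp_all
    ring
  rw [← Finset.sum_filter_add_sum_filter_not (freqBox M) (· ∈ halfLattice), h1]
  simp_rw [h2]
  rw [Finset.sum_add_distrib, Finset.sum_filter (s := halfBox M)]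
  rfl

/-! ### Stationary Gaussian trigonometric fields -/

/-- The coefficients of the real Gaussian field with covariance
`(2π)⁻² ∑ a_n² cos(n·(x-y))`. -/
def trigField (a : Freq → ℝ) (M : ℕ) (x₀ : Torus) (d : halfBox M × Bool) (z : Torus) : ℝ :=
  Real.sqrt (multiplicity d.1) * a d.1 / (2 * Real.pi) *
    (if d.2 then -(echar d.1 (x₀ + z)).im else (echar d.1 (x₀ + z)).re)

lemma measurable_trigField (a : Freq → ℝ) (M : ℕ) (x₀ : Torus) (d : halfBox M × Bool) :
    Measurable (trigField a M x₀ d) := by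
  have h : Continuous fun z => echar d.1 (x₀ + z) :=
    (continuous_echar _).comp (continuous_const.add continuous_id)
  refine Measurable.const_mul ?_ _
  split_ifs
  · exact (Complex.continuous_im.comp h).neg.measurable
  · exact (Complex.continuous_re.comp h).measurable

lemma gpart_trigField (a : Freq → ℝ) (M : ℕ) (x₀ : Torus) (H : Freq → ℝ) :
    gpart (fun d : halfBox M × Bool => H d.1) (trigField a M x₀) =
      trigField (fun n => H n * a n) M x₀ := by
  ext d z
  simp only [gpart, trigField]
  ring

lemma abs_trigField_le {a : Freq → ℝ} {M : ℕ} {x₀ : Torus} {b : ℝ} (hb : ∀ n ∈ freqBox M, |a n| ≤ b)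
    (d : halfBox M × Bool) (z : Torus) : |trigField a M x₀ d z| ≤ b := by
  have hd : (d.1 : Freq) ∈ freqBox M := halfBox_subset M d.1.2
  have h0 := hb _ hd
  have hpi := Real.pi_gt_three
  have hm : Real.sqrt (multiplicity d.1) ≤ 2 * Real.pi := by
    refine Real.sqrt_le_iff.2 ⟨by positivity, ?_⟩
    have : multiplicity d.1 ≤ 2 := by unfold multiplicity; split_ifs <;> norm_num
    nlinarith
  have h1 : |if d.2 then -(echar d.1 (x₀ + z)).im else (echar d.1 (x₀ + z)).re| ≤ 1 := by
    split_ifs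
    · rw [abs_neg]
      exact (Complex.abs_im_le_norm _).trans (norm_echar _ _).le
    · exact (Complex.abs_re_le_norm _).trans (norm_echar _ _).le
  rw [trigField, abs_mul, abs_div, abs_mul, abs_of_nonneg (Real.sqrt_nonneg _),
    abs_of_pos (by positivity : 0 < 2 * Real.pi)]
  have hb0 : 0 ≤ b := (abs_nonneg _).trans h0
  calc _ ≤ (2 * Real.pi * b / (2 * Real.pi)) * 1 := by gcongr
    _ = b := by field_simp

/-- The cosine and sine coordinates combine by the addition formula, so the covariance depends on x
- y alone and the base point x₀ disappears. -/
lemma gcov_trigField {a : Freq → ℝ} (ha : ∀ n, a (-n) = a n) (M : ℕ) (x₀ x y : Torus) :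
    gcov (trigField a M x₀) x y = (4 * Real.pi ^ 2)⁻¹ *
      ∑ n ∈ freqBox M, a n ^ 2 * (displ x y 0 ^ n 0 * displ x y 1 ^ n 1).re := by
  have hpi := Real.pi_pos
  have hre : ∀ n, (echar n (x₀ + x)).re * (echar n (x₀ + y)).re +
      (echar n (x₀ + x)).im * (echar n (x₀ + y)).im =
        (displ x y 0 ^ n 0 * displ x y 1 ^ n 1).re := by
    intro n
    have e : echar n (x₀ + x) * conj (echar n (x₀ + y)) =
        displ x y 0 ^ n 0 * displ x y 1 ^ n 1 := by
      rw [← echar_mul_conj, echar_add, echar_add, map_mul]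
      linear_combination (echar n x * conj (echar n y)) * echar_mul_conj_self n x₀
    rw [← e, Complex.mul_re, Complex.conj_re, Complex.conj_im]
    ring
  have heven : ∀ n, a (-n) ^ 2 * (displ x y 0 ^ (-n) 0 * displ x y 1 ^ (-n) 1).re =
      a n ^ 2 * (displ x y 0 ^ n 0 * displ x y 1 ^ n 1).re := by
    intro n
    rw [ha, ← echar_mul_conj, ← echar_mul_conj, echar_neg, echar_neg, ← map_mul, Complex.conj_re]
  rw [sum_freqBox_eq_sum_halfBox M heven, ← Finset.sum_coe_sort (halfBox M), gcov,
    Fintype.sum_prod_type, Finset.mul_sum]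
  refine Finset.sum_congr rfl fun n _ => ?_
  rw [Fintype.sum_bool, ← hre]
  simp only [trigField, if_true, Bool.false_eq_true, if_false]
  have h2 := Real.mul_self_sqrt (multiplicity_pos n).le
  set s := Real.sqrt (multiplicity n)
  rw [← h2]
  field_simp
  ring

lemma gcov_trigField_add (a b : Freq → ℝ) (ha : ∀ n, a (-n) = a n) (hb : ∀ n, b (-n) = b n)
    {A L : ℝ} {M : ℕ} (h : ∀ n ∈ freqBox M, a n ^ 2 + b n ^ 2 = refCoeff A L n) (x₀ x y : Torus) :
    gcov (trigField a M x₀) x y + gcov (trigField b M x₀) x y =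
      (4 * Real.pi ^ 2)⁻¹ * refKernel A L M (displ x y) := by
  rw [gcov_trigField ha, gcov_trigField hb, ← mul_add, ← Finset.sum_add_distrib, refKernel]
  congr 1
  refine Finset.sum_congr rfl fun n hn => ?_
  rw [← h n hn]
  ring

/-- The constant in the doubling property of the reference kernel. -/
def doublingConst (β A : ℝ) : ℝ := β ^ 2 * ((4 * Real.pi ^ 2)⁻¹ * (310 * (1 / 2 + A)))

/-- Both values are compared with `refLow` and then the two radii with each other: 310 = 2 · 137 +
36. -/
lemma refKernel_le_of_tdist_le {A L : ℝ} (hA : 0 ≤ A) (M : ℕ) {a b c d : Torus}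
    (h : tdist c d ≤ 2 * tdist a b) :
    refKernel A L M (displ a b) ≤ refKernel A L M (displ c d) + 310 * (1 / 2 + A) := by
  have h1 := abs_le.1 (abs_refKernel_sub_refLow_le (L := L) hA M (norm_displ a b)
    (exists_norm_displ_sub_one a b) (norm_displ_sub_one_le a b))
  have h2 := abs_le.1 (abs_refKernel_sub_refLow_le (L := L) hA M (norm_displ c d)
    (exists_norm_displ_sub_one c d) (norm_displ_sub_one_le c d))
  have h3 := refLow_le_of_le (L := L) hA M (tdist_nonneg a b) h
  linarith [h1.2, h2.1]

/-- The exponent is 2β² · (4π²)⁻¹ · π log(1/r) = 2 · (β²/(4π)) · log(1/r) up to a constant. On the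
diagonal the right-hand side is infinite unless β = 0. -/
lemma exp_refKernel_sq_le {A L β : ℝ} (hA : 0 ≤ A) (M : ℕ) (x y : Torus) :
    ENNReal.ofReal (Real.exp (β ^ 2 * ((4 * Real.pi ^ 2)⁻¹ * refKernel A L M (displ x y)))) ^ 2 ≤
      ENNReal.ofReal (Real.exp (β ^ 2 * (2 * (4 * Real.pi ^ 2)⁻¹ *
        (1 + 3 * Real.pi + 9 * A + 137 * (1 / 2 + A))))) *
      ENNReal.ofReal (tdist x y) ^ (-(2 * (β ^ 2 / (4 * Real.pi)))) := by
  have hpi := Real.pi_pos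
  have hβ := sq_nonneg β
  rcases (tdist_nonneg x y).eq_or_lt with h0 | h0
  · rcases eq_or_lt_of_le hβ with hb | hb
    · rw [← hb]; simp
    · rw [← h0, ENNReal.ofReal_zero, ENNReal.zero_rpow_of_neg (by
        rw [neg_lt_zero]; positivity), ENNReal.mul_top (by simp [Real.exp_pos])]
      exact le_top
  · have h1 := abs_le.1 (abs_refKernel_sub_refLow_le (L := L) hA M (norm_displ x y)
      (exists_norm_displ_sub_one x y) (norm_displ_sub_one_le x y))
    have h2 := refLow_le_log (L := L) hA M h0 (tdist_le_two x y)
    rw [one_div, Real.log_inv] at h2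
    rw [← ENNReal.ofReal_pow (Real.exp_pos _).le, ENNReal.ofReal_rpow_of_pos h0,
      ← ENNReal.ofReal_mul (Real.exp_pos _).le, Real.rpow_def_of_pos h0, ← Real.exp_nat_mul,
      ← Real.exp_add]
    gcongr
    have h3 : refKernel A L M (displ x y) ≤ -(Real.pi * Real.log (tdist x y)) +
        (1 + 3 * Real.pi + 9 * A + 137 * (1 / 2 + A)) := by linarith [h1.2]
    have h4 : 0 ≤ 2 * β ^ 2 * (4 * Real.pi ^ 2)⁻¹ := by positivity
    calc _ = 2 * β ^ 2 * (4 * Real.pi ^ 2)⁻¹ * refKernel A L M (displ x y) := by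
          push_cast; ring
      _ ≤ 2 * β ^ 2 * (4 * Real.pi ^ 2)⁻¹ * (-(Real.pi * Real.log (tdist x y)) +
        (1 + 3 * Real.pi + 9 * A + 137 * (1 / 2 + A))) := by gcongr
      _ = _ := by field_simp; ring

/-- The moments of the high frequency fluctuations of averages of the imaginary chaos of a
stationary trigonometric field with coefficients dominated by those of the reference field. -/
lemma lintegral_enorm_integral_trig_sub_pow_le (β : ℝ) {a : Freq → ℝ} (ha : ∀ n, a (-n) = a n)
    {A L : ℝ} (hA : 0 ≤ A) {M : ℕ} (haL : ∀ n ∈ freqBox M, a n ^ 2 ≤ refCoeff A L n) (x₀ : Torus)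
    {H : Freq → ℝ} (hH : ∀ n, H n = 0 ∨ H n = 1) {ν : Measure Torus} [IsProbabilityMeasure ν]
    {K Q : ℝ≥0∞}
    (hK : ∫⁻ z : Torus × Torus, ENNReal.ofReal (tdist z.1 z.2) ^ (-(2 * (β ^ 2 / (4 * Real.pi))))
      ∂ν.prod ν ≤ K)
    (hQ : ∫⁻ z : Torus × Torus,
      ENNReal.ofReal |gcov (trigField (fun n => H n * a n) M x₀) z.1 z.2| ^ 2 ∂ν.prod ν ≤ Q) {m : ℕ}
    (hm : 1 ≤ m) :
    ∫⁻ g, ‖∫ x, gchaos β (trigField a M x₀) g x -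
        gchaos β (trigField (fun n => (1 - H n) * a n) M x₀) g x ∂ν‖ₑ ^ (2 * m)
      ∂gaussPi (halfBox M × Bool) ≤ chaosMomentConst β (doublingConst β A) m *
        ((Q * (ENNReal.ofReal (Real.exp (β ^ 2 * (2 * (4 * Real.pi ^ 2)⁻¹ *
        (1 + 3 * Real.pi + 9 * A + 137 * (1 / 2 + A))))) * K)) ^ (1 / 2 : ℝ)) ^ m := by
  -- The coefficients of the complementary field: a² + b² equals the reference coefficient exactly,
  -- so the sum of the two covariances is the reference kernel however irregular a may be.
  set b : Freq → ℝ := fun n => Real.sqrt (refCoeff A L n - a n ^ 2) with hb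
  have hbneg : ∀ n, b (-n) = b n := fun n => by simp only [hb, refCoeff_neg, ha]
  have hab : ∀ n ∈ freqBox M, a n ^ 2 + b n ^ 2 = refCoeff A L n := by
    intro n hn
    rw [hb, Real.sq_sqrt (sub_nonneg.2 (haL n hn))]
    ring
  set c : ℝ := ∑ n ∈ freqBox M, (|a n| + |b n|) with hc
  have hca : ∀ n ∈ freqBox M, |a n| ≤ c := fun n hn =>
    (le_add_of_nonneg_right (abs_nonneg (b n))).trans
      (Finset.single_le_sum (f := fun n => |a n| + |b n|) (fun _ _ => by positivity) hn)
  have hcb : ∀ n ∈ freqBox M, |b n| ≤ c := fun n hn =>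
    (le_add_of_nonneg_left (abs_nonneg (a n))).trans
      (Finset.single_le_sum (f := fun n => |a n| + |b n|) (fun _ _ => by positivity) hn)
  rw [← gpart_trigField a M x₀ fun n => 1 - H n]
  rw [← gpart_trigField a M x₀ H] at hQ
  have hsum := gcov_trigField_add a b ha hbneg hab x₀
  refine lintegral_enorm_integral_gchaos_sub_pow_le (ν := ν) β (u := trigField a M x₀)
    (w := trigField b M x₀) (measurable_trigField _ _ _) (measurable_trigField _ _ _) (b := c)
    (abs_trigField_le hca) (abs_trigField_le hcb) (h := fun d => H d.1) (fun d => hH d.1)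
    (ρ := tdist) (fun x y => dist_comm _ _) (fun x y z => dist_triangle _ _ _)
    (by unfold doublingConst; positivity) ?_ ?_ hQ hm
  · intro x y x' y' h
    rw [hsum, hsum, doublingConst, ← mul_add, ← mul_add]
    gcongr
    exact refKernel_le_of_tdist_le hA M h
  · simp_rw [hsum]
    calc _ ≤ ∫⁻ z : Torus × Torus, ENNReal.ofReal (Real.exp (β ^ 2 * (2 * (4 * Real.pi ^ 2)⁻¹ *
        (1 + 3 * Real.pi + 9 * A + 137 * (1 / 2 + A))))) *
          ENNReal.ofReal (tdist z.1 z.2) ^ (-(2 * (β ^ 2 / (4 * Real.pi)))) ∂ν.prod ν :=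
          lintegral_mono fun z => exp_refKernel_sq_le hA M z.1 z.2
      _ ≤ _ := by
          rw [lintegral_const_mul' _ _ (by simp)]
          gcongr

/-! ### Negative moments of the wrapped Gaussian law -/

section Wrapped

open ProbabilityTheory

/-- The length of the chord between `exp(i x)` and `1`. -/
def chord (x : ℝ) : ℝ := |2 * Real.sin (x / 2)|

lemma chord_add_int_mul (x : ℝ) (k : ℤ) : chord (x + k * (2 * Real.pi)) = chord x := by
  have e : (x + k * (2 * Real.pi)) / 2 = x / 2 + k * Real.pi := by ring
  rw [chord, chord, e, Real.sin_add_int_mul_pi, abs_mul, abs_mul, abs_mul, abs_zpow, abs_neg, abs_one, one_zpow, one_mul]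

lemma measurable_chord : Measurable chord := by unfold chord; fun_prop

lemma le_chord {x : ℝ} (hx : |x| ≤ Real.pi) : 2 / Real.pi * |x| ≤ chord x := by
  have h := Real.mul_abs_le_abs_sin (x := x / 2) (by rw [abs_div, abs_two]; linarith)
  rw [chord, abs_mul, abs_two]
  rw [abs_div, abs_two] at h
  linarith

lemma setLIntegral_abs_rpow_lt_top {γ : ℝ} (hγ1 : γ < 1) :
    ∫⁻ x in Set.Icc (-Real.pi) Real.pi, ENNReal.ofReal |x| ^ (-γ) < ⊤ := by
  have hpi := Real.pi_pos
  have hm : Measurable fun x : ℝ => ENNReal.ofReal |x| ^ (-γ) := by fun_prop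
  have h1 : ∫⁻ x in Set.Icc 0 Real.pi, ENNReal.ofReal |x| ^ (-γ) < ⊤ := by
    have h2 : IntegrableOn (fun x : ℝ => x ^ (-γ)) (Set.Ioc 0 Real.pi) :=
      (intervalIntegrable_iff_integrableOn_Ioc_of_le hpi.le).1
        (intervalIntegral.intervalIntegrable_rpow' (by linarith))
    rw [setLIntegral_congr Ioc_ae_eq_Icc.symm]
    have h3 : ∫⁻ x in Set.Ioc 0 Real.pi, ENNReal.ofReal |x| ^ (-γ) =
        ∫⁻ x in Set.Ioc 0 Real.pi, ENNReal.ofReal (x ^ (-γ)) := by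
      refine setLIntegral_congr_fun measurableSet_Ioc fun x hx => ?_
      rw [abs_of_pos hx.1, ENNReal.ofReal_rpow_of_pos hx.1]
    rw [h3]
    exact h2.lintegral_lt_top
  have h4 : ∫⁻ x in Set.Icc (-Real.pi) 0, ENNReal.ofReal |x| ^ (-γ) =
      ∫⁻ x in Set.Icc 0 Real.pi, ENNReal.ofReal |x| ^ (-γ) := by
    have h5 := (Measure.measurePreserving_neg (volume : Measure ℝ)).setLIntegral_comp_preimage
      (s := Set.Icc 0 Real.pi) measurableSet_Icc hm
    rw [← h5]
    simp
  calc _ ≤ ∫⁻ x in Set.Icc (-Real.pi) 0 ∪ Set.Icc 0 Real.pi, ENNReal.ofReal |x| ^ (-γ) := by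
        refine lintegral_mono_set fun x hx => ?_
        rcases le_total x 0 with h | h
        · exact Or.inl ⟨hx.1, h⟩
        · exact Or.inr ⟨h, hx.2⟩
    _ ≤ _ := lintegral_union_le _ _ _
    _ < ⊤ := by
        rw [h4]
        exact ENNReal.add_lt_top.2 ⟨h1, h1⟩

lemma lintegral_abs_rpow_gaussianReal_lt_top {γ : ℝ} (hγ0 : 0 < γ) (hγ1 : γ < 1) :
    ∫⁻ x, ENNReal.ofReal |x| ^ (-γ) ∂gaussianReal 0 1 < ⊤ := by
  have hm : Measurable fun x : ℝ => ENNReal.ofReal |x| ^ (-γ) := by fun_prop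
  have hpi := Real.pi_gt_three
  rw [← lintegral_add_compl _ (measurableSet_Icc (a := -Real.pi) (b := Real.pi))]
  refine ENNReal.add_lt_top.2 ⟨?_, ?_⟩
  · refine lt_of_le_of_lt ?_ (setLIntegral_abs_rpow_lt_top hγ1)
    rw [gaussianReal_of_var_ne_zero _ one_ne_zero,
      restrict_withDensity measurableSet_Icc,
      lintegral_withDensity_eq_lintegral_mul _ (measurable_gaussianPDF _ _) hm]
    refine lintegral_mono fun x => ?_
    refine mul_le_of_le_one_left zero_le ?_
    rw [gaussianPDF, gaussianPDFReal_def, ENNReal.ofReal_le_one]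
    have h1 : 1 ≤ Real.sqrt (2 * Real.pi * (1 : ℝ≥0)) := Real.le_sqrt_of_sq_le (by simp; linarith)
    refine mul_le_one₀ (inv_le_one_of_one_le₀ h1) (Real.exp_pos _).le (Real.exp_le_one_iff.2 ?_)
    rw [neg_div]
    simp only [Left.neg_nonpos_iff]
    positivity
  · calc _ ≤ ∫⁻ x in (Set.Icc (-Real.pi) Real.pi)ᶜ, 1 ∂gaussianReal 0 1 := by
          refine setLIntegral_mono measurable_const fun x hx => ?_
          have h1 : 1 ≤ |x| := by
            by_contra! h
            exact hx (by constructor <;> linarith [(abs_lt.1 h).1, (abs_lt.1 h).2])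
          rw [ENNReal.rpow_neg, ENNReal.inv_le_one]
          exact ENNReal.one_le_rpow (by rwa [ENNReal.one_le_ofReal]) hγ0
      _ < ⊤ := by simp

lemma setLIntegral_Ioc_add (F : ℝ → ℝ≥0∞) (hF : Measurable F) (a b c : ℝ) :
    ∫⁻ x in Set.Ioc (a + c) (b + c), F x = ∫⁻ x in Set.Ioc a b, F (x + c) := by
  have h := (measurePreserving_add_right (volume : Measure ℝ) c).setLIntegral_comp_preimage
    (s := Set.Ioc (a + c) (b + c)) measurableSet_Ioc hF
  rw [← h, Set.preimage_add_const_Ioc]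
  simp

/-- The line is cut into cells of length 2π, on each of which the chord is comparable to the
distance to the centre. The central cell gives t^{-γ} by scaling; the others give O(t). The growth
in t is harmless because t² will have Gamma tails. -/
lemma exists_lintegral_chord_le {γ : ℝ} (hγ0 : 0 < γ) (hγ1 : γ < 1) :
    ∃ C : ℝ≥0∞, C ≠ ⊤ ∧ ∀ t : ℝ, 0 < t →
      ∫⁻ x, ENNReal.ofReal (chord (t * x)) ^ (-γ) ∂gaussianReal 0 1 ≤
        C * (ENNReal.ofReal t ^ (-γ) + ENNReal.ofReal t) := by
  have hpi := Real.pi_pos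
  set J := ∫⁻ x in Set.Icc (-Real.pi) Real.pi, ENNReal.ofReal |x| ^ (-γ) with hJdef
  have hJ : J < ⊤ := setLIntegral_abs_rpow_lt_top hγ1
  set G := ∫⁻ x, ENNReal.ofReal |x| ^ (-γ) ∂gaussianReal 0 1
  have hG : G < ⊤ := lintegral_abs_rpow_gaussianReal_lt_top hγ0 hγ1
  set c : ℝ≥0∞ := ENNReal.ofReal (2 / Real.pi) ^ (-γ) with hc
  have hc' : c ≠ ⊤ := by
    rw [hc, ENNReal.ofReal_rpow_of_pos (by positivity)]
    exact ENNReal.ofReal_ne_top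
  have hc0 : ENNReal.ofReal (2 / Real.pi) ^ γ ≠ 0 := by
    rw [ENNReal.ofReal_rpow_of_pos (by positivity)]
    exact (ENNReal.ofReal_pos.2 (by positivity)).ne'
  set Z : ℝ≥0∞ := ∑' k : ℤ, ENNReal.ofReal (1 / (k : ℝ) ^ 2)
  have hZ : Z ≠ ⊤ := (Real.summable_one_div_int_pow.2 one_lt_two).tsum_ofReal_ne_top
  have hfm : Measurable fun x => ENNReal.ofReal (chord x) ^ (-γ) :=
    (measurable_chord.ennreal_ofReal).pow_const _
  have hcell : ∀ x ∈ Set.Ioc (-Real.pi) Real.pi,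
      ENNReal.ofReal (chord x) ^ (-γ) ≤ c * ENNReal.ofReal |x| ^ (-γ) := by
    intro x hx
    have h1 := le_chord (abs_le.2 ⟨hx.1.le, hx.2⟩)
    rw [ENNReal.rpow_neg, hc]
    calc _ ≤ (ENNReal.ofReal (2 / Real.pi * |x|) ^ γ)⁻¹ := by
          rw [ENNReal.inv_le_inv]
          gcongr
      _ = _ := by
          rw [ENNReal.ofReal_mul (by positivity), ENNReal.mul_rpow_of_nonneg _ _ hγ0.le,
            ENNReal.mul_inv (Or.inl hc0) (Or.inl (by finiteness)),
            ENNReal.rpow_neg, ENNReal.rpow_neg]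
  refine ⟨c * G + c * ENNReal.ofReal 1 * Z * J, by finiteness, fun t ht => ?_⟩
  set v : ℝ≥0 := ⟨t ^ 2, sq_nonneg t⟩ with hv
  have hv0 : v ≠ 0 := by
    intro h
    have : t ^ 2 = 0 := congrArg NNReal.toReal h
    nlinarith
  have hmap : (gaussianReal 0 1).map (fun x => t * x) = gaussianReal 0 v := by
    rw [gaussianReal_map_const_mul, mul_zero, mul_one]
    rfl
  -- On the k-th cell |x| ≥ |k|π, and exp(-u) ≤ 1/u with u = x²/(2t²) makes the density at most
  -- t/k², which is summable over k.
  have hpdf : ∀ y ∈ Set.Ioc (-Real.pi) Real.pi, ∀ k : ℤ, k ≠ 0 →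
      gaussianPDF 0 v (y + k * (2 * Real.pi)) ≤ ENNReal.ofReal t * ENNReal.ofReal (1 / (k : ℝ) ^ 2) := by
    intro y hy k hk
    rw [← ENNReal.ofReal_mul ht.le, gaussianPDF, gaussianPDFReal_def]
    refine ENNReal.ofReal_le_ofReal ?_
    set x := y + k * (2 * Real.pi) with hx
    have hk1 : (1 : ℝ) ≤ |(k : ℝ)| := by exact_mod_cast Int.one_le_abs hk
    have hxk : |(k : ℝ)| * Real.pi ≤ |x| := by
      have h1 : |(k : ℝ) * (2 * Real.pi)| ≤ |x| + |y| := by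
        have : (k : ℝ) * (2 * Real.pi) = x - y := by rw [hx]; ring
        rw [this]
        exact abs_sub _ _
      rw [abs_mul, abs_of_pos (by positivity : 0 < 2 * Real.pi)] at h1
      have h2 : |y| ≤ Real.pi := abs_le.2 ⟨hy.1.le, hy.2⟩
      nlinarith
    have hx2 : (k : ℝ) ^ 2 * Real.pi ^ 2 ≤ x ^ 2 := by
      rw [← sq_abs x, ← sq_abs (k : ℝ), ← mul_pow]
      exact pow_le_pow_left₀ (by positivity) hxk 2
    have hk2 : (0 : ℝ) < (k : ℝ) ^ 2 := by positivity
    have hx0 : 0 < x ^ 2 := lt_of_lt_of_le (by positivity) hx2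
    have hvt : (v : ℝ) = t ^ 2 := rfl
    have h1 : (Real.sqrt (2 * Real.pi * v))⁻¹ ≤ 1 / t := by
      rw [← one_div]
      refine one_div_le_one_div_of_le ht (Real.le_sqrt_of_sq_le ?_)
      rw [hvt]
      have := Real.pi_gt_three
      nlinarith [sq_nonneg t]
    have h2 : Real.exp (-(x - 0) ^ 2 / (2 * v)) ≤ 2 * t ^ 2 / x ^ 2 := by
      rw [sub_zero, hvt, neg_div, Real.exp_neg, ← one_div]
      have h3 : x ^ 2 / (2 * t ^ 2) ≤ Real.exp (x ^ 2 / (2 * t ^ 2)) := by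
        have := Real.add_one_le_exp (x ^ 2 / (2 * t ^ 2))
        linarith
      calc _ ≤ 1 / (x ^ 2 / (2 * t ^ 2)) := one_div_le_one_div_of_le (by positivity) h3
        _ = _ := by rw [one_div_div]
    calc _ ≤ 1 / t * (2 * t ^ 2 / x ^ 2) :=
          mul_le_mul h1 h2 (Real.exp_pos _).le (by positivity)
      _ = 2 * t / x ^ 2 := by field_simp
      _ ≤ 2 * t / ((k : ℝ) ^ 2 * Real.pi ^ 2) := by gcongr
      _ ≤ t * (1 / (k : ℝ) ^ 2) := by
          rw [mul_one_div, div_le_div_iff₀ (by positivity) hk2]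
          have := Real.pi_gt_three
          have h5 : 2 ≤ Real.pi ^ 2 := by nlinarith
          have h6 : 0 < t * (k : ℝ) ^ 2 := by positivity
          nlinarith
  have hF : Measurable fun x => gaussianPDF 0 v x * ENNReal.ofReal (chord x) ^ (-γ) :=
    (measurable_gaussianPDF _ _).mul hfm
  have hterm : ∀ k : ℤ, ∫⁻ x in Set.Ioc (-Real.pi + k • (2 * Real.pi))
      (-Real.pi + (k + 1) • (2 * Real.pi)), gaussianPDF 0 v x * ENNReal.ofReal (chord x) ^ (-γ) ≤
        (if k = 0 then c * G * ENNReal.ofReal t ^ (-γ) else 0) +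
          ENNReal.ofReal (1 / (k : ℝ) ^ 2) * (ENNReal.ofReal t * (c * J)) := by
    intro k
    have e : -Real.pi + (k + 1) • (2 * Real.pi) = Real.pi + k * (2 * Real.pi) := by
      rw [zsmul_eq_mul]; push_cast; ring
    rw [e, zsmul_eq_mul, setLIntegral_Ioc_add _ hF]
    simp only [chord_add_int_mul]
    by_cases hk : k = 0
    · rw [if_pos hk]
      refine le_add_right ?_
      subst hk
      simp only [Int.cast_zero, zero_mul, add_zero]
      calc _ ≤ ∫⁻ x in Set.Ioc (-Real.pi) Real.pi,
            gaussianPDF 0 v x * (c * ENNReal.ofReal |x| ^ (-γ)) :=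
            setLIntegral_mono' measurableSet_Ioc fun x hx => by
              gcongr
              exact hcell x hx
        _ ≤ ∫⁻ x, gaussianPDF 0 v x * (c * ENNReal.ofReal |x| ^ (-γ)) :=
            setLIntegral_le_lintegral _ _
        _ = ∫⁻ x, c * ENNReal.ofReal |x| ^ (-γ) ∂gaussianReal 0 v := by
            rw [gaussianReal_of_var_ne_zero _ hv0,
              lintegral_withDensity_eq_lintegral_mul _ (measurable_gaussianPDF _ _) (by fun_prop)]
            rfl
        _ = ∫⁻ x, ENNReal.ofReal t ^ (-γ) * (c * ENNReal.ofReal |x| ^ (-γ)) ∂gaussianReal 0 1 := by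
            rw [← hmap, lintegral_map (by fun_prop) (by fun_prop)]
            refine lintegral_congr fun x => ?_
            rw [abs_mul, abs_of_pos ht, ENNReal.ofReal_mul ht.le,
              ENNReal.mul_rpow_of_ne_top ENNReal.ofReal_ne_top ENNReal.ofReal_ne_top, mul_left_comm]
        _ = _ := by
            rw [lintegral_const_mul _ (by fun_prop), lintegral_const_mul _ (by fun_prop), mul_comm]
    · rw [if_neg hk, zero_add]
      calc _ ≤ ∫⁻ x in Set.Ioc (-Real.pi) Real.pi,
            ENNReal.ofReal t * ENNReal.ofReal (1 / (k : ℝ) ^ 2) * (c * ENNReal.ofReal |x| ^ (-γ)) :=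
            setLIntegral_mono' measurableSet_Ioc fun x hx =>
              mul_le_mul' (hpdf x hx k hk) (hcell x hx)
        _ = ENNReal.ofReal t * ENNReal.ofReal (1 / (k : ℝ) ^ 2) * (c *
            ∫⁻ x in Set.Ioc (-Real.pi) Real.pi, ENNReal.ofReal |x| ^ (-γ)) := by
            rw [lintegral_const_mul _ (by fun_prop), lintegral_const_mul _ (by fun_prop)]
        _ ≤ ENNReal.ofReal t * ENNReal.ofReal (1 / (k : ℝ) ^ 2) * (c * J) := by
            gcongr
            exact lintegral_mono_set Set.Ioc_subset_Icc_self
        _ = _ := by ring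
  calc _ = ∫⁻ x, ENNReal.ofReal (chord x) ^ (-γ) ∂gaussianReal 0 v := by
        rw [← hmap, lintegral_map hfm (by fun_prop)]
    _ = ∫⁻ x, gaussianPDF 0 v x * ENNReal.ofReal (chord x) ^ (-γ) := by
        rw [gaussianReal_of_var_ne_zero _ hv0,
          lintegral_withDensity_eq_lintegral_mul _ (measurable_gaussianPDF _ _) hfm]
        rfl
    _ = ∫⁻ x in ⋃ k : ℤ, Set.Ioc (-Real.pi + k • (2 * Real.pi))
        (-Real.pi + (k + 1) • (2 * Real.pi)),
          gaussianPDF 0 v x * ENNReal.ofReal (chord x) ^ (-γ) := by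
        rw [iUnion_Ioc_add_zsmul (by positivity), Measure.restrict_univ]
    _ ≤ ∑' k : ℤ, ∫⁻ x in Set.Ioc (-Real.pi + k • (2 * Real.pi))
        (-Real.pi + (k + 1) • (2 * Real.pi)),
          gaussianPDF 0 v x * ENNReal.ofReal (chord x) ^ (-γ) := lintegral_iUnion_le _ _
    _ ≤ ∑' k : ℤ, ((if k = 0 then c * G * ENNReal.ofReal t ^ (-γ) else 0) +
          ENNReal.ofReal (1 / (k : ℝ) ^ 2) * (ENNReal.ofReal t * (c * J))) :=
        ENNReal.tsum_le_tsum hterm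
    _ = c * G * ENNReal.ofReal t ^ (-γ) + c * ENNReal.ofReal 1 * Z * J * ENNReal.ofReal t := by
        rw [ENNReal.tsum_add, tsum_ite_eq, ENNReal.tsum_mul_right, ENNReal.ofReal_one]
        ring
    _ ≤ _ := by
        rw [mul_add, add_mul, add_mul]
        gcongr
        · exact le_self_add
        · exact le_add_self

end Wrapped

/-! ### The Bessel measure -/

section Bessel

open ProbabilityTheory

lemma measurable_gammaPDF (a : ℝ) : Measurable (gammaPDF a 1) :=
  (measurable_gammaPDFReal a 1).ennreal_ofReal

lemma ae_pos_gammaMeasure (a : ℝ) : ∀ᵐ s ∂gammaMeasure a 1, 0 < s := by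
  rw [gammaMeasure, ae_withDensity_iff (measurable_gammaPDF a)]
  have h0 : ∀ᵐ s : ℝ, s ≠ 0 := by simp [ae_iff]
  filter_upwards [h0] with s hs h
  by_contra! h1
  exact h (gammaPDF_of_neg (lt_of_le_of_ne h1 hs))

lemma lintegral_gammaMeasure (a : ℝ) {f : ℝ → ℝ≥0∞} (hf : Measurable f) :
    ∫⁻ s, f s ∂gammaMeasure a 1 = ∫⁻ s in Set.Ioi 0,
      ENNReal.ofReal (1 / Real.Gamma a * s ^ (a - 1) * Real.exp (-s)) * f s := by
  have h1 : (gammaMeasure a 1).restrict (Set.Ioi 0) = gammaMeasure a 1 :=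
    Measure.restrict_eq_self_of_ae_mem (ae_pos_gammaMeasure a)
  rw [← h1, gammaMeasure, restrict_withDensity measurableSet_Ioi,
    lintegral_withDensity_eq_lintegral_mul _ (measurable_gammaPDF a) hf]
  refine setLIntegral_congr_fun measurableSet_Ioi fun s hs => ?_
  have : (0 : ℝ) ≤ s := le_of_lt hs
  simp [gammaPDF_of_nonneg this]

lemma lintegral_rpow_gammaMeasure_lt_top {a q : ℝ} (haq : 0 < a + q) :
    ∫⁻ s, ENNReal.ofReal s ^ q ∂gammaMeasure a 1 < ⊤ := by
  rw [lintegral_gammaMeasure a (by fun_prop)]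
  have h1 : IntegrableOn (fun s : ℝ => 1 / Real.Gamma a * (Real.exp (-s) * s ^ (a + q - 1)))
      (Set.Ioi 0) := (Real.GammaIntegral_convergent haq).const_mul _
  refine lt_of_le_of_lt (le_of_eq ?_) h1.lintegral_lt_top
  refine setLIntegral_congr_fun measurableSet_Ioi fun s hs => ?_
  have hs : (0 : ℝ) < s := hs
  rw [ENNReal.ofReal_rpow_of_pos hs, ← ENNReal.ofReal_mul' (by positivity)]
  congr 1
  rw [show a + q - 1 = (a - 1) + q by ring, Real.rpow_add hs]
  ring

lemma integral_exp_neg_mul_gammaMeasure {a c : ℝ} (ha : 0 < a) (hc : 0 ≤ c) :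
    ∫ s, Real.exp (-(c * s)) ∂gammaMeasure a 1 = (1 + c) ^ (-a) := by
  rw [integral_eq_lintegral_of_nonneg_ae (ae_of_all _ fun s => (Real.exp_pos _).le)
    (by fun_prop), lintegral_gammaMeasure a (by fun_prop)]
  have h1 : ∫⁻ s in Set.Ioi 0, ENNReal.ofReal (1 / Real.Gamma a * s ^ (a - 1) * Real.exp (-s)) *
      ENNReal.ofReal (Real.exp (-(c * s))) =
      ∫⁻ s in Set.Ioi 0, ENNReal.ofReal (1 / Real.Gamma a * (s ^ (a - 1) *
        Real.exp (-((1 + c) * s)))) := by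
    refine setLIntegral_congr_fun measurableSet_Ioi fun s hs => ?_
    rw [← ENNReal.ofReal_mul' (Real.exp_pos _).le]
    congr 1
    rw [mul_assoc, ← Real.exp_add, mul_assoc]
    congr 4
    ring
  have hG := Real.Gamma_pos_of_pos ha
  have hpos : 0 ≤ᵐ[volume.restrict (Set.Ioi 0)] fun s : ℝ => 1 / Real.Gamma a * (s ^ (a - 1) *
        Real.exp (-((1 + c) * s))) := by
    filter_upwards [ae_restrict_mem measurableSet_Ioi] with s hs
    have : (0 : ℝ) < s := hs
    positivity
  rw [h1, ← integral_eq_lintegral_of_nonneg_ae hpos (by fun_prop), integral_const_mul,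
    Real.integral_rpow_mul_exp_neg_mul_Ioi ha (by linarith), Real.rpow_neg (by linarith),
    one_div, one_div, Real.inv_rpow (by linarith)]
  field_simp

/-- Brownian motion on the torus at a time with a Gamma law. -/
def besselMap (p : ℝ × (Fin 2 → ℝ)) : Torus := fun i => ((Real.sqrt (2 * p.1) * p.2 i : ℝ) : AddCircle (2 * Real.pi))

lemma measurable_besselMap : Measurable besselMap := by
  refine measurable_pi_iff.2 fun i => ?_
  exact (AddCircle.measurable_mk'.comp
    (show Measurable fun p : ℝ × (Fin 2 → ℝ) => Real.sqrt (2 * p.1) * p.2 i by fun_prop))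

/-- The probability measure on the torus with Fourier transform `⟨n⟩^{-α}`, `α > 0`. -/
def besselMeasure (α : ℝ) : Measure Torus :=
  ((gammaMeasure (α / 2) 1).prod (gaussPi (Fin 2))).map besselMap

lemma isProbabilityMeasure_besselMeasure {α : ℝ} (hα : 0 < α) :
    IsProbabilityMeasure (besselMeasure α) := by
  have := isProbabilityMeasure_gammaMeasure (half_pos hα) one_pos
  exact Measure.isProbabilityMeasure_map measurable_besselMap.aemeasurable

lemma echar_coe (n : Freq) (y : Fin 2 → ℝ) :
    echar n (fun i => (y i : AddCircle (2 * Real.pi))) =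
      Complex.exp (Complex.I * (∑ i, n i * y i : ℝ)) := by
  rw [echar, Complex.ofReal_sum, Finset.mul_sum, Complex.exp_sum]
  refine Finset.prod_congr rfl fun i _ => ?_
  rw [fourier_coe_apply]
  congr 1
  have := Real.pi_ne_zero
  push_cast
  field_simp

/-- Given the time s, the coordinates are Gaussian of variance 2s, which gives exp(-s|n|²). The
Laplace transform of the Gamma law of parameter α/2 turns this into (1 + |n|²)^{-α/2}. -/
lemma integral_echar_besselMeasure {α : ℝ} (hα : 0 < α) (n : Freq) :
    ∫ x, echar n x ∂besselMeasure α = (bracket n ^ (-α) : ℝ) := by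
  have := isProbabilityMeasure_gammaMeasure (half_pos hα) one_pos
  have hm := (continuous_echar n).measurable
  rw [besselMeasure, integral_map measurable_besselMap.aemeasurable hm.aestronglyMeasurable,
    integral_prod]
  · have h1 : ∀ᵐ s ∂gammaMeasure (α / 2) 1, ∫ g, echar n (besselMap (s, g)) ∂gaussPi (Fin 2) =
        (Real.exp (-((∑ i, (n i : ℝ) ^ 2) * s)) : ℝ) := by
      filter_upwards [ae_pos_gammaMeasure (α / 2)] with s hs
      have h2 : ∀ g : Fin 2 → ℝ, echar n (besselMap (s, g)) =
          Complex.exp (Complex.I * (∑ i, (n i * Real.sqrt (2 * s)) * g i : ℝ)) := by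
        intro g
        refine (echar_coe n fun i => Real.sqrt (2 * s) * g i).trans ?_
        simp only [mul_assoc]
      simp only [h2]
      rw [integral_cexp_gaussPi]
      congr 2
      simp only [mul_pow, Real.sq_sqrt (by linarith : 0 ≤ 2 * s), ← Finset.sum_mul]
      ring
    rw [integral_congr_ae h1, integral_complex_ofReal,
      integral_exp_neg_mul_gammaMeasure (half_pos hα) (by positivity), ← bracket_sq,
      ← Real.rpow_natCast, ← Real.rpow_mul (bracket_pos n).le]
    congr 2
    push_cast
    ring
  · refine Integrable.of_bound (hm.comp measurable_besselMap).aestronglyMeasurable 1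
      (ae_of_all _ fun p => ?_)
    rw [norm_echar]

lemma norm_displ_coe (y y' : Fin 2 → ℝ) (i : Fin 2) :
    ‖displ (fun i => (y i : AddCircle (2 * Real.pi))) (fun i => (y' i : AddCircle (2 * Real.pi))) i - 1‖ =
      chord (y i - y' i) := by
  have h : displ (fun i => (y i : AddCircle (2 * Real.pi))) (fun i => (y' i : AddCircle (2 * Real.pi))) i =
      Complex.exp (Complex.I * ((y i - y' i : ℝ) : ℂ)) := by
    have hpi := Real.pi_ne_zero
    rw [displ, unitPt, unitPt, fourier_coe_apply, fourier_coe_apply, ← Complex.exp_conj, ← Complex.exp_add]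
    congr 1
    simp only [map_mul, map_div₀, Complex.conj_I, Complex.conj_ofReal, map_ofNat, Int.cast_one, map_one]
    push_cast
    field_simp
    ring
  rw [h, Complex.norm_exp_I_mul_ofReal_sub_one, chord, Real.norm_eq_abs]

/-- The distance is at least each of the two chords, so the exponent 2γ can be split evenly. Each
coordinate then carries a singularity of exponent γ < 1, integrable in dimension one. -/
lemma tdist_rpow_le {γ : ℝ} (hγ : 0 < γ) (y y' : Fin 2 → ℝ) :
    ENNReal.ofReal (tdist (fun i => (y i : AddCircle (2 * Real.pi)))
      (fun i => (y' i : AddCircle (2 * Real.pi)))) ^ (-(2 * γ)) ≤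
      ∏ i, ENNReal.ofReal (chord (y i - y' i)) ^ (-γ) := by
  rw [Fin.prod_univ_two, show -(2 * γ) = -γ * (2 : ℕ) by push_cast; ring, ENNReal.rpow_mul, ENNReal.rpow_natCast, sq]
  have h : ∀ i, ENNReal.ofReal (tdist (fun i => (y i : AddCircle (2 * Real.pi)))
      (fun i => (y' i : AddCircle (2 * Real.pi)))) ^ (-γ) ≤ ENNReal.ofReal (chord (y i - y' i)) ^ (-γ) := by
    intro i
    rw [ENNReal.rpow_neg, ENNReal.rpow_neg, ENNReal.inv_le_inv, ← norm_displ_coe]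
    gcongr
    exact norm_displ_sub_one_le _ _ i
  exact mul_le_mul' (h 0) (h 1)

lemma exists_lintegral_prod_chord_le {γ : ℝ} (hγ0 : 0 < γ) (hγ1 : γ < 1) :
    ∃ C : ℝ≥0∞, C ≠ ⊤ ∧ ∀ s s' : ℝ, 0 < s → 0 < s' →
      ∫⁻ p, ∏ i, ENNReal.ofReal (chord (Real.sqrt (2 * s) * p.1 i - Real.sqrt (2 * s') * p.2 i)) ^ (-γ)
        ∂(gaussPi (Fin 2)).prod (gaussPi (Fin 2)) ≤
      C * (ENNReal.ofReal s ^ (-(γ / 2)) * ENNReal.ofReal s' ^ (-(γ / 2)) + (ENNReal.ofReal s + ENNReal.ofReal s')) := by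
  obtain ⟨C, hC, hb⟩ := exists_lintegral_chord_le hγ0 hγ1
  refine ⟨C ^ 2 * 4, by finiteness, fun s s' hs hs' => ?_⟩
  set τ := Real.sqrt (2 * s)
  set τ' := Real.sqrt (2 * s')
  set r := Real.sqrt (2 * (s + s')) with hr
  have hr0 : 0 < r := Real.sqrt_pos.2 (by linarith)
  have hτ : 0 < τ := Real.sqrt_pos.2 (by linarith)
  have hτ2 : τ ^ 2 = 2 * s := Real.sq_sqrt (by linarith)
  have hτ'2 : τ' ^ 2 = 2 * s' := Real.sq_sqrt (by linarith)
  have hr2 : r ^ 2 = 2 * (s + s') := Real.sq_sqrt (by linarith)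
  -- The difference of two independent Gaussians of scales τ and τ' is a Gaussian of scale r; it is
  -- realized here by a rotation, with r cos θ = τ and r sin θ = -τ'.
  obtain ⟨θ, hc, hsn⟩ : ∃ θ : ℝ, r * Real.cos θ = τ ∧ r * Real.sin θ = -τ' := by
    have hz : (⟨τ, -τ'⟩ : ℂ) ≠ 0 := fun h => hτ.ne' (congrArg Complex.re h)
    have hn : ‖(⟨τ, -τ'⟩ : ℂ)‖ = r := by
      rw [Complex.norm_def, Complex.normSq_mk, hr]
      congr 1
      nlinarith
    refine ⟨Complex.arg ⟨τ, -τ'⟩, ?_, ?_⟩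
    · rw [Complex.cos_arg hz, hn]
      field_simp
    · rw [Complex.sin_arg, hn]
      field_simp
  set f : ℝ → ℝ≥0∞ := fun x => ENNReal.ofReal (chord (r * x)) ^ (-γ) with hf
  have hfm : Measurable f := by
    have := measurable_chord
    fun_prop
  have hFm : Measurable fun g : Fin 2 → ℝ => ∏ i, f (g i) :=
    Finset.measurable_fun_prod _ fun i _ => hfm.comp (measurable_pi_apply i)
  have hmp := (measurePreserving_fst (μ := gaussPi (Fin 2)) (ν := gaussPi (Fin 2))).comp
    (measurePreserving_gaussRot fun _ : Fin 2 => θ)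
  have h1 : ∫⁻ p, ∏ i, ENNReal.ofReal (chord (τ * p.1 i - τ' * p.2 i)) ^ (-γ)
        ∂(gaussPi (Fin 2)).prod (gaussPi (Fin 2)) = ∫⁻ g, ∏ i, f (g i) ∂gaussPi (Fin 2) := by
    rw [← hmp.lintegral_comp hFm]
    refine lintegral_congr fun p => Finset.prod_congr rfl fun i _ => ?_
    simp only [hf, Function.comp_apply, gaussRot]
    congr 3
    rw [mul_add, ← mul_assoc, ← mul_assoc, hc, hsn]
    ring
  rw [h1, gaussPi, lintegral_fin_prod_eq_prod fun _ => hfm, Fin.prod_univ_two]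
  set a := ENNReal.ofReal r ^ (-γ)
  set b := ENNReal.ofReal r
  -- √(ss') ≤ 2(s + s') shares the singularity between the two times, so that each contributes only
  -- s^{-γ/2}.
  have ha : a ^ 2 ≤ ENNReal.ofReal s ^ (-(γ / 2)) * ENNReal.ofReal s' ^ (-(γ / 2)) := by
    have e1 : a ^ 2 = ENNReal.ofReal ((2 * (s + s')) ^ (-γ)) := by
      rw [← ENNReal.rpow_natCast, ← ENNReal.rpow_mul, mul_comm, ENNReal.rpow_mul, ENNReal.rpow_natCast,
        ← ENNReal.ofReal_pow hr0.le, hr2, ENNReal.ofReal_rpow_of_pos (by linarith)]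
    rw [e1, ENNReal.ofReal_rpow_of_pos hs, ENNReal.ofReal_rpow_of_pos hs', ← ENNReal.ofReal_mul (by positivity)]
    refine ENNReal.ofReal_le_ofReal ?_
    rw [← Real.mul_rpow hs.le hs'.le, show -(γ / 2) = (1 / 2) * (-γ) by ring, Real.rpow_mul (by positivity), ← Real.sqrt_eq_rpow]
    refine Real.rpow_le_rpow_of_nonpos (Real.sqrt_pos.2 (by positivity)) ?_ (by linarith)
    refine Real.sqrt_le_left (by positivity) |>.2 ?_
    nlinarith
  have hb2 : b ^ 2 = 2 * (ENNReal.ofReal s + ENNReal.ofReal s') := by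
    rw [← ENNReal.ofReal_pow hr0.le, hr2, ENNReal.ofReal_mul zero_le_two, ENNReal.ofReal_add hs.le hs'.le, ENNReal.ofReal_ofNat]
  calc _ ≤ (C * (a + b)) * (C * (a + b)) := mul_le_mul' (hb r hr0) (hb r hr0)
    _ = C ^ 2 * (a + b) ^ 2 := by ring
    _ ≤ C ^ 2 * (2 * (a ^ 2 + b ^ 2)) := by
        gcongr
        have := ENNReal.rpow_add_le_mul_rpow_add_rpow a b one_le_two
        norm_num at this
        exact_mod_cast this
    _ ≤ C ^ 2 * (4 * (ENNReal.ofReal s ^ (-(γ / 2)) * ENNReal.ofReal s' ^ (-(γ / 2)) + (ENNReal.ofReal s + ENNReal.ofReal s'))) := by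
        refine mul_le_mul_right ?_ _
        rw [hb2]
        have hA : a ^ 2 ≤ 2 * (ENNReal.ofReal s ^ (-(γ / 2)) * ENNReal.ofReal s' ^ (-(γ / 2))) :=
          ha.trans (le_mul_of_one_le_left zero_le one_le_two)
        refine (mul_le_mul_right (add_le_add_left hA _) 2).trans (le_of_eq ?_)
        rw [← mul_add, ← mul_assoc]
        norm_num
    _ = _ := by ring

/-- This is where α > β²/(4π) enters: s^{-γ/2} has a finite mean under the Gamma law of parameter
α/2 because γ < α. The condition γ < 1 is used for the chords. -/
lemma lintegral_tdist_besselMeasure_lt_top {α γ : ℝ} (hγ0 : 0 < γ) (hγ1 : γ < 1) (hγα : γ < α) :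
    ∫⁻ z, ENNReal.ofReal (tdist z.1 z.2) ^ (-(2 * γ))
      ∂(besselMeasure α).prod (besselMeasure α) < ⊤ := by
  have hα : 0 < α := hγ0.trans hγα
  have := isProbabilityMeasure_gammaMeasure (half_pos hα) one_pos
  have := isProbabilityMeasure_besselMeasure hα
  obtain ⟨C, hC, hb⟩ := exists_lintegral_prod_chord_le hγ0 hγ1
  set Γ := gammaMeasure (α / 2) 1
  set G := gaussPi (Fin 2)
  have htm : Measurable fun z : Torus × Torus => ENNReal.ofReal (tdist z.1 z.2) ^ (-(2 * γ)) := by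
    have h1 := continuous_unitPt
    have : Continuous fun z : Torus × Torus => tdist z.1 z.2 := by
      unfold tdist
      fun_prop
    have := this.measurable
    fun_prop
  have hchord := measurable_chord
  have hbm := measurable_besselMap
  rw [besselMeasure, Measure.map_prod_map _ _ hbm hbm,
    lintegral_map htm (by fun_prop)]
  have hFm : Measurable fun q : (ℝ × (Fin 2 → ℝ)) × (ℝ × (Fin 2 → ℝ)) =>
      ∏ i, ENNReal.ofReal (chord (Real.sqrt (2 * q.1.1) * q.1.2 i - Real.sqrt (2 * q.2.1) * q.2.2 i)) ^ (-γ) := by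
    refine Finset.measurable_fun_prod _ fun i _ => ?_
    have : Measurable fun q : (ℝ × (Fin 2 → ℝ)) × (ℝ × (Fin 2 → ℝ)) =>
      Real.sqrt (2 * q.1.1) * q.1.2 i - Real.sqrt (2 * q.2.1) * q.2.2 i := by fun_prop
    exact (hchord.comp this).ennreal_ofReal.pow_const _
  set F := fun q : (ℝ × (Fin 2 → ℝ)) × (ℝ × (Fin 2 → ℝ)) =>
      ∏ i, ENNReal.ofReal (chord (Real.sqrt (2 * q.1.1) * q.1.2 i - Real.sqrt (2 * q.2.1) * q.2.2 i)) ^ (-γ) with hF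
  have h1 : ∫⁻ q, F q ∂(Γ.prod G).prod (Γ.prod G) =
      ∫⁻ u, ∫⁻ p, F ((u.1, p.1), (u.2, p.2)) ∂G.prod G ∂Γ.prod Γ := by
    rw [lintegral_prod _ hFm.aemeasurable, lintegral_prod _ (by fun_prop)]
    have e1 : ∀ q, ∫⁻ q', F (q, q') ∂Γ.prod G = ∫⁻ s', ∫⁻ g', F (q, (s', g')) ∂G ∂Γ := fun q =>
      lintegral_prod _ (by fun_prop)
    simp only [e1]
    rw [lintegral_prod _ (by
      have : Measurable fun r : (ℝ × ℝ) × ((Fin 2 → ℝ) × (Fin 2 → ℝ)) => F ((r.1.1, r.2.1), (r.1.2, r.2.2)) := by fun_prop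
      exact this.lintegral_prod_right'.aemeasurable)]
    refine lintegral_congr fun s => ?_
    rw [lintegral_lintegral_swap (by
      have : Measurable fun r : ((Fin 2 → ℝ) × ℝ) × (Fin 2 → ℝ) => F ((s, r.1.1), (r.1.2, r.2)) := by fun_prop
      exact this.lintegral_prod_right'.aemeasurable)]
    refine lintegral_congr fun s' => ?_
    rw [lintegral_prod _ (by fun_prop)]
  have hq1 : ∫⁻ s, ENNReal.ofReal s ^ (-(γ / 2)) ∂Γ < ⊤ := lintegral_rpow_gammaMeasure_lt_top (by linarith)
  have hq2 : ∫⁻ s, ENNReal.ofReal s ∂Γ < ⊤ := by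
    have := lintegral_rpow_gammaMeasure_lt_top (a := α / 2) (q := 1) (by linarith)
    simpa using this
  calc _ ≤ ∫⁻ q, F q ∂(Γ.prod G).prod (Γ.prod G) := lintegral_mono fun q => tdist_rpow_le hγ0 _ _
    _ = ∫⁻ u, ∫⁻ p, F ((u.1, p.1), (u.2, p.2)) ∂G.prod G ∂Γ.prod Γ := h1
    _ ≤ ∫⁻ u, C * (ENNReal.ofReal u.1 ^ (-(γ / 2)) * ENNReal.ofReal u.2 ^ (-(γ / 2)) + (ENNReal.ofReal u.1 + ENNReal.ofReal u.2)) ∂Γ.prod Γ := by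
        refine lintegral_mono_ae ?_
        have h2 := ae_pos_gammaMeasure (α / 2)
        have h3 : ∀ᵐ u ∂Γ.prod Γ, 0 < u.1 := Measure.quasiMeasurePreserving_fst.ae h2
        have h4 : ∀ᵐ u ∂Γ.prod Γ, 0 < u.2 := Measure.quasiMeasurePreserving_snd.ae h2
        filter_upwards [h3, h4] with u hu hu'
        exact hb u.1 u.2 hu hu'
    _ = C * ((∫⁻ s, ENNReal.ofReal s ^ (-(γ / 2)) ∂Γ) * (∫⁻ s, ENNReal.ofReal s ^ (-(γ / 2)) ∂Γ) +
          ((∫⁻ s, ENNReal.ofReal s ∂Γ) + ∫⁻ s, ENNReal.ofReal s ∂Γ)) := by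
        rw [lintegral_const_mul _ (by fun_prop), lintegral_add_left (by fun_prop), lintegral_add_left (by fun_prop),
          lintegral_prod_mul (f := fun s : ℝ => ENNReal.ofReal s ^ (-(γ / 2)))
            (g := fun s : ℝ => ENNReal.ofReal s ^ (-(γ / 2))) (by fun_prop) (by fun_prop),
          measurePreserving_fst.lintegral_comp (f := fun s : ℝ => ENNReal.ofReal s) (by fun_prop),
          measurePreserving_snd.lintegral_comp (f := fun s : ℝ => ENNReal.ofReal s) (by fun_prop)]
    _ < ⊤ := by finiteness

end Bessel

/-! ### The joint law of the Fourier modes of the stochastic convolution -/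

section Law

open ProbabilityTheory

variable {Ω : Type*} [MeasurableSpace Ω] {P : Measure Ω}

/-- Every continuous linear functional on ℝ^D is a finite combination of coordinates, so these
integrals are the whole characteristic function. -/
lemma map_eq_of_integral_cexp {D : Type*} [Fintype D] [IsProbabilityMeasure P] {J : Ω → D → ℝ}
    (hJ : AEMeasurable J P) (s : D → ℝ)
    (h : ∀ c : D → ℝ, ∫ ω, Complex.exp (Complex.I * (∑ d, c d * J ω d : ℝ)) ∂P =
      Real.exp (-(∑ d, (c d * s d) ^ 2) / 2)) :
    P.map J = (gaussPi D).map (fun g d => s d * g d) := by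
  classical
  have hs : Measurable fun (g : D → ℝ) d => s d * g d := by fun_prop
  have := Measure.isProbabilityMeasure_map hJ
  have := Measure.isProbabilityMeasure_map (μ := gaussPi D) hs.aemeasurable
  refine Measure.ext_of_charFunDual ?_
  ext L
  have hL : ∀ x : D → ℝ, L x = ∑ d, L (Pi.single d 1) * x d := by
    intro x
    conv_lhs => rw [pi_eq_sum_univ x, map_sum]
    refine Finset.sum_congr rfl fun d _ => ?_
    rw [map_smul, smul_eq_mul, mul_comm]
    congr 2
    ext j
    simp [Pi.single_apply, eq_comm]
  rw [charFunDual_apply, charFunDual_apply, integral_map hJ (by fun_prop),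
    integral_map hs.aemeasurable (by fun_prop)]
  have h1 := h fun d => L (Pi.single d 1)
  have h2 := integral_cexp_gaussPi fun d => L (Pi.single d 1) * s d
  rw [← h2] at h1
  simp only [hL (J _), hL fun d => s d * _, mul_comm _ Complex.I, ← mul_assoc]
  exact h1

lemma integral_cexp_mul_gaussianReal (v : ℝ≥0) (c : ℝ) :
    ∫ x, Complex.exp (Complex.I * (c * x : ℝ)) ∂gaussianReal 0 v = (Real.exp (-(c ^ 2 * v) / 2) : ℝ) := by
  have h := charFun_gaussianReal (μ := 0) (v := v) c
  rw [charFun_apply_real] at h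
  rw [Complex.ofReal_exp]
  convert h using 2
  · ext x
    push_cast
    ring_nf
  · push_cast
    ring

lemma integral_cexp_riemannSum [IsProbabilityMeasure P] {X : ℝ≥0 → Ω → ℝ} (hX : IsPreBrownianReal X P) (f : ℝ → ℝ)
    {t : ℝ} (ht : 0 ≤ t) (m : ℕ) (c : ℝ) :
    ∫ ω, Complex.exp (Complex.I * (c * ∑ k ∈ Finset.range m, f (k * t / m) *
      (X (((k + 1 : ℕ) * t / m : ℝ).toNNReal) ω - X ((k * t / m : ℝ).toNNReal) ω) : ℝ)) ∂P =
      (Real.exp (-(c ^ 2 * ∑ k ∈ Finset.range m, f (k * t / m) ^ 2 * (t / m)) / 2) : ℝ) := by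
  set τ : ℕ → ℝ≥0 := fun k => ((k * t / m : ℝ)).toNNReal with hτ
  have hmono : Monotone τ := fun i j hij => by
    refine Real.toNNReal_le_toNNReal ?_
    gcongr
  have hind : iIndepFun (fun k ω => X (τ (k + 1)) ω - X (τ k) ω) P := hX.hasIndepIncrements.nat hmono
  have hind2 : iIndepFun (fun (k : Fin m) ω => X (τ (k + 1)) ω - X (τ k) ω) P :=
    hind.precomp (g := fun k : Fin m => (k : ℕ)) Fin.val_injective
  have hind3 : iIndepFun (fun (k : Fin m) ω => Complex.exp (Complex.I * (c * f (k * t / m) * (X (τ (k + 1)) ω - X (τ k) ω) : ℝ))) P :=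
    hind2.comp (fun k x => Complex.exp (Complex.I * (c * f (k * t / m) * x : ℝ))) fun k => by fun_prop
  have hXm : ∀ s, AEMeasurable (X s) P := hX.aemeasurable
  have h1 : ∀ ω, Complex.exp (Complex.I * (c * ∑ k ∈ Finset.range m, f (k * t / m) *
      (X (((k + 1 : ℕ) * t / m : ℝ).toNNReal) ω - X ((k * t / m : ℝ).toNNReal) ω) : ℝ)) =
      ∏ k : Fin m, Complex.exp (Complex.I * (c * f (k * t / m) * (X (τ (k + 1)) ω - X (τ k) ω) : ℝ)) := by
    intro ω
    rw [← Complex.exp_sum, ← Finset.mul_sum, ← Complex.ofReal_sum, Finset.mul_sum,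
      ← Fin.sum_univ_eq_sum_range (fun k => c * (f (k * t / m) *
      (X (((k + 1 : ℕ) * t / m : ℝ).toNNReal) ω - X ((k * t / m : ℝ).toNNReal) ω)))]
    simp only [mul_assoc, hτ]
  simp_rw [h1]
  rw [hind3.integral_fun_prod_eq_prod_integral (fun k => by
    have h1 := hXm (τ (k + 1))
    have h2 := hXm (τ k)
    have h3 : AEMeasurable (fun ω => Complex.exp (Complex.I * (c * f (k * t / m) * (X (τ (k + 1)) ω - X (τ k) ω) : ℝ))) P := by fun_prop
    exact h3.aestronglyMeasurable)]
  have h2 : ∀ k : Fin m, ∫ ω, Complex.exp (Complex.I * (c * f (k * t / m) * (X (τ (k + 1)) ω - X (τ k) ω) : ℝ)) ∂P =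
      (Real.exp (-(c ^ 2 * (f (k * t / m) ^ 2 * (t / m))) / 2) : ℝ) := by
    intro k
    have h3 := (hX.hasLaw_sub (τ (k + 1)) (τ k)).integral_comp (f := fun x : ℝ => Complex.exp (Complex.I * (c * f (k * t / m) * x : ℝ))) (by fun_prop)
    refine h3.trans ?_
    rw [integral_cexp_mul_gaussianReal]
    congr 4
    have h4 : ((nndist (τ (k + 1) : ℝ) (τ k) : ℝ≥0) : ℝ) = t / m := by
      rw [coe_nndist, hτ]
      simp only
      rw [Real.coe_toNNReal _ (by positivity), Real.coe_toNNReal _ (by positivity), Real.dist_eq]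
      have : ((k + 1 : ℕ) : ℝ) * t / m - k * t / m = t / m := by push_cast; ring
      rw [this, abs_of_nonneg (by positivity)]
    exact (congrArg (fun y => (c * f (k * t / m)) ^ 2 * y) h4).trans (by ring)
  simp_rw [h2]
  rw [← Complex.ofReal_prod, ← Real.exp_sum, Finset.mul_sum, ← Fin.sum_univ_eq_sum_range (fun k => c ^ 2 * (f (k * t / m) ^ 2 * (t / m))),
    ← Finset.sum_div, Finset.sum_neg_distrib]

/-- This is `tendsto_riemannSum` for f² with the identity as integrator; one integration by parts
identifies the limit. -/
lemma tendsto_sum_sq_riemann {f f' : ℝ → ℝ} (hf : ∀ s, HasDerivAt f (f' s) s)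
    (hf' : Continuous f') {t : ℝ} (ht : 0 ≤ t) :
    Tendsto (fun m : ℕ => ∑ k ∈ Finset.range m, f (k * t / m) ^ 2 * (t / m)) atTop
      (𝓝 (∫ s in (0 : ℝ)..t, f s ^ 2)) := by
  have hfc : Continuous f := continuous_iff_continuousAt.2 fun s => (hf s).continuousAt
  have hd : ∀ s, HasDerivAt (fun s => f s ^ 2) (2 * f s * f' s) s := fun s => by
    refine ((hf s).fun_pow 2).congr_deriv ?_
    ring
  have h := tendsto_riemannSum hd (by fun_prop) (b := fun s => ((s : ℝ) : ℂ)) (by fun_prop) ht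
  have h1 : ∀ m, riemannSum (fun s => f s ^ 2) (fun s => ((s : ℝ) : ℂ)) t m =
      ((∑ k ∈ Finset.range m, f (k * t / m) ^ 2 * (t / m) : ℝ) : ℂ) := by
    intro m
    rw [riemannSum, Complex.ofReal_sum]
    refine Finset.sum_congr rfl fun k _ => ?_
    rw [Real.coe_toNNReal _ (by positivity), Real.coe_toNNReal _ (by positivity), ← Complex.ofReal_sub, ← Complex.ofReal_mul]
    congr 2
    push_cast
    ring
  have h2 : ((f t ^ 2 : ℝ) : ℂ) * ((t.toNNReal : ℝ) : ℂ) - ((f 0 ^ 2 : ℝ) : ℂ) * (((0 : ℝ≥0) : ℝ) : ℂ) -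
      ∫ s in (0 : ℝ)..t, ((2 * f s * f' s : ℝ) : ℂ) * ((s.toNNReal : ℝ) : ℂ) =
      ((∫ s in (0 : ℝ)..t, f s ^ 2 : ℝ) : ℂ) := by
    have h3 : ∫ s in (0 : ℝ)..t, ((2 * f s * f' s : ℝ) : ℂ) * ((s.toNNReal : ℝ) : ℂ) =
        ((∫ s in (0 : ℝ)..t, s * (2 * f s * f' s) : ℝ) : ℂ) := by
      rw [← intervalIntegral.integral_ofReal]
      refine intervalIntegral.integral_congr fun s hs => ?_
      rw [Set.uIcc_of_le ht] at hs
      rw [Real.coe_toNNReal _ hs.1, ← Complex.ofReal_mul, mul_comm]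
    have h4 := intervalIntegral.integral_mul_deriv_eq_deriv_mul (a := 0) (b := t) (u := fun s : ℝ => s) (u' := fun _ => 1)
      (v := fun s => f s ^ 2) (v' := fun s => 2 * f s * f' s)
      (fun s _ => hasDerivAt_id s) (fun s _ => hd s) (Continuous.intervalIntegrable (by fun_prop) _ _)
      (Continuous.intervalIntegrable (by fun_prop) _ _)
    rw [h3, h4, Real.coe_toNNReal _ ht]
    simp
    ring
  rw [h2] at h
  rw [show riemannSum (fun s => f s ^ 2) (fun s => ((s : ℝ) : ℂ)) t = _ from funext h1] at h
  exact_mod_cast (Complex.continuous_re.tendsto _).comp h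

/-- The coefficient `∫_0^t K_ε(n,t-t') dB_n(t')` of the stochastic convolution. -/
def convMode (B : Freq → ℝ≥0 → Ω → ℂ) (ε t : ℝ) (n : Freq) (ω : Ω) : ℂ :=
  wienerIntegral (fun s => duhamelSymbol ε n (t - s)) (fun s => B n s ω) t

/-- The variances of the real (`false`) and imaginary (`true`) parts of `B_n(1)`. -/
def partVar (n : Freq) (b : Bool) : ℝ := if n = 0 then (if b then 0 else 1) else 1 / 2

lemma partVar_nonneg (n : Freq) (b : Bool) : 0 ≤ partVar n b := by
  unfold partVar; split_ifs <;> norm_num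

/-- The real and imaginary parts of a complex number. -/
def part (b : Bool) (z : ℂ) : ℝ := if b then z.im else z.re

lemma continuous_part (b : Bool) : Continuous (part b) := by
  cases b
  · exact Complex.continuous_re
  · exact Complex.continuous_im

lemma part_riemannSum (b : Bool) (f : ℝ → ℝ) (w : ℝ≥0 → ℂ) (t : ℝ) (m : ℕ) :
    part b (riemannSum f w t m) = ∑ k ∈ Finset.range m, f (k * t / m) *
      (part b (w (((k + 1 : ℕ) * t / m : ℝ).toNNReal)) - part b (w ((k * t / m : ℝ).toNNReal))) := by
  cases b <;> simp [part, riemannSum, Complex.re_sum, Complex.im_sum]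

namespace IsCylindricalWiener

variable {B : Freq → ℝ≥0 → Ω → ℂ} [IsProbabilityMeasure P]

lemma aemeasurable_riemannSum (hB : IsCylindricalWiener B P) (f : ℝ → ℝ) (n : Freq) (t : ℝ) (m : ℕ) :
    AEMeasurable (fun ω => riemannSum f (fun s => B n s ω) t m) P := by
  have h := hB.aemeasurable n
  unfold riemannSum
  refine Finset.aemeasurable_fun_sum _ fun k _ => ?_
  exact ((h _).sub (h _)).const_mul _

lemma integral_cexp_part (hB : IsCylindricalWiener B P) (f : ℝ → ℝ) (n : Freq) (b : Bool) {t : ℝ}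
    (ht : 0 ≤ t) (m : ℕ) (c : ℝ) :
    ∫ ω, Complex.exp (Complex.I * (c * part b (riemannSum f (fun s => B n s ω) t m) : ℝ)) ∂P =
      (Real.exp (-(c ^ 2 * partVar n b * ∑ k ∈ Finset.range m, f (k * t / m) ^ 2 * (t / m)) / 2) : ℝ) := by
  simp only [part_riemannSum]
  by_cases hn : n = 0
  · subst hn
    cases b
    · have h := integral_cexp_riemannSum hB.brownian_zero.toIsPreBrownianReal f ht m c
      simpa [part, partVar] using h
    · simp [part, partVar, hB.im_zero]
  · have h2 : Real.sqrt 2 ≠ 0 := by positivity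
    have key : ∀ X : ℝ≥0 → Ω → ℝ, IsBrownianReal (fun t ω => Real.sqrt 2 * X t ω) P →
        ∫ ω, Complex.exp (Complex.I * (c * ∑ k ∈ Finset.range m, f (k * t / m) *
        (X (((k + 1 : ℕ) * t / m : ℝ).toNNReal) ω - X ((k * t / m : ℝ).toNNReal) ω) : ℝ)) ∂P =
      (Real.exp (-(c ^ 2 * (1 / 2) * ∑ k ∈ Finset.range m, f (k * t / m) ^ 2 * (t / m)) / 2) : ℝ) := by
      intro X hX
      have h := integral_cexp_riemannSum hX.toIsPreBrownianReal f ht m (c / Real.sqrt 2)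
      have e1 : (c / Real.sqrt 2) ^ 2 = c ^ 2 * (1 / 2) := by
        rw [div_pow, Real.sq_sqrt zero_le_two]; ring
      rw [e1] at h
      rw [← h]
      congr 1
      ext ω
      congr 3
      rw [Finset.mul_sum, Finset.mul_sum]
      refine Finset.sum_congr rfl fun k _ => ?_
      field_simp
    have hp : partVar n b = 1 / 2 := if_neg hn
    rw [hp]
    cases b
    · exact key _ (hB.brownian_re n hn)
    · exact key _ (hB.brownian_im n hn)

lemma integral_cexp_parts (hB : IsCylindricalWiener B P) (f : ℝ → ℝ) (n : Freq) {t : ℝ}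
    (ht : 0 ≤ t) (m : ℕ) (c : Bool → ℝ) :
    ∫ ω, Complex.exp (Complex.I * (∑ b, c b * part b (riemannSum f (fun s => B n s ω) t m) : ℝ)) ∂P =
      ∏ b, ((Real.exp (-(c b ^ 2 * partVar n b * ∑ k ∈ Finset.range m, f (k * t / m) ^ 2 * (t / m)) / 2) : ℝ) : ℂ) := by
  have h1 : ∀ ω, Complex.exp (Complex.I * (∑ b, c b * part b (riemannSum f (fun s => B n s ω) t m) : ℝ)) =
      Complex.exp (Complex.I * (c false * part false (riemannSum f (fun s => B n s ω) t m) : ℝ)) *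
      Complex.exp (Complex.I * (c true * part true (riemannSum f (fun s => B n s ω) t m) : ℝ)) := by
    intro ω
    rw [← Complex.exp_add, Fintype.sum_bool]
    congr 1
    push_cast
    ring
  simp_rw [h1]
  have hmeas : ∀ b, AEStronglyMeasurable (fun ω => Complex.exp (Complex.I * (c b * part b (riemannSum f (fun s => B n s ω) t m) : ℝ))) P := by
    intro b
    have h := hB.aemeasurable_riemannSum f n t m
    have hc : Continuous fun z : ℂ => Complex.exp (Complex.I * (c b * part b z : ℝ)) := by
      have := continuous_part b
      fun_prop
    exact (hc.measurable.comp_aemeasurable h).aestronglyMeasurable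
  rw [Fintype.prod_bool, ← hB.integral_cexp_part f n true ht m, ← hB.integral_cexp_part f n false ht m, mul_comm (∫ _, _ ∂P)]
  refine IndepFun.integral_fun_mul_eq_mul_integral ?_ (hmeas false) (hmeas true)
  by_cases hn : n = 0
  · subst hn
    have h0 : ∀ ω, part true (riemannSum f (fun s => B 0 s ω) t m) = 0 := fun ω => by
      rw [part_riemannSum]
      simp [part, hB.im_zero]
    simp only [h0]
    exact indepFun_const_right _ _
  · have h := (hB.indep_re_im n hn).comp
      (φ := fun w : ℝ≥0 → ℝ => Complex.exp (Complex.I * (c false * ∑ k ∈ Finset.range m, f (k * t / m) *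
      (w (((k + 1 : ℕ) * t / m : ℝ).toNNReal) - w ((k * t / m : ℝ).toNNReal)) : ℝ)))
      (ψ := fun w : ℝ≥0 → ℝ => Complex.exp (Complex.I * (c true * ∑ k ∈ Finset.range m, f (k * t / m) *
      (w (((k + 1 : ℕ) * t / m : ℝ).toNNReal) - w ((k * t / m : ℝ).toNNReal)) : ℝ)))
      (by fun_prop) (by fun_prop)
    simp only [part_riemannSum]
    exact h

lemma integral_cexp_modes (hB : IsCylindricalWiener B P) (f : Freq → ℝ → ℝ) (M : ℕ) {t : ℝ}
    (ht : 0 ≤ t) (m : ℕ) (c : halfBox M × Bool → ℝ) :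
    ∫ ω, Complex.exp (Complex.I * (∑ d, c d * part d.2 (riemannSum (f d.1) (fun s => B d.1 s ω) t m) : ℝ)) ∂P =
      (Real.exp (-(∑ d, c d ^ 2 * partVar d.1 d.2 * ∑ k ∈ Finset.range m, f d.1 (k * t / m) ^ 2 * (t / m)) / 2) : ℝ) := by
  set Φ : halfBox M → (ℝ≥0 → ℂ) → ℂ := fun n w =>
    Complex.exp (Complex.I * (∑ b, c (n, b) * part b (riemannSum (f n) w t m) : ℝ)) with hΦ
  have hpart : ∀ b, Measurable (part b) := fun b => (continuous_part b).measurable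
  have hΦm : ∀ n, Measurable (Φ n) := by
    intro n
    have h1 : Measurable fun w : ℝ≥0 → ℂ => riemannSum (f n) w t m := by
      unfold riemannSum
      fun_prop
    have h2 : ∀ b, Measurable fun w : ℝ≥0 → ℂ => part b (riemannSum (f n) w t m) := fun b => (hpart b).comp h1
    have h3 : Measurable fun w : ℝ≥0 → ℂ => ∑ b, c (n, b) * part b (riemannSum (f n) w t m) :=
      Finset.measurable_fun_sum _ fun b _ => (h2 b).const_mul _
    fun_prop
  have hind : iIndepFun (fun (n : halfBox M) ω => Φ n (fun s => B n s ω)) P := by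
    have h1 := hB.indep.precomp (g := fun n : halfBox M => (⟨n.1, (mem_halfBox.1 n.2).2⟩ : halfLattice))
      (fun n n' h => Subtype.ext (congrArg (fun q : halfLattice => q.1) h))
    exact h1.comp Φ hΦm
  have h1 : ∀ ω, Complex.exp (Complex.I * (∑ d : halfBox M × Bool, c d * part d.2 (riemannSum (f d.1) (fun s => B d.1 s ω) t m) : ℝ)) =
      ∏ n, Φ n (fun s => B n s ω) := by
    intro ω
    rw [hΦ, ← Complex.exp_sum, ← Finset.mul_sum, ← Complex.ofReal_sum, Fintype.sum_prod_type]
  simp_rw [h1]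
  rw [hind.integral_fun_prod_eq_prod_integral]
  · have h2 : ∀ n : halfBox M, ∫ ω, Φ n (fun s => B n s ω) ∂P = _ := fun n =>
      hB.integral_cexp_parts (f n) n ht m (fun b => c (n, b))
    simp_rw [h2]
    rw [← Fintype.prod_prod_type' (f := fun (n : halfBox M) (b : Bool) => ((Real.exp (-(c (n, b) ^ 2 * partVar n b *
      ∑ k ∈ Finset.range m, f n (k * t / m) ^ 2 * (t / m)) / 2) : ℝ) : ℂ)), ← Complex.ofReal_prod, ← Real.exp_sum,
      ← Finset.sum_div, Finset.sum_neg_distrib]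
  · intro n
    have h := hB.aemeasurable_riemannSum (f n) n t m
    have hc : Continuous fun z : ℂ => Complex.exp (Complex.I * (∑ b, c (n, b) * part b z : ℝ)) := by
      have := continuous_part
      fun_prop
    exact (hc.measurable.comp_aemeasurable h).aestronglyMeasurable

/-- Continuity of the paths alone gives the convergence, so a single null set serves all ε, t and n.
-/
lemma ae_tendsto_riemannSum (hB : IsCylindricalWiener B P) :
    ∀ᵐ ω ∂P, ∀ ε, 0 ≤ ε → ∀ t, 0 ≤ t → ∀ n, Tendsto
      (riemannSum (fun s => duhamelSymbol ε n (t - s)) (fun s => B n s ω) t) atTop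
        (𝓝 (convMode B ε t n ω)) := by
  filter_upwards [hB.ae_regular] with ω hω ε hε t ht n
  have hd : ∀ s, HasDerivAt (fun s => duhamelSymbol ε n (t - s)) (-duhamelDeriv ε n (t - s)) s := fun s => by
    exact ((hasDerivAt_duhamelSymbol hε n (t - s)).comp s ((hasDerivAt_id s).const_sub t)).congr_deriv (by ring)
  have hc : Continuous fun s => -duhamelDeriv ε n (t - s) :=
    ((continuous_duhamelDeriv hε n).comp (by fun_prop)).neg
  have h := tendsto_riemannSum hd hc (hω n).1 ht
  rw [convMode, wienerIntegral, h.limUnder_eq]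
  exact h

lemma aemeasurable_convMode (hB : IsCylindricalWiener B P) {ε t : ℝ} (hε : 0 ≤ ε) (ht : 0 ≤ t) (n : Freq) :
    AEMeasurable (convMode B ε t n) P := by
  refine aemeasurable_of_tendsto_metrizable_ae atTop
    (fun m => hB.aemeasurable_riemannSum (fun s => duhamelSymbol ε n (t - s)) n t m) ?_
  filter_upwards [hB.ae_tendsto_riemannSum] with ω hω
  exact hω ε hε t ht n

/-- The real and imaginary parts of the modes in a half box. -/
def _root_.SmoluchowskiKramers.modeParts (B : Freq → ℝ≥0 → Ω → ℂ) (M : ℕ) (ε t : ℝ) (ω : Ω) (d : halfBox M × Bool) : ℝ :=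
  part d.2 (convMode B ε t d.1 ω)

/-- The standard deviations of `modeParts`. -/
def _root_.SmoluchowskiKramers.partStd (M : ℕ) (ε t : ℝ) (d : halfBox M × Bool) : ℝ :=
  Real.sqrt (partVar d.1 d.2 * modeVar ε d.1 t)

lemma aemeasurable_modeParts (hB : IsCylindricalWiener B P) (M : ℕ) {ε t : ℝ} (hε : 0 ≤ ε) (ht : 0 ≤ t) :
    AEMeasurable (modeParts B M ε t) P :=
  aemeasurable_pi_iff.2 fun d => (continuous_part d.2).measurable.comp_aemeasurable (hB.aemeasurable_convMode hε ht d.1)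

/-- The characteristic functions of the Riemann sums are explicit, by independence of the
increments, of the modes and of the real and imaginary parts. They are bounded by 1, so dominated
convergence passes to the limit. -/
lemma map_modeParts (hB : IsCylindricalWiener B P) (M : ℕ) {ε t : ℝ} (hε : 0 ≤ ε) (ht : 0 ≤ t) :
    P.map (modeParts B M ε t) = (gaussPi (halfBox M × Bool)).map (fun g d => partStd M ε t d * g d) := by
  refine map_eq_of_integral_cexp (hB.aemeasurable_modeParts M hε ht) _ fun c => ?_
  set f : Freq → ℝ → ℝ := fun n s => duhamelSymbol ε n (t - s) with hf
  have h1 := fun m => hB.integral_cexp_modes f M ht m c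
  have hvar : ∀ n, Tendsto (fun m : ℕ => ∑ k ∈ Finset.range m, f n (k * t / m) ^ 2 * (t / m)) atTop
      (𝓝 (modeVar ε n t)) := by
    intro n
    have hd : ∀ s, HasDerivAt (f n) (-duhamelDeriv ε n (t - s)) s := fun s => by
      exact ((hasDerivAt_duhamelSymbol hε n (t - s)).comp s ((hasDerivAt_id s).const_sub t)).congr_deriv (by ring)
    have hc : Continuous fun s => -duhamelDeriv ε n (t - s) :=
      ((continuous_duhamelDeriv hε n).comp (by fun_prop)).neg
    have h := tendsto_sum_sq_riemann hd hc ht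
    have e : ∫ s in (0 : ℝ)..t, f n s ^ 2 = modeVar ε n t := by
      rw [modeVar, hf]
      have := intervalIntegral.integral_comp_sub_left (a := 0) (b := t) (fun s => duhamelSymbol ε n s ^ 2) t
      simpa using this
    rwa [e] at h
  have hR : Tendsto (fun m : ℕ => ((Real.exp (-(∑ d : halfBox M × Bool, c d ^ 2 * partVar d.1 d.2 * ∑ k ∈ Finset.range m, f d.1 (k * t / m) ^ 2 * (t / m)) / 2) : ℝ) : ℂ))
      atTop (𝓝 ((Real.exp (-(∑ d, (c d * partStd M ε t d) ^ 2) / 2) : ℝ) : ℂ)) := by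
    have e : ∀ d : halfBox M × Bool, (c d * partStd M ε t d) ^ 2 = c d ^ 2 * partVar d.1 d.2 * modeVar ε d.1 t := by
      intro d
      rw [mul_pow, partStd, Real.sq_sqrt (mul_nonneg (partVar_nonneg _ _) (modeVar_nonneg ε _ ht)), mul_assoc]
    simp_rw [e]
    refine (Complex.continuous_ofReal.tendsto _).comp ((Real.continuous_exp.tendsto _).comp (Tendsto.div_const (Tendsto.neg ?_) _))
    exact tendsto_finsetSum _ fun d _ => (hvar d.1).const_mul _
  have hL : Tendsto (fun m : ℕ => ∫ ω, Complex.exp (Complex.I * (∑ d : halfBox M × Bool, c d * part d.2 (riemannSum (f d.1) (fun s => B d.1 s ω) t m) : ℝ)) ∂P)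
      atTop (𝓝 (∫ ω, Complex.exp (Complex.I * (∑ d, c d * modeParts B M ε t ω d : ℝ)) ∂P)) := by
    refine tendsto_integral_of_dominated_convergence (fun _ => 1) (fun m => ?_) (integrable_const _) (fun m => ?_) ?_
    · have h2 : ∀ d : halfBox M × Bool, AEMeasurable (fun ω => part d.2 (riemannSum (f d.1) (fun s => B d.1 s ω) t m)) P := fun d =>
        (continuous_part d.2).measurable.comp_aemeasurable (hB.aemeasurable_riemannSum (f d.1) d.1 t m)
      have h3 : AEMeasurable (fun ω => ∑ d : halfBox M × Bool, c d * part d.2 (riemannSum (f d.1) (fun s => B d.1 s ω) t m)) P :=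
        Finset.aemeasurable_fun_sum _ fun d _ => (h2 d).const_mul _
      have h4 : AEMeasurable (fun ω => Complex.exp (Complex.I * (∑ d : halfBox M × Bool, c d * part d.2 (riemannSum (f d.1) (fun s => B d.1 s ω) t m) : ℝ))) P := by
        fun_prop
      exact h4.aestronglyMeasurable
    · refine ae_of_all _ fun ω => ?_
      rw [mul_comm, Complex.norm_exp_ofReal_mul_I]
    · filter_upwards [hB.ae_tendsto_riemannSum] with ω hω
      have hc : Continuous fun x : ℝ => Complex.exp (Complex.I * (x : ℂ)) := by fun_prop
      refine (hc.tendsto _).comp (tendsto_finsetSum _ fun d _ => Tendsto.const_mul _ ?_)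
      exact ((continuous_part d.2).tendsto _).comp (hω ε hε t ht d.1)
  exact tendsto_nhds_unique hL (by simpa only [h1] using hR)

end IsCylindricalWiener

end Law

/-! ### The covariance of the high frequencies under the Bessel measure -/

section Covariance

lemma echar_sub (n m : Freq) (x : Torus) : echar (n - m) x = echar n x * conj (echar m x) := by
  rw [sub_eq_add_neg, ← echar_neg]
  have h0 : ∀ i, unitPt x i ≠ 0 := fun i h => by simpa [h] using norm_unitPt x i
  simp only [echar_eq, Pi.add_apply, zpow_add₀ (h0 0), zpow_add₀ (h0 1)]
  ring

/-- Split at distance r from n: nearby there are at most 9r² points of weight at most 1, and each of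
the at most 9R² others weighs at most r^{-2α}. -/
lemma sum_bracket_sub_le {α : ℝ} (hα : 0 < α) (S : Finset Freq) {R r : ℝ} (hr : 1 ≤ r)
    (hS : ∀ n ∈ S, bracket n ≤ R) (n : Freq) :
    ∑ k ∈ S, bracket (n - k) ^ (-(2 * α)) ≤ 9 * r ^ 2 + 9 * R ^ 2 * r ^ (-(2 * α)) := by
  classical
  rw [← Finset.sum_filter_add_sum_filter_not S (fun k => bracket (n - k) ≤ r)]
  refine add_le_add ?_ ?_
  · have h1 : ((S.filter fun k => bracket (n - k) ≤ r).card : ℝ) ≤ 9 * r ^ 2 := by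
      rw [← Finset.card_image_of_injective _ (sub_right_injective (b := n))]
      refine card_bracket_le fun k hk => ?_
      obtain ⟨l, hl, rfl⟩ := Finset.mem_image.1 hk
      exact (Finset.mem_filter.1 hl).2
    refine le_trans (Finset.sum_le_card_nsmul _ _ 1 fun k _ => ?_) (by simpa using h1)
    exact Real.rpow_le_one_of_one_le_of_nonpos (one_le_bracket _) (by linarith)
  · have h1 : ((S.filter fun k => ¬ bracket (n - k) ≤ r).card : ℝ) ≤ 9 * R ^ 2 :=
      card_bracket_le fun k hk => hS k (Finset.mem_filter.1 hk).1
    refine le_trans (Finset.sum_le_card_nsmul _ _ (r ^ (-(2 * α))) fun k hk => ?_) ?_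
    · exact Real.rpow_le_rpow_of_nonpos (by linarith) (not_le.1 (Finset.mem_filter.1 hk).2).le
        (by linarith)
    · rw [nsmul_eq_mul]
      gcongr

/-- Squaring the sum produces the characters e_{n-m}(x) conj e_{n-m}(y), whose integral under ν⊗ν is
⟨n-m⟩^{-2α}. The covariance in L²(ν⊗ν) is thus a double lattice sum. -/
lemma lintegral_sq_sum_echar_le {α : ℝ} (hα : 0 < α) (S : Finset Freq) (c : Freq → ℝ) {D R r : ℝ}
    (hr : 1 ≤ r) (hc0 : ∀ n ∈ S, 0 ≤ c n) (hcD : ∀ n ∈ S, c n ≤ D) (hD : 0 ≤ D)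
    (hS : ∀ n ∈ S, bracket n ≤ R) :
    ∫⁻ z : Torus × Torus, ENNReal.ofReal |(4 * Real.pi ^ 2)⁻¹ *
      ∑ n ∈ S, c n * (displ z.1 z.2 0 ^ n 0 * displ z.1 z.2 1 ^ n 1).re| ^ 2
        ∂(besselMeasure α).prod (besselMeasure α) ≤
      ENNReal.ofReal (9 * R ^ 2 * D * (D * (9 * r ^ 2 + 9 * R ^ 2 * r ^ (-(2 * α))))) := by
  have := isProbabilityMeasure_besselMeasure hα
  set ν := besselMeasure α
  set F : Torus × Torus → ℝ := fun z => ‖∑ n ∈ S, (c n : ℂ) * (echar n z.1 * conj (echar n z.2))‖ ^ 2 with hF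
  have hFc : Continuous F := by
    have := continuous_echar
    fun_prop
  have hFexp : ∀ z, (F z : ℂ) = ∑ n ∈ S, ∑ m ∈ S, ((c n * c m : ℝ) : ℂ) *
      (echar (n - m) z.1 * conj (echar (n - m) z.2)) := by
    intro z
    rw [hF]
    push_cast
    rw [← Complex.mul_conj', map_sum, Finset.sum_mul_sum]
    refine Finset.sum_congr rfl fun n _ => Finset.sum_congr rfl fun m _ => ?_
    rw [echar_sub, echar_sub]
    simp only [map_mul, Complex.conj_conj, Complex.conj_ofReal]
    ring
  have hint : ∀ n, Integrable (fun z : Torus × Torus => echar n z.1 * conj (echar n z.2)) (ν.prod ν) := by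
    intro n
    have := continuous_echar n
    refine Integrable.of_bound (Continuous.aestronglyMeasurable (by fun_prop)) 1 (ae_of_all _ fun z => ?_)
    rw [norm_mul, RCLike.norm_conj, norm_echar, norm_echar, mul_one]
  have hintv : ∀ n, ∫ z : Torus × Torus, echar n z.1 * conj (echar n z.2) ∂ν.prod ν =
      ((bracket n ^ (-(2 * α)) : ℝ) : ℂ) := by
    intro n
    rw [integral_prod_mul (echar n) (fun y => conj (echar n y)), integral_conj, integral_echar_besselMeasure hα,
      Complex.conj_ofReal, ← Complex.ofReal_mul, ← Real.rpow_add (bracket_pos n)]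
    congr 2
    ring
  have hFI : ∫ z, F z ∂ν.prod ν = ∑ n ∈ S, ∑ m ∈ S, c n * c m * bracket (n - m) ^ (-(2 * α)) := by
    have h1 : ((∫ z, F z ∂ν.prod ν : ℝ) : ℂ) = ((∑ n ∈ S, ∑ m ∈ S, c n * c m * bracket (n - m) ^ (-(2 * α)) : ℝ) : ℂ) := by
      rw [← integral_complex_ofReal]
      simp_rw [hFexp]
      rw [integral_finsetSum _ fun n _ => integrable_finsetSum _ fun m _ => (hint _).const_mul _]
      push_cast
      refine Finset.sum_congr rfl fun n _ => ?_
      rw [integral_finsetSum _ fun m _ => (hint _).const_mul _]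
      refine Finset.sum_congr rfl fun m _ => ?_
      rw [integral_const_mul, hintv]
    exact_mod_cast h1
  have hFint : Integrable F (ν.prod ν) := by
    refine Integrable.of_bound hFc.aestronglyMeasurable ((∑ n ∈ S, |c n|) ^ 2) (ae_of_all _ fun z => ?_)
    rw [Real.norm_of_nonneg (sq_nonneg _)]
    refine pow_le_pow_left₀ (norm_nonneg _) ((norm_sum_le _ _).trans (le_of_eq ?_)) 2
    refine Finset.sum_congr rfl fun n _ => ?_
    rw [norm_mul, norm_mul, RCLike.norm_conj, norm_echar, norm_echar, mul_one, mul_one, Complex.norm_real, Real.norm_eq_abs]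
  have hpw : ∀ z : Torus × Torus, ENNReal.ofReal |(4 * Real.pi ^ 2)⁻¹ *
      ∑ n ∈ S, c n * (displ z.1 z.2 0 ^ n 0 * displ z.1 z.2 1 ^ n 1).re| ^ 2 ≤ ENNReal.ofReal (F z) := by
    intro z
    rw [← ENNReal.ofReal_pow (abs_nonneg _)]
    refine ENNReal.ofReal_le_ofReal (pow_le_pow_left₀ (abs_nonneg _) ?_ 2)
    have hpi := Real.pi_gt_three
    have h1 : ∑ n ∈ S, c n * (displ z.1 z.2 0 ^ n 0 * displ z.1 z.2 1 ^ n 1).re =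
        (∑ n ∈ S, (c n : ℂ) * (echar n z.1 * conj (echar n z.2))).re := by
      rw [Complex.re_sum]
      refine Finset.sum_congr rfl fun n _ => ?_
      rw [Complex.re_ofReal_mul, echar_mul_conj]
    rw [h1, abs_mul, abs_of_pos (by positivity)]
    have h2 : (4 * Real.pi ^ 2)⁻¹ ≤ 1 := inv_le_one_of_one_le₀ (by nlinarith)
    exact (mul_le_of_le_one_left (abs_nonneg _) h2).trans (Complex.abs_re_le_norm _)
  refine (lintegral_mono hpw).trans ?_
  rw [← ofReal_integral_eq_lintegral_ofReal hFint (ae_of_all _ fun z => sq_nonneg _), hFI]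
  refine ENNReal.ofReal_le_ofReal ?_
  have hinner : ∀ n ∈ S, ∑ m ∈ S, c n * c m * bracket (n - m) ^ (-(2 * α)) ≤
      D * (D * (9 * r ^ 2 + 9 * R ^ 2 * r ^ (-(2 * α)))) := by
    intro n hn
    calc _ ≤ ∑ m ∈ S, D * (D * bracket (n - m) ^ (-(2 * α))) := by
          refine Finset.sum_le_sum fun m hm => ?_
          rw [mul_assoc]
          have hb : 0 ≤ bracket (n - m) ^ (-(2 * α)) := Real.rpow_nonneg (bracket_pos _).le _
          have := hc0 m hm
          exact mul_le_mul (hcD n hn) (mul_le_mul_of_nonneg_right (hcD m hm) hb) (by positivity) hD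
      _ = D * (D * ∑ m ∈ S, bracket (n - m) ^ (-(2 * α))) := by rw [Finset.mul_sum, Finset.mul_sum]
      _ ≤ _ := by
          gcongr
          exact sum_bracket_sub_le hα S hr hS n
  refine (Finset.sum_le_card_nsmul _ _ _ hinner).trans ?_
  rw [nsmul_eq_mul]
  have h0 : (0 : ℝ) ≤ D * (D * (9 * r ^ 2 + 9 * R ^ 2 * r ^ (-(2 * α)))) := by positivity
  calc _ ≤ 9 * R ^ 2 * (D * (D * (9 * r ^ 2 + 9 * R ^ 2 * r ^ (-(2 * α))))) :=
        mul_le_mul_of_nonneg_right (card_bracket_le hS) h0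
    _ = _ := by ring

end Covariance

/-! ### The stochastic convolution as a function of its modes -/

section Field

/-- The trigonometric polynomial with cut-off `k` and modes with real and imaginary parts `J`. -/
def modeField (k : Freq → ℝ) (M : ℕ) (J : halfBox M × Bool → ℝ) (x : Torus) : ℝ :=
  ∑ d : halfBox M × Bool, multiplicity d.1 * k d.1 / (2 * Real.pi) *
    (if d.2 then -(echar d.1 x).im else (echar d.1 x).re) * J d

/-- The variance of `modeField`. -/
def fieldVar (k : Freq → ℝ) (M : ℕ) (ε t : ℝ) : ℝ :=
  (4 * Real.pi ^ 2)⁻¹ * ∑ n ∈ freqBox M, k n ^ 2 * modeVar ε n t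

/-- The renormalized imaginary exponential of `modeField`. -/
def modeChaos (β : ℝ) (k : Freq → ℝ) (M : ℕ) (ε t : ℝ) (J : halfBox M × Bool → ℝ) (x : Torus) : ℂ :=
  (Real.exp (β ^ 2 / 2 * fieldVar k M ε t) : ℂ) * Complex.exp (Complex.I * β * modeField k M J x)

lemma duhamelSymbol_neg (ε : ℝ) (n : Freq) : duhamelSymbol ε (-n) = duhamelSymbol ε n := by
  ext t
  simp only [duhamelSymbol, waveSymbol, lowFreq, highFreq, bracket_neg]

lemma modeVar_neg (ε : ℝ) (n : Freq) (t : ℝ) : modeVar ε (-n) t = modeVar ε n t := by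
  simp only [modeVar, duhamelSymbol_neg]

lemma sum_re_eq_modeField {k : Freq → ℝ} (hk : ∀ n, k (-n) = k n) {I : Freq → ℂ}
    (hI : ∀ n, I (-n) = conj (I n)) (M : ℕ) (x : Torus) :
    (∑ n ∈ freqBox M, (k n : ℂ) * I n * torusChar n x).re =
      modeField k M (fun d => part d.2 (I d.1)) x := by
  have hterm : ∀ n, ((k n : ℂ) * I n * torusChar n x).re =
      k n / (2 * Real.pi) * ((I n).re * (echar n x).re - (I n).im * (echar n x).im) := by
    intro n
    have e : (k n : ℂ) * I n * torusChar n x = ((k n / (2 * Real.pi) : ℝ) : ℂ) * (I n * echar n x) := by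
      rw [torusChar_eq]
      push_cast
      ring
    rw [e, Complex.re_ofReal_mul, Complex.mul_re]
  have heven : ∀ n, ((k (-n) : ℂ) * I (-n) * torusChar (-n) x).re = ((k n : ℂ) * I n * torusChar n x).re := by
    intro n
    rw [hterm, hterm, hk, hI, echar_neg]
    simp
  rw [Complex.re_sum, sum_freqBox_eq_sum_halfBox M heven, ← Finset.sum_coe_sort (halfBox M), modeField,
    Fintype.sum_prod_type]
  refine Finset.sum_congr rfl fun n _ => ?_
  rw [Fintype.sum_bool, hterm]
  simp only [part, if_true, Bool.false_eq_true, if_false]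
  ring

/-- For n ≠ 0 this is 2 · √(1/2) = √2, the multiplicity against the standard deviation of each part.
At n = 0 the imaginary part drops out on both sides because Im e_0 = 0. The base point turns an
average around x₀ into an integral of the translated field. -/
lemma modeField_partStd (k : Freq → ℝ) (M : ℕ) {ε t : ℝ} (ht : 0 ≤ t) (g : halfBox M × Bool → ℝ) (x₀ z : Torus) :
    modeField k M (fun d => partStd M ε t d * g d) (x₀ + z) =
      gfield (trigField (fun n => k n * Real.sqrt (modeVar ε n t)) M x₀) g z := by
  refine Finset.sum_congr rfl fun d _ => ?_
  obtain ⟨n, b⟩ := d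
  have hv := modeVar_nonneg ε n ht
  have hm : Real.sqrt (multiplicity n) * Real.sqrt (multiplicity n) = multiplicity n :=
    Real.mul_self_sqrt (multiplicity_pos n).le
  by_cases hn : (n : Freq) = 0 ∧ b = true
  · obtain ⟨h0, rfl⟩ := hn
    simp [trigField, h0, echar_zero]
  · have hp : multiplicity n * Real.sqrt (partVar n b) = Real.sqrt (multiplicity n) := by
      by_cases h0 : (n : Freq) = 0
      · have hb : b = false := by
          cases b
          · rfl
          · exact absurd ⟨h0, rfl⟩ hn
        simp [multiplicity, partVar, h0, hb]
      · simp only [multiplicity, partVar, h0, if_false]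
        rw [one_div, Real.sqrt_inv]
        have h2 := Real.mul_self_sqrt (zero_le_two (α := ℝ))
        field_simp
        linarith
    simp only [partStd, trigField]
    rw [Real.sqrt_mul (partVar_nonneg _ _), ← hp]
    ring

lemma gcov_trigField_self {k : Freq → ℝ} (hk : ∀ n, k (-n) = k n) (M : ℕ) (ε : ℝ) {t : ℝ} (ht : 0 ≤ t) (x₀ z : Torus) :
    gcov (trigField (fun n => k n * Real.sqrt (modeVar ε n t)) M x₀) z z = fieldVar k M ε t := by
  rw [gcov_trigField (fun n => by rw [hk, modeVar_neg]), fieldVar]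
  congr 1
  refine Finset.sum_congr rfl fun n _ => ?_
  rw [← echar_mul_conj, echar_mul_conj_self, mul_pow, Real.sq_sqrt (modeVar_nonneg ε n ht)]
  simp

lemma modeChaos_partStd (β : ℝ) {k : Freq → ℝ} (hk : ∀ n, k (-n) = k n) (M : ℕ) {ε t : ℝ} (ht : 0 ≤ t)
    (g : halfBox M × Bool → ℝ) (x₀ z : Torus) :
    modeChaos β k M ε t (fun d => partStd M ε t d * g d) (x₀ + z) =
      gchaos β (trigField (fun n => k n * Real.sqrt (modeVar ε n t)) M x₀) g z := by
  rw [modeChaos, modeField_partStd k M ht, gchaos, gcov_trigField_self hk M ε ht]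

lemma continuous_modeField (k : Freq → ℝ) (M : ℕ) :
    Continuous fun p : (halfBox M × Bool → ℝ) × Torus => modeField k M p.1 p.2 := by
  unfold modeField
  refine continuous_finsetSum _ fun d _ => ?_
  have h := continuous_echar d.1
  have h1 : Continuous fun p : (halfBox M × Bool → ℝ) × Torus => p.1 d := by fun_prop
  refine Continuous.mul (Continuous.mul continuous_const ?_) h1
  split_ifs <;> fun_prop

lemma continuous_modeChaos (β : ℝ) (k : Freq → ℝ) (M : ℕ) (ε t : ℝ) :
    Continuous fun p : (halfBox M × Bool → ℝ) × Torus => modeChaos β k M ε t p.1 p.2 := by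
  have := continuous_modeField k M
  unfold modeChaos
  fun_prop

lemma continuous_modeField_right (k : Freq → ℝ) (M : ℕ) (J : halfBox M × Bool → ℝ) :
    Continuous (modeField k M J) :=
  (continuous_modeField k M).uncurry_left J

lemma continuous_modeChaos_right (β : ℝ) (k : Freq → ℝ) (M : ℕ) (ε t : ℝ) (J : halfBox M × Bool → ℝ) :
    Continuous (modeChaos β k M ε t J) := by
  have := continuous_modeField_right k M J
  unfold modeChaos
  fun_prop

lemma norm_modeChaos (β : ℝ) (k : Freq → ℝ) (M : ℕ) (ε t : ℝ) (J : halfBox M × Bool → ℝ) (x : Torus) :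
    ‖modeChaos β k M ε t J x‖ = Real.exp (β ^ 2 / 2 * fieldVar k M ε t) := by
  rw [modeChaos, norm_mul, Complex.norm_real, Real.norm_of_nonneg (Real.exp_pos _).le,
    show Complex.I * β * modeField k M J x = ((β * modeField k M J x : ℝ) : ℂ) * Complex.I by
      push_cast; ring, Complex.norm_exp_ofReal_mul_I, mul_one]

variable {Ω : Type*} [MeasurableSpace Ω] {P : Measure Ω} {B : Freq → ℝ≥0 → Ω → ℂ} [IsProbabilityMeasure P]

/-- The Fourier multiplier of the smooth cut-off. -/
def cutoffMult (χ : ℝ → ℝ) (N : ℕ) (n : Freq) : ℝ := χ (bracket n / N)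

lemma cutoffMult_neg (χ : ℝ → ℝ) (N : ℕ) (n : Freq) : cutoffMult χ N (-n) = cutoffMult χ N n := by
  simp [cutoffMult, bracket_neg]

lemma cutoffMult_eq_zero {χ : ℝ → ℝ} (hχ : IsCutoff χ) {N : ℕ} (hN : 1 ≤ N) {n : Freq} (h : 2 * (N : ℝ) < bracket n) :
    cutoffMult χ N n = 0 := by
  have hN' : (0 : ℝ) < N := by exact_mod_cast hN
  refine hχ.supp _ ?_
  rw [abs_of_pos (div_pos (bracket_pos n) hN'), lt_div_iff₀ hN']
  exact h

lemma cutoffMult_eq_one {χ : ℝ → ℝ} (hχ : IsCutoff χ) {N : ℕ} (hN : 1 ≤ N) {n : Freq} (h : bracket n ≤ N) :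
    cutoffMult χ N n = 1 := by
  have hN' : (0 : ℝ) < N := by exact_mod_cast hN
  refine hχ.eq_one _ ?_
  rw [abs_of_pos (div_pos (bracket_pos n) hN'), div_le_one hN']
  exact h

namespace IsCylindricalWiener

lemma ae_convMode_neg (hB : IsCylindricalWiener B P) :
    ∀ᵐ ω ∂P, ∀ ε, 0 ≤ ε → ∀ t, 0 ≤ t → ∀ n, convMode B ε t (-n) ω = conj (convMode B ε t n ω) := by
  filter_upwards [hB.ae_tendsto_riemannSum] with ω hω ε hε t ht n
  have h1 := hω ε hε t ht (-n)
  have h2 := (Complex.continuous_conj.tendsto _).comp (hω ε hε t ht n)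
  refine tendsto_nhds_unique h1 (h2.congr fun m => ?_)
  simp only [Function.comp_apply, riemannSum, map_sum, map_mul, map_sub, Complex.conj_ofReal, hB.conj_symm, duhamelSymbol_neg]

/-- Any box with M ≥ 2N contains the support of the cut-off. Leaving M free allows two truncations
to be written on one set of modes. -/
lemma ae_stochConv_eq (hB : IsCylindricalWiener B P) {χ : ℝ → ℝ} (hχ : IsCutoff χ) :
    ∀ᵐ ω ∂P, ∀ ε, 0 ≤ ε → ∀ t, 0 ≤ t → ∀ N, 1 ≤ N → ∀ M, 2 * N ≤ M → ∀ x,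
      stochConv χ B ε N t x ω = modeField (cutoffMult χ N) M (modeParts B M ε t ω) x := by
  filter_upwards [hB.ae_convMode_neg] with ω hω ε hε t ht N hN M hM x
  have h := sum_re_eq_modeField (cutoffMult_neg χ N) (I := fun n => convMode B ε t n ω) (hω ε hε t ht) M x
  unfold modeParts
  rw [← h, stochConv]
  congr 1
  refine tsum_eq_sum fun n hn => ?_
  have h0 : 2 * (N : ℝ) < bracket n := by
    by_contra! h1
    refine hn (mem_freqBox_of_bracket_le h1 ?_)
    rw [show (2 * (N : ℝ)) = ((2 * N : ℕ) : ℝ) by push_cast; ring, Nat.floor_natCast]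
    exact hM
  have h1 : χ (bracket n / N) = 0 := cutoffMult_eq_zero hχ hN h0
  rw [h1]
  simp

lemma integral_modeField_sq (hB : IsCylindricalWiener B P) {k : Freq → ℝ} (hk : ∀ n, k (-n) = k n) (M : ℕ) {ε t : ℝ}
    (hε : 0 ≤ ε) (ht : 0 ≤ t) (x : Torus) :
    ∫ ω, modeField k M (modeParts B M ε t ω) x ^ 2 ∂P = fieldVar k M ε t := by
  have hc : Continuous fun J : halfBox M × Bool → ℝ => modeField k M J x ^ 2 :=
    ((continuous_modeField k M).comp (show Continuous fun J : halfBox M × Bool → ℝ => (J, x) by fun_prop)).pow 2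
  have hs : Measurable fun (g : halfBox M × Bool → ℝ) d => partStd M ε t d * g d := by fun_prop
  rw [← integral_map (hB.aemeasurable_modeParts M hε ht) hc.aestronglyMeasurable,
    hB.map_modeParts M hε ht, integral_map hs.aemeasurable hc.aestronglyMeasurable]
  set u := trigField (fun n => k n * Real.sqrt (modeVar ε n t)) M x with hu
  have h1 : ∀ g : halfBox M × Bool → ℝ, modeField k M (fun d => partStd M ε t d * g d) x = ∑ d, u d 0 * g d := by
    intro g
    have := modeField_partStd k M (ε := ε) ht g x 0
    rw [add_zero] at this
    exact this
  simp_rw [h1]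
  have hlin : Measurable fun g : halfBox M × Bool → ℝ => ∑ d, u d 0 * g d := by fun_prop
  have h2 : ∫ g, (∑ d, u d 0 * g d) ^ 2 ∂gaussPi (halfBox M × Bool) =
      ∫ y, y ^ 2 ∂ProbabilityTheory.gaussianReal 0 (∑ d, u d 0 ^ 2).toNNReal := by
    rw [← map_linear_gaussPi, integral_map hlin.aemeasurable (by fun_prop)]
  rw [h2]
  have h3 := ProbabilityTheory.variance_id_gaussianReal (μ := 0) (v := (∑ d, u d 0 ^ 2).toNNReal)
  rw [ProbabilityTheory.variance_eq_integral (by fun_prop)] at h3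
  simp only [id_eq, ProbabilityTheory.integral_id_gaussianReal, sub_zero] at h3
  rw [h3, Real.coe_toNNReal _ (Finset.sum_nonneg fun d _ => sq_nonneg _), ← gcov_trigField_self hk M ε ht x 0]
  simp only [gcov, sq, hu]

lemma stochVar_eq (hB : IsCylindricalWiener B P) {χ : ℝ → ℝ} (hχ : IsCutoff χ) {ε t : ℝ} (hε : 0 ≤ ε) (ht : 0 ≤ t)
    {N M : ℕ} (hN : 1 ≤ N) (hM : 2 * N ≤ M) (x : Torus) :
    stochVar P χ B ε N t x = fieldVar (cutoffMult χ N) M ε t := by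
  rw [← hB.integral_modeField_sq (cutoffMult_neg χ N) M hε ht x, stochVar]
  refine integral_congr_ae ?_
  filter_upwards [hB.ae_stochConv_eq hχ] with ω hω
  rw [hω ε hε t ht N hN M hM x]

lemma ae_chaos_eq (hB : IsCylindricalWiener B P) {χ : ℝ → ℝ} (hχ : IsCutoff χ) (β : ℝ) :
    ∀ᵐ ω ∂P, ∀ ε, 0 ≤ ε → ∀ t, 0 ≤ t → ∀ N, 1 ≤ N → ∀ M, 2 * N ≤ M → ∀ x,
      chaos P χ B β ε N t ω x = modeChaos β (cutoffMult χ N) M ε t (modeParts B M ε t ω) x := by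
  filter_upwards [hB.ae_stochConv_eq hχ] with ω hω ε hε t ht N hN M hM x
  rw [chaos, modeChaos, hω ε hε t ht N hN M hM x, hB.stochVar_eq hχ hε ht hN hM]

end IsCylindricalWiener

end Field

/-! ### Moments of the smoothed increments at a point -/

section Pointwise

lemma measurable_enorm_integral_sub {X : Type*} [TopologicalSpace X] [SecondCountableTopology X]
    [MeasurableSpace X] [BorelSpace X] {F G : X → Torus → ℂ}
    (hF : Continuous fun p : X × Torus => F p.1 p.2) (hG : Continuous fun p : X × Torus => G p.1 p.2)
    (ν : Measure Torus) [SFinite ν] (x : Torus) :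
    Measurable fun J => ‖∫ z, F J (x + z) - G J (x + z) ∂ν‖ₑ := by
  have h4 : Continuous fun p : X × Torus => (p.1, x + p.2) := by fun_prop
  have h1 : Continuous fun p : X × Torus => F p.1 (x + p.2) - G p.1 (x + p.2) :=
    (hF.comp h4).sub (hG.comp h4)
  exact (h1.measurable.stronglyMeasurable.integral_prod_right' (ν := ν)).measurable.enorm

/-- The sharp cut-off. -/
def sharpMult (R : ℕ) (n : Freq) : ℝ := if bracket n ≤ R then 1 else 0

lemma sharpMult_neg (R : ℕ) (n : Freq) : sharpMult R (-n) = sharpMult R n := by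
  simp [sharpMult, bracket_neg]

lemma IsCutoff.exists_bound {χ : ℝ → ℝ} (hχ : IsCutoff χ) : ∃ C : ℝ, 1 ≤ C ∧ ∀ r, χ r ≤ C := by
  obtain ⟨C, hC⟩ := (isCompact_Icc (a := (-2 : ℝ)) (b := 2)).exists_bound_of_continuousOn
    hχ.smooth.continuous.continuousOn
  refine ⟨max C 1, le_max_right _ _, fun r => ?_⟩
  by_cases h : |r| ≤ 2
  · exact ((le_abs_self _).trans (hC r (abs_le.1 h))).trans (le_max_left _ _)
  · rw [hχ.supp r (not_le.1 h)]
    positivity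

/-- Averaging against the Bessel measure, that is `⟨∇⟩^{-α}`. -/
def besselAvg (α : ℝ) (u : Torus → ℂ) (x : Torus) : ℂ := ∫ z, u (x + z) ∂besselMeasure α

/-- χ is 1 up to N but may exceed 1 between N and 2N. There χ²/(2⟨n⟩²) ≤ C²/(2N²), which is the
constant part A/L² of the reference coefficient for A = 2C² and L = 2N. -/
lemma cutoff_sq_mul_modeVar_le {χ : ℝ → ℝ} (hχ : IsCutoff χ) {C : ℝ} (hC : ∀ r, χ r ≤ C) {N : ℕ} (hN : 1 ≤ N)
    {ε t : ℝ} (hε : 0 ≤ ε) (ht : 0 ≤ t) (n : Freq) :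
    (cutoffMult χ N n * Real.sqrt (modeVar ε n t)) ^ 2 ≤ refCoeff (2 * C ^ 2) (2 * N) n := by
  have hN' : (0 : ℝ) < N := by exact_mod_cast hN
  have hb := bracket_pos n
  have hv := modeVar_le hε n t
  rw [mul_pow, Real.sq_sqrt (modeVar_nonneg ε n ht)]
  unfold refCoeff
  split_ifs with h
  · by_cases h1 : bracket n ≤ N
    · rw [cutoffMult_eq_one hχ hN h1]
      have : 0 ≤ 2 * C ^ 2 / (2 * (N : ℝ)) ^ 2 := by positivity
      linarith
    · have h2 : cutoffMult χ N n ^ 2 ≤ C ^ 2 := pow_le_pow_left₀ (hχ.nonneg _) (hC _) 2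
      have h3 : (N : ℝ) ^ 2 ≤ bracket n ^ 2 := by gcongr; exact (not_le.1 h1).le
      calc _ ≤ C ^ 2 * (1 / (2 * bracket n ^ 2)) := mul_le_mul h2 hv (modeVar_nonneg ε n ht) (sq_nonneg _)
        _ ≤ C ^ 2 * (1 / (2 * N ^ 2)) := by gcongr
        _ = 2 * C ^ 2 / (2 * (N : ℝ)) ^ 2 := by field_simp
        _ ≤ _ := le_add_of_nonneg_left (by positivity)
  · rw [cutoffMult_eq_zero hχ hN (not_le.1 h)]
    simp

/-- The coefficients live on R < ⟨n⟩ ≤ 4R and are at most C²/(2R²). The splitting radius √R gives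
324 C⁴/R + 5184 C⁴ R^{-α}, both dominated by R^{-min(1,α)}. -/
lemma lintegral_highCov_le {χ : ℝ → ℝ} (hχ : IsCutoff χ) {C : ℝ} (hC : ∀ r, χ r ≤ C) {α : ℝ} (hα : 0 < α)
    {R N : ℕ} (hR : 1 ≤ R) (hRN : R ≤ N) (hNR : N ≤ 2 * R) {ε t : ℝ} (hε : 0 ≤ ε) (ht : 0 ≤ t) (M : ℕ) (x : Torus) :
    ∫⁻ z : Torus × Torus, ENNReal.ofReal |gcov (trigField (fun n => (1 - sharpMult R n) *
      (cutoffMult χ N n * Real.sqrt (modeVar ε n t))) M x) z.1 z.2| ^ 2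
        ∂(besselMeasure α).prod (besselMeasure α) ≤
      ENNReal.ofReal (22032 * C ^ 4) * ENNReal.ofReal ((R : ℝ) ^ (-(min 1 α))) := by
  classical
  have hR' : (1 : ℝ) ≤ R := by exact_mod_cast hR
  have hRN' : (R : ℝ) ≤ N := by exact_mod_cast hRN
  have hNR' : (N : ℝ) ≤ 2 * R := by exact_mod_cast hNR
  set a : Freq → ℝ := fun n => (1 - sharpMult R n) * (cutoffMult χ N n * Real.sqrt (modeVar ε n t)) with ha
  have haneg : ∀ n, a (-n) = a n := fun n => by
    simp only [ha, sharpMult_neg, cutoffMult_neg, modeVar_neg]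
  have hcov : ∀ z : Torus × Torus, gcov (trigField a M x) z.1 z.2 = (4 * Real.pi ^ 2)⁻¹ *
      ∑ n ∈ (freqBox M).filter (fun n => bracket n ≤ 4 * R), a n ^ 2 * (displ z.1 z.2 0 ^ n 0 * displ z.1 z.2 1 ^ n 1).re := by
    intro z
    rw [gcov_trigField haneg, Finset.sum_filter]
    congr 1
    refine Finset.sum_congr rfl fun n _ => ?_
    split_ifs with h
    · rfl
    · have h0 : cutoffMult χ N n = 0 := cutoffMult_eq_zero hχ (hR.trans hRN) (by linarith)
      simp [ha, h0]
  simp_rw [hcov]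
  have hD : ∀ n, a n ^ 2 ≤ C ^ 2 / (2 * R ^ 2) := by
    intro n
    simp only [ha, sharpMult]
    split_ifs with h
    · simp
      positivity
    · have h2 : cutoffMult χ N n ^ 2 ≤ C ^ 2 := pow_le_pow_left₀ (hχ.nonneg _) (hC _) 2
      rw [sub_zero, one_mul, mul_pow, Real.sq_sqrt (modeVar_nonneg ε n ht)]
      calc _ ≤ C ^ 2 * (1 / (2 * bracket n ^ 2)) := mul_le_mul h2 (modeVar_le hε n t) (modeVar_nonneg ε n ht) (sq_nonneg _)
        _ ≤ C ^ 2 * (1 / (2 * R ^ 2)) := by gcongr; exact (not_le.1 h).le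
        _ = _ := by ring
  refine (lintegral_sq_sum_echar_le hα _ (fun n => a n ^ 2) (r := Real.sqrt R) (R := 4 * R)
    (Real.one_le_sqrt.2 hR') (fun n _ => sq_nonneg _) (fun n _ => hD n) (by positivity)
    (fun n hn => (Finset.mem_filter.1 hn).2)).trans ?_
  have hC0 : 0 ≤ C ^ 4 := by positivity
  rw [← ENNReal.ofReal_mul (by positivity)]
  refine ENNReal.ofReal_le_ofReal ?_
  have hR0 : (0 : ℝ) < R := by linarith
  have e1 : Real.sqrt (R : ℝ) ^ 2 = R := Real.sq_sqrt hR0.le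
  have e2 : Real.sqrt (R : ℝ) ^ (-(2 * α)) = (R : ℝ) ^ (-α) := by
    rw [Real.sqrt_eq_rpow, ← Real.rpow_mul hR0.le]
    congr 1
    ring
  rw [e1, e2]
  have h1 : (R : ℝ)⁻¹ ≤ (R : ℝ) ^ (-(min 1 α)) := by
    rw [← Real.rpow_neg_one]
    exact Real.rpow_le_rpow_of_exponent_le hR' (neg_le_neg (min_le_left _ _))
  have h2 : (R : ℝ) ^ (-α) ≤ (R : ℝ) ^ (-(min 1 α)) :=
    Real.rpow_le_rpow_of_exponent_le hR' (neg_le_neg (min_le_right _ _))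
  calc _ = C ^ 4 * (324 * (R : ℝ)⁻¹ + 5184 * (R : ℝ) ^ (-α)) := by
        field_simp
        ring
    _ ≤ C ^ 4 * (324 * (R : ℝ) ^ (-(min 1 α)) + 5184 * (R : ℝ) ^ (-(min 1 α))) := by gcongr
    _ ≤ 22032 * C ^ 4 * (R : ℝ) ^ (-(min 1 α)) := by
        have h3 : 0 ≤ C ^ 4 * (R : ℝ) ^ (-(min 1 α)) := mul_nonneg hC0 (Real.rpow_nonneg hR0.le _)
        nlinarith

variable {Ω : Type*} [MeasurableSpace Ω] {P : Measure Ω} {B : Freq → ℝ≥0 → Ω → ℂ} [IsProbabilityMeasure P]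

/-- Since χ(⟨n⟩/N) = 1 for ⟨n⟩ ≤ R ≤ N, the sharply truncated chaos is the conditional expectation
of the smooth one given these modes. The decay comes from the high frequency covariance, the
singular integral K being fixed. -/
lemma IsCylindricalWiener.exists_lintegral_modeChaos_sub_sharp_le (hB : IsCylindricalWiener B P) {χ : ℝ → ℝ} (hχ : IsCutoff χ)
    {β α : ℝ} (hβ0 : 0 < β ^ 2) (hβ : β ^ 2 < 4 * Real.pi) (hα : β ^ 2 / (4 * Real.pi) < α) {m : ℕ} (hm : 1 ≤ m) :
    ∃ C : ℝ≥0∞, C ≠ ⊤ ∧ ∀ R N M : ℕ, 1 ≤ R → R ≤ N → N ≤ 2 * R → ∀ ε t : ℝ, 0 ≤ ε → 0 ≤ t → ∀ x,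
      ∫⁻ ω, ‖∫ z, modeChaos β (cutoffMult χ N) M ε t (modeParts B M ε t ω) (x + z) -
        modeChaos β (sharpMult R) M ε t (modeParts B M ε t ω) (x + z) ∂besselMeasure α‖ₑ ^ (2 * m) ∂P ≤
      C * ENNReal.ofReal ((R : ℝ) ^ (-(min 1 α * m / 2))) := by
  have hpi := Real.pi_pos
  have hγ0 : 0 < β ^ 2 / (4 * Real.pi) := by positivity
  have hγ1 : β ^ 2 / (4 * Real.pi) < 1 := (div_lt_one (by positivity)).2 hβ
  have hα0 : 0 < α := hγ0.trans hα
  have := isProbabilityMeasure_besselMeasure hα0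
  obtain ⟨c, hc1, hc⟩ := hχ.exists_bound
  set K := ∫⁻ z : Torus × Torus, ENNReal.ofReal (tdist z.1 z.2) ^ (-(2 * (β ^ 2 / (4 * Real.pi))))
      ∂(besselMeasure α).prod (besselMeasure α) with hKdef
  have hK : K < ⊤ := lintegral_tdist_besselMeasure_lt_top hγ0 hγ1 hα
  set A : ℝ := 2 * c ^ 2
  have hA : 0 ≤ A := by positivity
  set E : ℝ≥0∞ := ENNReal.ofReal (Real.exp (β ^ 2 * (2 * (4 * Real.pi ^ 2)⁻¹ *
        (1 + 3 * Real.pi + 9 * A + 137 * (1 / 2 + A))))) with hE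
  set G : ℝ≥0∞ := ENNReal.ofReal (22032 * c ^ 4) * (E * K) with hG
  have hGt : G ≠ ⊤ := by finiteness
  refine ⟨chaosMomentConst β (doublingConst β A) m * (G ^ (1 / 2 : ℝ)) ^ m,
    ENNReal.mul_ne_top (chaosMomentConst_ne_top _ _ _) (by finiteness), fun R N M hR hRN hNR ε t hε ht x => ?_⟩
  set a : Freq → ℝ := fun n => cutoffMult χ N n * Real.sqrt (modeVar ε n t) with ha
  set D := halfBox M × Bool
  set Φ : (D → ℝ) → ℝ≥0∞ := fun J => ‖∫ z, modeChaos β (cutoffMult χ N) M ε t J (x + z) -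
        modeChaos β (sharpMult R) M ε t J (x + z) ∂besselMeasure α‖ₑ ^ (2 * m) with hΦ
  have hΦm : Measurable Φ := (measurable_enorm_integral_sub (continuous_modeChaos β (cutoffMult χ N) M ε t)
    (continuous_modeChaos β (sharpMult R) M ε t) (besselMeasure α) x).pow_const (2 * m)
  have hs : Measurable fun (g : D → ℝ) d => partStd M ε t d * g d := by fun_prop
  have h1 : ∫⁻ ω, Φ (modeParts B M ε t ω) ∂P = ∫⁻ g, Φ (fun d => partStd M ε t d * g d) ∂gaussPi D := by
    rw [← lintegral_map' hΦm.aemeasurable (hB.aemeasurable_modeParts M hε ht), hB.map_modeParts M hε ht,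
      lintegral_map hΦm hs]
  have hsharp : (fun n => sharpMult R n * Real.sqrt (modeVar ε n t)) = fun n => (1 - (1 - sharpMult R n)) * a n := by
    ext n
    simp only [ha, sharpMult]
    split_ifs with h
    · rw [cutoffMult_eq_one hχ (hR.trans hRN) (h.trans (by exact_mod_cast hRN))]
      ring
    · simp
  have h2 : ∀ g : D → ℝ, Φ (fun d => partStd M ε t d * g d) =
      ‖∫ z, gchaos β (trigField a M x) g z -
        gchaos β (trigField (fun n => (1 - (1 - sharpMult R n)) * a n) M x) g z ∂besselMeasure α‖ₑ ^ (2 * m) := by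
    intro g
    rw [← hsharp]
    refine congrArg (fun w : ℂ => ‖w‖ₑ ^ (2 * m)) (integral_congr_ae (ae_of_all _ fun z => ?_))
    exact congrArg₂ (· - ·) (modeChaos_partStd β (cutoffMult_neg χ N) M ht g x z)
      (modeChaos_partStd β (sharpMult_neg R) M ht g x z)
  refine h1.trans_le ?_
  simp_rw [h2]
  refine (lintegral_enorm_integral_trig_sub_pow_le β (fun n => ?_) hA (L := 2 * N)
    (fun n _ => cutoff_sq_mul_modeVar_le hχ hc (hR.trans hRN) hε ht n) x (fun n => ?_) hKdef.ge
    (lintegral_highCov_le hχ hc hα0 hR hRN hNR hε ht M x) hm).trans (le_of_eq ?_)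
  · simp only [cutoffMult_neg, modeVar_neg]
  · unfold sharpMult
    split_ifs <;> simp
  · have hR0 : (0 : ℝ) < R := by exact_mod_cast hR
    have e : ENNReal.ofReal (22032 * c ^ 4) * ENNReal.ofReal ((R : ℝ) ^ (-(min 1 α))) * (E * K) =
        G * ENNReal.ofReal ((R : ℝ) ^ (-(min 1 α))) := by
      rw [hG]; ring
    rw [e, ENNReal.mul_rpow_of_nonneg _ _ (by norm_num), mul_pow, mul_assoc]
    congr 2
    rw [ENNReal.ofReal_rpow_of_pos (Real.rpow_pos_of_pos hR0 _), ← Real.rpow_mul hR0.le,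
      ← ENNReal.ofReal_pow (Real.rpow_nonneg hR0.le _), ← Real.rpow_natCast, ← Real.rpow_mul hR0.le]
    congr 2
    ring

lemma enorm_add_pow_le {E : Type*} [NormedAddCommGroup E] (a b : E) (q : ℕ) :
    ‖a + b‖ₑ ^ q ≤ 2 ^ q * (‖a‖ₑ ^ q + ‖b‖ₑ ^ q) := by
  calc ‖a + b‖ₑ ^ q ≤ (‖a‖ₑ + ‖b‖ₑ) ^ q := by gcongr; exact enorm_add_le a b
    _ ≤ (2 * max ‖a‖ₑ ‖b‖ₑ) ^ q := by
        gcongr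
        rw [two_mul]
        exact add_le_add (le_max_left _ _) (le_max_right _ _)
    _ = 2 ^ q * (max ‖a‖ₑ ‖b‖ₑ) ^ q := mul_pow _ _ _
    _ ≤ _ := by
        gcongr
        rcases max_choice ‖a‖ₑ ‖b‖ₑ with h | h <;> rw [h]
        · exact le_self_add
        · exact le_add_self

/-- The truncations at N and at R are both compared with the sharp truncation at R, on the common
box of size 2N. -/
lemma IsCylindricalWiener.exists_lintegral_besselAvg_sub_le (hB : IsCylindricalWiener B P) {χ : ℝ → ℝ} (hχ : IsCutoff χ)
    {β α : ℝ} (hβ0 : 0 < β ^ 2) (hβ : β ^ 2 < 4 * Real.pi) (hα : β ^ 2 / (4 * Real.pi) < α) {m : ℕ} (hm : 1 ≤ m) :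
    ∃ C : ℝ≥0∞, C ≠ ⊤ ∧ ∀ R N : ℕ, 1 ≤ R → R ≤ N → N ≤ 2 * R → ∀ ε t : ℝ, 0 ≤ ε → 0 ≤ t → ∀ x,
      ∫⁻ ω, ‖besselAvg α (chaos P χ B β ε N t ω) x - besselAvg α (chaos P χ B β ε R t ω) x‖ₑ ^ (2 * m) ∂P ≤
      C * ENNReal.ofReal ((R : ℝ) ^ (-(min 1 α * m / 2))) := by
  have hα0 : 0 < α := lt_of_le_of_lt (by positivity) hα
  have := isProbabilityMeasure_besselMeasure hα0
  obtain ⟨C, hC, h⟩ := hB.exists_lintegral_modeChaos_sub_sharp_le hχ hβ0 hβ hα hm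
  refine ⟨2 ^ (2 * m) * (C + C), by finiteness, fun R N hR hRN hNR ε t hε ht x => ?_⟩
  obtain ⟨M, hM⟩ : ∃ M, M = 2 * N := ⟨_, rfl⟩
  obtain ⟨Φ, hΦ⟩ : ∃ Φ : ℕ → (halfBox M × Bool → ℝ) → ℂ, ∀ N' J,
      ∫ z, modeChaos β (cutoffMult χ N') M ε t J (x + z) -
        modeChaos β (sharpMult R) M ε t J (x + z) ∂besselMeasure α = Φ N' J := ⟨_, fun _ _ => rfl⟩
  have hint : ∀ (k : Freq → ℝ) (J : halfBox M × Bool → ℝ),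
      Integrable (fun z => modeChaos β k M ε t J (x + z)) (besselMeasure α) := by
    intro k J
    have h1 : Continuous fun z => modeChaos β k M ε t J (x + z) :=
      (continuous_modeChaos_right β k M ε t J).comp (continuous_const.add continuous_id)
    exact Integrable.of_bound h1.aestronglyMeasurable _ (ae_of_all _ fun z => (norm_modeChaos β k M ε t J _).le)
  have hSm : ∀ N', AEMeasurable (fun ω => ‖Φ N' (modeParts B M ε t ω)‖ₑ ^ (2 * m)) P := by
    intro N'
    have h1 := measurable_enorm_integral_sub (continuous_modeChaos β (cutoffMult χ N') M ε t)
      (continuous_modeChaos β (sharpMult R) M ε t) (besselMeasure α) x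
    simp_rw [hΦ] at h1
    exact (h1.pow_const (2 * m)).comp_aemeasurable (hB.aemeasurable_modeParts M hε ht)
  have hae : ∀ᵐ ω ∂P, ‖besselAvg α (chaos P χ B β ε N t ω) x - besselAvg α (chaos P χ B β ε R t ω) x‖ₑ ^ (2 * m) ≤
      2 ^ (2 * m) * (‖Φ N (modeParts B M ε t ω)‖ₑ ^ (2 * m) + ‖Φ R (modeParts B M ε t ω)‖ₑ ^ (2 * m)) := by
    filter_upwards [hB.ae_chaos_eq hχ β] with ω hω
    have h1 : besselAvg α (chaos P χ B β ε N t ω) x - besselAvg α (chaos P χ B β ε R t ω) x = Φ N (modeParts B M ε t ω) + -Φ R (modeParts B M ε t ω) := by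
      simp only [besselAvg, ← hΦ]
      simp_rw [hω ε hε t ht N (hR.trans hRN) M hM.ge, hω ε hε t ht R hR M (by omega)]
      rw [integral_sub (hint _ _) (hint _ _), integral_sub (hint _ _) (hint _ _)]
      ring
    rw [h1]
    refine (enorm_add_pow_le _ _ _).trans (le_of_eq ?_)
    rw [enorm_neg]
  refine (lintegral_mono_ae hae).trans ?_
  have hR2 := h R R M hR le_rfl (by omega) ε t hε ht x
  have hN2 := h R N M hR hRN hNR ε t hε ht x
  simp_rw [hΦ] at hR2 hN2
  rw [lintegral_const_mul' _ _ (by finiteness), lintegral_add_left' (hSm N)]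
  calc _ ≤ 2 ^ (2 * m) * (C * ENNReal.ofReal ((R : ℝ) ^ (-(min 1 α * m / 2))) + C * ENNReal.ofReal ((R : ℝ) ^ (-(min 1 α * m / 2)))) := by
        gcongr
    _ = _ := by ring

end Pointwise

/-! ### Regularity of the smoothed chaos in the parameters -/

section Regularity

lemma norm_echar_sub_le (n : Freq) (x x' : Torus) : ‖echar n x - echar n x'‖ ≤ 2 * bracket n * tdist x x' := by
  have h1 : echar n x - echar n x' = (displ x x' 0 ^ n 0 * displ x x' 1 ^ n 1 - 1) * echar n x' := by
    rw [← echar_mul_conj, sub_mul, mul_assoc, mul_comm (conj _), echar_mul_conj_self]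
    ring
  have h2 : displ x x' 0 ^ n 0 * displ x x' 1 ^ n 1 - 1 =
      (displ x x' 0 ^ n 0 - 1) * displ x x' 1 ^ n 1 + (displ x x' 1 ^ n 1 - 1) := by ring
  have hd : ∀ i, ‖displ x x' i‖ = 1 := fun i => by simp [displ, norm_unitPt]
  have hz : ∀ i, ‖displ x x' i ^ n i - 1‖ ≤ bracket n * tdist x x' := fun i =>
    (norm_zpow_sub_one_le (hd i) (n i)).trans (mul_le_mul (abs_le_bracket n i) (norm_displ_sub_one_le _ _ i)
      (norm_nonneg _) (bracket_pos n).le)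
  rw [h1, norm_mul, norm_echar, mul_one, h2]
  refine (norm_add_le _ _).trans ?_
  rw [norm_mul, norm_zpow, hd, one_zpow, mul_one]
  linarith [hz 0, hz 1]

lemma bracket_le_of_mem_freqBox {N : ℕ} (hN : 1 ≤ N) {n : Freq} (hn : n ∈ freqBox (2 * N)) : bracket n ≤ 3 * N := by
  have hN' : (1 : ℝ) ≤ N := by exact_mod_cast hN
  rw [mem_freqBox] at hn
  have h1 : ∀ i, (n i : ℝ) ^ 2 ≤ (2 * N) ^ 2 := fun i => by
    rw [← sq_abs]
    refine pow_le_pow_left₀ (abs_nonneg _) ?_ 2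
    exact_mod_cast hn i
  refine Real.sqrt_le_iff.2 ⟨by positivity, ?_⟩
  rw [Fin.sum_univ_two]
  nlinarith [h1 0, h1 1]

/-- The modulus of continuity of the smoothed chaos. -/
def paramDist (ε ε' t t' : ℝ) (x x' : Torus) : ℝ :=
  |ε - ε'| ^ (1 / 4 : ℝ) + |t - t'| ^ (1 / 4 : ℝ) + tdist x x'

lemma paramDist_nonneg (ε ε' t t' : ℝ) (x x' : Torus) : 0 ≤ paramDist ε ε' t t' x x' := by
  have := tdist_nonneg x x'
  unfold paramDist
  positivity

variable {Ω : Type*} [MeasurableSpace Ω] {P : Measure Ω} {B : Freq → ℝ≥0 → Ω → ℂ} [IsProbabilityMeasure P]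

namespace IsCylindricalWiener

lemma ae_stochConv_eq_sum (hB : IsCylindricalWiener B P) {χ : ℝ → ℝ} (hχ : IsCutoff χ) :
    ∀ᵐ ω ∂P, ∀ ε, 0 ≤ ε → ∀ t, 0 ≤ t → ∀ N, 1 ≤ N → ∀ x,
      stochConv χ B ε N t x ω = (∑ n ∈ freqBox (2 * N), (cutoffMult χ N n : ℂ) * convMode B ε t n ω * torusChar n x).re := by
  filter_upwards [hB.ae_stochConv_eq hχ, hB.ae_convMode_neg] with ω hω hω' ε hε t ht N hN x
  rw [hω ε hε t ht N hN _ le_rfl x,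
    sum_re_eq_modeField (cutoffMult_neg χ N) (I := fun n => convMode B ε t n ω) (hω' ε hε t ht)]
  rfl

lemma ae_norm_convMode_sub_le (hB : IsCylindricalWiener B P) {T : ℝ} (hT : 0 < T) {H : Freq → Ω → ℝ}
    (hH0 : ∀ n ω, 0 ≤ H n ω)
    (hH : ∀ n, ∀ᵐ ω ∂P, ∀ s s' : ℝ, s ≤ T → s' ≤ T →
      ‖B n s.toNNReal ω - B n s'.toNNReal ω‖ ≤ H n ω * |s - s'| ^ (1 / 4 : ℝ)) :
    ∀ᵐ ω ∂P, ∀ n, ∀ ε ∈ Set.Icc (0 : ℝ) 1, ∀ ε' ∈ Set.Icc (0 : ℝ) 1, ∀ t ∈ Set.Icc 0 T, ∀ t' ∈ Set.Icc 0 T,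
      ‖convMode B ε t n ω - convMode B ε' t' n ω‖ ≤
        (5 + 3 * T) * bracket n ^ 2 * H n ω * (|ε - ε'| ^ (1 / 4 : ℝ) + |t - t'| ^ (1 / 4 : ℝ)) ∧
      ‖convMode B ε t n ω‖ ≤ (5 + 3 * T) * bracket n ^ 2 * H n ω * (1 + T) := by
  filter_upwards [hB.ae_regular, ae_all_iff.2 hH] with ω hω hHω n ε hε ε' hε' t ht t' ht'
  have hg : Continuous fun s : ℝ => B n s.toNNReal ω := (hω n).1.comp continuous_real_toNNReal
  have hg0 : ∀ s : ℝ, s ≤ 0 → B n s.toNNReal ω = 0 := fun s hs => by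
    rw [Real.toNNReal_of_nonpos hs]
    exact (hω n).2
  have e : ∀ ε ∈ Set.Icc (0 : ℝ) 1, ∀ t ∈ Set.Icc 0 T, convMode B ε t n ω =
      duhamelInt ε n (fun s => B n s.toNNReal ω) t := fun ε hε t ht =>
    wienerIntegral_duhamelSymbol hε.1 n (hω n).1 (hω n).2 ht.1
  have key : ∀ t' ∈ Set.Icc 0 T, ∀ ε' ∈ Set.Icc (0 : ℝ) 1, ‖convMode B ε t n ω - convMode B ε' t' n ω‖ ≤
        (5 + 3 * T) * bracket n ^ 2 * H n ω * (|ε - ε'| ^ (1 / 4 : ℝ) + |t - t'| ^ (1 / 4 : ℝ)) := by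
    intro t' ht' ε' hε'
    rw [e ε hε t ht, e ε' hε' t' ht']
    exact norm_duhamelInt_sub_le hε hε' n hg hg0 (hH0 n ω) (hHω n) ht ht'
  refine ⟨key t' ht' ε' hε', ?_⟩
  have h0T : (0 : ℝ) ∈ Set.Icc 0 T := ⟨le_rfl, hT.le⟩
  have h0 : convMode B ε 0 n ω = 0 := by
    rw [e ε hε 0 h0T, duhamelInt]
    simp [(hω n).2]
  have h1 := key 0 h0T ε hε
  rw [h0, sub_zero, sub_self, abs_zero, Real.zero_rpow (by norm_num), zero_add, sub_zero, abs_of_nonneg ht.1] at h1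
  refine h1.trans ?_
  have h2 : t ^ (1 / 4 : ℝ) ≤ 1 + T := by
    calc t ^ (1 / 4 : ℝ) ≤ (1 + T) ^ (1 / 4 : ℝ) := Real.rpow_le_rpow ht.1 (by linarith [ht.2]) (by norm_num)
      _ ≤ (1 + T) ^ (1 : ℝ) := Real.rpow_le_rpow_of_exponent_le (by linarith) (by norm_num)
      _ = _ := Real.rpow_one _
  have h3 : 0 ≤ (5 + 3 * T) * bracket n ^ 2 * H n ω := by
    have := hH0 n ω
    positivity
  exact mul_le_mul_of_nonneg_left h2 h3

/-- Each mode contributes ⟨n⟩² from its modulus in (ε,t) and one more ⟨n⟩ from the gradient in x,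
with ⟨n⟩ ≤ 3N (whence 54 = 2 · 3³), and there are at most 25N² modes. The constant is thus of size
N⁵, and its 4m-th moment of size N^{20m}; any polynomial growth would do. -/
lemma exists_stochConv_holder (hB : IsCylindricalWiener B P) {χ : ℝ → ℝ} (hχ : IsCutoff χ) {m : ℕ} (hm : 2 ≤ m)
    {T : ℝ} (hT : 0 < T) : ∃ C : ℝ≥0∞, C ≠ ⊤ ∧ ∀ N : ℕ, 1 ≤ N → ∃ S : Ω → ℝ, (∀ ω, 0 ≤ S ω) ∧ AEMeasurable S P ∧
      ∫⁻ ω, ENNReal.ofReal (S ω) ^ (4 * m) ∂P ≤ C * (N : ℝ≥0∞) ^ (20 * m) ∧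
      ∀ᵐ ω ∂P, ∀ ε ∈ Set.Icc (0 : ℝ) 1, ∀ ε' ∈ Set.Icc (0 : ℝ) 1, ∀ t ∈ Set.Icc 0 T, ∀ t' ∈ Set.Icc 0 T, ∀ x x',
        |stochConv χ B ε N t x ω - stochConv χ B ε' N t' x' ω| ≤ S ω * paramDist ε ε' t t' x x' ∧
        |stochConv χ B ε N t x ω| ≤ S ω := by
  obtain ⟨C, hC, hex⟩ := hB.exists_holder hm hT
  choose H hH0 hHm hHC hHω using hex
  obtain ⟨c, hc1, hc⟩ := hχ.exists_bound
  set L : ℝ := 54 * c * (5 + 3 * T) * (1 + T) with hL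
  have hL0 : 0 ≤ L := by positivity
  refine ⟨ENNReal.ofReal L ^ (4 * m) * (25 ^ (4 * m) * C), by finiteness, fun N hN => ?_⟩
  have hN' : (1 : ℝ) ≤ N := by exact_mod_cast hN
  refine ⟨fun ω => L * N ^ 3 * ∑ n ∈ freqBox (2 * N), H n ω, fun ω => ?_, ?_, ?_, ?_⟩
  · exact mul_nonneg (by positivity) (Finset.sum_nonneg fun n _ => hH0 n ω)
  · exact (Finset.aemeasurable_fun_sum _ fun n _ => hHm n).const_mul _
  · have hcard : ((freqBox (2 * N)).card : ℝ≥0∞) ≤ 25 * (N : ℝ≥0∞) ^ 2 := by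
      rw [card_freqBox]
      have : (2 * (2 * N) + 1) ^ 2 ≤ 25 * N ^ 2 := by nlinarith
      exact_mod_cast this
    have hcard0 : (freqBox (2 * N)).card ≠ 0 := by rw [card_freqBox]; positivity
    have hsum : ∀ ω, ENNReal.ofReal (L * N ^ 3 * ∑ n ∈ freqBox (2 * N), H n ω) ^ (4 * m) ≤
        (ENNReal.ofReal L * (N : ℝ≥0∞) ^ 3) ^ (4 * m) * (((freqBox (2 * N)).card : ℝ≥0∞) ^ (4 * m - 1) *
          ∑ n ∈ freqBox (2 * N), ENNReal.ofReal (H n ω) ^ (4 * m)) := by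
      intro ω
      rw [ENNReal.ofReal_mul (by positivity), ENNReal.ofReal_mul hL0, mul_pow,
        ENNReal.ofReal_sum_of_nonneg fun n _ => hH0 n ω, ENNReal.ofReal_pow (by positivity), ENNReal.ofReal_natCast]
      gcongr
      have h := ENNReal.rpow_sum_le_const_mul_sum_rpow (freqBox (2 * N)) (fun n => ENNReal.ofReal (H n ω))
        (p := ((4 * m : ℕ) : ℝ)) (by exact_mod_cast (by omega : 1 ≤ 4 * m))
      have e : ((4 * m : ℕ) : ℝ) - 1 = ((4 * m - 1 : ℕ) : ℝ) := by
        rw [Nat.cast_sub (by omega)]; simp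
      rw [e] at h
      simpa only [ENNReal.rpow_natCast] using h
    calc _ ≤ ∫⁻ ω, (ENNReal.ofReal L * (N : ℝ≥0∞) ^ 3) ^ (4 * m) * (((freqBox (2 * N)).card : ℝ≥0∞) ^ (4 * m - 1) *
          ∑ n ∈ freqBox (2 * N), ENNReal.ofReal (H n ω) ^ (4 * m)) ∂P := lintegral_mono hsum
      _ = (ENNReal.ofReal L * (N : ℝ≥0∞) ^ 3) ^ (4 * m) * (((freqBox (2 * N)).card : ℝ≥0∞) ^ (4 * m - 1) *
          ∑ n ∈ freqBox (2 * N), ∫⁻ ω, ENNReal.ofReal (H n ω) ^ (4 * m) ∂P) := by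
          rw [lintegral_const_mul' _ _ (by finiteness), lintegral_const_mul' _ _ (by finiteness),
            lintegral_finsetSum' _ fun n _ => (hHm n).ennreal_ofReal.pow_const _]
      _ ≤ (ENNReal.ofReal L * (N : ℝ≥0∞) ^ 3) ^ (4 * m) * (((freqBox (2 * N)).card : ℝ≥0∞) ^ (4 * m - 1) *
          ((freqBox (2 * N)).card * C)) := by
          gcongr
          refine (Finset.sum_le_card_nsmul _ _ C fun n _ => hHC n).trans (le_of_eq ?_)
          rw [nsmul_eq_mul]
      _ = (ENNReal.ofReal L * (N : ℝ≥0∞) ^ 3) ^ (4 * m) * (((freqBox (2 * N)).card : ℝ≥0∞) ^ (4 * m) * C) := by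
          rw [← mul_assoc (_ ^ (4 * m - 1)), ← pow_succ, Nat.sub_add_cancel (by omega)]
      _ ≤ (ENNReal.ofReal L * (N : ℝ≥0∞) ^ 3) ^ (4 * m) * ((25 * (N : ℝ≥0∞) ^ 2) ^ (4 * m) * C) := by gcongr
      _ = _ := by
          rw [mul_pow, mul_pow, ← pow_mul, ← pow_mul, show 20 * m = 3 * (4 * m) + 2 * (4 * m) by ring, pow_add]
          ring
  · filter_upwards [hB.ae_stochConv_eq_sum hχ, hB.ae_norm_convMode_sub_le hT hH0 hHω] with ω hω hωc ε hε ε' hε' t ht t' ht' x x'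
    have hpi := Real.pi_gt_three
    have hk : ∀ n, ‖(cutoffMult χ N n : ℂ)‖ ≤ c := fun n => by
      rw [Complex.norm_real, cutoffMult, Real.norm_of_nonneg (hχ.nonneg _)]
      exact hc _
    have hpi1 : ‖(2 * (Real.pi : ℂ))⁻¹‖ ≤ 1 := by
      rw [norm_inv, norm_mul, Complex.norm_real, Real.norm_of_nonneg (by positivity)]
      refine inv_le_one_of_one_le₀ ?_
      simp only [Complex.norm_ofNat]
      linarith
    have hd0 := tdist_nonneg x x'
    set d0 := |ε - ε'| ^ (1 / 4 : ℝ) + |t - t'| ^ (1 / 4 : ℝ) with hd0def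
    have hd00 : 0 ≤ d0 := by positivity
    have hpd : paramDist ε ε' t t' x x' = d0 + tdist x x' := rfl
    rw [hω ε hε.1 t ht.1 N hN x, hω ε' hε'.1 t' ht'.1 N hN x', hpd]
    refine ⟨?_, ?_⟩
    · rw [← Complex.sub_re, ← Finset.sum_sub_distrib]
      refine (Complex.abs_re_le_norm _).trans ((norm_sum_le _ _).trans ?_)
      rw [mul_comm (L * _), mul_assoc, Finset.sum_mul]
      refine Finset.sum_le_sum fun n hn => ?_
      have hb := bracket_le_of_mem_freqBox hN hn
      have hb0 := bracket_pos n
      have hHn := hH0 n ω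
      have h1 := (hωc n ε hε ε' hε' t ht t' ht').1
      have h2 := (hωc n ε' hε' ε hε t' ht' t ht).2
      have h3 := norm_echar_sub_le n x x'
      have e : (cutoffMult χ N n : ℂ) * convMode B ε t n ω * torusChar n x -
          (cutoffMult χ N n : ℂ) * convMode B ε' t' n ω * torusChar n x' =
          (cutoffMult χ N n : ℂ) * ((2 * (Real.pi : ℂ))⁻¹ * ((convMode B ε t n ω - convMode B ε' t' n ω) * echar n x +
            convMode B ε' t' n ω * (echar n x - echar n x'))) := by
        rw [torusChar_eq, torusChar_eq]; ring
      rw [e, norm_mul, norm_mul]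
      have h4 : ‖(convMode B ε t n ω - convMode B ε' t' n ω) * echar n x +
            convMode B ε' t' n ω * (echar n x - echar n x')‖ ≤
          (5 + 3 * T) * bracket n ^ 2 * H n ω * d0 +
            (5 + 3 * T) * bracket n ^ 2 * H n ω * (1 + T) * (2 * bracket n * tdist x x') := by
        refine (norm_add_le _ _).trans (add_le_add ?_ ?_)
        · rw [norm_mul, norm_echar, mul_one]
          exact h1
        · rw [norm_mul]
          exact mul_le_mul h2 h3 (norm_nonneg _) (by positivity)
      have h5 : (5 + 3 * T) * bracket n ^ 2 * H n ω * d0 +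
            (5 + 3 * T) * bracket n ^ 2 * H n ω * (1 + T) * (2 * bracket n * tdist x x') ≤
          54 * (5 + 3 * T) * (1 + T) * N ^ 3 * H n ω * (d0 + tdist x x') := by
        have hb2 : bracket n ^ 2 ≤ 9 * N ^ 2 := by nlinarith
        have hb3 : bracket n ^ 2 * (2 * bracket n) ≤ 54 * N ^ 3 := by
          calc _ ≤ (9 * (N : ℝ) ^ 2) * (2 * (3 * N)) := by gcongr
            _ = _ := by ring
        have hb4 : bracket n ^ 2 ≤ 54 * (N : ℝ) ^ 3 := by
          have : (N : ℝ) ^ 2 ≤ N ^ 3 := pow_le_pow_right₀ hN' (by norm_num)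
          nlinarith
        have hb5 : bracket n ^ 2 ≤ (1 + T) * (54 * (N : ℝ) ^ 3) :=
          hb4.trans (le_mul_of_one_le_left (by positivity) (by linarith))
        calc _ = (5 + 3 * T) * H n ω * (bracket n ^ 2 * d0 + (1 + T) * (bracket n ^ 2 * (2 * bracket n)) * tdist x x') := by ring
          _ ≤ (5 + 3 * T) * H n ω * ((1 + T) * (54 * (N : ℝ) ^ 3) * d0 + (1 + T) * (54 * (N : ℝ) ^ 3) * tdist x x') := by
              gcongr
          _ = _ := by ring
      calc _ ≤ c * (1 * (54 * (5 + 3 * T) * (1 + T) * N ^ 3 * H n ω * (d0 + tdist x x'))) := by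
            refine mul_le_mul (hk n) (mul_le_mul hpi1 (h4.trans h5) (norm_nonneg _) zero_le_one) (by positivity) (by linarith)
        _ = _ := by rw [hL]; ring
    · refine (Complex.abs_re_le_norm _).trans ((norm_sum_le _ _).trans ?_)
      rw [Finset.mul_sum]
      refine Finset.sum_le_sum fun n hn => ?_
      have hb := bracket_le_of_mem_freqBox hN hn
      have hb0 := bracket_pos n
      have hHn := hH0 n ω
      have h2 := (hωc n ε hε ε' hε' t ht t' ht').2
      rw [torusChar_eq, norm_mul, norm_mul, norm_mul, norm_echar, mul_one]
      have hb4 : bracket n ^ 2 ≤ 54 * (N : ℝ) ^ 3 := by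
        have : (N : ℝ) ^ 2 ≤ N ^ 3 := pow_le_pow_right₀ hN' (by norm_num)
        nlinarith
      calc _ ≤ c * ((5 + 3 * T) * bracket n ^ 2 * H n ω * (1 + T)) * 1 := by
            refine mul_le_mul (mul_le_mul (hk n) h2 (norm_nonneg _) (by linarith)) hpi1 (norm_nonneg _) (by positivity)
        _ ≤ c * ((5 + 3 * T) * (54 * (N : ℝ) ^ 3) * H n ω * (1 + T)) * 1 := by gcongr
        _ = _ := by rw [hL]; ring

end IsCylindricalWiener

end Regularity

/-! ### Hölder bounds for the chaos and its Bessel averages. -/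

section ChaosRegularity

lemma tdist_add_right_le (x x' z : Torus) : tdist (x + z) (x' + z) ≤ tdist x x' := by
  obtain ⟨i, hi⟩ := exists_norm_displ_sub_one (x + z) (x' + z)
  have e : displ (x + z) (x' + z) i = displ x x' i := by
    simp only [displ, unitPt_add, map_mul]
    linear_combination (unitPt x i * conj (unitPt x' i)) * unitPt_mul_conj z i
  rw [← hi, e]
  exact norm_displ_sub_one_le _ _ i

lemma norm_exp_mul_sub_le {a a' θ θ' E : ℝ} (ha : Real.exp a ≤ E) (ha' : Real.exp a' ≤ E) :
    ‖(Real.exp a : ℂ) * Complex.exp (Complex.I * θ) - (Real.exp a' : ℂ) * Complex.exp (Complex.I * θ')‖ ≤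
      E * (|a - a'| + |θ - θ'|) := by
  have hexp : |Real.exp a - Real.exp a'| ≤ E * |a - a'| := by
    have key : ∀ b b' : ℝ, Real.exp b ≤ E → Real.exp b - Real.exp b' ≤ E * |b - b'| := by
      intro b b' hb
      have h1 := Real.add_one_le_exp (b' - b)
      have h2 : Real.exp b' = Real.exp b * Real.exp (b' - b) := by rw [← Real.exp_add]; ring_nf
      have h3 := Real.exp_pos b
      calc Real.exp b - Real.exp b' = Real.exp b * (1 - Real.exp (b' - b)) := by rw [h2]; ring
        _ ≤ Real.exp b * |b - b'| := by
            gcongr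
            have := le_abs_self (b - b')
            linarith
        _ ≤ _ := by gcongr
    refine abs_sub_le_iff.2 ⟨key a a' ha, ?_⟩
    rw [abs_sub_comm]
    exact key a' a ha'
  have hθ : ‖Complex.exp (Complex.I * θ) - Complex.exp (Complex.I * θ')‖ ≤ |θ - θ'| := by
    have e : Complex.exp (Complex.I * θ) - Complex.exp (Complex.I * θ') =
        (Complex.exp (Complex.I * ((θ - θ' : ℝ) : ℂ)) - 1) * Complex.exp (Complex.I * θ') := by
      rw [sub_mul, ← Complex.exp_add, one_mul]
      congr 2
      push_cast
      ring
    rw [e, norm_mul, mul_comm Complex.I (θ' : ℂ), Complex.norm_exp_ofReal_mul_I, mul_one]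
    exact Real.norm_exp_I_mul_ofReal_sub_one_le
  have e : (Real.exp a : ℂ) * Complex.exp (Complex.I * θ) - (Real.exp a' : ℂ) * Complex.exp (Complex.I * θ') =
      ((Real.exp a - Real.exp a' : ℝ) : ℂ) * Complex.exp (Complex.I * θ) +
        (Real.exp a' : ℂ) * (Complex.exp (Complex.I * θ) - Complex.exp (Complex.I * θ')) := by
    push_cast
    ring
  rw [e]
  refine (norm_add_le _ _).trans ?_
  rw [norm_mul, norm_mul, mul_comm Complex.I (θ : ℂ), Complex.norm_exp_ofReal_mul_I, mul_one,
    Complex.norm_real, Complex.norm_real, Real.norm_eq_abs, Real.norm_of_nonneg (Real.exp_pos _).le, mul_add]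
  rw [mul_comm (θ : ℂ)]
  exact add_le_add hexp (mul_le_mul ha' hθ (norm_nonneg _) ((Real.exp_pos _).le.trans ha'))

variable {Ω : Type*} [MeasurableSpace Ω] {P : Measure Ω} {B : Freq → ℝ≥0 → Ω → ℂ} [IsProbabilityMeasure P]

namespace IsCylindricalWiener

lemma aemeasurable_stochConv (hB : IsCylindricalWiener B P) {χ : ℝ → ℝ} (hχ : IsCutoff χ) {ε t : ℝ} (hε : 0 ≤ ε) (ht : 0 ≤ t)
    {N : ℕ} (hN : 1 ≤ N) (x : Torus) : AEMeasurable (stochConv χ B ε N t x) P := by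
  have h1 : Measurable fun J : halfBox (2 * N) × Bool → ℝ => modeField (cutoffMult χ N) (2 * N) J x :=
    ((continuous_modeField (cutoffMult χ N) (2 * N)).comp (show Continuous fun J : halfBox (2 * N) × Bool → ℝ => (J, x) by fun_prop)).measurable
  refine (h1.comp_aemeasurable (hB.aemeasurable_modeParts (2 * N) hε ht)).congr ?_
  filter_upwards [hB.ae_stochConv_eq hχ] with ω hω
  exact (hω ε hε t ht N hN _ le_rfl x).symm

/-- |Ψ² - Ψ'²| ≤ 2S² · `paramDist`, and S² ≤ 1 + S⁸ has a mean of order N⁴⁰ by the moment bound with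
m = 2. -/
lemma exists_stochVar_holder (hB : IsCylindricalWiener B P) {χ : ℝ → ℝ} (hχ : IsCutoff χ) {T : ℝ} (hT : 0 < T) :
    ∃ C : ℝ, 0 ≤ C ∧ ∀ N : ℕ, 1 ≤ N → ∀ ε ∈ Set.Icc (0 : ℝ) 1, ∀ ε' ∈ Set.Icc (0 : ℝ) 1, ∀ t ∈ Set.Icc 0 T, ∀ t' ∈ Set.Icc 0 T, ∀ x x',
      |stochVar P χ B ε N t x - stochVar P χ B ε' N t' x'| ≤ C * N ^ 40 * paramDist ε ε' t t' x x' := by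
  obtain ⟨C, hC, hex⟩ := hB.exists_stochConv_holder hχ (le_refl 2) hT
  refine ⟨2 * (1 + C).toReal, by positivity, fun N hN ε hε ε' hε' t ht t' ht' x x' => ?_⟩
  obtain ⟨S, hS0, hSm, hSC, hSω⟩ := hex N hN
  have hN' : (1 : ℝ≥0∞) ≤ N := by exact_mod_cast hN
  have hS2 : ∫⁻ ω, ENNReal.ofReal (S ω ^ 2) ∂P ≤ (1 + C) * (N : ℝ≥0∞) ^ 40 := by
    calc _ ≤ ∫⁻ ω, (1 + ENNReal.ofReal (S ω) ^ (4 * 2)) ∂P := by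
          refine lintegral_mono fun ω => ?_
          rw [ENNReal.ofReal_pow (hS0 ω)]
          rcases le_total (ENNReal.ofReal (S ω)) 1 with h | h
          · exact le_add_right (pow_le_one' h 2)
          · exact le_add_left (pow_le_pow_right' h (by norm_num))
      _ = 1 + ∫⁻ ω, ENNReal.ofReal (S ω) ^ (4 * 2) ∂P := by
          rw [lintegral_add_left measurable_const]; simp
      _ ≤ (N : ℝ≥0∞) ^ 40 + C * (N : ℝ≥0∞) ^ 40 := add_le_add (one_le_pow_of_one_le' hN' 40) hSC
      _ = _ := by ring
  have hS2int : Integrable (fun ω => S ω ^ 2) P := by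
    refine ⟨(hSm.pow_const 2).aestronglyMeasurable, ?_⟩
    rw [hasFiniteIntegral_iff_ofReal (ae_of_all _ fun ω => sq_nonneg _)]
    exact hS2.trans_lt (by finiteness)
  have hS2le : ∫ ω, S ω ^ 2 ∂P ≤ (1 + C).toReal * N ^ 40 := by
    rw [integral_eq_lintegral_of_nonneg_ae (ae_of_all _ fun ω => sq_nonneg _) (hSm.pow_const 2).aestronglyMeasurable]
    refine (ENNReal.toReal_mono (by finiteness) hS2).trans (le_of_eq ?_)
    rw [ENNReal.toReal_mul, ENNReal.toReal_pow, ENNReal.toReal_natCast]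
  have hΨm : ∀ {ε t : ℝ} (hε : ε ∈ Set.Icc (0 : ℝ) 1) (ht : t ∈ Set.Icc 0 T) (x : Torus), Integrable (fun ω => stochConv χ B ε N t x ω ^ 2) P := by
    intro ε t hε ht x
    refine hS2int.mono' ((hB.aemeasurable_stochConv hχ hε.1 ht.1 hN x).pow_const 2).aestronglyMeasurable ?_
    filter_upwards [hSω] with ω hω
    rw [Real.norm_eq_abs, abs_pow]
    exact pow_le_pow_left₀ (abs_nonneg _) (hω ε hε ε hε t ht t ht x x).2 2
  rw [stochVar, stochVar, ← integral_sub (hΨm hε ht x) (hΨm hε' ht' x')]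
  rw [← Real.norm_eq_abs]
  refine (norm_integral_le_integral_norm _).trans ?_
  have hp := paramDist_nonneg ε ε' t t' x x'
  calc _ ≤ ∫ ω, 2 * paramDist ε ε' t t' x x' * S ω ^ 2 ∂P := by
        refine integral_mono_ae ((hΨm hε ht x).sub (hΨm hε' ht' x')).norm (hS2int.const_mul _) ?_
        filter_upwards [hSω] with ω hω
        obtain ⟨h1, h2⟩ := hω ε hε ε' hε' t ht t' ht' x x'
        have h3 := (hω ε' hε' ε hε t' ht' t ht x' x).2
        rw [Real.norm_eq_abs, sq_sub_sq, abs_mul]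
        calc _ ≤ (S ω + S ω) * (S ω * paramDist ε ε' t t' x x') :=
              mul_le_mul ((abs_add_le _ _).trans (add_le_add h2 h3)) h1 (abs_nonneg _) (by have := hS0 ω; positivity)
          _ = _ := by ring
    _ = 2 * paramDist ε ε' t t' x x' * ∫ ω, S ω ^ 2 ∂P := integral_const_mul _ _
    _ ≤ 2 * paramDist ε ε' t t' x x' * ((1 + C).toReal * N ^ 40) := by gcongr
    _ = _ := by ring

/-- The variance is at most (1/4π) log N + O(1), so the prefactor is O(N^{β²/(8π)}); the first power
of N is a convenient upper bound. -/
lemma exists_exp_stochVar_le (hB : IsCylindricalWiener B P) {χ : ℝ → ℝ} (hχ : IsCutoff χ) {β : ℝ} (hβ : β ^ 2 < 4 * Real.pi) :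
    ∃ C : ℝ, 1 ≤ C ∧ ∀ N : ℕ, 1 ≤ N → ∀ ε t : ℝ, 0 ≤ ε → 0 ≤ t → ∀ x,
      Real.exp (β ^ 2 / 2 * stochVar P χ B ε N t x) ≤ C * N := by
  obtain ⟨c, hc1, hc⟩ := hχ.exists_bound
  have hpi := Real.pi_gt_three
  set A : ℝ := 2 * c ^ 2
  have hA : 0 ≤ A := by positivity
  set b : ℝ := β ^ 2 / 2 * ((4 * Real.pi ^ 2)⁻¹ * (1 + 2 * Real.pi + 9 * A)) with hb
  have hb0 : 0 ≤ b := by positivity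
  refine ⟨3 * Real.exp b, by have := Real.one_le_exp hb0; linarith, fun N hN ε t hε ht x => ?_⟩
  have hN' : (1 : ℝ) ≤ N := by exact_mod_cast hN
  rw [hB.stochVar_eq hχ hε ht hN le_rfl]
  have h1 : ∑ n ∈ freqBox (2 * N), cutoffMult χ N n ^ 2 * modeVar ε n t ≤
      Real.pi * Real.log (3 * N) + (1 + 2 * Real.pi + 9 * A) := by
    refine (Finset.sum_le_sum fun n _ => ?_).trans
      (sum_refCoeff_le (L := 2 * N) hA (by linarith) (fun n hn => bracket_le_of_mem_freqBox hN hn))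
    have := cutoff_sq_mul_modeVar_le hχ hc hN hε ht n
    rwa [mul_pow, Real.sq_sqrt (modeVar_nonneg ε n ht)] at this
  have hlog : 0 ≤ Real.log (3 * N) := Real.log_nonneg (by linarith)
  have h2 : β ^ 2 / 2 * fieldVar (cutoffMult χ N) (2 * N) ε t ≤ Real.log (3 * N) + b := by
    calc _ ≤ β ^ 2 / 2 * ((4 * Real.pi ^ 2)⁻¹ * (Real.pi * Real.log (3 * N) + (1 + 2 * Real.pi + 9 * A))) := by
          unfold fieldVar
          gcongr
      _ = (β ^ 2 / (8 * Real.pi)) * Real.log (3 * N) + b := by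
          rw [hb]
          field_simp
          ring
      _ ≤ 1 * Real.log (3 * N) + b := by
          gcongr
          rw [div_le_one (by positivity)]
          linarith
      _ = _ := by rw [one_mul]
  calc _ ≤ Real.exp (Real.log (3 * N) + b) := Real.exp_le_exp.2 h2
    _ = 3 * Real.exp b * N := by
        rw [Real.exp_add, Real.exp_log (by positivity)]
        ring

lemma ae_continuous_chaos (hB : IsCylindricalWiener B P) {χ : ℝ → ℝ} (hχ : IsCutoff χ) (β : ℝ) :
    ∀ᵐ ω ∂P, ∀ ε, 0 ≤ ε → ∀ t, 0 ≤ t → ∀ N, 1 ≤ N → Continuous (chaos P χ B β ε N t ω) := by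
  filter_upwards [hB.ae_chaos_eq hχ β] with ω hω ε hε t ht N hN
  have : chaos P χ B β ε N t ω = modeChaos β (cutoffMult χ N) (2 * N) ε t (modeParts B (2 * N) ε t ω) :=
    funext fun x => hω ε hε t ht N hN _ le_rfl x
  rw [this]
  exact continuous_modeChaos_right _ _ _ _ _ _

lemma _root_.SmoluchowskiKramers.norm_chaos (χ : ℝ → ℝ) (β ε : ℝ) (N : ℕ) (t : ℝ) (ω : Ω) (x : Torus) :
    ‖chaos P χ B β ε N t ω x‖ = Real.exp (β ^ 2 / 2 * stochVar P χ B ε N t x) := by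
  rw [chaos, norm_mul, Complex.norm_real, Real.norm_of_nonneg (Real.exp_pos _).le,
    show Complex.I * β * stochConv χ B ε N t x ω = ((β * stochConv χ B ε N t x ω : ℝ) : ℂ) * Complex.I by
      push_cast; ring, Complex.norm_exp_ofReal_mul_I, mul_one]

lemma exists_norm_besselAvg_chaos_le (hB : IsCylindricalWiener B P) {χ : ℝ → ℝ} (hχ : IsCutoff χ) {β : ℝ} (hβ : β ^ 2 < 4 * Real.pi)
    {α : ℝ} (hα : 0 < α) :
    ∃ C : ℝ, 1 ≤ C ∧ ∀ N : ℕ, 1 ≤ N → ∀ ε t : ℝ, 0 ≤ ε → 0 ≤ t → ∀ ω x,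
      ‖besselAvg α (chaos P χ B β ε N t ω) x‖ ≤ C * N := by
  have := isProbabilityMeasure_besselMeasure hα
  obtain ⟨C, hC1, hC⟩ := hB.exists_exp_stochVar_le hχ hβ
  refine ⟨C, hC1, fun N hN ε t hε ht ω x => ?_⟩
  refine (norm_integral_le_of_norm_le_const (ae_of_all _ fun z => ?_)).trans (le_of_eq (by rw [probReal_univ, mul_one]))
  rw [norm_chaos]
  exact hC N hN ε t hε ht _

/-- One factor N comes from the exponential prefactor and N⁴⁰ from the variance, hence 4m · 41 =
164m. Translation does not increase the distance, so the average against a probability measure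
inherits the modulus. -/
lemma exists_besselAvg_holder (hB : IsCylindricalWiener B P) {χ : ℝ → ℝ} (hχ : IsCutoff χ) {β : ℝ} (hβ : β ^ 2 < 4 * Real.pi)
    {α : ℝ} (hα : 0 < α) {m : ℕ} (hm : 2 ≤ m)
    {T : ℝ} (hT : 0 < T) : ∃ C : ℝ≥0∞, C ≠ ⊤ ∧ ∀ N : ℕ, 1 ≤ N → ∃ W : Ω → ℝ, (∀ ω, 0 ≤ W ω) ∧ AEMeasurable W P ∧
      ∫⁻ ω, ENNReal.ofReal (W ω) ^ (4 * m) ∂P ≤ C * (N : ℝ≥0∞) ^ (164 * m) ∧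
      ∀ᵐ ω ∂P, ∀ ε ∈ Set.Icc (0 : ℝ) 1, ∀ ε' ∈ Set.Icc (0 : ℝ) 1, ∀ t ∈ Set.Icc 0 T, ∀ t' ∈ Set.Icc 0 T, ∀ x x',
        ‖besselAvg α (chaos P χ B β ε N t ω) x - besselAvg α (chaos P χ B β ε' N t' ω) x'‖ ≤
          W ω * paramDist ε ε' t t' x x' := by
  have := isProbabilityMeasure_besselMeasure hα
  obtain ⟨E, hE1, hE⟩ := hB.exists_exp_stochVar_le hχ hβ
  obtain ⟨V, hV0, hV⟩ := hB.exists_stochVar_holder hχ hT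
  obtain ⟨C, hC, hex⟩ := hB.exists_stochConv_holder hχ hm hT
  refine ⟨(ENNReal.ofReal E * 2) ^ (4 * m) * (ENNReal.ofReal (β ^ 2 / 2 * V) ^ (4 * m) + ENNReal.ofReal |β| ^ (4 * m) * C), by finiteness, fun N hN => ?_⟩
  obtain ⟨S, hS0, hSm, hSC, hSω⟩ := hex N hN
  have hN' : (1 : ℝ≥0∞) ≤ N := by exact_mod_cast hN
  refine ⟨fun ω => E * N * (β ^ 2 / 2 * V * N ^ 40 + |β| * S ω), fun ω => ?_, ?_, ?_, ?_⟩
  · have := hS0 ω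
    positivity
  · exact ((hSm.const_mul _).const_add _).const_mul _
  · have hpt : ∀ ω, ENNReal.ofReal (E * N * (β ^ 2 / 2 * V * N ^ 40 + |β| * S ω)) ^ (4 * m) ≤
        (ENNReal.ofReal E * 2) ^ (4 * m) * (N : ℝ≥0∞) ^ (4 * m) * (ENNReal.ofReal (β ^ 2 / 2 * V) ^ (4 * m) * (N : ℝ≥0∞) ^ (160 * m) +
          ENNReal.ofReal |β| ^ (4 * m) * ENNReal.ofReal (S ω) ^ (4 * m)) := by
      intro ω
      have h0 := hS0 ω
      rw [ENNReal.ofReal_mul (by positivity), ENNReal.ofReal_mul (by positivity), ENNReal.ofReal_natCast,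
        ENNReal.ofReal_add (by positivity) (by positivity), ENNReal.ofReal_mul (by positivity), ENNReal.ofReal_mul (abs_nonneg _),
        ENNReal.ofReal_pow (Nat.cast_nonneg _), ENNReal.ofReal_natCast, mul_pow]
      set a := ENNReal.ofReal (β ^ 2 / 2 * V) * (N : ℝ≥0∞) ^ 40 with ha
      set b := ENNReal.ofReal |β| * ENNReal.ofReal (S ω) with hb
      have hab : (a + b) ^ (4 * m) ≤ 2 ^ (4 * m) * (a ^ (4 * m) + b ^ (4 * m)) := by
        calc (a + b) ^ (4 * m) ≤ (2 * max a b) ^ (4 * m) := by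
              gcongr
              rw [two_mul]
              exact add_le_add (le_max_left _ _) (le_max_right _ _)
          _ = 2 ^ (4 * m) * (max a b) ^ (4 * m) := mul_pow _ _ _
          _ ≤ _ := by
              gcongr
              rcases max_choice a b with h | h <;> rw [h]
              · exact le_self_add
              · exact le_add_self
      calc _ ≤ (ENNReal.ofReal E * N) ^ (4 * m) * (2 ^ (4 * m) * (a ^ (4 * m) + b ^ (4 * m))) := by gcongr
        _ = _ := by
            rw [ha, hb, mul_pow, mul_pow, mul_pow, mul_pow, ← pow_mul, show 40 * (4 * m) = 160 * m by ring]
            ring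
    calc _ ≤ ∫⁻ ω, (ENNReal.ofReal E * 2) ^ (4 * m) * (N : ℝ≥0∞) ^ (4 * m) * (ENNReal.ofReal (β ^ 2 / 2 * V) ^ (4 * m) * (N : ℝ≥0∞) ^ (160 * m) +
          ENNReal.ofReal |β| ^ (4 * m) * ENNReal.ofReal (S ω) ^ (4 * m)) ∂P := lintegral_mono hpt
      _ = (ENNReal.ofReal E * 2) ^ (4 * m) * (N : ℝ≥0∞) ^ (4 * m) * (ENNReal.ofReal (β ^ 2 / 2 * V) ^ (4 * m) * (N : ℝ≥0∞) ^ (160 * m) +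
          ENNReal.ofReal |β| ^ (4 * m) * ∫⁻ ω, ENNReal.ofReal (S ω) ^ (4 * m) ∂P) := by
          rw [lintegral_const_mul' _ _ (by finiteness), lintegral_add_left measurable_const,
            lintegral_const, measure_univ, mul_one, lintegral_const_mul' _ _ (by finiteness)]
      _ ≤ (ENNReal.ofReal E * 2) ^ (4 * m) * (N : ℝ≥0∞) ^ (4 * m) * (ENNReal.ofReal (β ^ 2 / 2 * V) ^ (4 * m) * (N : ℝ≥0∞) ^ (160 * m) +
          ENNReal.ofReal |β| ^ (4 * m) * (C * (N : ℝ≥0∞) ^ (160 * m))) := by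
          gcongr
          refine hSC.trans ?_
          refine mul_le_mul_right (pow_le_pow_right₀ hN' ?_) _
          lia
      _ = _ := by
          rw [show 164 * m = 4 * m + 160 * m by ring, pow_add]
          ring
  · filter_upwards [hSω, hB.ae_continuous_chaos hχ β] with ω hω hcont ε hε ε' hε' t ht t' ht' x x'
    have hint : ∀ {ε t : ℝ} (_ : ε ∈ Set.Icc (0 : ℝ) 1) (_ : t ∈ Set.Icc 0 T) (x : Torus),
        Integrable (fun z => chaos P χ B β ε N t ω (x + z)) (besselMeasure α) := by
      intro ε t hε ht x
      have hc : Continuous fun z => chaos P χ B β ε N t ω (x + z) :=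
        (hcont ε hε.1 t ht.1 N hN).comp (continuous_const.add continuous_id)
      refine Integrable.of_bound hc.aestronglyMeasurable (E * N) (ae_of_all _ fun z => ?_)
      rw [norm_chaos]
      exact hE N hN ε t hε.1 ht.1 _
    rw [besselAvg, besselAvg, ← integral_sub (hint hε ht x) (hint hε' ht' x')]
    refine (norm_integral_le_of_norm_le_const (C := E * N * (β ^ 2 / 2 * V * N ^ 40 + |β| * S ω) * paramDist ε ε' t t' x x')
      (ae_of_all _ fun z => ?_)).trans (le_of_eq (by rw [probReal_univ, mul_one]))
    have hp : paramDist ε ε' t t' (x + z) (x' + z) ≤ paramDist ε ε' t t' x x' := by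
      unfold paramDist
      have := tdist_add_right_le x x' z
      linarith
    have h1 := (hω ε hε ε' hε' t ht t' ht' (x + z) (x' + z)).1
    have h2 := hV N hN ε hε ε' hε' t ht t' ht' (x + z) (x' + z)
    have h3 := norm_exp_mul_sub_le (a := β ^ 2 / 2 * stochVar P χ B ε N t (x + z)) (a' := β ^ 2 / 2 * stochVar P χ B ε' N t' (x' + z))
      (θ := β * stochConv χ B ε N t (x + z) ω) (θ' := β * stochConv χ B ε' N t' (x' + z) ω)
      (hE N hN ε t hε.1 ht.1 _) (hE N hN ε' t' hε'.1 ht'.1 _)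
    have e : ∀ {ε t : ℝ} {x : Torus}, chaos P χ B β ε N t ω x = (Real.exp (β ^ 2 / 2 * stochVar P χ B ε N t x) : ℂ) *
        Complex.exp (Complex.I * ((β * stochConv χ B ε N t x ω : ℝ) : ℂ)) := by
      intro ε t x
      rw [chaos]
      congr 2
      push_cast
      ring
    rw [e, e]
    refine h3.trans ?_
    rw [← mul_sub, ← mul_sub, abs_mul, abs_mul, abs_of_nonneg (by positivity : 0 ≤ β ^ 2 / 2)]
    have hS := hS0 ω
    have hp0 := paramDist_nonneg ε ε' t t' x x'
    calc _ ≤ E * N * (β ^ 2 / 2 * (V * N ^ 40 * paramDist ε ε' t t' x x') + |β| * (S ω * paramDist ε ε' t t' x x')) := by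
          refine mul_le_mul_of_nonneg_left (add_le_add ?_ ?_) (by positivity)
          · exact mul_le_mul_of_nonneg_left (h2.trans (by gcongr)) (by positivity)
          · exact mul_le_mul_of_nonneg_left (h1.trans (by gcongr)) (by positivity)
      _ = _ := by ring

end IsCylindricalWiener

end ChaosRegularity

/-! ### Uniform moment bounds -/

section Uniform

lemma exists_grid {a s : ℝ} (ha : 0 < a) (hs : s ∈ Set.Icc 0 a) {K : ℕ} (hK : 1 ≤ K) :
    ∃ j ∈ Finset.range (K + 1), |s - a * j / K| ≤ a / K := by
  have hK' : (0 : ℝ) < K := by exact_mod_cast hK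
  have h0 : 0 ≤ s * K / a := div_nonneg (mul_nonneg hs.1 hK'.le) ha.le
  refine ⟨⌊s * K / a⌋₊, ?_, ?_⟩
  · rw [Finset.mem_range, Nat.lt_succ_iff]
    refine Nat.floor_le_of_le ?_
    rw [div_le_iff₀ ha]
    nlinarith [hs.2]
  · have h1 := Nat.floor_le h0
    have h2 := (Nat.lt_floor_add_one (s * K / a)).le
    have e : s = a * (s * K / a) / K := by field_simp
    have e2 : s - a * (⌊s * K / a⌋₊ : ℝ) / K = (a / K) * (s * K / a - ⌊s * K / a⌋₊) := by
      conv_lhs => rw [e]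
      field_simp
    rw [e2, abs_mul, abs_of_pos (div_pos ha hK')]
    refine mul_le_of_le_one_right (div_pos ha hK').le ?_
    rw [abs_of_nonneg (by linarith)]
    linarith

lemma grid_mem_Icc {a : ℝ} (ha : 0 < a) {K j : ℕ} (hK : 1 ≤ K) (hj : j ∈ Finset.range (K + 1)) : a * j / K ∈ Set.Icc 0 a := by
  have hK' : (0 : ℝ) < K := by exact_mod_cast hK
  have hj' : (j : ℝ) ≤ K := by exact_mod_cast Nat.lt_succ_iff.1 (Finset.mem_range.1 hj)
  refine ⟨by positivity, ?_⟩
  rw [div_le_iff₀ hK']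
  gcongr

lemma tdist_coe_le {y y' : Fin 2 → ℝ} {r : ℝ} (h : ∀ i, |y i - y' i| ≤ r) :
    tdist (fun i => (y i : AddCircle (2 * Real.pi))) (fun i => (y' i : AddCircle (2 * Real.pi))) ≤ r := by
  obtain ⟨i, hi⟩ := exists_norm_displ_sub_one (fun i => (y i : AddCircle (2 * Real.pi))) (fun i => (y' i : AddCircle (2 * Real.pi)))
  rw [← hi, norm_displ_coe, chord, abs_mul, abs_two]
  have h1 : |Real.sin ((y i - y' i) / 2)| ≤ |(y i - y' i) / 2| := Real.abs_sin_le_abs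
  rw [abs_div, abs_two] at h1
  linarith [h i]

/-- There are four real parameters, two of them spatial. Spacing 1/K in each yields distance
K^{-1/4}, because of the exponent 1/4 in ε and t. -/
lemma exists_param_net {T : ℝ} (hT : 0 < T) {K : ℕ} (hK : 1 ≤ K) :
    ∃ F : Finset (ℝ × ℝ × Torus), F.card ≤ (K + 1) ^ 4 ∧
      (∀ p ∈ F, p.1 ∈ Set.Icc (0 : ℝ) 1 ∧ p.2.1 ∈ Set.Icc 0 T) ∧
      ∀ ε ∈ Set.Icc (0 : ℝ) 1, ∀ t ∈ Set.Icc 0 T, ∀ x, ∃ p ∈ F,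
        paramDist ε p.1 t p.2.1 x p.2.2 ≤ (1 + T ^ (1 / 4 : ℝ) + 2 * Real.pi) * (K : ℝ) ^ (-(1 / 4 : ℝ)) := by
  classical
  have hpi := Real.pi_pos
  have hK' : (1 : ℝ) ≤ K := by exact_mod_cast hK
  set S := Finset.range (K + 1)
  set f : ℕ × ℕ × ℕ × ℕ → ℝ × ℝ × Torus := fun j => (1 * j.1 / K, T * j.2.1 / K,
    fun i => ((if i = 0 then 2 * Real.pi * j.2.2.1 / K else 2 * Real.pi * j.2.2.2 / K : ℝ) : AddCircle (2 * Real.pi))) with hf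
  refine ⟨(S ×ˢ S ×ˢ S ×ˢ S).image f, ?_, ?_, ?_⟩
  · refine Finset.card_image_le.trans (le_of_eq ?_)
    simp only [Finset.card_product, S, Finset.card_range]
    ring
  · intro p hp
    obtain ⟨j, hj, rfl⟩ := Finset.mem_image.1 hp
    simp only [Finset.mem_product] at hj
    exact ⟨grid_mem_Icc one_pos hK hj.1, grid_mem_Icc hT hK hj.2.1⟩
  · intro ε hε t ht x
    have hx : ∀ i, ∃ y ∈ Set.Icc 0 (2 * Real.pi), (y : AddCircle (2 * Real.pi)) = x i := by
      intro i
      have h := AddCircle.coe_image_Icc_eq (2 * Real.pi) 0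
      have h1 : x i ∈ ((↑) : ℝ → AddCircle (2 * Real.pi)) '' Set.Icc 0 (0 + 2 * Real.pi) := by rw [h]; trivial
      rwa [zero_add] at h1
    choose y hy hyx using hx
    obtain ⟨j0, hj0, h0⟩ := exists_grid one_pos hε hK
    obtain ⟨j1, hj1, h1⟩ := exists_grid hT ht hK
    obtain ⟨j2, hj2, h2⟩ := exists_grid (by positivity) (hy 0) hK
    obtain ⟨j3, hj3, h3⟩ := exists_grid (by positivity) (hy 1) hK
    refine ⟨f (j0, j1, j2, j3), Finset.mem_image_of_mem _ (by simp only [Finset.mem_product]; exact ⟨hj0, hj1, hj2, hj3⟩), ?_⟩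
    have hx' : x = fun i => (y i : AddCircle (2 * Real.pi)) := funext fun i => (hyx i).symm
    have hd : tdist x (f (j0, j1, j2, j3)).2.2 ≤ 2 * Real.pi / K := by
      rw [hx']
      refine tdist_coe_le fun i => ?_
      fin_cases i
      · exact h2
      · exact h3
    have hpow : ∀ a r : ℝ, 0 ≤ r → |a| ≤ r / K → |a| ^ (1 / 4 : ℝ) ≤ r ^ (1 / 4 : ℝ) * (K : ℝ) ^ (-(1 / 4 : ℝ)) := by
      intro a r hr ha
      refine (Real.rpow_le_rpow (abs_nonneg _) ha (by norm_num)).trans (le_of_eq ?_)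
      rw [Real.div_rpow hr (by linarith), Real.rpow_neg (by linarith)]
      rfl
    have hd' : 2 * Real.pi / K ≤ 2 * Real.pi * (K : ℝ) ^ (-(1 / 4 : ℝ)) := by
      rw [div_eq_mul_inv, ← Real.rpow_neg_one]
      gcongr
      norm_num
    have e0 := hpow _ 1 zero_le_one h0
    have e1 := hpow _ T hT.le h1
    rw [Real.one_rpow] at e0
    unfold paramDist
    calc _ ≤ 1 * (K : ℝ) ^ (-(1 / 4 : ℝ)) + T ^ (1 / 4 : ℝ) * (K : ℝ) ^ (-(1 / 4 : ℝ)) + 2 * Real.pi * (K : ℝ) ^ (-(1 / 4 : ℝ)) :=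
          add_le_add (add_le_add e0 e1) (hd.trans hd')
      _ = _ := by ring

variable {Ω : Type*} [MeasurableSpace Ω] {P : Measure Ω} {B : Freq → ℝ≥0 → Ω → ℂ} [IsProbabilityMeasure P]

lemma measurable_integral_add_right {X : Type*} [TopologicalSpace X] [SecondCountableTopology X]
    [MeasurableSpace X] [BorelSpace X] {F : X → Torus → ℂ}
    (hF : Continuous fun p : X × Torus => F p.1 p.2) (ν : Measure Torus) [SFinite ν] (x : Torus) :
    Measurable fun J => ∫ z, F J (x + z) ∂ν := by
  have h4 : Continuous fun p : X × Torus => (p.1, x + p.2) := by fun_prop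
  exact ((hF.comp h4).measurable.stronglyMeasurable.integral_prod_right' (ν := ν)).measurable

namespace IsCylindricalWiener

lemma aemeasurable_besselAvg_chaos (hB : IsCylindricalWiener B P) {χ : ℝ → ℝ} (hχ : IsCutoff χ) (β : ℝ)
    {ε t : ℝ} (hε : 0 ≤ ε) (ht : 0 ≤ t) {N : ℕ} (hN : 1 ≤ N) (α : ℝ) [SFinite (besselMeasure α)] (x : Torus) :
    AEMeasurable (fun ω => besselAvg α (chaos P χ B β ε N t ω) x) P := by
  have h1 := (measurable_integral_add_right (continuous_modeChaos β (cutoffMult χ N) (2 * N) ε t)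
    (besselMeasure α) x).comp_aemeasurable (hB.aemeasurable_modeParts (2 * N) hε ht)
  refine h1.congr ?_
  filter_upwards [hB.ae_chaos_eq hχ β] with ω hω
  simp only [Function.comp_apply, besselAvg, hω ε hε t ht N hN (2 * N) le_rfl]

/-- The supremum is at most the maximum over a net, estimated by the sum of the pointwise moments,
plus the oscillation between neighbouring net points, estimated by the Hölder constants. -/
lemma exists_lintegral_iSup_sub_le (hB : IsCylindricalWiener B P) {χ : ℝ → ℝ} (hχ : IsCutoff χ)
    {β α : ℝ} (hβ0 : 0 < β ^ 2) (hβ : β ^ 2 < 4 * Real.pi) (hα : β ^ 2 / (4 * Real.pi) < α) {T : ℝ} (hT : 0 < T)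
    {m : ℕ} (hm : 1320 ≤ min 1 α * m) :
    ∃ C : ℝ≥0∞, C ≠ ⊤ ∧ ∀ R N : ℕ, 1 ≤ R → R ≤ N → N ≤ 2 * R →
      ∫⁻ ω, (⨆ z : (Set.Icc (0 : ℝ) 1 × Set.Icc 0 T) × Torus,
        ‖besselAvg α (chaos P χ B β z.1.1 N z.1.2 ω) z.2 - besselAvg α (chaos P χ B β z.1.1 R z.1.2 ω) z.2‖ₑ) ^ (4 * m) ∂P ≤
      C * ENNReal.ofReal ((R : ℝ) ^ (-(min 1 α / 8 * (4 * m : ℕ)))) := by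
  have hα0 : 0 < α := lt_of_le_of_lt (by positivity) hα
  set δ := min 1 α with hδ
  have hδ0 : 0 < δ := lt_min one_pos hα0
  have hδ1 : δ ≤ 1 := min_le_left _ _
  have hm' : (1320 : ℝ) ≤ m := hm.trans (mul_le_of_le_one_left (Nat.cast_nonneg _) hδ1)
  have hm2 : 1320 ≤ m := by exact_mod_cast hm'
  obtain ⟨C₁, hC₁, h₁⟩ := hB.exists_lintegral_besselAvg_sub_le hχ hβ0 hβ hα (m := 2 * m) (by omega)
  obtain ⟨C₂, hC₂, h₂⟩ := hB.exists_besselAvg_holder hχ hβ hα0 (m := m) (by omega) hT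
  set D : ℝ := 1 + T ^ (1 / 4 : ℝ) + 2 * Real.pi with hD
  have hD0 : 0 ≤ D := by positivity
  have := isProbabilityMeasure_besselMeasure hα0
  refine ⟨2 ^ (4 * m) * (16 * C₁ + (2 * ENNReal.ofReal D) ^ (4 * m) * (C₂ * 2 ^ (164 * m) + C₂)), by finiteness,
    fun R N hR hRN hNR => ?_⟩
  have hR' : (1 : ℝ) ≤ R := by exact_mod_cast hR
  have hR0 : (0 : ℝ) < R := by linarith
  -- The oscillation contributes K^{-m} N^{164m}, of order R^{-m}. The net has at most 16R^{660}
  -- points, each with a 4m-th moment of order R^{-δm}; since δm ≥ 1320 = 2 · 660, a factor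
  -- R^{-δm/2} remains.
  set K := R ^ 165 with hK
  have hK1 : 1 ≤ K := Nat.one_le_pow _ _ hR
  obtain ⟨F, hFc, hF, hFd⟩ := exists_param_net hT hK1
  obtain ⟨W, hW0, hWm, hWC, hWω⟩ := h₂ N (hR.trans hRN)
  obtain ⟨W', hW0', hWm', hWC', hWω'⟩ := h₂ R hR
  set u : ℕ → ℝ × ℝ × Torus → Ω → ℂ := fun N' p ω => besselAvg α (chaos P χ B β p.1 N' p.2.1 ω) p.2.2 with hu
  set k : ℝ := D * (K : ℝ) ^ (-(1 / 4 : ℝ)) with hk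
  have hk0 : 0 ≤ k := by positivity
  have hk4 : ENNReal.ofReal k ^ (4 * m) = ENNReal.ofReal D ^ (4 * m) * ENNReal.ofReal ((R : ℝ) ^ (-(165 * m : ℝ))) := by
    rw [hk, ENNReal.ofReal_mul hD0, mul_pow, ← ENNReal.ofReal_pow (Real.rpow_nonneg (Nat.cast_nonneg _) _)]
    congr 2
    rw [hK]
    push_cast
    rw [← Real.rpow_natCast (R : ℝ) 165, ← Real.rpow_mul hR0.le, ← Real.rpow_natCast, ← Real.rpow_mul hR0.le]
    congr 1
    push_cast
    ring
  have hpt : ∀ᵐ ω ∂P, (⨆ z : (Set.Icc (0 : ℝ) 1 × Set.Icc 0 T) × Torus,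
        ‖besselAvg α (chaos P χ B β z.1.1 N z.1.2 ω) z.2 - besselAvg α (chaos P χ B β z.1.1 R z.1.2 ω) z.2‖ₑ) ^ (4 * m) ≤
      2 ^ (4 * m) * (∑ p ∈ F, ‖u N p ω - u R p ω‖ₑ ^ (4 * m) +
        (2 ^ (4 * m) * ENNReal.ofReal k ^ (4 * m)) * (ENNReal.ofReal (W ω) ^ (4 * m) + ENNReal.ofReal (W' ω) ^ (4 * m))) := by
    filter_upwards [hWω, hWω'] with ω hω hω'
    have key : ∀ z : (Set.Icc (0 : ℝ) 1 × Set.Icc 0 T) × Torus,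
        ‖besselAvg α (chaos P χ B β z.1.1 N z.1.2 ω) z.2 - besselAvg α (chaos P χ B β z.1.1 R z.1.2 ω) z.2‖ₑ ^ (4 * m) ≤
      2 ^ (4 * m) * (∑ p ∈ F, ‖u N p ω - u R p ω‖ₑ ^ (4 * m) +
        (2 ^ (4 * m) * ENNReal.ofReal k ^ (4 * m)) * (ENNReal.ofReal (W ω) ^ (4 * m) + ENNReal.ofReal (W' ω) ^ (4 * m))) := by
      intro z
      obtain ⟨⟨⟨ε, hε⟩, ⟨t, ht⟩⟩, x⟩ := z
      obtain ⟨p, hp, hpd⟩ := hFd ε hε t ht x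
      have hWp := hω ε hε p.1 (hF p hp).1 t ht p.2.1 (hF p hp).2 x p.2.2
      have hWp' := hω' ε hε p.1 (hF p hp).1 t ht p.2.1 (hF p hp).2 x p.2.2
      have e : besselAvg α (chaos P χ B β ε N t ω) x - besselAvg α (chaos P χ B β ε R t ω) x =
          (u N p ω - u R p ω) + ((besselAvg α (chaos P χ B β ε N t ω) x - u N p ω) -
            (besselAvg α (chaos P χ B β ε R t ω) x - u R p ω)) := by ring
      have h1 : ‖(besselAvg α (chaos P χ B β ε N t ω) x - u N p ω) -
            (besselAvg α (chaos P χ B β ε R t ω) x - u R p ω)‖ ≤ (W ω + W' ω) * k := by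
        refine (norm_sub_le _ _).trans ?_
        rw [add_mul]
        exact add_le_add (hWp.trans (mul_le_mul_of_nonneg_left hpd (hW0 ω))) (hWp'.trans (mul_le_mul_of_nonneg_left hpd (hW0' ω)))
      have h2 : ‖(besselAvg α (chaos P χ B β ε N t ω) x - u N p ω) -
            (besselAvg α (chaos P χ B β ε R t ω) x - u R p ω)‖ₑ ^ (4 * m) ≤
          (2 ^ (4 * m) * ENNReal.ofReal k ^ (4 * m)) * (ENNReal.ofReal (W ω) ^ (4 * m) + ENNReal.ofReal (W' ω) ^ (4 * m)) := by
        have h3 := enorm_add_pow_le (W ω) (W' ω) (4 * m)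
        rw [Real.enorm_eq_ofReal (hW0 ω), Real.enorm_eq_ofReal (hW0' ω), Real.enorm_eq_ofReal (add_nonneg (hW0 ω) (hW0' ω))] at h3
        calc _ ≤ ENNReal.ofReal ((W ω + W' ω) * k) ^ (4 * m) := by
              rw [← ofReal_norm]
              gcongr
          _ = ENNReal.ofReal (W ω + W' ω) ^ (4 * m) * ENNReal.ofReal k ^ (4 * m) := by
              rw [ENNReal.ofReal_mul (add_nonneg (hW0 ω) (hW0' ω)), mul_pow]
          _ ≤ 2 ^ (4 * m) * (ENNReal.ofReal (W ω) ^ (4 * m) + ENNReal.ofReal (W' ω) ^ (4 * m)) * ENNReal.ofReal k ^ (4 * m) := by gcongr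
          _ = _ := by ring
      change ‖besselAvg α (chaos P χ B β ε N t ω) x - besselAvg α (chaos P χ B β ε R t ω) x‖ₑ ^ (4 * m) ≤ _
      rw [e]
      refine (enorm_add_pow_le _ _ _).trans (mul_le_mul_right (add_le_add ?_ h2) _)
      exact Finset.single_le_sum (f := fun p => ‖u N p ω - u R p ω‖ₑ ^ (4 * m)) (fun _ _ => zero_le) hp
    rw [ENNReal.iSup_pow_of_ne_zero (by omega)]
    exact iSup_le key
  have hW'' : AEMeasurable (fun ω => ENNReal.ofReal (W ω) ^ (4 * m)) P := hWm.ennreal_ofReal.pow_const _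
  have hNe : (N : ℝ≥0∞) ^ (164 * m) ≤ 2 ^ (164 * m) * (R : ℝ≥0∞) ^ (164 * m) := by
    rw [← mul_pow]
    gcongr
    exact_mod_cast hNR
  have hRe : ∀ j : ℕ, (R : ℝ≥0∞) ^ j = ENNReal.ofReal ((R : ℝ) ^ (j : ℝ)) := fun j => by
    rw [Real.rpow_natCast, ENNReal.ofReal_pow hR0.le, ENNReal.ofReal_natCast]
  set ρ : ℝ≥0∞ := ENNReal.ofReal ((R : ℝ) ^ (-(δ / 8 * (4 * m : ℕ)))) with hρ
  have hρ1 : (R : ℝ≥0∞) ^ 660 * ENNReal.ofReal ((R : ℝ) ^ (-(δ * (2 * m : ℕ) / 2))) ≤ ρ := by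
    rw [hRe, ← ENNReal.ofReal_mul (by positivity), ← Real.rpow_add hR0]
    refine ENNReal.ofReal_le_ofReal (Real.rpow_le_rpow_of_exponent_le hR' ?_)
    push_cast
    linarith
  have hρ2 : ENNReal.ofReal ((R : ℝ) ^ (-(165 * m : ℝ))) * (R : ℝ≥0∞) ^ (164 * m) ≤ ρ := by
    rw [hRe, ← ENNReal.ofReal_mul (by positivity), ← Real.rpow_add hR0]
    refine ENNReal.ofReal_le_ofReal (Real.rpow_le_rpow_of_exponent_le hR' ?_)
    push_cast
    nlinarith
  have hcard : (F.card : ℝ≥0∞) ≤ 16 * (R : ℝ≥0∞) ^ 660 := by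
    have h1 : F.card ≤ 16 * R ^ 660 := by
      calc F.card ≤ (K + 1) ^ 4 := hFc
        _ ≤ (2 * K) ^ 4 := by gcongr; omega
        _ = 16 * R ^ 660 := by rw [hK, mul_pow, ← pow_mul]; norm_num
    exact_mod_cast h1
  calc _ ≤ ∫⁻ ω, 2 ^ (4 * m) * (∑ p ∈ F, ‖u N p ω - u R p ω‖ₑ ^ (4 * m) +
        (2 ^ (4 * m) * ENNReal.ofReal k ^ (4 * m)) * (ENNReal.ofReal (W ω) ^ (4 * m) + ENNReal.ofReal (W' ω) ^ (4 * m))) ∂P :=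
        lintegral_mono_ae hpt
    _ ≤ 2 ^ (4 * m) * (∑ p ∈ F, ∫⁻ ω, ‖u N p ω - u R p ω‖ₑ ^ (4 * m) ∂P +
        (2 ^ (4 * m) * ENNReal.ofReal k ^ (4 * m)) * (∫⁻ ω, ENNReal.ofReal (W ω) ^ (4 * m) ∂P + ∫⁻ ω, ENNReal.ofReal (W' ω) ^ (4 * m) ∂P)) := by
        rw [lintegral_const_mul' _ _ (by finiteness)]
        refine mul_le_mul_right ?_ _
        have hm2 : AEMeasurable (fun ω => (2 ^ (4 * m) * ENNReal.ofReal k ^ (4 * m)) *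
            (ENNReal.ofReal (W ω) ^ (4 * m) + ENNReal.ofReal (W' ω) ^ (4 * m))) P :=
          (hW''.add (hWm'.ennreal_ofReal.pow_const _)).const_mul _
        rw [lintegral_add_right' _ hm2, lintegral_const_mul' _ _ (by finiteness), lintegral_add_left' hW'', lintegral_finsetSum']
        intro p hp
        have hp := hF p hp
        exact (((hB.aemeasurable_besselAvg_chaos hχ β hp.1.1 hp.2.1 (hR.trans hRN) α p.2.2).sub
          (hB.aemeasurable_besselAvg_chaos hχ β hp.1.1 hp.2.1 hR α p.2.2)).enorm.pow_const _)
    _ ≤ 2 ^ (4 * m) * (F.card * (C₁ * ENNReal.ofReal ((R : ℝ) ^ (-(δ * (2 * m : ℕ) / 2)))) +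
        (2 ^ (4 * m) * ENNReal.ofReal k ^ (4 * m)) * (C₂ * (N : ℝ≥0∞) ^ (164 * m) + C₂ * (R : ℝ≥0∞) ^ (164 * m))) := by
        gcongr
        refine (Finset.sum_le_card_nsmul _ _ (C₁ * ENNReal.ofReal ((R : ℝ) ^ (-(δ * (2 * m : ℕ) / 2)))) fun p hp => ?_).trans
          (le_of_eq (nsmul_eq_mul _ _))
        have h3 := h₁ R N hR hRN hNR p.1 p.2.1 (hF p hp).1.1 (hF p hp).2.1 p.2.2
        rw [show 2 * (2 * m) = 4 * m by ring] at h3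
        exact h3
    _ ≤ 2 ^ (4 * m) * (16 * (R : ℝ≥0∞) ^ 660 * (C₁ * ENNReal.ofReal ((R : ℝ) ^ (-(δ * (2 * m : ℕ) / 2)))) +
        (2 ^ (4 * m) * (ENNReal.ofReal D ^ (4 * m) * ENNReal.ofReal ((R : ℝ) ^ (-(165 * m : ℝ))))) *
          (C₂ * (2 ^ (164 * m) * (R : ℝ≥0∞) ^ (164 * m)) + C₂ * (R : ℝ≥0∞) ^ (164 * m))) := by
        rw [hk4]
        gcongr
    _ = 2 ^ (4 * m) * (16 * C₁ * ((R : ℝ≥0∞) ^ 660 * ENNReal.ofReal ((R : ℝ) ^ (-(δ * (2 * m : ℕ) / 2)))) +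
        (2 * ENNReal.ofReal D) ^ (4 * m) * (C₂ * 2 ^ (164 * m) + C₂) *
          (ENNReal.ofReal ((R : ℝ) ^ (-(165 * m : ℝ))) * (R : ℝ≥0∞) ^ (164 * m))) := by
        rw [mul_pow 2 (ENNReal.ofReal D)]
        ring
    _ ≤ 2 ^ (4 * m) * (16 * C₁ * ρ + (2 * ENNReal.ofReal D) ^ (4 * m) * (C₂ * 2 ^ (164 * m) + C₂) * ρ) := by gcongr
    _ = _ := by ring

end IsCylindricalWiener

end Uniform

/-! ### Random continuous functions and polynomial rates of convergence -/

section RandomFunctions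

/-- A random element of `C(X, ℂ)` is measurable as soon as its evaluations are. -/
lemma aestronglyMeasurable_continuousMap {X Ω : Type*} [TopologicalSpace X] [CompactSpace X] [T2Space X]
    [SecondCountableTopology X] [Nonempty X] [MeasurableSpace Ω] {P : Measure Ω} {G : Ω → C(X, ℂ)}
    (h : ∀ x, AEMeasurable (fun ω => G ω x) P) : AEStronglyMeasurable G P := by
  borelize C(X, ℂ)
  have hc : Continuous fun (f : C(X, ℂ)) (k : ℕ) => f (TopologicalSpace.denseSeq X k) :=
    continuous_pi fun k => continuous_eval_const _
  -- Evaluation along a dense sequence embeds C(X,ℂ) continuously and injectively. As this space is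
  -- Polish, the Lusin–Souslin theorem makes the embedding measurable, so measurability can be
  -- checked pointwise.
  have hi : Function.Injective fun (f : C(X, ℂ)) (k : ℕ) => f (TopologicalSpace.denseSeq X k) := by
    intro f g hfg
    refine DFunLike.coe_injective ((TopologicalSpace.denseRange_denseSeq X).equalizer f.continuous g.continuous ?_)
    ext k
    exact congrFun hfg k
  have he := hc.measurableEmbedding hi
  have h1 : AEMeasurable G P := he.aemeasurable_comp_iff.1 (aemeasurable_pi_iff.2 fun k => h _)
  exact h1.aestronglyMeasurable

/-- Induction on the number of doublings between R and N. The constant c' = c/(1 - 2^{-η}) is the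
fixed point of c' = c + 2^{-η}c'. -/
lemma dist_le_of_dyadic {E : Type*} [PseudoMetricSpace E] {x : ℕ → E} {c η : ℝ} (hc : 0 ≤ c) (hη : 0 < η)
    (h : ∀ R N : ℕ, 1 ≤ R → R ≤ N → N ≤ 2 * R → dist (x N) (x R) ≤ c * (R : ℝ) ^ (-η))
    {R N : ℕ} (hR : 1 ≤ R) (hRN : R ≤ N) :
    dist (x N) (x R) ≤ c / (1 - 2 ^ (-η)) * (R : ℝ) ^ (-η) := by
  have h2 : (2 : ℝ) ^ (-η) < 1 := Real.rpow_lt_one_of_one_lt_of_neg one_lt_two (neg_lt_zero.2 hη)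
  have h2' : 0 < 1 - (2 : ℝ) ^ (-η) := by linarith
  have h20 : (0 : ℝ) ≤ 2 ^ (-η) := by positivity
  have hcc : c ≤ c / (1 - 2 ^ (-η)) := by
    rw [le_div_iff₀ h2']
    nlinarith
  suffices H : ∀ k R N : ℕ, 1 ≤ R → R ≤ N → N ≤ 2 ^ k * R → dist (x N) (x R) ≤ c / (1 - 2 ^ (-η)) * (R : ℝ) ^ (-η) by
    refine H N R N hR hRN ?_
    exact (Nat.lt_two_pow_self).le.trans (Nat.le_mul_of_pos_right _ hR)
  intro k
  induction k with
  | zero =>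
    intro R N hR hRN hN
    have : N = R := by omega
    rw [this, dist_self]
    positivity
  | succ k ih =>
    intro R N hR hRN hN
    by_cases hN2 : N ≤ 2 * R
    · exact (h R N hR hRN hN2).trans (by gcongr)
    · have h3 := ih (2 * R) N (by omega) (by omega) (by rw [pow_succ] at hN; linarith)
      have h4 := h R (2 * R) hR (by omega) le_rfl
      have e : ((2 * R : ℕ) : ℝ) ^ (-η) = 2 ^ (-η) * (R : ℝ) ^ (-η) := by
        push_cast
        rw [Real.mul_rpow (by norm_num) (Nat.cast_nonneg _)]
      rw [e] at h3
      calc dist (x N) (x R) ≤ dist (x N) (x (2 * R)) + dist (x (2 * R)) (x R) := dist_triangle _ _ _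
        _ ≤ c / (1 - 2 ^ (-η)) * (2 ^ (-η) * (R : ℝ) ^ (-η)) + c * (R : ℝ) ^ (-η) := add_le_add h3 h4
        _ = c / (1 - 2 ^ (-η)) * (R : ℝ) ^ (-η) := by field_simp; ring

/-- A sequence with dyadic increments of size `R^{-η}` in `L^q`, where `η q > 1`, converges in `L^q`
and almost surely. -/
lemma exists_limit_of_dyadic {E Ω : Type*} [NormedAddCommGroup E] [CompleteSpace E] [MeasurableSpace Ω]
    {P : Measure Ω} {G : ℕ → Ω → E} {q : ℕ} (hq1 : 1 ≤ q) (hG : ∀ N, MemLp (G N) q P) {η : ℝ} (hη : 0 < η)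
    (hq : 1 < η * q) {C : ℝ≥0∞} (hC : C ≠ ⊤)
    (h : ∀ R N : ℕ, 1 ≤ R → R ≤ N → N ≤ 2 * R →
      ∫⁻ ω, ‖G N ω - G R ω‖ₑ ^ q ∂P ≤ C * ENNReal.ofReal ((R : ℝ) ^ (-(η * q)))) :
    ∃ L : Ω → E, MemLp L q P ∧ Tendsto (fun N => eLpNorm (G N - L) q P) atTop (𝓝 0) ∧
      ∀ᵐ ω ∂P, Tendsto (fun N => G N ω) atTop (𝓝 (L ω)) := by
  have hq0 : q ≠ 0 := by omega
  have hqe : (q : ℝ≥0∞) ≠ 0 := by exact_mod_cast hq0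
  have : Fact (1 ≤ (q : ℝ≥0∞)) := ⟨by exact_mod_cast hq1⟩
  have hnorm : ∀ f : Ω → E, eLpNorm f q P ^ q = ∫⁻ ω, ‖f ω‖ₑ ^ q ∂P := by
    intro f
    rw [eLpNorm_eq_lintegral_rpow_enorm_toReal hqe (by finiteness), ENNReal.toReal_natCast,
      ← ENNReal.rpow_natCast, ← ENNReal.rpow_mul, one_div, inv_mul_cancel₀ (by exact_mod_cast hq0), ENNReal.rpow_one]
    simp only [ENNReal.rpow_natCast]
  set g : ℕ → Lp E q P := fun N => (hG N).toLp with hg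
  set c : ℝ := C.toReal ^ (1 / q : ℝ) with hc
  have hc0 : 0 ≤ c := by positivity
  have hd : ∀ R N : ℕ, 1 ≤ R → R ≤ N → N ≤ 2 * R → dist (g N) (g R) ≤ c * (R : ℝ) ^ (-η) := by
    intro R N hR hRN hNR
    have h1 := h R N hR hRN hNR
    have h2 : ‖g N - g R‖ ^ q ≤ (c * (R : ℝ) ^ (-η)) ^ q := by
      rw [hg, ← MemLp.toLp_sub, Lp.norm_toLp, ← ENNReal.toReal_pow, hnorm]
      refine (ENNReal.toReal_mono (by finiteness) h1).trans (le_of_eq ?_)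
      rw [ENNReal.toReal_mul, ENNReal.toReal_ofReal (by positivity), mul_pow, hc, ← Real.rpow_natCast,
        ← Real.rpow_mul ENNReal.toReal_nonneg, one_div, inv_mul_cancel₀ (by exact_mod_cast hq0), Real.rpow_one,
        ← Real.rpow_natCast, ← Real.rpow_mul (Nat.cast_nonneg _), neg_mul]
    rw [dist_eq_norm]
    exact le_of_pow_le_pow_left₀ hq0 (by positivity) h2
  set c' : ℝ := c / (1 - 2 ^ (-η)) with hc'
  have hd' : ∀ {R N : ℕ}, 1 ≤ R → R ≤ N → dist (g N) (g R) ≤ c' * (R : ℝ) ^ (-η) := fun hR hRN =>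
    dist_le_of_dyadic hc0 hη hd hR hRN
  have hlim : Tendsto (fun R : ℕ => c' * (R : ℝ) ^ (-η)) atTop (𝓝 0) := by
    have := ((tendsto_rpow_neg_atTop hη).comp tendsto_natCast_atTop_atTop).const_mul c'
    rwa [mul_zero] at this
  have hcau : CauchySeq g := by
    rw [Metric.cauchySeq_iff']
    intro e he
    obtain ⟨R, hR1, hR⟩ := ((eventually_ge_atTop 1).and (hlim.eventually (gt_mem_nhds he))).exists
    exact ⟨R, fun N hN => (hd' hR1 hN).trans_lt hR⟩
  obtain ⟨l, hl⟩ := cauchySeq_tendsto_of_complete hcau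
  have hgl : ∀ {R : ℕ}, 1 ≤ R → dist (g R) l ≤ c' * (R : ℝ) ^ (-η) := by
    intro R hR
    rw [dist_comm]
    refine le_of_tendsto (hl.dist tendsto_const_nhds) ?_
    filter_upwards [eventually_ge_atTop R] with N hN
    exact hd' hR hN
  have hed : ∀ N, eLpNorm (G N - (l : Ω → E)) q P = edist (g N) l := by
    intro N
    rw [Lp.edist_def]
    refine eLpNorm_congr_ae ?_
    filter_upwards [(hG N).coeFn_toLp] with ω hω
    simp [hg, hω]
  refine ⟨l, Lp.memLp l, ?_, ?_⟩
  · simp_rw [hed]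
    exact (tendsto_iff_edist_tendsto_0.1 hl)
  -- The distance to the limit is controlled at every N, not only along powers of two. Because ηq >
  -- 1 the moments are summable over N, and almost sure convergence of the full sequence follows.
  · have hI : ∀ N : ℕ, ∫⁻ ω, ‖G (N + 1) ω - l ω‖ₑ ^ q ∂P ≤
        ENNReal.ofReal (c' ^ q * ((N + 1 : ℕ) : ℝ) ^ (-(η * q))) := by
      intro N
      have h1 := hnorm (G (N + 1) - (l : Ω → E))
      simp only [Pi.sub_apply] at h1
      have h2 := hgl (R := N + 1) (by omega)
      rw [← h1, hed, edist_dist, ← ENNReal.ofReal_pow dist_nonneg]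
      refine ENNReal.ofReal_le_ofReal ((pow_le_pow_left₀ dist_nonneg h2 q).trans (le_of_eq ?_))
      rw [mul_pow, ← Real.rpow_natCast (_ ^ (-η)), ← Real.rpow_mul (Nat.cast_nonneg _), neg_mul]
    have hsum : Summable fun N : ℕ => c' ^ q * ((N + 1 : ℕ) : ℝ) ^ (-(η * q)) :=
      (((summable_nat_add_iff 1).2 (Real.summable_nat_rpow.2 (by linarith))).mul_left _)
    have hms : ∀ N, AEMeasurable (fun ω => ‖G (N + 1) ω - l ω‖ₑ ^ q) P := fun N =>
      (((hG (N + 1)).1.sub (Lp.memLp l).1).enorm.pow_const _)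
    have hfin : ∫⁻ ω, ∑' N : ℕ, ‖G (N + 1) ω - l ω‖ₑ ^ q ∂P ≠ ⊤ := by
      rw [lintegral_tsum hms]
      refine ne_top_of_le_ne_top ?_ (ENNReal.tsum_le_tsum hI)
      exact hsum.tsum_ofReal_ne_top
    filter_upwards [ae_lt_top' (AEMeasurable.tsum hms) hfin] with ω hω
    have h1 := ENNReal.tendsto_atTop_zero_of_tsum_ne_top hω.ne
    have h2 : Tendsto (fun N : ℕ => ‖G (N + 1) ω - l ω‖ₑ) atTop (𝓝 0) := by
      have h3 := (ENNReal.continuous_rpow_const (y := (q : ℝ)⁻¹)).tendsto 0 |>.comp h1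
      rw [ENNReal.zero_rpow_of_pos (by positivity)] at h3
      refine h3.congr fun N => ?_
      rw [Function.comp_apply, ← ENNReal.rpow_natCast, ← ENNReal.rpow_mul, mul_inv_cancel₀ (by exact_mod_cast hq0),
        ENNReal.rpow_one]
    refine (tendsto_add_atTop_iff_nat 1).1 ?_
    rw [tendsto_iff_edist_tendsto_0]
    simpa only [edist_eq_enorm_sub] using h2

end RandomFunctions

/-! ### From continuous potentials to `W^{s,∞}` -/

section Potentials

/-- The element of `W^{s,∞}` with a given continuous potential. -/
def toSobolev (s : ℝ) : C(Torus, ℂ) →L[ℂ] SobolevInfty s :=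
  (ContinuousMap.toLp ∞ (volume : Measure Torus) ℂ : C(Torus, ℂ) →L[ℂ] Lp ℂ ∞ (volume : Measure Torus))

lemma toDistribution_toSobolev (s : ℝ) (f : C(Torus, ℂ)) (n : Freq) :
    (toSobolev s f).toDistribution n = ((bracket n ^ (-s) : ℝ) : ℂ) * torusCoeff f n := by
  unfold SobolevInfty.toDistribution torusCoeff
  congr 1
  refine integral_congr_ae ?_
  filter_upwards [ContinuousMap.coeFn_toLp (p := ∞) (𝕜 := ℂ) (volume : Measure Torus) f] with x hx
  congr 1

variable {K : Type*} [TopologicalSpace K] [CompactSpace K] [T2Space K]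

/-- A continuous family of continuous potentials, as a continuous family in `W^{s,∞}`. -/
def toSobolevFamily (s : ℝ) : C(K × Torus, ℂ) →L[ℂ] C(K, SobolevInfty s) where
  toFun f := ((toSobolev s : C(Torus, ℂ) →L[ℂ] SobolevInfty s) : C(C(Torus, ℂ), SobolevInfty s)).comp f.curry
  map_add' f g := by
    ext1 k
    exact map_add (toSobolev s) (f.curry k) (g.curry k)
  map_smul' a f := by
    ext1 k
    exact map_smul (toSobolev s) a (f.curry k)
  cont := (ContinuousMap.continuous_postcomp _).comp ContinuousMap.continuous_curry

lemma toSobolevFamily_apply (s : ℝ) (f : C(K × Torus, ℂ)) (k : K) :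
    toSobolevFamily s f k = toSobolev s (f.curry k) := rfl

variable {Y : Type*} [TopologicalSpace Y] [SecondCountableTopology Y] [MeasurableSpace Y] [BorelSpace Y]

/-- A continuous family of continuous potentials, as an element of `L^q(Y; W^{s,∞})`. -/
def toSobolevLp (s : ℝ) (q : ℝ≥0∞) [Fact (1 ≤ q)] (μ : Measure Y) [IsFiniteMeasure μ] (κ : C(Y, K)) :
    C(K × Torus, ℂ) →L[ℂ] Lp (SobolevInfty s) q μ where
  toFun f := BoundedContinuousFunction.toLp q μ ℂ
    ((ContinuousMap.linearIsometryBoundedOfCompact K (SobolevInfty s) ℂ (toSobolevFamily s f)).compContinuous κ)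
  map_add' f g := by
    rw [map_add, map_add, ← map_add]
    rfl
  map_smul' a f := by
    rw [map_smul, map_smul, RingHom.id_apply, ← map_smul]
    rfl
  cont := (BoundedContinuousFunction.toLp q μ ℂ).continuous.comp
    ((BoundedContinuousFunction.continuous_compContinuous κ).comp
      ((ContinuousMap.linearIsometryBoundedOfCompact K (SobolevInfty s) ℂ).continuous.comp (toSobolevFamily s).continuous))

lemma coeFn_toSobolevLp (s : ℝ) (q : ℝ≥0∞) [Fact (1 ≤ q)] (μ : Measure Y) [IsFiniteMeasure μ] (κ : C(Y, K))
    (f : C(K × Torus, ℂ)) : ∀ᵐ y ∂μ, toSobolevLp s q μ κ f y = toSobolev s (f.curry (κ y)) :=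
  BoundedContinuousFunction.coeFn_toLp (p := q) (𝕜 := ℂ) μ
    ((ContinuousMap.linearIsometryBoundedOfCompact K (SobolevInfty s) ℂ (toSobolevFamily s f)).compContinuous κ)

/-- Convergence of the potentials in `L^p(Ω; C(K × 𝕋²))` implies convergence of the distributions in
`L^p(Ω; L^q(Y; W^{s,∞}))`. -/
lemma convergesLpLq_of_potentials {Ω : Type*} [MeasurableSpace Ω] {P : Measure Ω} {s : ℝ} {p q : ℝ≥0∞}
    [Fact (1 ≤ p)] [Fact (1 ≤ q)] {μ : Measure Y} [IsFiniteMeasure μ] (κ : C(Y, K))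
    {G : ℕ → Ω → C(K × Torus, ℂ)} {L : Ω → C(K × Torus, ℂ)} (hG : ∀ N, MemLp (G N) p P) (hL : MemLp L p P)
    (hlim : Tendsto (fun N => eLpNorm (G N - L) p P) atTop (𝓝 0))
    {V : ℕ → Y → Ω → TorusDistribution} {Vlim : Y → Ω → TorusDistribution}
    (hV : ∀ N, 1 ≤ N → ∀ᵐ ω ∂P, ∀ᵐ y ∂μ, (toSobolev s ((G N ω).curry (κ y))).toDistribution = V N y ω)
    (hVlim : ∀ᵐ ω ∂P, ∀ᵐ y ∂μ, (toSobolev s ((L ω).curry (κ y))).toDistribution = Vlim y ω) :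
    ConvergesLpLq P p q μ s V Vlim := by
  -- The passage from potentials to distributions is a bounded operator that does not depend on ω.
  -- It lifts to L^p(Ω), and convergence is transported by continuity.
  set T := (toSobolevLp s q μ κ).compLpL p P
  have hcl : ∀ {F : Ω → C(K × Torus, ℂ)} (hF : MemLp F p P) {W : Y → Ω → TorusDistribution},
      (∀ᵐ ω ∂P, ∀ᵐ y ∂μ, (toSobolev s ((F ω).curry (κ y))).toDistribution = W y ω) →
      IsClassOf (T hF.toLp) W := by
    intro F hF W hW
    filter_upwards [(toSobolevLp s q μ κ).coeFn_compLpL (p := p) (μ := P) hF.toLp, hF.coeFn_toLp, hW] with ω h1 h2 h3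
    filter_upwards [coeFn_toSobolevLp s q μ κ (F ω), h3] with y h4 h5
    rw [h1, h2, h4, h5]
  have ht : Tendsto (fun N => T (hG N).toLp) atTop (𝓝 (T hL.toLp)) := by
    refine (T.continuous.tendsto _).comp ?_
    rw [tendsto_iff_edist_tendsto_0]
    simpa only [Lp.edist_toLp_toLp] using hlim
  exact ⟨fun N => T (hG N).toLp, T hL.toLp, fun N hN => hcl (hG N) (hV N hN), hcl hL hVlim, ht.cauchySeq, ht⟩

end Potentials

/-! ### Fourier coefficients of Bessel averages -/

section Coefficients

lemma torusChar_sub (n : Freq) (x z : Torus) : torusChar n (x - z) = torusChar n x * conj (echar n z) := by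
  have h : echar n (x - z) = echar n x * conj (echar n z) := by
    simp only [echar, Pi.sub_apply, sub_eq_add_neg, map_prod, ← Finset.prod_mul_distrib]
    refine Finset.prod_congr rfl fun i _ => ?_
    simp only [fourier_apply, smul_add, smul_neg, AddCircle.toCircle_add, AddCircle.toCircle_neg, Circle.coe_mul,
      Circle.coe_inv_eq_conj]
  rw [torusChar_eq, torusChar_eq, h, mul_assoc]

lemma continuous_torusChar (n : Freq) : Continuous (torusChar n) := by
  unfold torusChar
  fun_prop

lemma continuous_torusCoeff (n : Freq) : Continuous fun f : C(Torus, ℂ) => torusCoeff f n := by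
  set g : C(Torus, ℂ) := ⟨fun x => conj (torusChar n x), (continuous_torusChar n).star⟩
  have h1 : ∀ f : C(Torus, ℂ), torusCoeff f n =
      ∫ x, (ContinuousMap.toLp 1 (volume : Measure Torus) ℂ (f * g)) x := fun f => by
    refine integral_congr_ae ?_
    filter_upwards [ContinuousMap.coeFn_toLp (p := 1) (𝕜 := ℂ) (volume : Measure Torus) (f * g)] with x hx
    rw [hx]
    rfl
  simp_rw [h1]
  exact continuous_integral.comp ((ContinuousMap.toLp 1 (volume : Measure Torus) ℂ).continuous.comp
    (continuous_id.mul continuous_const))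

/-- Fubini and the translation invariance of Lebesgue measure produce the factor ∫ e^{in·z} dν(z).
-/
lemma torusCoeff_besselAvg {α : ℝ} (hα : 0 < α) {f : Torus → ℂ} (hf : Continuous f) (n : Freq) :
    torusCoeff (besselAvg α f) n = (bracket n ^ (-α) : ℝ) * torusCoeff f n := by
  have := isProbabilityMeasure_besselMeasure hα
  have hc : Continuous (Function.uncurry fun x z : Torus => f (x + z) * conj (torusChar n x)) := by
    have := continuous_torusChar n
    unfold Function.uncurry
    fun_prop
  have hint : Integrable (Function.uncurry fun x z : Torus => f (x + z) * conj (torusChar n x))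
      ((volume : Measure Torus).prod (besselMeasure α)) :=
    hc.integrable_of_hasCompactSupport (HasCompactSupport.of_compactSpace _)
  calc torusCoeff (besselAvg α f) n = ∫ x : Torus, (∫ z, f (x + z) * conj (torusChar n x) ∂besselMeasure α) := by
        simp only [torusCoeff, besselAvg, integral_mul_const]
    _ = ∫ z, (∫ x : Torus, f (x + z) * conj (torusChar n x)) ∂besselMeasure α := integral_integral_swap hint
    _ = ∫ z, echar n z * torusCoeff f n ∂besselMeasure α := by
        refine integral_congr_ae (ae_of_all _ fun z => ?_)
        have h1 := integral_add_right_eq_self (μ := (volume : Measure Torus))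
          (fun x => f x * conj (torusChar n (x - z))) z
        simp only [add_sub_cancel_right] at h1
        simp only [h1, torusChar_sub, map_mul, Complex.conj_conj, torusCoeff, ← integral_const_mul]
        congr 1
        ext x
        ring
    _ = _ := by rw [integral_mul_const, integral_echar_besselMeasure hα]

/-- The Bessel average is the potential ⟨∇⟩^{-α}f: the factors ⟨n⟩^{-α} and ⟨n⟩^α cancel. -/
lemma toDistribution_toSobolev_besselAvg {α : ℝ} (hα : 0 < α) {f : Torus → ℂ} (hf : Continuous f)
    {g : C(Torus, ℂ)} (hg : ∀ x, g x = besselAvg α f x) : (toSobolev (-α) g).toDistribution = torusCoeff f := by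
  ext n
  have hb := bracket_pos n
  rw [toDistribution_toSobolev, show (g : Torus → ℂ) = besselAvg α f from funext hg, torusCoeff_besselAvg hα hf,
    neg_neg, ← mul_assoc, ← Complex.ofReal_mul, ← Real.rpow_add hb, add_neg_cancel, Real.rpow_zero, Complex.ofReal_one,
    one_mul]

end Coefficients

/-! ### Convergence of the chaos -/

section Convergence

lemma tendsto_paramDist {ε₀ t₀ : ℝ} {x₀ : Torus} :
    Tendsto (fun z : ℝ × ℝ × Torus => paramDist z.1 ε₀ z.2.1 t₀ z.2.2 x₀) (𝓝 (ε₀, t₀, x₀)) (𝓝 0) := by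
  have h : Continuous fun z : ℝ × ℝ × Torus => paramDist z.1 ε₀ z.2.1 t₀ z.2.2 x₀ := by
    have h1 := continuous_unitPt
    have h2 : Continuous fun r : ℝ => r ^ (1 / 4 : ℝ) := Real.continuous_rpow_const (by norm_num)
    unfold paramDist tdist
    fun_prop
  have h0 : paramDist ε₀ ε₀ t₀ t₀ x₀ x₀ = 0 := by
    simp [paramDist, tdist]
  have := h.tendsto (ε₀, t₀, x₀)
  rwa [h0] at this

lemma enorm_continuousMap_le {X : Type*} [TopologicalSpace X] [CompactSpace X] (f : C(X, ℂ)) :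
    ‖f‖ₑ ≤ ⨆ x, ‖f x‖ₑ := by
  by_cases h : (⨆ x, ‖f x‖ₑ) = ⊤
  · rw [h]
    exact le_top
  · rw [← ENNReal.ofReal_toReal h, ← ofReal_norm]
    refine ENNReal.ofReal_le_ofReal ((ContinuousMap.norm_le _ ENNReal.toReal_nonneg).2 fun x => ?_)
    rw [← toReal_enorm]
    exact ENNReal.toReal_mono h (le_iSup (fun x => ‖f x‖ₑ) x)

variable {Ω : Type*} [MeasurableSpace Ω] {P : Measure Ω} {B : Freq → ℝ≥0 → Ω → ℂ} [IsProbabilityMeasure P]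

/-- The potential `⟨∇⟩^{-α} Θ_{ε,N}(t)` as a continuous function of `ε`, `t` and `x`. -/
def potential (P : Measure Ω) (χ : ℝ → ℝ) (B : Freq → ℝ≥0 → Ω → ℂ) (β α T : ℝ) (N : ℕ) (ω : Ω) :
    C((Set.Icc (0 : ℝ) 1 × Set.Icc 0 T) × Torus, ℂ) :=
  -- The default value 0 is taken on the null set where joint continuity may fail, and `max 1 N`
  -- replaces the meaningless index N = 0.
  ContinuousMap.mkD (fun z => besselAvg α (chaos P χ B β z.1.1 (max 1 N) z.1.2 ω) z.2) 0

/-- The limit of the chaos, coefficient by coefficient. -/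
def limitChaos (P : Measure Ω) (χ : ℝ → ℝ) (B : Freq → ℝ≥0 → Ω → ℂ) (β ε t : ℝ) (ω : Ω) : TorusDistribution :=
  -- No reference is made to α, T, p or q, so one family of distributions serves all of them.
  fun n => limUnder atTop fun N => torusCoeff (chaos P χ B β ε N t ω) n

namespace IsCylindricalWiener

/-- The Hölder estimate gives joint continuity in (ε,t,x) outside a null set, where
`ContinuousMap.mkD` returns the given function. -/
lemma ae_potential_eq (hB : IsCylindricalWiener B P) {χ : ℝ → ℝ} (hχ : IsCutoff χ) {β : ℝ}
    (hβ : β ^ 2 < 4 * Real.pi) {α : ℝ} (hα : 0 < α) {T : ℝ} (hT : 0 < T) :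
    ∀ᵐ ω ∂P, ∀ N z, potential P χ B β α T N ω z = besselAvg α (chaos P χ B β z.1.1 (max 1 N) z.1.2 ω) z.2 := by
  obtain ⟨C, hC, h⟩ := hB.exists_besselAvg_holder hχ hβ hα (m := 2) le_rfl hT
  rw [ae_all_iff]
  intro N
  obtain ⟨W, hW0, -, -, hW⟩ := h (max 1 N) (le_max_left _ _)
  filter_upwards [hW] with ω hω z
  refine ContinuousMap.mkD_apply_of_continuous (continuous_iff_continuousAt.2 fun z₀ => ?_)
  rw [ContinuousAt, tendsto_iff_norm_sub_tendsto_zero]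
  have h1 : Continuous fun z : (Set.Icc (0 : ℝ) 1 × Set.Icc 0 T) × Torus => ((z.1.1 : ℝ), (z.1.2 : ℝ), z.2) := by
    fun_prop
  have h2 := ((tendsto_paramDist (ε₀ := z₀.1.1) (t₀ := z₀.1.2) (x₀ := z₀.2)).comp (h1.tendsto z₀)).const_mul (W ω)
  rw [mul_zero] at h2
  exact squeeze_zero (fun _ => norm_nonneg _) (fun z => hω _ z.1.1.2 _ z₀.1.1.2 _ z.1.2.2 _ z₀.1.2.2 _ _) h2

/-- For each N the chaos has the deterministic modulus exp(β²σ/2), so the potential is essentially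
bounded; measurability is checked on evaluations. -/
lemma memLp_potential (hB : IsCylindricalWiener B P) {χ : ℝ → ℝ} (hχ : IsCutoff χ) {β : ℝ}
    (hβ : β ^ 2 < 4 * Real.pi) {α : ℝ} (hα : 0 < α) {T : ℝ} (hT : 0 < T) (N : ℕ) (p : ℝ≥0∞) :
    MemLp (potential P χ B β α T N) p P := by
  have := isProbabilityMeasure_besselMeasure hα
  have hae := hB.ae_potential_eq hχ hβ hα hT
  obtain ⟨C, hC1, hC⟩ := hB.exists_norm_besselAvg_chaos_le hχ hβ hα
  have : Nonempty ((Set.Icc (0 : ℝ) 1 × Set.Icc 0 T) × Torus) :=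
    ⟨((⟨0, by simp⟩, ⟨0, by simp [hT.le]⟩), 0)⟩
  refine MemLp.of_bound (aestronglyMeasurable_continuousMap fun z => ?_) (C * (max 1 N : ℕ)) ?_
  · refine (hB.aemeasurable_besselAvg_chaos hχ β z.1.1.2.1 z.1.2.2.1 (le_max_left 1 N) α z.2).congr ?_
    filter_upwards [hae] with ω hω
    exact (hω N z).symm
  · filter_upwards [hae] with ω hω
    refine (ContinuousMap.norm_le _ (by positivity)).2 fun z => ?_
    rw [hω]
    exact hC _ (le_max_left _ _) _ _ z.1.1.2.1 z.1.2.2.1 _ _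

/-- The potentials converge in `L^p(Ω; C)` and almost surely in `C`. -/
lemma exists_limit_potential (hB : IsCylindricalWiener B P) {χ : ℝ → ℝ} (hχ : IsCutoff χ) {β α : ℝ}
    (hβ0 : 0 < β ^ 2) (hβ : β ^ 2 < 4 * Real.pi) (hα : β ^ 2 / (4 * Real.pi) < α) {T : ℝ} (hT : 0 < T)
    {p : ℝ≥0∞} (hp : p ≠ ∞) :
    ∃ L : Ω → C((Set.Icc (0 : ℝ) 1 × Set.Icc 0 T) × Torus, ℂ), MemLp L p P ∧
      Tendsto (fun N => eLpNorm (potential P χ B β α T N - L) p P) atTop (𝓝 0) ∧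
      ∀ᵐ ω ∂P, Tendsto (fun N => potential P χ B β α T N ω) atTop (𝓝 (L ω)) := by
  have hα0 : 0 < α := lt_of_le_of_lt (by positivity) hα
  set δ := min 1 α with hδ
  have hδ0 : 0 < δ := lt_min one_pos hα0
  -- m is large enough for the net argument, δm ≥ 1320, and for the moment 4m to dominate p.
  obtain ⟨m, hm⟩ := exists_nat_ge (max (1320 / δ) p.toReal)
  have hm1 : 1320 ≤ δ * m := by
    rw [mul_comm, ← div_le_iff₀ hδ0]
    exact (le_max_left _ _).trans hm
  have hm0 : 1 ≤ m := by
    by_contra h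
    have : m = 0 := by omega
    rw [this] at hm1
    norm_num at hm1
  have hpm : p ≤ (4 * m : ℕ) := by
    rw [← ENNReal.ofReal_toReal hp, ← ENNReal.ofReal_natCast]
    refine ENNReal.ofReal_le_ofReal (((le_max_right _ _).trans hm).trans ?_)
    push_cast
    linarith [(Nat.cast_nonneg m : (0 : ℝ) ≤ m)]
  obtain ⟨C, hC, h⟩ := hB.exists_lintegral_iSup_sub_le hχ hβ0 hβ hα hT hm1
  have hae := hB.ae_potential_eq hχ hβ hα0 hT
  obtain ⟨L, hL, hL1, hL2⟩ := exists_limit_of_dyadic (P := P) (G := potential P χ B β α T) (q := 4 * m) (by omega)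
    (fun N => hB.memLp_potential hχ hβ hα0 hT N _) (η := δ / 8) (by positivity)
    (by push_cast; linarith) hC (fun R N hR hRN hNR => by
      refine (lintegral_mono_ae ?_).trans (h R N hR hRN hNR)
      filter_upwards [hae] with ω hω
      gcongr
      refine (enorm_continuousMap_le _).trans (iSup_mono fun z => ?_)
      rw [ContinuousMap.sub_apply, hω, hω, max_eq_right hR, max_eq_right (hR.trans hRN)])
  refine ⟨L, hL.mono_exponent hpm, ?_, hL2⟩
  refine tendsto_of_tendsto_of_tendsto_of_le_of_le tendsto_const_nhds hL1 (fun _ => zero_le) fun N => ?_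
  exact eLpNorm_le_eLpNorm_of_exponent_le hpm ((hB.memLp_potential hχ hβ hα0 hT N 1).1.sub hL.1)

lemma ae_toDistribution_potential (hB : IsCylindricalWiener B P) {χ : ℝ → ℝ} (hχ : IsCutoff χ) {β : ℝ}
    (hβ : β ^ 2 < 4 * Real.pi) {α : ℝ} (hα : 0 < α) {T : ℝ} (hT : 0 < T) :
    ∀ᵐ ω ∂P, ∀ N, 1 ≤ N → ∀ k, (toSobolev (-α) ((potential P χ B β α T N ω).curry k)).toDistribution =
      torusCoeff (chaos P χ B β k.1 N k.2 ω) := by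
  filter_upwards [hB.ae_potential_eq hχ hβ hα hT, hB.ae_continuous_chaos hχ β] with ω h1 h2 N hN k
  refine toDistribution_toSobolev_besselAvg hα (h2 _ k.1.2.1 _ k.2.2.1 N hN) fun x => ?_
  rw [ContinuousMap.curry_apply, h1, max_eq_right hN]

/-- Fourier coefficients are continuous functionals of the potential, so those of the limit
potential are limits of the coefficients of the chaos, whatever α and T are. -/
lemma ae_toDistribution_limit (hB : IsCylindricalWiener B P) {χ : ℝ → ℝ} (hχ : IsCutoff χ) {β : ℝ}
    (hβ : β ^ 2 < 4 * Real.pi) {α : ℝ} (hα : 0 < α) {T : ℝ} (hT : 0 < T)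
    {L : Ω → C((Set.Icc (0 : ℝ) 1 × Set.Icc 0 T) × Torus, ℂ)}
    (hL : ∀ᵐ ω ∂P, Tendsto (fun N => potential P χ B β α T N ω) atTop (𝓝 (L ω))) :
    ∀ᵐ ω ∂P, ∀ k, (toSobolev (-α) ((L ω).curry k)).toDistribution = limitChaos P χ B β k.1 k.2 ω := by
  filter_upwards [hB.ae_toDistribution_potential hχ hβ hα hT, hL] with ω h1 h2 k
  ext n
  refine (Tendsto.limUnder_eq ?_).symm
  have hc : Continuous fun f : C((Set.Icc (0 : ℝ) 1 × Set.Icc 0 T) × Torus, ℂ) =>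
      (toSobolev (-α) (f.curry k)).toDistribution n := by
    simp only [toDistribution_toSobolev]
    exact continuous_const.mul ((continuous_torusCoeff n).comp
      ((continuous_eval_const k).comp ContinuousMap.continuous_curry))
  refine ((hc.tendsto (L ω)).comp h2).congr' ?_
  filter_upwards [eventually_ge_atTop 1] with N hN
  rw [Function.comp_apply, h1 N hN k]

end IsCylindricalWiener

end Convergence

end SmoluchowskiKramers

end

/-! ### The three modes of convergence. -/

open SmoluchowskiKramers in
theorem proposition5p6 {Ω : Type*} [MeasurableSpace Ω] (P : Measure Ω) [IsProbabilityMeasure P]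
    (B : Freq → ℝ≥0 → Ω → ℂ) (hB : IsCylindricalWiener B P)
    (χ : ℝ → ℝ) (hχ : IsCutoff χ)
    (β : ℝ) (hβ_pos : 0 < β ^ 2) (hβ_lt : β ^ 2 < 4 * Real.pi) :
    ∃ Θ : ℝ → ℝ → Ω → TorusDistribution,
      ∀ (p q : ℝ≥0∞) [Fact (1 ≤ p)] [Fact (1 ≤ q)], p ≠ ∞ → q ≠ ∞ →
      ∀ T : ℝ, 0 < T → ∀ α : ℝ, β ^ 2 / (4 * Real.pi) < α →
        (∀ ε ∈ Set.Icc (0 : ℝ) 1,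
          ConvergesLpLq P p q (volume.restrict (Set.Icc (0 : ℝ) T)) (-α)
            (fun N t ω => torusCoeff (chaos P χ B β ε N t ω)) (Θ ε)) ∧
        ConvergesLpLq P p q (volume.restrict (Set.Icc (0 : ℝ) 1 ×ˢ Set.Icc (0 : ℝ) T)) (-α)
          (fun N (z : ℝ × ℝ) ω => torusCoeff (chaos P χ B β z.1 N z.2 ω))
          (fun z => Θ z.1 z.2) ∧
        (∀ᵐ ω ∂P, ConvergesC T (-α)
          (fun N ε t => torusCoeff (chaos P χ B β ε N t ω)) (fun ε t => Θ ε t ω)) := by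
  refine ⟨limitChaos P χ B β, ?_⟩
  intro p q _ _ hp _ T hT α hα
  have hα0 : 0 < α := lt_of_le_of_lt (by positivity) hα
  obtain ⟨L, hL, hLp, hLae⟩ := hB.exists_limit_potential hχ hβ_pos hβ_lt hα hT hp
  have hV := hB.ae_toDistribution_potential hχ hβ_lt hα0 hT
  have hVlim := hB.ae_toDistribution_limit hχ hβ_lt hα0 hT hLae
  have hM := fun N => hB.memLp_potential hχ hβ_lt hα0 hT N p
  refine ⟨fun ε hε => ?_, ?_, ?_⟩
  -- `Set.projIcc` extends the parameter map continuously to the whole line; its values outside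
  -- [0,T] are invisible to the restricted measure.
  · refine convergesLpLq_of_potentials
      (⟨fun t => (⟨ε, hε⟩, Set.projIcc 0 T hT.le t), by fun_prop⟩ : C(ℝ, Set.Icc (0 : ℝ) 1 × Set.Icc 0 T))
      hM hL hLp (fun N hN => ?_) ?_
    · filter_upwards [hV] with ω hω
      filter_upwards [ae_restrict_mem measurableSet_Icc] with t ht
      rw [hω N hN]
      simp [Set.projIcc_of_mem hT.le ht]
    · filter_upwards [hVlim] with ω hω
      filter_upwards [ae_restrict_mem measurableSet_Icc] with t ht
      rw [hω]
      simp [Set.projIcc_of_mem hT.le ht]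
  · have : IsFiniteMeasure ((volume : Measure (ℝ × ℝ)).restrict (Set.Icc (0 : ℝ) 1 ×ˢ Set.Icc (0 : ℝ) T)) :=
      isFiniteMeasure_restrict.2 (isCompact_Icc.prod isCompact_Icc).measure_lt_top.ne
    refine convergesLpLq_of_potentials
      (⟨fun z => (Set.projIcc 0 1 zero_le_one z.1, Set.projIcc 0 T hT.le z.2), by fun_prop⟩ :
        C(ℝ × ℝ, Set.Icc (0 : ℝ) 1 × Set.Icc 0 T)) hM hL hLp (fun N hN => ?_) ?_
    · filter_upwards [hV] with ω hω
      filter_upwards [ae_restrict_mem (measurableSet_Icc.prod measurableSet_Icc)] with z hz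
      rw [hω N hN]
      simp [Set.projIcc_of_mem hT.le hz.2, Set.projIcc_of_mem zero_le_one hz.1]
    · filter_upwards [hVlim] with ω hω
      filter_upwards [ae_restrict_mem (measurableSet_Icc.prod measurableSet_Icc)] with z hz
      rw [hω]
      simp [Set.projIcc_of_mem hT.le hz.2, Set.projIcc_of_mem zero_le_one hz.1]
  · filter_upwards [hV, hVlim, hLae] with ω h1 h2 h3
    refine ⟨fun N => toSobolevFamily (-α) (potential P χ B β α T N ω), toSobolevFamily (-α) (L ω), fun N hN k => ?_,
      fun k => ?_, ((toSobolevFamily (-α)).continuous.tendsto _).comp h3⟩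
    · rw [toSobolevFamily_apply, h1 N hN]
    · rw [toSobolevFamily_apply, h2]
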